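/- Let $(\mathcal M,g)$ be a smooth $3+1$-dimensional Lorentzian manifold of signature $(-,+,+,+)$, and let $\mathcal R\subset\mathcal M$ be a domain on which $g$ is globally expressed in double null gauge: $\mathcal R$ is diffeomorphic to $\mathcal U\times\mathbb S^2$ with $\mathcal U\subset\mathbb R^2$ the range of $(u,v)$, and \[ g=-2\Omega^2\bigl(\mathrm du\otimes\mathrm dv+\mathrm dv\otimes\mathrm du\bigr)+\gamma_{AB}\bigl(\mathrm d\vartheta^A-b^A\mathrm dv\bigr)\otimes\bigl(\mathrm d\vartheta^B-b^B\mathrm dv\bigr),\qquad \Omega>0, \] where $\gamma$ is the Riemannian metric induced on the spheres $S_{u,v}$. Put $\hat L=\Omega^{-1}(\partial_v+b^A\partial_{\vartheta^A})$ and $\hat{\underline L}=\Omega^{-1}\partial_u$. Let the area radius $r(u,v)$ be defined by $4\pi r^2=\mathrm{Area}(S_{u,v},\gamma)$, and assume that its level sets $\Sigma_r$ are spacelike on $\mathcal R$. Let $V^\mu=-g^{\mu\nu}\partial_\nu r$, and let $n=V/\sqrt{-g(V,V)}$ be the unit normal and $\overline g_r$ the induced metric of $\Sigma_r$. Let $r_1<r_2$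 and $\underline u,\underline v\in\mathbb R$ be such that \[ \mathcal D=\bigcup_{r_1\le r\le r_2}\Sigma_r\cap\{u\le\underline u\}\cap\{v\le\underline v\}\subset\mathcal R \] is compact, and put $\Sigma_{r_i}^c=\Sigma_{r_i}\cap\mathcal D$. Let $W$ be a smooth Weyl field on $\mathcal R$, that is, a $4$-covariant tensor field which is antisymmetric in the first two and in the last two indices and satisfies $W_{\alpha[\beta\mu\nu]}=0$ and $g^{\alpha\mu}W_{\alpha\beta\mu\nu}=0$, and suppose that it satisfies the Bianchi equations $\nabla^\alpha W_{\alpha\beta\gamma\delta}=J_{\beta\gamma\delta}$ on $\mathcal R$. Let \[ Q[W]_{\alpha\beta\gamma\delta}=W_{\alpha\rho\gamma\sigma}W_{\beta\phantom{\rho}\delta}^{\phantom{\beta}\rho\phantom{\delta}\sigma}+{}^\ast W_{\alpha\rho\gamma\sigma}{}^\ast W_{\beta\phantom{\rho}\delta}^{\phantom{\beta}\rho\phantom{\delta}\sigma} \] be its Bel-Robinson tensor, where ${}^\ast W_{\alpha\beta\mu\nu}=\tfrac12W_{\alpha\beta}{}^{\gamma\delta}\epsilon_{\gamma\delta\mu\nu}$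 (left and right duals coincide). Then for all smooth vector fields $X,Y,Z$ on $\mathcal R$, \[ \begin{aligned} &\int\mathrm dv\int_{S_{\underline u,v}}\Omega\,Q[W](\hat L,X,Y,Z)\,\mathrm d\mu_\gamma +\int_{\Sigma_{r_2}^c}Q[W](n,X,Y,Z)\,\mathrm d\mu_{\overline g_{r_2}} +\int_{\mathcal D}\bigl(\operatorname{div}Q[W]\bigr)(X,Y,Z)\,\mathrm d\mu_g\\ &\quad+\int\mathrm du\int_{S_{u,\underline v}}\Omega\,Q[W](\hat{\underline L},X,Y,Z)\,\mathrm d\mu_\gamma +\int_{\mathcal D}K^{(X,Y,Z)}[W]\,\mathrm d\mu_g =\int_{\Sigma_{r_1}^c}Q[W](n,X,Y,Z)\,\mathrm d\mu_{\overline g_{r_1}}, \end{aligned} \] where the $v$- and $u$-integrals extend over the values with $S_{\underline u,v}\subset\mathcal D$ and $S_{u,\underline v}\subset\mathcal D$ respectively, $(\operatorname{div}Q)_{\beta\gamma\delta}=\nabla^\alpha Q_{\alpha\beta\gamma\delta}$, and \[ K^{(X,Y,Z)}[W]=\tfrac12Q[W]_{\alpha\beta\gamma\delta}\Bigl({}^{(X)}\hat\pi^{\alpha\beta}Y^\gamma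 Z^\delta+{}^{(Y)}\hat\pi^{\alpha\beta}X^\gamma Z^\delta+{}^{(Z)}\hat\pi^{\alpha\beta}X^\gamma Y^\delta\Bigr), \] with ${}^{(X)}\pi_{\mu\nu}=(\mathcal L_Xg)_{\mu\nu}=\nabla_\mu X_\nu+\nabla_\nu X_\mu$ and ${}^{(X)}\hat\pi={}^{(X)}\pi-\tfrac14(\operatorname{tr}{}^{(X)}\pi)\,g$. -/

import Mathlib

open Set MeasureTheory
open scoped Manifold ContDiff

noncomputable section

/-! ### Tensor calculus on a four-dimensional manifold -/

section Tensors

variable {M : Type*} [TopologicalSpace M] [ChartedSpace (EuclideanSpace ℝ (Fin 4)) M]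

/-- A covariant `k`-tensor field on `M`: at every point `p` a multilinear form on `T_p M`. -/
abbrev CovTensorField (k : ℕ) (M : Type*) [TopologicalSpace M]
    [ChartedSpace (EuclideanSpace ℝ (Fin 4)) M] :=
  ∀ p : M, ContinuousMultilinearMap ℝ (fun _ : Fin k => TangentSpace (𝓡 4) p) ℝ

/-- A vector field on `M`. -/
abbrev VecField (M : Type*) [TopologicalSpace M]
    [ChartedSpace (EuclideanSpace ℝ (Fin 4)) M] :=
  ∀ p : M, TangentSpace (𝓡 4) p

/-- The basis `∂_0, ∂_1, ∂_2, ∂_3` of `T_p M` given by the preferred chart at `p` (Mathlib identifies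
`T_p M` with the model space through this chart). -/
def basisVec (p : M) (i : Fin 4) : TangentSpace (𝓡 4) p :=
  (EuclideanSpace.single i (1 : ℝ) : EuclideanSpace ℝ (Fin 4))

/-- The component `X^i` of a tangent vector at `p` in the basis `basisVec p`, as a linear form. -/
def vecComp (p : M) (i : Fin 4) : TangentSpace (𝓡 4) p →L[ℝ] ℝ :=
  (EuclideanSpace.proj i : EuclideanSpace ℝ (Fin 4) →L[ℝ] ℝ)

/-- The coordinate vector field `∂_i` of the preferred chart `φ` at `p`, at a point `q` near `p`:
the vector `(dφ_q)⁻¹ e_i`. -/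
def coordField (p : M) (i : Fin 4) (q : M) : TangentSpace (𝓡 4) q :=
  (mfderiv (𝓡 4) 𝓘(ℝ, EuclideanSpace ℝ (Fin 4)) (extChartAt (𝓡 4) p) q).inverse
    (EuclideanSpace.single i (1 : ℝ) : EuclideanSpace ℝ (Fin 4))

/-- At `p` itself the coordinate fields of the chart at `p` are the basis `basisVec p`. -/
theorem coordField_self [IsManifold (𝓡 4) ∞ M] (p : M) (i : Fin 4) :
    coordField p i p = basisVec p i := by
  have h1 : IsManifold (𝓡 4) 1 M := IsManifold.of_le (n := ∞) (by simp)
  have h : mfderiv (𝓡 4) 𝓘(ℝ, EuclideanSpace ℝ (Fin 4)) (extChartAt (𝓡 4) p) p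
      = ContinuousLinearMap.id ℝ (EuclideanSpace ℝ (Fin 4)) := by
    ext1 v
    have h2 := mfderiv_chartAt_eq_tangentCoordChange (I := 𝓡 4) (mem_chart_source
      (EuclideanSpace ℝ (Fin 4)) p)
    have h3 := tangentCoordChange_self (I := 𝓡 4) (x := p) (z := p) (v := v)
      (mem_extChartAt_source p)
    have h4 := congrArg (fun L => L v) h2
    exact h4.trans h3
  unfold coordField
  rw [h]
  have h5 : (ContinuousLinearMap.id ℝ (EuclideanSpace ℝ (Fin 4))).inverse
      = ContinuousLinearMap.id ℝ (EuclideanSpace ℝ (Fin 4)) := ContinuousLinearMap.inverse_id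
  exact congrArg (fun L => L (EuclideanSpace.single i (1 : ℝ))) h5

/-- The components `T_{i_1 … i_k}` at `p` in the basis `basisVec p`. -/
def comp {k : ℕ} (T : CovTensorField k M) (p : M) (i : Fin k → Fin 4) : ℝ :=
  T p (fun j => basisVec p (i j))

/-- The components of `T` at `q` in the coordinate fields of the preferred chart at `p`. -/
def chartComp {k : ℕ} (T : CovTensorField k M) (p : M) (i : Fin k → Fin 4) (q : M) : ℝ :=
  T q (fun j => coordField p (i j) q)

/-- The `k`-form with prescribed components at `p` in the basis `basisVec p`. -/
def ofComp {k : ℕ} (p : M) (c : (Fin k → Fin 4) → ℝ) :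
    ContinuousMultilinearMap ℝ (fun _ : Fin k => TangentSpace (𝓡 4) p) ℝ :=
  ∑ i : Fin k → Fin 4, c i •
    (ContinuousMultilinearMap.mkPiAlgebra ℝ (Fin k) ℝ).compContinuousLinearMap
      (fun j => vecComp p (i j))

/-- The partial derivative `∂_a f (p)` in the preferred chart at `p`. -/
def partialD (f : M → ℝ) (p : M) (a : Fin 4) : ℝ :=
  mvfderiv (𝓡 4) f p (basisVec p a)

/-- A tensor field is smooth on the open set `R`: its components in the coordinates around each
point of `R` are smooth. -/
def TensorSmoothOn {k : ℕ} (T : CovTensorField k M) (R : Set M) : Prop :=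
  ∀ p ∈ R, ∀ i : Fin k → Fin 4, ContMDiffAt (𝓡 4) 𝓘(ℝ, ℝ) ∞ (chartComp T p i) p

/-- A vector field is smooth on `R`. -/
def VecSmoothOn [IsManifold (𝓡 4) ∞ M] (X : VecField M) (R : Set M) : Prop :=
  ContMDiffOn (𝓡 4) (𝓡 4).tangent ∞ (fun p => (⟨p, X p⟩ : TangentBundle (𝓡 4) M)) R

/-- A smooth Lorentzian metric of signature `(-,+,+,+)`. -/
structure IsLorentzMetric (g : CovTensorField 2 M) : Prop where
  smooth : TensorSmoothOn g univ
  symm : ∀ (p : M) (X Y : TangentSpace (𝓡 4) p), g p ![X, Y] = g p ![Y, X]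
  signature : ∀ p : M, ∃ b : Module.Basis (Fin 4) ℝ (TangentSpace (𝓡 4) p), ∀ i j,
    g p ![b i, b j] = if i = j then (if i = 0 then -1 else 1) else 0

variable (g : CovTensorField 2 M)

/-- The matrix `g_{ij}` at `p`. -/
def gLow (p : M) : Matrix (Fin 4) (Fin 4) ℝ := fun i j => comp g p ![i, j]

/-- The inverse matrix `g^{ij}` at `p`. -/
def gUp (p : M) : Matrix (Fin 4) (Fin 4) ℝ := (gLow g p)⁻¹

/-- The Christoffel symbol `Γ^m_{ab}` at `p` of the Levi-Civita connection of `g`, in the preferred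
chart at `p`. -/
def christoffel (p : M) (m a b : Fin 4) : ℝ :=
  (1 / 2) * ∑ l, gUp g p m l *
    (partialD (chartComp g p ![b, l]) p a + partialD (chartComp g p ![a, l]) p b
      - partialD (chartComp g p ![a, b]) p l)

/-- The components `∇_a T_{i_1 … i_k}` at `p` of the covariant derivative of a covariant tensor
field. -/
def covDeriv {k : ℕ} (T : CovTensorField k M) (p : M) (a : Fin 4) (i : Fin k → Fin 4) : ℝ :=
  partialD (chartComp T p i) p a
    - ∑ j : Fin k, ∑ m, christoffel g p m a (i j) * comp T p (Function.update i j m)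

/-- The divergence `∇^α T_{α β_1 … β_k}`. -/
def divergence {k : ℕ} (T : CovTensorField (k + 1) M) : CovTensorField k M := fun p =>
  ofComp p fun i => ∑ a, ∑ c, gUp g p a c * covDeriv g T p c (Fin.cons a i)

/-- The one-form `X_a = g_{ab} X^b` of a vector field. -/
def flat (X : VecField M) : CovTensorField 1 M := fun p =>
  ofComp p fun i => ∑ b, gLow g p (i 0) b * vecComp p b (X p)

/-- The deformation tensor `π_{ab} = (𝓛_X g)_{ab} = ∇_a X_b + ∇_b X_a` at `p`. -/
def deformation (X : VecField M) (p : M) (a b : Fin 4) : ℝ :=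
  covDeriv g (flat g X) p a ![b] + covDeriv g (flat g X) p b ![a]

/-- The trace-free part `π - (1/4) (tr π) g` of the deformation tensor, indices down. -/
def deformationHat (X : VecField M) (p : M) (a b : Fin 4) : ℝ :=
  deformation g X p a b
    - (1 / 4) * (∑ c, ∑ d, gUp g p c d * deformation g X p c d) * gLow g p a b

/-- The trace-free part of the deformation tensor, indices up. -/
def deformationHatUp (X : VecField M) (p : M) (a b : Fin 4) : ℝ :=
  ∑ c, ∑ d, gUp g p a c * gUp g p b d * deformationHat g X p c d

/-! ### Weyl fields and the Bel-Robinson tensor -/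

/-- A Weyl field on `R`: a `4`-tensor field, antisymmetric in the first two and in the last two
indices, satisfying the cyclic identity `W_{α[βμν]} = 0` and trace-free,
`g^{αμ} W_{αβμν} = 0`. -/
structure IsWeylFieldOn (W : CovTensorField 4 M) (R : Set M) : Prop where
  antisymm_left : ∀ p ∈ R, ∀ a b c d : TangentSpace (𝓡 4) p,
    W p ![a, b, c, d] = - W p ![b, a, c, d]
  antisymm_right : ∀ p ∈ R, ∀ a b c d : TangentSpace (𝓡 4) p,
    W p ![a, b, c, d] = - W p ![a, b, d, c]
  cyclic : ∀ p ∈ R, ∀ a b c d : TangentSpace (𝓡 4) p,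
    W p ![a, b, c, d] + W p ![a, c, d, b] + W p ![a, d, b, c] = 0
  trace_free : ∀ p ∈ R, ∀ b d : Fin 4,
    ∑ a, ∑ c, gUp g p a c * comp W p ![a, b, c, d] = 0

/-- The volume form `ε_{abcd} = √|det g| [abcd]` at `p`, for the orientation of the preferred chart.
It only enters quadratically in the Bel-Robinson tensor, so the orientation is immaterial. -/
def volForm (p : M) (i : Fin 4 → Fin 4) : ℝ :=
  Real.sqrt |(gLow g p).det| * Matrix.det (fun a b : Fin 4 => if i a = b then (1 : ℝ) else 0)

/-- The dual `*W_{αβμν} = (1/2) W_{αβ}^{γδ} ε_{γδμν}` at `p` (left and right duals of a Weyl field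
coincide). -/
def dualComp (W : CovTensorField 4 M) (p : M) (a b m n : Fin 4) : ℝ :=
  (1 / 2) * ∑ c, ∑ d, ∑ c', ∑ d', gUp g p c c' * gUp g p d d' *
    comp W p ![a, b, c', d'] * volForm g p ![c, d, m, n]

/-- The Bel-Robinson tensor
`Q_{αβγδ} = W_{αργσ} W_β^ρ_δ^σ + *W_{αργσ} *W_β^ρ_δ^σ`. -/
def belRobinson (W : CovTensorField 4 M) : CovTensorField 4 M := fun p =>
  ofComp p fun i => ∑ r, ∑ s, ∑ r', ∑ s', gUp g p r r' * gUp g p s s' *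
    (comp W p ![i 0, r, i 2, s] * comp W p ![i 1, r', i 3, s']
      + dualComp g W p (i 0) r (i 2) s * dualComp g W p (i 1) r' (i 3) s')

/-- The bulk density
`K^{(X,Y,Z)}[W] = (1/2) Q_{αβγδ} (π̂_X^{αβ} Y^γ Z^δ + π̂_Y^{αβ} X^γ Z^δ + π̂_Z^{αβ} X^γ Y^δ)`. -/
def bulkK (W : CovTensorField 4 M) (X Y Z : VecField M) (p : M) : ℝ :=
  (1 / 2) * ∑ a, ∑ b, ∑ c, ∑ d, comp (belRobinson g W) p ![a, b, c, d] *
    (deformationHatUp g X p a b * vecComp p c (Y p) * vecComp p d (Z p)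
      + deformationHatUp g Y p a b * vecComp p c (X p) * vecComp p d (Z p)
      + deformationHatUp g Z p a b * vecComp p c (X p) * vecComp p d (Y p))

/-- The density `√|det g(v_i, v_j)|` of the volume element of `g` on the parallelepiped spanned by
`v_0, …, v_{n-1}` in `T_p M`. -/
def gramDensity {n : ℕ} (p : M) (v : Fin n → TangentSpace (𝓡 4) p) : ℝ :=
  Real.sqrt |Matrix.det (fun i j => g p ![v i, v j])|

end Tensors

/-! ### The sphere -/

/-- The unit sphere in `ℝ³`, with its standard smooth structure. -/
abbrev S2 : Type := Metric.sphere (0 : EuclideanSpace ℝ (Fin 3)) 1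

/-- The area measure of the round metric on the unit sphere. -/
def roundMeasure : Measure S2 := (volume : Measure (EuclideanSpace ℝ (Fin 3))).toSphere

/-- The coordinate basis `∂_{ϑ¹}, ∂_{ϑ²}` of `T_x S²` given by the preferred chart at `x`. -/
def sphereBasis (x : S2) (A : Fin 2) : TangentSpace (𝓡 2) x :=
  (EuclideanSpace.single A (1 : ℝ) : EuclideanSpace ℝ (Fin 2))

/-- The coordinate basis vectors `sphereBasis x A`, seen as vectors of `ℝ³`. -/
def sphereVec (x : S2) (A : Fin 2) : EuclideanSpace ℝ (Fin 3) :=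
  mfderiv (𝓡 2) 𝓘(ℝ, EuclideanSpace ℝ (Fin 3))
    (fun y : S2 => (y : EuclideanSpace ℝ (Fin 3))) x (sphereBasis x A)

/-- The density `√det` of the round metric in the basis `sphereBasis x`. Dividing the density of
another volume element in this basis by it gives the density with respect to `roundMeasure`,
independently of the basis. -/
def roundDensity (x : S2) : ℝ :=
  Real.sqrt (Matrix.det (fun A B : Fin 2 => inner ℝ (sphereVec x A) (sphereVec x B)))

/-! ### Double null gauge -/

/-- A global expression of `g` in double null gauge on a domain `R = chart.target` of `M`: a
diffeomorphism of `R` with `U × S²`, with `U ⊆ ℝ²` the range of `(u, v)`, in which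
`g = -2Ω² (du ⊗ dv + dv ⊗ du) + γ_{AB} (dϑ^A - b^A dv) ⊗ (dϑ^B - b^B dv)`.
Here `(a, c, ξ)` stands for the tangent vector `a ∂_u + c ∂_v + ξ` with `ξ` tangent to the sphere,
`γ` is the metric induced on the spheres `S_{u,v}` and `b` is the shift. -/
structure DoubleNullGauge {M : Type*} [TopologicalSpace M]
    [ChartedSpace (EuclideanSpace ℝ (Fin 4)) M] (g : CovTensorField 2 M) where
  chart : OpenPartialHomeomorph ((ℝ × ℝ) × S2) M
  smooth_chart : ContMDiffOn (𝓘(ℝ, ℝ × ℝ).prod (𝓡 2)) (𝓡 4) ∞ chart chart.source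
  smooth_symm : ContMDiffOn (𝓡 4) (𝓘(ℝ, ℝ × ℝ).prod (𝓡 2)) ∞ chart.symm chart.target
  U : Set (ℝ × ℝ)
  source_eq : chart.source = U ×ˢ univ
  Ω : ℝ × ℝ → S2 → ℝ
  γ : ∀ (_ : ℝ × ℝ) (x : S2), TangentSpace (𝓡 2) x →L[ℝ] TangentSpace (𝓡 2) x →L[ℝ] ℝ
  b : ∀ (_ : ℝ × ℝ) (x : S2), TangentSpace (𝓡 2) x
  Ω_pos : ∀ q ∈ U, ∀ x, 0 < Ω q x
  γ_symm : ∀ q ∈ U, ∀ x ξ η, γ q x ξ η = γ q x η ξ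
  γ_pos : ∀ q ∈ U, ∀ x ξ, ξ ≠ 0 → 0 < γ q x ξ ξ
  metric_eq : ∀ q ∈ U, ∀ (x : S2) (a c a' c' : ℝ) (ξ ξ' : TangentSpace (𝓡 2) x),
    g (chart (q, x))
        ![mfderiv (𝓘(ℝ, ℝ × ℝ).prod (𝓡 2)) (𝓡 4) chart (q, x) ((a, c), ξ),
          mfderiv (𝓘(ℝ, ℝ × ℝ).prod (𝓡 2)) (𝓡 4) chart (q, x) ((a', c'), ξ')]
      = -2 * Ω q x ^ 2 * (a * c' + c * a')
        + γ q x (ξ - c • b q x) (ξ' - c' • b q x)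

namespace DoubleNullGauge

variable {M : Type*} [TopologicalSpace M] [ChartedSpace (EuclideanSpace ℝ (Fin 4)) M]
  {g : CovTensorField 2 M} (N : DoubleNullGauge g)

/-- The domain `R` of the double null gauge. -/
def R : Set M := N.chart.target

/-- The tangent vector `a ∂_u + c ∂_v + ξ` of `M` at the point with coordinates `(q, x)`. -/
def push (q : ℝ × ℝ) (x : S2) (a c : ℝ) (ξ : TangentSpace (𝓡 2) x) :
    TangentSpace (𝓡 4) (N.chart (q, x)) :=
  mfderiv (𝓘(ℝ, ℝ × ℝ).prod (𝓡 2)) (𝓡 4) N.chart (q, x) ((a, c), ξ)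

/-- The outgoing normalised null normal `L̂ = Ω⁻¹ (∂_v + b^A ∂_A)`. -/
def Lhat (q : ℝ × ℝ) (x : S2) : TangentSpace (𝓡 4) (N.chart (q, x)) :=
  (N.Ω q x)⁻¹ • N.push q x 0 1 (N.b q x)

/-- The ingoing normalised null normal `L̲̂ = Ω⁻¹ ∂_u`. -/
def Lbarhat (q : ℝ × ℝ) (x : S2) : TangentSpace (𝓡 4) (N.chart (q, x)) :=
  (N.Ω q x)⁻¹ • N.push q x 1 0 0

/-- The density of the area element of `S_{u,v}` with respect to `roundMeasure`. -/
def sphereDensity (q : ℝ × ℝ) (x : S2) : ℝ :=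
  Real.sqrt (Matrix.det (fun A B : Fin 2 => N.γ q x (sphereBasis x A) (sphereBasis x B)))
    / roundDensity x

/-- The integral `∫_{S_{u,v}} f dμ_γ`. -/
def sphereIntegral (q : ℝ × ℝ) (f : S2 → ℝ) : ℝ :=
  ∫ x, f x * N.sphereDensity q x ∂roundMeasure

/-- The area radius: `4π r(u,v)²` is the area of `S_{u,v}`. -/
def radius (q : ℝ × ℝ) : ℝ :=
  Real.sqrt (N.sphereIntegral q (fun _ => 1) / (4 * Real.pi))

/-- The area radius as a function on `R`. -/
def radiusFun (p : M) : ℝ := N.radius (N.chart.symm p).1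

/-- The level sets of the area radius are spacelike on `R`: all their tangent vectors are
spacelike. -/
def LevelsSpacelike : Prop :=
  ∀ p ∈ N.R, ∀ w : TangentSpace (𝓡 4) p, w ≠ 0 → mvfderiv (𝓡 4) N.radiusFun p w = 0 →
    0 < g p ![w, w]

/-- The vector field `V^a = -g^{ab} ∂_b r`. -/
def gradV (p : M) : TangentSpace (𝓡 4) p :=
  ∑ a, (-∑ c, gUp g p a c * partialD N.radiusFun p c) • basisVec p a

/-- The unit normal `n = φ V`, `φ = 1/√(-g(V,V))`, of the level sets of the area radius. -/
def normal (p : M) : TangentSpace (𝓡 4) p :=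
  (1 / Real.sqrt (-(g p ![N.gradV p, N.gradV p]))) • N.gradV p

/-- The range of `(u, v)` on the domain
`D = ⋃_{r₁ ≤ r ≤ r₂} Σ_r ∩ {u ≤ u₁} ∩ {v ≤ v₁}`. -/
def quotientDomain (r₁ r₂ u₁ v₁ : ℝ) : Set (ℝ × ℝ) :=
  {q | q ∈ N.U ∧ r₁ ≤ N.radius q ∧ N.radius q ≤ r₂ ∧ q.1 ≤ u₁ ∧ q.2 ≤ v₁}

/-- The domain `D = ⋃_{r₁ ≤ r ≤ r₂} Σ_r ∩ {u ≤ u₁} ∩ {v ≤ v₁}` in `R`. -/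
def domain (r₁ r₂ u₁ v₁ : ℝ) : Set M :=
  {p | p ∈ N.R ∧ r₁ ≤ N.radiusFun p ∧ N.radiusFun p ≤ r₂ ∧
    (N.chart.symm p).1.1 ≤ u₁ ∧ (N.chart.symm p).1.2 ≤ v₁}

/-- The density of `dμ_g` with respect to `du dv` times `roundMeasure`. -/
def bulkDensity (q : ℝ × ℝ) (x : S2) : ℝ :=
  gramDensity g (N.chart (q, x))
      ![N.push q x 1 0 0, N.push q x 0 1 0,
        N.push q x 0 0 (sphereBasis x 0), N.push q x 0 0 (sphereBasis x 1)]
    / roundDensity x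

/-- The integral `∫_D f dμ_g`, in the coordinates `(u, v, x)`. -/
def bulkIntegral (r₁ r₂ u₁ v₁ : ℝ) (f : M → ℝ) : ℝ :=
  ∫ q in N.quotientDomain r₁ r₂ u₁ v₁, ∫ x, f (N.chart (q, x)) * N.bulkDensity q x ∂roundMeasure

/-- The slope `dv/du` of the level curves of the area radius in the `(u, v)` plane. -/
def slope (q : ℝ × ℝ) : ℝ :=
  -(fderiv ℝ N.radius q (1, 0)) / fderiv ℝ N.radius q (0, 1)

/-- The density of the volume element of the metric induced by `g` on a level set of the area radius,
with respect to `du` times `roundMeasure`; the coordinate field `∂_u` of the level set is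
`∂_u + (dv/du) ∂_v`. -/
def levelDensity (q : ℝ × ℝ) (x : S2) : ℝ :=
  gramDensity g (N.chart (q, x))
      ![N.push q x 1 (N.slope q) 0,
        N.push q x 0 0 (sphereBasis x 0), N.push q x 0 0 (sphereBasis x 1)]
    / roundDensity x

/-- The flux `∫_{Σ_r ∩ D} Q(n, X, Y, Z) dμ_{g_r}`, in the coordinates `(u, x)` on `Σ_r`. For each
`u` the values of `v` with `(u, v)` in the domain and `r(u, v) = r` are summed over; there is at most
one such `v` if the lines `u = const` in the range of `(u, v)` are connected. -/
def levelFlux (r₁ r₂ u₁ v₁ r : ℝ) (Q : CovTensorField 4 M) (X Y Z : VecField M) : ℝ :=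
  ∫ u, ∑ᶠ v ∈ {v | (u, v) ∈ N.quotientDomain r₁ r₂ u₁ v₁ ∧ N.radius (u, v) = r},
    ∫ x, (fun p => Q p ![N.normal p, X p, Y p, Z p]) (N.chart ((u, v), x))
      * N.levelDensity (u, v) x ∂roundMeasure

/-- The flux `∫ dv ∫_{S_{u₁,v}} Ω Q(L̂, X, Y, Z) dμ_γ` through the part of `u = u₁` in `D`. -/
def outgoingFlux (r₁ r₂ u₁ v₁ : ℝ) (Q : CovTensorField 4 M) (X Y Z : VecField M) : ℝ :=
  ∫ v in {v | (u₁, v) ∈ N.quotientDomain r₁ r₂ u₁ v₁},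
    N.sphereIntegral (u₁, v) fun x =>
      N.Ω (u₁, v) x * Q (N.chart ((u₁, v), x))
        ![N.Lhat (u₁, v) x, X _, Y _, Z _]

/-- The flux `∫ du ∫_{S_{u,v₁}} Ω Q(L̲̂, X, Y, Z) dμ_γ` through the part of `v = v₁` in `D`. -/
def ingoingFlux (r₁ r₂ u₁ v₁ : ℝ) (Q : CovTensorField 4 M) (X Y Z : VecField M) : ℝ :=
  ∫ u in {u | (u, v₁) ∈ N.quotientDomain r₁ r₂ u₁ v₁},
    N.sphereIntegral (u, v₁) fun x =>
      N.Ω (u, v₁) x * Q (N.chart ((u, v₁), x))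
        ![N.Lbarhat (u, v₁) x, X _, Y _, Z _]

end DoubleNullGauge

end

/-! Write `Q` for the Bel-Robinson tensor and let `P^a = Q^a(X, Y, Z)` be its `current`. The
identity is the divergence theorem for `P` on the domain, combined with two computations: the
divergence of `P` is the bulk integrand, and the normal components of `P` on the boundary are the
fluxes.

The divergence is algebra. By the Leibniz rule `∇_a P^a` is `(div Q)(X, Y, Z)` plus three
contractions of `Q` with `∇X`, `∇Y` and `∇Z`. Since `Q` is totally symmetric and trace-free, it sees
only the trace-free symmetric part of each derivative, and the three terms add up to `K`
(`bulkK_eq`, `divergence_add_bulkK`). The symmetries of `Q` are proved at a point in an orthonormal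
frame, where a Weyl tensor has ten free components (`IsMinkWeyl.eq_weylArr`). The two hardest
claims, exchange of the middle slots and vanishing trace, are then polynomial identities.
`frameBel_basis_change` carries the result to the coordinate frame in which `Q` is defined.

For the divergence theorem, coordinates on the sphere are avoided. The gauge chart is extended to `U
× (ℝ³ ∖ 0)`, constant along rays, by `gaugeMap`; the pull-back of `g` is degenerate only in the
radial direction, and adding `dρ ⊗ dρ` makes it a nondegenerate form on an open set of a vector
space. The current lifts to a field `gaugeLift` tangent to the spheres. The coordinate divergence of
density times lift is the density times half the trace of a Lie derivative
(`trace_fderiv_formDensity_smul`), and by naturality of Lie derivatives (`lieForm_pullForm`) this is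
the density times the geometric divergence of `P`. Integration over a sphere removes the angular
derivatives (`integral_sphere_divergence`). What is left is `∂_u F + ∂_v G`, with `F` and `G` the
sphere integrals `fluxU` and `fluxV` of the `u` and `v` components.

It remains to apply Green's formula in the `(u, v)` plane to the region between two levels of `r`
(`green_levelRegion`). Spacelike levels force `∂_u r · ∂_v r > 0`
(`DoubleNullGauge.radius_deriv_pos`), since otherwise some tangent vector of a level would be null
or timelike. Hence `r` is locally monotone in both variables in the same sense and its level curves
are decreasing graphs. On a box one uses the fundamental theorem of calculus on lines and a change
of variables along the level curve; a partition of unity glues the boxes.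

The boundary terms are then matched pointwise. From `g(∂_v + b, P) = -2Ω² P^u` and `g(∂_u, P) = -2Ω²
P^v` the null fluxes are minus the integrals of `F` and `G`. On a level of `r` the flux density is
minus `sign(∂_v r) (G + (∂_u r / ∂_v r) F)` (`level_density`), where the sign accounts for the time
orientation of the normal. Inserting these in Green's formula gives the claim. -/

noncomputable section

/-! ### Green's formula for regions bounded by level curves in the plane -/

section Green

open Filter Topology

/-- The fundamental theorem of calculus on a sublevel set of a monotone function. -/
theorem integral_sublevel_slice {c d c' d' ρ v₁ : ℝ} {φ G G' : ℝ → ℝ}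
    (hmono : StrictMonoOn φ (Ioo c d)) (hcont : ContinuousOn φ (Ioo c d))
    (hG : ∀ v, HasDerivAt G (G' v) v) (hG' : Continuous G')
    (hc : c < c') (hd : d' < d) (hsupp : ∀ v, v ∉ Icc c' d' → G v = 0)
    (hv₁ : v₁ ∈ Ioo c d → φ v₁ ≠ ρ) :
    ∫ v in {v | v ∈ Ioo c d ∧ φ v ≤ ρ ∧ v ≤ v₁}, G' v
      = (if v₁ ∈ Ioo c d ∧ φ v₁ ≤ ρ then G v₁ else 0)
        + ∑ᶠ v ∈ {v | (v ∈ Ioo c d ∧ φ v ≤ ρ ∧ v ≤ v₁) ∧ φ v = ρ}, G v := by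
  have hGc : G c = 0 := hsupp c (fun h => absurd h.1 (not_le.2 hc))
  have hGd : G d = 0 := hsupp d (fun h => absurd h.2 (not_le.2 hd))
  have key : ∀ e, c < e → ∫ v in Ioc c e, G' v = G e := by
    intro e he
    rw [← intervalIntegral.integral_of_le he.le,
      intervalIntegral.integral_eq_sub_of_hasDerivAt (fun v _ => hG v)
        (hG'.intervalIntegrable _ _), hGc, sub_zero]
  -- The slice is an interval starting at `c`, where `G` vanishes. Its upper end is `v₁`, or the
  -- level point, or `d`, where `G` vanishes again. The hypothesis `hv₁` keeps `v₁` from being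
  -- counted both as an endpoint and as a level point.
  by_cases h1 : v₁ ∈ Ioo c d ∧ φ v₁ ≤ ρ
  · have hlt : φ v₁ < ρ := lt_of_le_of_ne h1.2 (hv₁ h1.1)
    have hle : ∀ v ∈ Ioo c d, v ≤ v₁ → φ v < ρ := fun v hv hvv =>
      (hmono.monotoneOn hv h1.1 hvv).trans_lt hlt
    have hs : {v | v ∈ Ioo c d ∧ φ v ≤ ρ ∧ v ≤ v₁} = Ioc c v₁ := by
      ext v
      refine ⟨fun h => ⟨h.1.1, h.2.2⟩, fun h => ?_⟩
      have hv : v ∈ Ioo c d := ⟨h.1, h.2.trans_lt h1.1.2⟩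
      exact ⟨hv, (hle v hv h.2).le, h.2⟩
    have he : {v | (v ∈ Ioo c d ∧ φ v ≤ ρ ∧ v ≤ v₁) ∧ φ v = ρ} = ∅ := by
      ext v
      simp only [mem_ofPred_eq, mem_empty_iff_false, iff_false]
      rintro ⟨⟨h2, _, h3⟩, h4⟩
      exact (hle v h2 h3).ne h4
    rw [hs, he, if_pos h1, key v₁ h1.1.1]
    simp
  rw [if_neg h1, zero_add]
  by_cases h2 : ∃ e, (e ∈ Ioo c d ∧ φ e ≤ ρ ∧ e ≤ v₁) ∧ φ e = ρ
  · obtain ⟨e, ⟨he, -, hev⟩, heρ⟩ := h2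
    have hs : {v | v ∈ Ioo c d ∧ φ v ≤ ρ ∧ v ≤ v₁} = Ioc c e := by
      ext v
      refine ⟨fun h => ⟨h.1.1, ?_⟩, fun h => ?_⟩
      · by_contra! hlt
        exact absurd (hmono he h.1 hlt) (by rw [heρ]; exact not_lt.2 h.2.1)
      · have hv : v ∈ Ioo c d := ⟨h.1, h.2.trans_lt he.2⟩
        exact ⟨hv, heρ ▸ hmono.monotoneOn hv he h.2, h.2.trans hev⟩
    have hset : {v | (v ∈ Ioo c d ∧ φ v ≤ ρ ∧ v ≤ v₁) ∧ φ v = ρ} = {e} := by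
      ext v
      refine ⟨fun h => hmono.injOn h.1.1 he (h.2.trans heρ.symm), ?_⟩
      rintro rfl
      exact ⟨⟨he, heρ.le, hev⟩, heρ⟩
    rw [hs, hset, finsum_mem_singleton, key e he.1]
  have he : {v | (v ∈ Ioo c d ∧ φ v ≤ ρ ∧ v ≤ v₁) ∧ φ v = ρ} = ∅ := by
    ext v
    simp only [mem_ofPred_eq, mem_empty_iff_false, iff_false]
    exact fun h => h2 ⟨v, h⟩
  rw [he, finsum_mem_empty]
  -- With no level point, the intermediate value theorem leaves two possibilities: the slice is all
  -- of `(c, d)`, or it is empty. Both contribute zero.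
  by_cases h3 : ∃ v₀, v₀ ∈ Ioo c d ∧ φ v₀ ≤ ρ ∧ v₀ ≤ v₁
  · obtain ⟨v₀, h0, h0ρ, h0v⟩ := h3
    have hall : ∀ v ∈ Ioo c d, v ≤ v₁ → φ v ≤ ρ := by
      intro v hv hvv
      by_contra! hlt
      have hv0 : v₀ ≤ v := by
        by_contra! hh
        exact absurd (hmono hv h0 hh) (by linarith)
      have hsub : Icc v₀ v ⊆ Ioo c d := fun x hx => ⟨h0.1.trans_le hx.1, hx.2.trans_lt hv.2⟩
      obtain ⟨e, he, heρ⟩ := intermediate_value_Icc hv0 (hcont.mono hsub) ⟨h0ρ, hlt.le⟩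
      exact h2 ⟨e, ⟨hsub he, heρ.le, he.2.trans hvv⟩, heρ⟩
    have hd1 : d ≤ v₁ := by
      by_contra! hh
      have : v₁ ∈ Ioo c d := ⟨h0.1.trans_le h0v, hh⟩
      exact h1 ⟨this, hall v₁ this le_rfl⟩
    have hs : {v | v ∈ Ioo c d ∧ φ v ≤ ρ ∧ v ≤ v₁} = Ioo c d := by
      ext v
      refine ⟨fun h => h.1, fun h => ⟨h, hall v h (h.2.le.trans hd1), h.2.le.trans hd1⟩⟩
    rw [hs, ← integral_Ioc_eq_integral_Ioo, key d (h0.1.trans h0.2), hGd]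
  · have hs : {v | v ∈ Ioo c d ∧ φ v ≤ ρ ∧ v ≤ v₁} = ∅ := by
      ext v
      simp only [mem_ofPred_eq, mem_empty_iff_false, iff_false]
      exact fun h => h3 ⟨v, h⟩
    rw [hs]; simp

/-- The part of a box below a level of `r` and of the coordinates. -/
def boxRegion (a b c d : ℝ) (r : ℝ × ℝ → ℝ) (ρ u₁ v₁ : ℝ) : Set (ℝ × ℝ) :=
  {q | (q.1 ∈ Ioo a b ∧ q.2 ∈ Ioo c d) ∧ r q ≤ ρ ∧ q.1 ≤ u₁ ∧ q.2 ≤ v₁}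

theorem measurableSet_boxRegion {a b c d : ℝ} {r : ℝ × ℝ → ℝ} {ρ u₁ v₁ : ℝ}
    (hr : ContinuousOn r (Ioo a b ×ˢ Ioo c d)) : MeasurableSet (boxRegion a b c d r ρ u₁ v₁) := by
  have hB : IsOpen (Ioo a b ×ˢ Ioo c d) := isOpen_Ioo.prod isOpen_Ioo
  have h1 : MeasurableSet ((Ioo a b ×ˢ Ioo c d) ∩ r ⁻¹' Ioi ρ) :=
    (hr.isOpen_inter_preimage hB isOpen_Ioi).measurableSet
  have h2 : boxRegion a b c d r ρ u₁ v₁ = ((Ioo a b ×ˢ Ioo c d) \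
      ((Ioo a b ×ˢ Ioo c d) ∩ r ⁻¹' Ioi ρ)) ∩ (Prod.fst ⁻¹' Iic u₁ ∩ Prod.snd ⁻¹' Iic v₁) := by
    ext q
    simp only [boxRegion, mem_ofPred_eq, mem_inter_iff, Set.mem_sdiff, mem_prod, mem_preimage, mem_Ioi,
      mem_Iic, not_and, not_lt]
    tauto
  rw [h2]
  exact (hB.measurableSet.diff h1).inter
    ((measurable_fst measurableSet_Iic).inter (measurable_snd measurableSet_Iic))

/-- Fubini, with `integral_sublevel_slice` on almost every line `u = const`. This is the half of
Green's formula that concerns `∂_v G`; the other half follows by exchanging the coordinates. -/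
theorem boxRegion_vertical {a b c d c' d' ρ u₁ v₁ : ℝ} {r G G' : ℝ × ℝ → ℝ}
    (hcont : ContinuousOn r (Ioo a b ×ˢ Ioo c d))
    (hmu : ∀ v ∈ Ioo c d, StrictMonoOn (fun u => r (u, v)) (Ioo a b))
    (hmv : ∀ u ∈ Ioo a b, StrictMonoOn (fun v => r (u, v)) (Ioo c d))
    (hG : ∀ q : ℝ × ℝ, HasDerivAt (fun v => G (q.1, v)) (G' q) q.2) (hGc : Continuous G)
    (hGs : HasCompactSupport G)
    (hG' : Continuous G') (hG's : HasCompactSupport G')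
    (hc : c < c') (hd : d' < d) (hsupp : ∀ u v, v ∉ Icc c' d' → G (u, v) = 0) :
    Integrable (fun u => ∑ᶠ v ∈ {v | (u, v) ∈ boxRegion a b c d r ρ u₁ v₁ ∧ r (u, v) = ρ},
        G (u, v)) ∧
    ∫ q in boxRegion a b c d r ρ u₁ v₁, G' q
      = (∫ u in {u | (u, v₁) ∈ boxRegion a b c d r ρ u₁ v₁}, G (u, v₁))
        + ∫ u, ∑ᶠ v ∈ {v | (u, v) ∈ boxRegion a b c d r ρ u₁ v₁ ∧ r (u, v) = ρ}, G (u, v) := by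
  classical
  have hA := measurableSet_boxRegion (ρ := ρ) (u₁ := u₁) (v₁ := v₁) hcont
  set A := boxRegion a b c d r ρ u₁ v₁ with hAdef
  have hint : Integrable (A.indicator G') (volume.prod volume) :=
    (hG'.integrable_of_hasCompactSupport hG's).indicator hA
  have hline : MeasurableSet {u : ℝ | (u, v₁) ∈ A} :=
    (measurable_id.prodMk measurable_const) hA
  have hG1 : Integrable (fun u => G (u, v₁)) := by
    have h : HasCompactSupport (fun u => G (u, v₁)) := by
      refine HasCompactSupport.of_support_subset_isCompact (hGs.image continuous_fst) ?_
      intro u hu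
      exact ⟨(u, v₁), subset_tsupport _ hu, rfl⟩
    exact (hGc.comp (by fun_prop)).integrable_of_hasCompactSupport h
  have hfirst : Integrable ({u : ℝ | (u, v₁) ∈ A}.indicator fun u => G (u, v₁)) :=
    hG1.indicator hline
  -- The slice formula fails only where `v₁` itself lies on the level. Monotonicity in `u` leaves at
  -- most one such `u`, a null set.
  have hexc : {u : ℝ | u ∈ Ioo a b ∧ v₁ ∈ Ioo c d ∧ r (u, v₁) = ρ}.Subsingleton := by
    rintro u ⟨hu, hv, he⟩ u' ⟨hu', -, he'⟩
    exact (hmu v₁ hv).injOn hu hu' (he.trans he'.symm)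
  have hslice : ∀ᵐ u : ℝ, ∫ v, A.indicator G' (u, v)
      = {u : ℝ | (u, v₁) ∈ A}.indicator (fun u => G (u, v₁)) u
        + ∑ᶠ v ∈ {v | (u, v) ∈ A ∧ r (u, v) = ρ}, G (u, v) := by
    have h0 : ∀ᵐ u : ℝ, u ∉ {u : ℝ | u ∈ Ioo a b ∧ v₁ ∈ Ioo c d ∧ r (u, v₁) = ρ} := by
      have := (hexc.countable.measure_zero volume)
      exact measure_eq_zero_iff_ae_notMem.1 this
    filter_upwards [h0] with u hu
    by_cases hub : u ∈ Ioo a b ∧ u ≤ u₁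
    · have hs := integral_sublevel_slice (ρ := ρ) (v₁ := v₁) (G := fun v => G (u, v))
        (G' := fun v => G' (u, v)) (hmv u hub.1)
        (hcont.comp (by fun_prop : ContinuousOn (fun v : ℝ => (u, v)) (Ioo c d))
          (fun v hv => ⟨hub.1, hv⟩)) (fun v => hG (u, v)) (hG'.comp (by fun_prop)) hc hd
        (hsupp u) (fun h1 h2 => hu ⟨hub.1, h1, h2⟩)
      have e1 : ∀ v, (u, v) ∈ A ↔ v ∈ Ioo c d ∧ r (u, v) ≤ ρ ∧ v ≤ v₁ := by
        intro v
        simp only [hAdef, boxRegion, mem_ofPred_eq]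
        tauto
      have e2 : ∫ v, A.indicator G' (u, v)
          = ∫ v in {v | v ∈ Ioo c d ∧ r (u, v) ≤ ρ ∧ v ≤ v₁}, G' (u, v) := by
        have hm : MeasurableSet {v : ℝ | v ∈ Ioo c d ∧ r (u, v) ≤ ρ ∧ v ≤ v₁} := by
          have : {v : ℝ | v ∈ Ioo c d ∧ r (u, v) ≤ ρ ∧ v ≤ v₁} = (fun v => (u, v)) ⁻¹' A := by
            ext v; exact (e1 v).symm
          rw [this]
          exact (measurable_const.prodMk measurable_id) hA
        rw [← integral_indicator hm]
        congr 1
        ext v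
        simp only [indicator_apply, mem_ofPred_eq, e1]
      rw [e2, hs]
      congr 1
      · simp only [indicator_apply, mem_ofPred_eq, e1]
        simp
      · simp only [mem_ofPred_eq, e1]
    · have e1 : ∀ v, (u, v) ∉ A := by
        intro v hv
        exact hub ⟨hv.1.1, hv.2.2.1⟩
      simp [e1]
  have htot : Integrable (fun u => ∫ v, A.indicator G' (u, v)) := hint.integral_prod_left
  -- Measurability of the level term is not checked by hand: almost everywhere it is the difference
  -- of two functions known to be integrable.
  have hsecond : Integrable (fun u => ∑ᶠ v ∈ {v | (u, v) ∈ A ∧ r (u, v) = ρ}, G (u, v)) := by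
    refine (htot.sub hfirst).congr ?_
    filter_upwards [hslice] with u hu
    simp [hu]
  refine ⟨hsecond, ?_⟩
  rw [← integral_indicator hA, ← integral_indicator hline, ← integral_add hfirst hsecond,
    Measure.volume_eq_prod, integral_prod _ hint]
  exact integral_congr_ae hslice

/-- The level curve of a function with `∂_u r > 0`, `∂_v r > 0` is a graph with slope
`- ∂_u r / ∂_v r`. -/
theorem hasDerivWithinAt_levelCurve {a b c d ρ : ℝ} {r : ℝ × ℝ → ℝ}
    {r' : ℝ × ℝ → (ℝ × ℝ →L[ℝ] ℝ)} {S : Set ℝ} {f : ℝ → ℝ}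
    (hr : ∀ q ∈ Ioo a b ×ˢ Ioo c d, HasFDerivAt r (r' q) q)
    (hpos : ∀ q ∈ Ioo a b ×ˢ Ioo c d, 0 < r' q (0, 1))
    (hmv : ∀ u ∈ Ioo a b, StrictMonoOn (fun v => r (u, v)) (Ioo c d))
    (hf : ∀ u ∈ S, u ∈ Ioo a b ∧ f u ∈ Ioo c d ∧ r (u, f u) = ρ) {u₀ : ℝ} (hu₀ : u₀ ∈ S) :
    HasDerivWithinAt f (-(r' (u₀, f u₀) (1, 0) / r' (u₀, f u₀) (0, 1))) S u₀ := by
  obtain ⟨hua, hva, hρ⟩ := hf u₀ hu₀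
  set v₀ := f u₀ with hv₀
  have hq : ((u₀, v₀) : ℝ × ℝ) ∈ Ioo a b ×ˢ Ioo c d := ⟨hua, hva⟩
  have hcontu : ∀ v ∈ Ioo c d, ContinuousAt (fun u => r (u, v)) u₀ := fun v hv =>
    ContinuousAt.comp (g := r) (f := fun u => (u, v)) (hr (u₀, v) ⟨hua, hv⟩).continuousAt
      (by fun_prop)
  -- Continuity of the curve comes from trapping it between two horizontal lines: at `u₀` the value
  -- of `r` on them lies strictly on either side of `ρ`, and this persists for nearby `u`.
  have hcont : Tendsto f (𝓝[S] u₀) (𝓝 v₀) := by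
    rw [tendsto_order]
    have hS : ∀ᶠ u in 𝓝[S] u₀, u ∈ S := self_mem_nhdsWithin
    constructor
    · intro l hl
      obtain ⟨l', hl1, hl2⟩ := exists_between (max_lt hl hva.1)
      have hl' : l' ∈ Ioo c d := ⟨(le_max_right _ _).trans_lt hl1, hl2.trans hva.2⟩
      have h1 : r (u₀, l') < ρ := hρ ▸ hmv u₀ hua hl' hva hl2
      have h2 : ∀ᶠ u in 𝓝[S] u₀, r (u, l') < ρ :=
        ((hcontu l' hl').eventually_lt continuousAt_const h1).filter_mono nhdsWithin_le_nhds
      filter_upwards [hS, h2] with u hu h3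
      obtain ⟨hu1, hu2, hu3⟩ := hf u hu
      by_contra! h4
      have h5 : f u ≤ l' := h4.trans ((le_max_left _ _).trans hl1.le)
      have := (hmv u hu1).monotoneOn hu2 hl' h5
      simp only [hu3] at this
      linarith
    · intro l hl
      obtain ⟨l', hl1, hl2⟩ := exists_between (lt_min hl hva.2)
      have hl' : l' ∈ Ioo c d := ⟨hva.1.trans hl1, hl2.trans_le (min_le_right _ _)⟩
      have h1 : ρ < r (u₀, l') := hρ ▸ hmv u₀ hua hva hl' hl1
      have h2 : ∀ᶠ u in 𝓝[S] u₀, ρ < r (u, l') :=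
        (continuousAt_const.eventually_lt (hcontu l' hl') h1).filter_mono nhdsWithin_le_nhds
      filter_upwards [hS, h2] with u hu h3
      obtain ⟨hu1, hu2, hu3⟩ := hf u hu
      by_contra! h4
      have h5 : l' ≤ f u := (hl2.le.trans (min_le_left _ _)).trans h4
      have := (hmv u hu1).monotoneOn hl' hu2 h5
      simp only [hu3] at this
      linarith
  set α := r' (u₀, v₀) (1, 0)
  set β := r' (u₀, v₀) (0, 1)
  have hβ : 0 < β := hpos _ hq
  have htend : Tendsto (fun u => (u, f u)) (𝓝[S] u₀) (𝓝 (u₀, v₀)) :=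
    (tendsto_id.mono_left nhdsWithin_le_nhds).prodMk_nhds hcont
  have h1 := ((hr _ hq).isLittleO).comp_tendsto htend
  have h2 : (fun u => α * (u - u₀) + β * (f u - v₀))
      =o[𝓝[S] u₀] fun u => ((u - u₀, f u - v₀) : ℝ × ℝ) := by
    refine (h1.neg_left).congr' ?_ (Eventually.of_forall fun u => rfl)
    filter_upwards [self_mem_nhdsWithin] with u hu
    have h3 : ((u, f u) - (u₀, v₀) : ℝ × ℝ)
        = (u - u₀) • ((1, 0) : ℝ × ℝ) + (f u - v₀) • ((0, 1) : ℝ × ℝ) := by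
      ext <;> simp
    simp only [Function.comp, (hf u hu).2.2, hρ, h3, map_add, map_smul, smul_eq_mul]
    ring
  -- Taking the little-o constant to be `β / 2` lets half of `β |f u - v₀|` absorb the error, which
  -- leaves a bound by a multiple of `|u - u₀|`.
  have h3 : (fun u => ((u - u₀, f u - v₀) : ℝ × ℝ)) =O[𝓝[S] u₀] fun u => u - u₀ := by
    have h4 := h2.def (half_pos hβ)
    refine Asymptotics.IsBigO.of_bound (1 + (|α| + β / 2) / (β / 2)) ?_
    filter_upwards [h4] with u hu
    have h5 : |f u - v₀| ≤ (|α| + β / 2) / (β / 2) * |u - u₀| := by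
      rw [div_mul_eq_mul_div, le_div_iff₀ (half_pos hβ)]
      have h6 : ‖((u - u₀, f u - v₀) : ℝ × ℝ)‖ ≤ |u - u₀| + |f u - v₀| := by
        rw [Prod.norm_def]
        exact max_le (by simp) (by simp)
      have h7 : |β * (f u - v₀)| ≤ |α * (u - u₀) + β * (f u - v₀)| + |α * (u - u₀)| := by
        have := abs_sub (α * (u - u₀) + β * (f u - v₀)) (α * (u - u₀))
        simpa using this
      rw [abs_mul, abs_mul, abs_of_pos hβ] at h7
      rw [Real.norm_eq_abs] at hu
      have := mul_le_mul_of_nonneg_left h6 (half_pos hβ).le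
      nlinarith
    rw [Prod.norm_def, Real.norm_eq_abs, Real.norm_eq_abs]
    have h8 : 0 ≤ (|α| + β / 2) / (β / 2) * |u - u₀| := by positivity
    refine max_le ?_ ?_
    · show |u - u₀| ≤ _
      nlinarith
    · show |f u - v₀| ≤ _
      nlinarith [abs_nonneg (u - u₀)]
  have h4 := (h2.trans_isBigO h3).const_mul_left β⁻¹
  rw [hasDerivWithinAt_iff_isLittleO]
  refine h4.congr' (Eventually.of_forall fun u => ?_) (Eventually.of_forall fun u => rfl)
  simp only [smul_eq_mul]
  field_simp
  ring

end Green

/-! ### Green's formula on one box -/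

section Green

open Filter Topology

/-- `boxRegion_vertical` is applied to `G`, and to `F` with the coordinates exchanged. The level
term of `F` then appears as an integral over `v`; it becomes an integral over `u` by substituting
along the level curve `v = f u`, whose Jacobian `|f'|` is `∂_u r / ∂_v r`. -/
theorem boxRegion_green {a b c d a' b' c' d' ρ u₁ v₁ : ℝ} {r F F' G G' : ℝ × ℝ → ℝ}
    {r' : ℝ × ℝ → (ℝ × ℝ →L[ℝ] ℝ)}
    (hr : ∀ q ∈ Ioo a b ×ˢ Ioo c d, HasFDerivAt r (r' q) q)
    (hpu : ∀ q ∈ Ioo a b ×ˢ Ioo c d, 0 < r' q (1, 0))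
    (hpv : ∀ q ∈ Ioo a b ×ˢ Ioo c d, 0 < r' q (0, 1))
    (hF : ∀ q : ℝ × ℝ, HasDerivAt (fun u => F (u, q.2)) (F' q) q.1) (hFc : Continuous F)
    (hFs : HasCompactSupport F) (hF' : Continuous F') (hF's : HasCompactSupport F')
    (hG : ∀ q : ℝ × ℝ, HasDerivAt (fun v => G (q.1, v)) (G' q) q.2) (hGc : Continuous G)
    (hGs : HasCompactSupport G) (hG' : Continuous G') (hG's : HasCompactSupport G')
    (ha : a < a') (hb : b' < b) (hc : c < c') (hd : d' < d)
    (hFsupp : ∀ u v, u ∉ Icc a' b' → F (u, v) = 0)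
    (hGsupp : ∀ u v, v ∉ Icc c' d' → G (u, v) = 0) :
    Integrable (fun u => ∑ᶠ v ∈ {v | (u, v) ∈ boxRegion a b c d r ρ u₁ v₁ ∧ r (u, v) = ρ},
        (G (u, v) + r' (u, v) (1, 0) / r' (u, v) (0, 1) * F (u, v))) ∧
    ∫ q in boxRegion a b c d r ρ u₁ v₁, (F' q + G' q)
      = (∫ v in {v | (u₁, v) ∈ boxRegion a b c d r ρ u₁ v₁}, F (u₁, v))
        + (∫ u in {u | (u, v₁) ∈ boxRegion a b c d r ρ u₁ v₁}, G (u, v₁))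
        + ∫ u, ∑ᶠ v ∈ {v | (u, v) ∈ boxRegion a b c d r ρ u₁ v₁ ∧ r (u, v) = ρ},
            (G (u, v) + r' (u, v) (1, 0) / r' (u, v) (0, 1) * F (u, v)) := by
  classical
  have hcont : ContinuousOn r (Ioo a b ×ˢ Ioo c d) := fun q hq =>
    (hr q hq).continuousAt.continuousWithinAt
  have hdu : ∀ q ∈ Ioo a b ×ˢ Ioo c d, HasDerivAt (fun u => r (u, q.2)) (r' q (1, 0)) q.1 := by
    intro q hq
    have h := (hr q hq).comp_hasDerivAt q.1 (f := fun u : ℝ => (u, q.2))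
      ((hasDerivAt_id q.1).prodMk (hasDerivAt_const q.1 q.2))
    exact h
  have hdv : ∀ q ∈ Ioo a b ×ˢ Ioo c d, HasDerivAt (fun v => r (q.1, v)) (r' q (0, 1)) q.2 := by
    intro q hq
    have h := (hr q hq).comp_hasDerivAt q.2 (f := fun v : ℝ => (q.1, v))
      ((hasDerivAt_const q.2 q.1).prodMk (hasDerivAt_id q.2))
    exact h
  have hmu : ∀ v ∈ Ioo c d, StrictMonoOn (fun u => r (u, v)) (Ioo a b) := by
    intro v hv
    refine strictMonoOn_of_deriv_pos (convex_Ioo a b) (fun u hu =>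
      (hdu (u, v) ⟨hu, hv⟩).continuousAt.continuousWithinAt) fun u hu => ?_
    rw [interior_Ioo] at hu
    rw [(hdu (u, v) ⟨hu, hv⟩).deriv]
    exact hpu _ ⟨hu, hv⟩
  have hmv : ∀ u ∈ Ioo a b, StrictMonoOn (fun v => r (u, v)) (Ioo c d) := by
    intro u hu
    refine strictMonoOn_of_deriv_pos (convex_Ioo c d) (fun v hv =>
      (hdv (u, v) ⟨hu, hv⟩).continuousAt.continuousWithinAt) fun v hv => ?_
    rw [interior_Ioo] at hv
    rw [(hdv (u, v) ⟨hu, hv⟩).deriv]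
    exact hpv _ ⟨hu, hv⟩
  have hA := measurableSet_boxRegion (ρ := ρ) (u₁ := u₁) (v₁ := v₁) hcont
  obtain ⟨hiG, heG⟩ := boxRegion_vertical (ρ := ρ) (u₁ := u₁) (v₁ := v₁) hcont hmu hmv hG hGc hGs
    hG' hG's hc hd hGsupp
  have hswap : ∀ {φ : ℝ × ℝ → ℝ}, HasCompactSupport φ → HasCompactSupport (φ ∘ Prod.swap) :=
    fun h => h.comp_homeomorph (Homeomorph.prodComm ℝ ℝ)
  obtain ⟨hiF, heF⟩ := boxRegion_vertical (a := c) (b := d) (c := a) (d := b) (ρ := ρ) (u₁ := v₁)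
    (v₁ := u₁) (r := r ∘ Prod.swap) (G := F ∘ Prod.swap) (G' := F' ∘ Prod.swap)
    (hcont.comp continuous_swap.continuousOn (fun q hq => ⟨hq.2, hq.1⟩)) hmv hmu
    (fun q => hF q.swap) (hFc.comp continuous_swap) (hswap hFs) (hF'.comp continuous_swap)
    (hswap hF's) ha hb (fun u v => hFsupp v u)
  set A := boxRegion a b c d r ρ u₁ v₁ with hAdef
  have hAs : ∀ u v, (v, u) ∈ boxRegion c d a b (r ∘ Prod.swap) ρ v₁ u₁ ↔ (u, v) ∈ A := by
    intro u v
    simp only [hAdef, boxRegion, mem_ofPred_eq, Function.comp, Prod.swap]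
    tauto
  have hAsw : boxRegion c d a b (r ∘ Prod.swap) ρ v₁ u₁ = Prod.swap ⁻¹' A := by
    ext ⟨v, u⟩
    exact hAs u v
  simp only [hAs, Function.comp, Prod.swap_prod_mk] at hiF heF
  have hL : ∫ q in boxRegion c d a b (r ∘ Prod.swap) ρ v₁ u₁, F' q.swap = ∫ q in A, F' q := by
    rw [hAsw]
    exact (Measure.measurePreserving_swap (μ := (volume : Measure ℝ))
      (ν := (volume : Measure ℝ))).setIntegral_preimage_emb
      MeasurableEquiv.prodComm.measurableEmbedding F' A
  rw [hL] at heF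
  -- the level curve
  let S : Set ℝ := {u | ∃ v, (u, v) ∈ A ∧ r (u, v) = ρ}
  let f : ℝ → ℝ := fun u => if h : ∃ v, (u, v) ∈ A ∧ r (u, v) = ρ then h.choose else 0
  have hf : ∀ u ∈ S, (u, f u) ∈ A ∧ r (u, f u) = ρ := by
    intro u hu
    have : f u = hu.choose := dif_pos hu
    rw [this]
    exact hu.choose_spec
  have hfuniq : ∀ u v, (u, v) ∈ A → r (u, v) = ρ → v = f u := by
    intro u v h1 h2
    obtain ⟨h3, h4⟩ := hf u ⟨v, h1, h2⟩
    exact (hmv u h1.1.1).injOn h1.1.2 h3.1.2 (h2.trans h4.symm)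
  have hfinj : InjOn f S := by
    intro u hu u' hu' he
    obtain ⟨h1, h2⟩ := hf u hu
    obtain ⟨h3, h4⟩ := hf u' hu'
    rw [he] at h1 h2
    exact (hmu _ h1.1.2).injOn h1.1.1 h3.1.1 (h2.trans h4.symm)
  have hfder : ∀ u ∈ S, HasDerivWithinAt f (-(r' (u, f u) (1, 0) / r' (u, f u) (0, 1))) S u :=
    fun u hu => hasDerivWithinAt_levelCurve hr hpv hmv
      (fun w hw => ⟨(hf w hw).1.1.1, (hf w hw).1.1.2, (hf w hw).2⟩) hu
  -- The projection of the level curve is an interval. Between two of its points the intermediate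
  -- value theorem produces a level point, and this point respects the bounds `u₁` and `v₁` because
  -- the curve decreases.
  have hSm : MeasurableSet S := by
    refine OrdConnected.measurableSet ⟨?_⟩
    intro x hx y hy z hz
    obtain ⟨hx1, hx2⟩ := hf x hx
    obtain ⟨hy1, hy2⟩ := hf y hy
    have hz1 : z ∈ Ioo a b := ⟨hx1.1.1.1.trans_le hz.1, hz.2.trans_lt hy1.1.1.2⟩
    have h1 : ρ ≤ r (z, f x) := hx2 ▸ (hmu _ hx1.1.2).monotoneOn hx1.1.1 hz1 hz.1
    have h2 : r (z, f y) ≤ ρ := hy2 ▸ (hmu _ hy1.1.2).monotoneOn hz1 hy1.1.1 hz.2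
    have h3 : f y ≤ f x := by
      by_contra! hlt
      have h4 := hmv z hz1 hx1.1.2 hy1.1.2 hlt
      simp only at h4
      linarith
    have hsub : Icc (f y) (f x) ⊆ Ioo c d := fun w hw =>
      ⟨hy1.1.2.1.trans_le hw.1, hw.2.trans_lt hx1.1.2.2⟩
    obtain ⟨w, hw, hwρ⟩ := intermediate_value_Icc h3 (f := fun v => r (z, v))
      (hcont.comp (by fun_prop : ContinuousOn (fun v : ℝ => (z, v)) _)
        (fun v hv => ⟨hz1, hsub hv⟩)) ⟨h2, h1⟩
    exact ⟨w, ⟨⟨hz1, hsub hw⟩, hwρ.le, hz.2.trans hy1.2.2.1, hw.2.trans hx1.2.2.2⟩, hwρ⟩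
  have hset : ∀ u ∈ S, {v | (u, v) ∈ A ∧ r (u, v) = ρ} = {f u} := by
    intro u hu
    ext v
    refine ⟨fun h => hfuniq u v h.1 h.2, ?_⟩
    rintro rfl
    exact hf u hu
  have hset0 : ∀ u, u ∉ S → {v | (u, v) ∈ A ∧ r (u, v) = ρ} = ∅ := by
    intro u hu
    ext v
    simp only [mem_ofPred_eq, mem_empty_iff_false, iff_false]
    exact fun h => hu ⟨v, h⟩
  have hfin : ∀ φ : ℝ × ℝ → ℝ, (fun u => ∑ᶠ v ∈ {v | (u, v) ∈ A ∧ r (u, v) = ρ}, φ (u, v))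
      = S.indicator fun u => φ (u, f u) := by
    intro φ
    ext u
    by_cases hu : u ∈ S
    · rw [hset u hu, finsum_mem_singleton, indicator_of_mem hu]
    · rw [hset0 u hu, finsum_mem_empty, indicator_of_notMem hu]
  -- The level term of `F` as a function of `v`: it is `F` along the curve over the image of `f` and
  -- zero elsewhere, so its integral is one over that image.
  let gF : ℝ → ℝ := fun v => ∑ᶠ u ∈ {u | (u, v) ∈ A ∧ r (u, v) = ρ}, F (u, v)
  have hgF : ∀ u ∈ S, gF (f u) = F (u, f u) := by
    intro u hu
    have : {u' | (u', f u) ∈ A ∧ r (u', f u) = ρ} = {u} := by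
      ext u'
      obtain ⟨h3, h4⟩ := hf u hu
      refine ⟨fun h => (hmu _ h3.1.2).injOn h.1.1.1 h3.1.1 (h.2.trans h4.symm), ?_⟩
      rintro rfl
      exact hf u' hu
    show ∑ᶠ u' ∈ {u' | (u', f u) ∈ A ∧ r (u', f u) = ρ}, F (u', f u) = _
    rw [this, finsum_mem_singleton]
  have hgF0 : ∀ v, v ∉ f '' S → gF v = 0 := by
    intro v hv
    have : {u' | (u', v) ∈ A ∧ r (u', v) = ρ} = ∅ := by
      ext u'
      simp only [mem_ofPred_eq, mem_empty_iff_false, iff_false]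
      rintro ⟨h1, h2⟩
      exact hv ⟨u', ⟨v, h1, h2⟩, (hfuniq u' v h1 h2).symm⟩
    show ∑ᶠ u' ∈ {u' | (u', v) ∈ A ∧ r (u', v) = ρ}, F (u', v) = _
    rw [this, finsum_mem_empty]
  have habs : ∀ u ∈ S, |(-(r' (u, f u) (1, 0) / r' (u, f u) (0, 1)))| • gF (f u)
      = r' (u, f u) (1, 0) / r' (u, f u) (0, 1) * F (u, f u) := by
    intro u hu
    have hq : (u, f u) ∈ Ioo a b ×ˢ Ioo c d := (hf u hu).1.1
    rw [abs_neg, abs_of_pos (div_pos (hpu _ hq) (hpv _ hq)), hgF u hu, smul_eq_mul]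
  have hcvi : ∫ v, gF v = ∫ u in S, r' (u, f u) (1, 0) / r' (u, f u) (0, 1) * F (u, f u) := by
    have h1 : ∫ v, gF v = ∫ v in f '' S, gF v :=
      (setIntegral_eq_integral_of_forall_compl_eq_zero hgF0).symm
    rw [h1, integral_image_eq_integral_abs_deriv_smul hSm hfder hfinj]
    exact setIntegral_congr_fun hSm habs
  have hcvint : IntegrableOn (fun u => r' (u, f u) (1, 0) / r' (u, f u) (0, 1) * F (u, f u)) S := by
    refine IntegrableOn.congr_fun ?_ habs hSm
    exact (integrableOn_image_iff_integrableOn_abs_deriv_smul hSm hfder hfinj gF).1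
      hiF.integrableOn
  rw [hfin] at hiG
  have heG' := hfin G
  have hfinal := hfin fun q => G q + r' q (1, 0) / r' q (0, 1) * F q
  rw [integrable_indicator_iff hSm] at hiG
  rw [hfinal]
  refine ⟨((integrable_indicator_iff hSm).2 (hiG.add hcvint)), ?_⟩
  have hFint : IntegrableOn F' A := (hF'.integrable_of_hasCompactSupport hF's).integrableOn
  have hGint : IntegrableOn G' A := (hG'.integrable_of_hasCompactSupport hG's).integrableOn
  rw [integral_add hFint hGint, heF, heG, integral_indicator hSm, integral_add hiG hcvint, heG',
    integral_indicator hSm]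
  have : ∫ v, ∑ᶠ u ∈ {u | (u, v) ∈ A ∧ r (u, v) = ρ}, F (u, v) = ∫ v, gF v := rfl
  rw [this, hcvi]
  ring

/-- The part of a box between two levels of `r` and below levels of the coordinates. -/
def boxStrip (a b c d : ℝ) (r : ℝ × ℝ → ℝ) (r₁ r₂ u₁ v₁ : ℝ) : Set (ℝ × ℝ) :=
  {q | (q.1 ∈ Ioo a b ∧ q.2 ∈ Ioo c d) ∧ r₁ ≤ r q ∧ r q ≤ r₂ ∧ q.1 ≤ u₁ ∧ q.2 ≤ v₁}

/-- Subtract `boxRegion_green` at `r₁` from the same formula at `r₂`. The strip and the difference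
of the two regions differ only in points of the level `r₁`, which is null in the plane and meets
each coordinate line in at most one point. -/
theorem boxStrip_green_pos {a b c d a' b' c' d' r₁ r₂ u₁ v₁ : ℝ} {r F F' G G' : ℝ × ℝ → ℝ}
    {r' : ℝ × ℝ → (ℝ × ℝ →L[ℝ] ℝ)} (h₁₂ : r₁ ≤ r₂)
    (hr : ∀ q ∈ Ioo a b ×ˢ Ioo c d, HasFDerivAt r (r' q) q)
    (hpu : ∀ q ∈ Ioo a b ×ˢ Ioo c d, 0 < r' q (1, 0))
    (hpv : ∀ q ∈ Ioo a b ×ˢ Ioo c d, 0 < r' q (0, 1))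
    (hF : ∀ q : ℝ × ℝ, HasDerivAt (fun u => F (u, q.2)) (F' q) q.1) (hFc : Continuous F)
    (hFs : HasCompactSupport F) (hF' : Continuous F') (hF's : HasCompactSupport F')
    (hG : ∀ q : ℝ × ℝ, HasDerivAt (fun v => G (q.1, v)) (G' q) q.2) (hGc : Continuous G)
    (hGs : HasCompactSupport G) (hG' : Continuous G') (hG's : HasCompactSupport G')
    (ha : a < a') (hb : b' < b) (hc : c < c') (hd : d' < d)
    (hFsupp : ∀ u v, u ∉ Icc a' b' → F (u, v) = 0)
    (hGsupp : ∀ u v, v ∉ Icc c' d' → G (u, v) = 0) :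
    (∀ ρ ∈ ({r₁, r₂} : Set ℝ), Integrable (fun u => ∑ᶠ v ∈ {v | (u, v) ∈ boxStrip a b c d r r₁ r₂ u₁ v₁ ∧
        r (u, v) = ρ}, (G (u, v) + r' (u, v) (1, 0) / r' (u, v) (0, 1) * F (u, v)))) ∧
    ∫ q in boxStrip a b c d r r₁ r₂ u₁ v₁, (F' q + G' q)
      = (∫ v in {v | (u₁, v) ∈ boxStrip a b c d r r₁ r₂ u₁ v₁}, F (u₁, v))
        + (∫ u in {u | (u, v₁) ∈ boxStrip a b c d r r₁ r₂ u₁ v₁}, G (u, v₁))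
        + (∫ u, ∑ᶠ v ∈ {v | (u, v) ∈ boxStrip a b c d r r₁ r₂ u₁ v₁ ∧ r (u, v) = r₂},
            (G (u, v) + r' (u, v) (1, 0) / r' (u, v) (0, 1) * F (u, v)))
        - ∫ u, ∑ᶠ v ∈ {v | (u, v) ∈ boxStrip a b c d r r₁ r₂ u₁ v₁ ∧ r (u, v) = r₁},
            (G (u, v) + r' (u, v) (1, 0) / r' (u, v) (0, 1) * F (u, v)) := by
  have hcont : ContinuousOn r (Ioo a b ×ˢ Ioo c d) := fun q hq =>
    (hr q hq).continuousAt.continuousWithinAt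
  have hA : ∀ ρ, MeasurableSet (boxRegion a b c d r ρ u₁ v₁) := fun ρ =>
    measurableSet_boxRegion hcont
  have H := fun ρ => boxRegion_green (ρ := ρ) (u₁ := u₁) (v₁ := v₁) hr hpu hpv hF hFc hFs hF' hF's
    hG hGc hGs hG' hG's ha hb hc hd hFsupp hGsupp
  have hinju : ∀ v ∈ Ioo c d, InjOn (fun u => r (u, v)) (Ioo a b) := by
    intro v hv
    refine (strictMonoOn_of_hasDerivWithinAt_pos (f' := fun u => r' (u, v) (1, 0))
      (convex_Ioo a b) (fun u hu => ?_) (fun u hu => ?_) fun u hu => ?_).injOn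
    · exact (ContinuousAt.comp (g := r) (f := fun u => (u, v)) (hr (u, v) ⟨hu, hv⟩).continuousAt
        (by fun_prop)).continuousWithinAt
    · rw [interior_Ioo] at hu ⊢
      exact ((hr (u, v) ⟨hu, hv⟩).comp_hasDerivAt u (f := fun u : ℝ => (u, v))
        ((hasDerivAt_id u).prodMk (hasDerivAt_const u v))).hasDerivWithinAt
    · rw [interior_Ioo] at hu
      exact hpu _ ⟨hu, hv⟩
  have hinjv : ∀ u ∈ Ioo a b, InjOn (fun v => r (u, v)) (Ioo c d) := by
    intro u hu
    refine (strictMonoOn_of_hasDerivWithinAt_pos (f' := fun v => r' (u, v) (0, 1))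
      (convex_Ioo c d) (fun v hv => ?_) (fun v hv => ?_) fun v hv => ?_).injOn
    · exact (ContinuousAt.comp (g := r) (f := fun v => (u, v)) (hr (u, v) ⟨hu, hv⟩).continuousAt
        (by fun_prop)).continuousWithinAt
    · rw [interior_Ioo] at hv ⊢
      exact ((hr (u, v) ⟨hu, hv⟩).comp_hasDerivAt v (f := fun v : ℝ => (u, v))
        ((hasDerivAt_const v u).prodMk (hasDerivAt_id v))).hasDerivWithinAt
    · rw [interior_Ioo] at hv
      exact hpv _ ⟨hu, hv⟩
  have hsub : boxRegion a b c d r r₁ u₁ v₁ ⊆ boxRegion a b c d r r₂ u₁ v₁ := fun q hq =>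
    ⟨hq.1, hq.2.1.trans h₁₂, hq.2.2⟩
  have hmem : ∀ q, q ∈ boxStrip a b c d r r₁ r₂ u₁ v₁ ↔
      q ∈ boxRegion a b c d r r₂ u₁ v₁ ∧ r₁ ≤ r q := by
    intro q
    simp only [boxStrip, boxRegion, mem_ofPred_eq]
    tauto
  have hmem' : ∀ q, q ∉ boxRegion a b c d r r₂ u₁ v₁ \ boxRegion a b c d r r₁ u₁ v₁ →
      q ∈ boxStrip a b c d r r₁ r₂ u₁ v₁ → q ∈ boxRegion a b c d r r₁ u₁ v₁ ∧ r q = r₁ := by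
    intro q h1 h2
    rw [hmem] at h2
    have h3 : q ∈ boxRegion a b c d r r₁ u₁ v₁ := by
      by_contra h
      exact h1 ⟨h2.1, h⟩
    exact ⟨h3, le_antisymm h3.2.1 h2.2⟩
  have hdiffsub : boxRegion a b c d r r₂ u₁ v₁ \ boxRegion a b c d r r₁ u₁ v₁ ⊆
      boxStrip a b c d r r₁ r₂ u₁ v₁ := by
    rintro q ⟨h1, h2⟩
    refine (hmem q).2 ⟨h1, ?_⟩
    by_contra! h3
    exact h2 ⟨h1.1, h3.le, h1.2.2⟩
  have hae : boxStrip a b c d r r₁ r₂ u₁ v₁ =ᵐ[volume]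
      (boxRegion a b c d r r₂ u₁ v₁ \ boxRegion a b c d r r₁ u₁ v₁ : Set (ℝ × ℝ)) := by
    have hL : MeasurableSet {q | q ∈ boxRegion a b c d r r₁ u₁ v₁ ∧ r q = r₁} := by
      have h1 : {q | q ∈ boxRegion a b c d r r₁ u₁ v₁ ∧ r q = r₁}
          = boxRegion a b c d r r₁ u₁ v₁ \ ((Ioo a b ×ˢ Ioo c d) ∩ r ⁻¹' Iio r₁) := by
        ext q
        simp only [boxRegion, mem_ofPred_eq, Set.mem_sdiff, mem_inter_iff, mem_prod, mem_preimage,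
          mem_Iio, not_and, not_lt]
        constructor
        · rintro ⟨h1, h2⟩
          exact ⟨h1, fun _ => h2.ge⟩
        · rintro ⟨h1, h2⟩
          exact ⟨h1, le_antisymm h1.2.1 (h2 h1.1)⟩
      rw [h1]
      exact (hA r₁).diff
        (hcont.isOpen_inter_preimage (isOpen_Ioo.prod isOpen_Ioo) isOpen_Iio).measurableSet
    have hnull : volume {q | q ∈ boxRegion a b c d r r₁ u₁ v₁ ∧ r q = r₁} = 0 := by
      rw [Measure.volume_eq_prod, Measure.measure_prod_null hL]
      refine Eventually.of_forall fun u => ?_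
      refine (Set.Subsingleton.countable ?_).measure_zero volume
      intro v hv v' hv'
      exact hinjv u hv.1.1.1 hv.1.1.2 hv'.1.1.2 (hv.2.trans hv'.2.symm)
    refine (ae_le_set.2 (measure_mono_null ?_ hnull)).antisymm (LE.le.eventuallyLE hdiffsub)
    rintro q ⟨h1, h2⟩
    exact hmem' q h2 h1
  have hlev2 : ∀ u, {v | (u, v) ∈ boxStrip a b c d r r₁ r₂ u₁ v₁ ∧ r (u, v) = r₂}
      = {v | (u, v) ∈ boxRegion a b c d r r₂ u₁ v₁ ∧ r (u, v) = r₂} := by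
    intro u
    ext v
    simp only [mem_ofPred_eq, hmem]
    exact ⟨fun h => ⟨h.1.1, h.2⟩, fun h => ⟨⟨h.1, h.2 ▸ h₁₂⟩, h.2⟩⟩
  have hlev1 : ∀ u, {v | (u, v) ∈ boxStrip a b c d r r₁ r₂ u₁ v₁ ∧ r (u, v) = r₁}
      = {v | (u, v) ∈ boxRegion a b c d r r₁ u₁ v₁ ∧ r (u, v) = r₁} := by
    intro u
    ext v
    simp only [mem_ofPred_eq, hmem]
    exact ⟨fun h => ⟨⟨h.1.1.1, h.2.le, h.1.1.2.2⟩, h.2⟩, fun h => ⟨⟨hsub h.1, h.2.ge⟩, h.2⟩⟩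
  have hlineF : ∫ v in {v | (u₁, v) ∈ boxStrip a b c d r r₁ r₂ u₁ v₁}, F (u₁, v)
      = (∫ v in {v | (u₁, v) ∈ boxRegion a b c d r r₂ u₁ v₁}, F (u₁, v))
        - ∫ v in {v | (u₁, v) ∈ boxRegion a b c d r r₁ u₁ v₁}, F (u₁, v) := by
    have hF1 : Integrable (fun v => F (u₁, v)) := by
      have h : HasCompactSupport (fun v => F (u₁, v)) := by
        refine HasCompactSupport.of_support_subset_isCompact (hFs.image continuous_snd) ?_
        intro v hv
        exact ⟨(u₁, v), subset_tsupport _ hv, rfl⟩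
      exact (hFc.comp (by fun_prop)).integrable_of_hasCompactSupport h
    have hm : MeasurableSet {v | (u₁, v) ∈ boxRegion a b c d r r₁ u₁ v₁} :=
      (measurable_const.prodMk measurable_id) (hA r₁)
    rw [← setIntegral_sdiff hm hF1.integrableOn (t := {v | (u₁, v) ∈ boxRegion a b c d r r₁ u₁ v₁})
      (s := {v | (u₁, v) ∈ boxRegion a b c d r r₂ u₁ v₁}) (fun x hx => hsub hx)]
    refine setIntegral_congr_set ?_
    refine (ae_le_set.2 (measure_mono_null ?_ (Set.Subsingleton.measure_zero
      (s := {v | (u₁, v) ∈ boxRegion a b c d r r₁ u₁ v₁ ∧ r (u₁, v) = r₁}) ?_ _))).antisymm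
      (LE.le.eventuallyLE fun v hv => hdiffsub hv)
    · rintro v ⟨h1, h2⟩
      exact hmem' _ h2 h1
    · intro v hv v' hv'
      exact hinjv u₁ hv.1.1.1 hv.1.1.2 hv'.1.1.2 (hv.2.trans hv'.2.symm)
  have hlineG : ∫ u in {u | (u, v₁) ∈ boxStrip a b c d r r₁ r₂ u₁ v₁}, G (u, v₁)
      = (∫ u in {u | (u, v₁) ∈ boxRegion a b c d r r₂ u₁ v₁}, G (u, v₁))
        - ∫ u in {u | (u, v₁) ∈ boxRegion a b c d r r₁ u₁ v₁}, G (u, v₁) := by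
    have hG1 : Integrable (fun u => G (u, v₁)) := by
      have h : HasCompactSupport (fun u => G (u, v₁)) := by
        refine HasCompactSupport.of_support_subset_isCompact (hGs.image continuous_fst) ?_
        intro u hu
        exact ⟨(u, v₁), subset_tsupport _ hu, rfl⟩
      exact (hGc.comp (by fun_prop)).integrable_of_hasCompactSupport h
    have hm : MeasurableSet {u | (u, v₁) ∈ boxRegion a b c d r r₁ u₁ v₁} :=
      (measurable_id.prodMk measurable_const) (hA r₁)
    rw [← setIntegral_sdiff hm hG1.integrableOn (t := {u | (u, v₁) ∈ boxRegion a b c d r r₁ u₁ v₁})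
      (s := {u | (u, v₁) ∈ boxRegion a b c d r r₂ u₁ v₁}) (fun x hx => hsub hx)]
    refine setIntegral_congr_set ?_
    refine (ae_le_set.2 (measure_mono_null ?_ (Set.Subsingleton.measure_zero
      (s := {u | (u, v₁) ∈ boxRegion a b c d r r₁ u₁ v₁ ∧ r (u, v₁) = r₁}) ?_ _))).antisymm
      (LE.le.eventuallyLE fun v hv => hdiffsub hv)
    · rintro v ⟨h1, h2⟩
      exact hmem' _ h2 h1
    · intro v hv v' hv'
      exact hinju v₁ hv.1.1.2 hv.1.1.1 hv'.1.1.1 (hv.2.trans hv'.2.symm)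
  have hint : Integrable (fun q => F' q + G' q) :=
    (hF'.integrable_of_hasCompactSupport hF's).add (hG'.integrable_of_hasCompactSupport hG's)
  constructor
  · rintro ρ (rfl | rfl)
    · simp only [hlev1]
      exact (H _).1
    · simp only [hlev2]
      exact (H _).1
  · rw [setIntegral_congr_set hae, setIntegral_sdiff (hA r₁) hint.integrableOn hsub, (H r₁).2,
      (H r₂).2, hlineF, hlineG]
    simp only [hlev1, hlev2]
    ring

end Green

/-! ### Green's formula on a compact region between two levels -/

section Green

open Filter Topology

theorem IsCompact.exists_subset_Icc_of_subset_Ioo {C : Set ℝ} (hC : IsCompact C) {a b : ℝ}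
    (h : C ⊆ Ioo a b) : ∃ a' b', a < a' ∧ b' < b ∧ C ⊆ Icc a' b' := by
  rcases C.eq_empty_or_nonempty with rfl | hne
  · exact ⟨a + 1, b - 1, by linarith, by linarith, empty_subset _⟩
  · obtain ⟨x, hx⟩ := hC.exists_isLeast hne
    obtain ⟨y, hy⟩ := hC.exists_isGreatest hne
    exact ⟨x, y, (h hx.1).1, (h hy.1).2, fun z hz => ⟨hx.2 hz, hy.2 hz⟩⟩

/-- `r` is strictly increasing in both variables or strictly decreasing in both variables. -/
def SameSignOn (r' : ℝ × ℝ → (ℝ × ℝ →L[ℝ] ℝ)) (s : Set (ℝ × ℝ)) : Prop :=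
  (∀ q ∈ s, 0 < r' q (1, 0) ∧ 0 < r' q (0, 1)) ∨ (∀ q ∈ s, r' q (1, 0) < 0 ∧ r' q (0, 1) < 0)

/-- A decreasing `r` is handled by passing to `-r`. This exchanges the two levels and hence the
signs of the level terms, while the quotient of the partial derivatives stays the same; the factor
`Real.sign` records the difference. -/
theorem boxStrip_green {a b c d r₁ r₂ u₁ v₁ : ℝ} {r F F' G G' : ℝ × ℝ → ℝ}
    {r' : ℝ × ℝ → (ℝ × ℝ →L[ℝ] ℝ)} (h₁₂ : r₁ ≤ r₂)
    (hr : ∀ q ∈ Ioo a b ×ˢ Ioo c d, HasFDerivAt r (r' q) q)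
    (hs : SameSignOn r' (Ioo a b ×ˢ Ioo c d))
    (hF : ∀ q : ℝ × ℝ, HasDerivAt (fun u => F (u, q.2)) (F' q) q.1) (hFc : Continuous F)
    (hF' : Continuous F')
    (hG : ∀ q : ℝ × ℝ, HasDerivAt (fun v => G (q.1, v)) (G' q) q.2) (hGc : Continuous G)
    (hG' : Continuous G') {C : Set (ℝ × ℝ)} (hC : IsCompact C) (hCB : C ⊆ Ioo a b ×ˢ Ioo c d)
    (hF0 : ∀ q, q ∉ C → F q = 0) (hF'0 : ∀ q, q ∉ C → F' q = 0)
    (hG0 : ∀ q, q ∉ C → G q = 0) (hG'0 : ∀ q, q ∉ C → G' q = 0) :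
    (∀ ρ ∈ ({r₁, r₂} : Set ℝ), Integrable (fun u => ∑ᶠ v ∈ {v | (u, v) ∈ boxStrip a b c d r r₁ r₂ u₁ v₁ ∧
        r (u, v) = ρ}, Real.sign (r' (u, v) (0, 1)) *
          (G (u, v) + r' (u, v) (1, 0) / r' (u, v) (0, 1) * F (u, v)))) ∧
    ∫ q in boxStrip a b c d r r₁ r₂ u₁ v₁, (F' q + G' q)
      = (∫ v in {v | (u₁, v) ∈ boxStrip a b c d r r₁ r₂ u₁ v₁}, F (u₁, v))
        + (∫ u in {u | (u, v₁) ∈ boxStrip a b c d r r₁ r₂ u₁ v₁}, G (u, v₁))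
        + (∫ u, ∑ᶠ v ∈ {v | (u, v) ∈ boxStrip a b c d r r₁ r₂ u₁ v₁ ∧ r (u, v) = r₂},
            Real.sign (r' (u, v) (0, 1)) *
            (G (u, v) + r' (u, v) (1, 0) / r' (u, v) (0, 1) * F (u, v)))
        - ∫ u, ∑ᶠ v ∈ {v | (u, v) ∈ boxStrip a b c d r r₁ r₂ u₁ v₁ ∧ r (u, v) = r₁},
            Real.sign (r' (u, v) (0, 1)) *
            (G (u, v) + r' (u, v) (1, 0) / r' (u, v) (0, 1) * F (u, v)) := by
  obtain ⟨a', b', ha, hb, hab⟩ := (hC.image continuous_fst).exists_subset_Icc_of_subset_Ioo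
    (a := a) (b := b) (by rintro _ ⟨q, hq, rfl⟩; exact (hCB hq).1)
  obtain ⟨c', d', hc, hd, hcd⟩ := (hC.image continuous_snd).exists_subset_Icc_of_subset_Ioo
    (a := c) (b := d) (by rintro _ ⟨q, hq, rfl⟩; exact (hCB hq).2)
  have hFs := HasCompactSupport.intro hC hF0
  have hF's := HasCompactSupport.intro hC hF'0
  have hGs := HasCompactSupport.intro hC hG0
  have hG's := HasCompactSupport.intro hC hG'0
  have hFsupp : ∀ u v, u ∉ Icc a' b' → F (u, v) = 0 := fun u v h =>
    hF0 _ fun h' => h (hab ⟨_, h', rfl⟩)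
  have hGsupp : ∀ u v, v ∉ Icc c' d' → G (u, v) = 0 := fun u v h =>
    hG0 _ fun h' => h (hcd ⟨_, h', rfl⟩)
  rcases hs with hs | hs
  · have H := boxStrip_green_pos (u₁ := u₁) (v₁ := v₁) h₁₂ hr (fun q hq => (hs q hq).1)
      (fun q hq => (hs q hq).2) hF hFc hFs hF' hF's hG hGc hGs hG' hG's ha hb hc hd hFsupp hGsupp
    have hfin : ∀ ρ u, ∑ᶠ v ∈ {v | (u, v) ∈ boxStrip a b c d r r₁ r₂ u₁ v₁ ∧ r (u, v) = ρ},
          Real.sign (r' (u, v) (0, 1)) *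
            (G (u, v) + r' (u, v) (1, 0) / r' (u, v) (0, 1) * F (u, v))
        = ∑ᶠ v ∈ {v | (u, v) ∈ boxStrip a b c d r r₁ r₂ u₁ v₁ ∧ r (u, v) = ρ},
            (G (u, v) + r' (u, v) (1, 0) / r' (u, v) (0, 1) * F (u, v)) := by
      intro ρ u
      refine finsum_mem_congr rfl fun v hv => ?_
      rw [Real.sign_of_pos (hs _ hv.1.1).2, one_mul]
    simp only [hfin]
    exact H
  · have H := boxStrip_green_pos (r := fun q => - r q) (r' := fun q => - r' q) (u₁ := u₁) (v₁ := v₁)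
      (neg_le_neg h₁₂) (fun q hq => (hr q hq).neg) (fun q hq => by simpa using (hs q hq).1)
      (fun q hq => by simpa using (hs q hq).2) hF hFc hFs hF' hF's hG hGc hGs hG' hG's ha hb hc hd
      hFsupp hGsupp
    have hstrip : boxStrip a b c d (fun q => - r q) (-r₂) (-r₁) u₁ v₁
        = boxStrip a b c d r r₁ r₂ u₁ v₁ := by
      ext q
      simp only [boxStrip, mem_ofPred_eq, neg_le_neg_iff]
      tauto
    have hfin : ∀ ρ u, ∑ᶠ v ∈ {v | (u, v) ∈ boxStrip a b c d r r₁ r₂ u₁ v₁ ∧ r (u, v) = ρ},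
          Real.sign (r' (u, v) (0, 1)) *
            (G (u, v) + r' (u, v) (1, 0) / r' (u, v) (0, 1) * F (u, v))
        = -∑ᶠ v ∈ {v | (u, v) ∈ boxStrip a b c d r r₁ r₂ u₁ v₁ ∧ r (u, v) = ρ},
            (G (u, v) + r' (u, v) (1, 0) / r' (u, v) (0, 1) * F (u, v)) := by
      intro ρ u
      simp only [← finsum_neg_distrib]
      refine finsum_mem_congr rfl fun v hv => ?_
      rw [Real.sign_of_neg (hs _ hv.1.1).2, neg_one_mul]
    simp only [hstrip, neg_inj, neg_apply, neg_div_neg_eq] at H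
    simp only [hfin, integral_neg]
    refine ⟨?_, by rw [H.2]; ring⟩
    rintro ρ (rfl | rfl)
    · have h := (H.1 (-ρ) (by simp)).neg
      simp only [neg_inj] at h
      exact h
    · have h := (H.1 (-ρ) (by simp)).neg
      simp only [neg_inj] at h
      exact h

/-- Around every point there is a box on which the signs of the partial derivatives are constant. -/
theorem exists_box_sameSignOn {U : Set (ℝ × ℝ)} (hU : IsOpen U) {r : ℝ × ℝ → ℝ}
    (hr : ∀ q ∈ U, DifferentiableAt ℝ r q)
    (hpos : ∀ q ∈ U, 0 < fderiv ℝ r q (1, 0) * fderiv ℝ r q (0, 1)) {q : ℝ × ℝ} (hq : q ∈ U) :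
    ∃ a b c d, q ∈ Ioo a b ×ˢ Ioo c d ∧ Ioo a b ×ˢ Ioo c d ⊆ U ∧
      SameSignOn (fderiv ℝ r) (Ioo a b ×ˢ Ioo c d) ∧
      ∀ u ∈ Ioo a b, InjOn (fun v => r (u, v)) (Ioo c d) := by
  obtain ⟨ε, hε, hball⟩ := Metric.isOpen_iff.1 hU q hq
  have hsub : Ioo (q.1 - ε) (q.1 + ε) ×ˢ Ioo (q.2 - ε) (q.2 + ε) ⊆ U := by
    rw [← Real.ball_eq_Ioo, ← Real.ball_eq_Ioo, ball_prod_same]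
    exact hball
  set I := Ioo (q.1 - ε) (q.1 + ε)
  set J := Ioo (q.2 - ε) (q.2 + ε)
  have hqI : q.1 ∈ I := ⟨by linarith, by linarith⟩
  have hqJ : q.2 ∈ J := ⟨by linarith, by linarith⟩
  have hdu : ∀ u ∈ I, ∀ v ∈ J, HasDerivAt (fun u => r (u, v)) (fderiv ℝ r (u, v) (1, 0)) u :=
    fun u hu v hv => (hr _ (hsub ⟨hu, hv⟩)).hasFDerivAt.comp_hasDerivAt u (f := fun u : ℝ => (u, v))
      ((hasDerivAt_id u).prodMk (hasDerivAt_const u v))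
  have hdv : ∀ u ∈ I, ∀ v ∈ J, HasDerivAt (fun v => r (u, v)) (fderiv ℝ r (u, v) (0, 1)) v :=
    fun u hu v hv => (hr _ (hsub ⟨hu, hv⟩)).hasFDerivAt.comp_hasDerivAt v (f := fun v : ℝ => (u, v))
      ((hasDerivAt_const v u).prodMk (hasDerivAt_id v))
  have hneu : ∀ u ∈ I, ∀ v ∈ J, fderiv ℝ r (u, v) (1, 0) ≠ 0 := fun u hu v hv h => by
    have := hpos (u, v) (hsub ⟨hu, hv⟩)
    rw [h] at this
    simp at this
  have hnev : ∀ u ∈ I, ∀ v ∈ J, fderiv ℝ r (u, v) (0, 1) ≠ 0 := fun u hu v hv h => by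
    have := hpos (u, v) (hsub ⟨hu, hv⟩)
    rw [h] at this
    simp at this
  -- By Darboux's theorem a nowhere vanishing derivative has constant sign on an interval, so no
  -- continuity of the partial derivatives is needed. The sign at `q` spreads first along one line,
  -- then across the box, the positive product tying the two derivatives together.
  have hu := fun v (hv : v ∈ J) => hasDerivWithinAt_forall_lt_or_forall_gt_of_forall_ne
    (convex_Ioo _ _) (fun u hu => (hdu u hu v hv).hasDerivWithinAt)
    (fun u hu => hneu u hu v hv)
  have hv := fun u (hu : u ∈ I) => hasDerivWithinAt_forall_lt_or_forall_gt_of_forall_ne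
    (convex_Ioo _ _) (fun v hv => (hdv u hu v hv).hasDerivWithinAt)
    (fun v hv => hnev u hu v hv)
  refine ⟨q.1 - ε, q.1 + ε, q.2 - ε, q.2 + ε, ⟨hqI, hqJ⟩, hsub, ?_, ?_⟩
  · rcases lt_or_gt_of_ne (hneu q.1 hqI q.2 hqJ) with h | h
    · right
      have h2 := neg_of_mul_pos_right (hpos (q.1, q.2) (hsub ⟨hqI, hqJ⟩)) h.le
      rintro ⟨u, v⟩ ⟨hu1, hv1⟩
      have h3 : fderiv ℝ r (q.1, v) (0, 1) < 0 := by
        rcases hv q.1 hqI with h4 | h4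
        · exact h4 v hv1
        · exact absurd (h4 q.2 hqJ) (not_lt.2 h2.le)
      have h5 := neg_of_mul_pos_left (hpos (q.1, v) (hsub ⟨hqI, hv1⟩)) h3.le
      have h6 : fderiv ℝ r (u, v) (1, 0) < 0 := by
        rcases hu v hv1 with h4 | h4
        · exact h4 u hu1
        · exact absurd (h4 q.1 hqI) (not_lt.2 h5.le)
      exact ⟨h6, neg_of_mul_pos_right (hpos (u, v) (hsub ⟨hu1, hv1⟩)) h6.le⟩
    · left
      have h2 := pos_of_mul_pos_right (hpos (q.1, q.2) (hsub ⟨hqI, hqJ⟩)) h.le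
      rintro ⟨u, v⟩ ⟨hu1, hv1⟩
      have h3 : 0 < fderiv ℝ r (q.1, v) (0, 1) := by
        rcases hv q.1 hqI with h4 | h4
        · exact absurd (h4 q.2 hqJ) (not_lt.2 h2.le)
        · exact h4 v hv1
      have h5 := pos_of_mul_pos_left (hpos (q.1, v) (hsub ⟨hqI, hv1⟩)) h3.le
      have h6 : 0 < fderiv ℝ r (u, v) (1, 0) := by
        rcases hu v hv1 with h4 | h4
        · exact absurd (h4 q.1 hqI) (not_lt.2 h5.le)
        · exact h4 u hu1
      exact ⟨h6, pos_of_mul_pos_right (hpos (u, v) (hsub ⟨hu1, hv1⟩)) h6.le⟩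
  · intro u hu1
    rcases hv u hu1 with h | h
    · exact (strictAntiOn_of_hasDerivWithinAt_neg (convex_Ioo _ _)
        (fun v hv => (hdv u hu1 v hv).continuousAt.continuousWithinAt)
        (fun v hv => (hdv u hu1 v (interior_subset hv)).hasDerivWithinAt)
        (fun v hv => h v (interior_subset hv))).injOn
    · exact (strictMonoOn_of_hasDerivWithinAt_pos (convex_Ioo _ _)
        (fun v hv => (hdv u hu1 v hv).continuousAt.continuousWithinAt)
        (fun v hv => (hdv u hu1 v (interior_subset hv)).hasDerivWithinAt)
        (fun v hv => h v (interior_subset hv))).injOn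

/-- The region of `U` between two levels of `r` and below levels of the coordinates. -/
def levelRegion (U : Set (ℝ × ℝ)) (r : ℝ × ℝ → ℝ) (r₁ r₂ u₁ v₁ : ℝ) : Set (ℝ × ℝ) :=
  {q | q ∈ U ∧ r₁ ≤ r q ∧ r q ≤ r₂ ∧ q.1 ≤ u₁ ∧ q.2 ≤ v₁}

/-- Finitely many boxes with constant signs cover the compact region. Cutting `F` and `G` off by a
subordinate partition of unity reduces to `boxStrip_green`; after summation the terms with
derivatives of the cut-off functions cancel. -/
theorem green_levelRegion {U : Set (ℝ × ℝ)} (hU : IsOpen U) {r : ℝ × ℝ → ℝ}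
    (hr : ∀ q ∈ U, DifferentiableAt ℝ r q)
    (hpos : ∀ q ∈ U, 0 < fderiv ℝ r q (1, 0) * fderiv ℝ r q (0, 1)) {r₁ r₂ u₁ v₁ : ℝ}
    (h₁₂ : r₁ ≤ r₂) (hK : IsCompact (levelRegion U r r₁ r₂ u₁ v₁)) {F F' G G' : ℝ × ℝ → ℝ}
    (hF : ∀ q ∈ U, HasDerivAt (fun u => F (u, q.2)) (F' q) q.1) (hFc : ContinuousOn F U)
    (hF' : ContinuousOn F' U)
    (hG : ∀ q ∈ U, HasDerivAt (fun v => G (q.1, v)) (G' q) q.2) (hGc : ContinuousOn G U)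
    (hG' : ContinuousOn G' U) :
    ∫ q in levelRegion U r r₁ r₂ u₁ v₁, (F' q + G' q)
      = (∫ v in {v | (u₁, v) ∈ levelRegion U r r₁ r₂ u₁ v₁}, F (u₁, v))
        + (∫ u in {u | (u, v₁) ∈ levelRegion U r r₁ r₂ u₁ v₁}, G (u, v₁))
        + (∫ u, ∑ᶠ v ∈ {v | (u, v) ∈ levelRegion U r r₁ r₂ u₁ v₁ ∧ r (u, v) = r₂},
            Real.sign (fderiv ℝ r (u, v) (0, 1)) *
            (G (u, v) + fderiv ℝ r (u, v) (1, 0) / fderiv ℝ r (u, v) (0, 1) * F (u, v)))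
        - ∫ u, ∑ᶠ v ∈ {v | (u, v) ∈ levelRegion U r r₁ r₂ u₁ v₁ ∧ r (u, v) = r₁},
            Real.sign (fderiv ℝ r (u, v) (0, 1)) *
            (G (u, v) + fderiv ℝ r (u, v) (1, 0) / fderiv ℝ r (u, v) (0, 1) * F (u, v)) := by
  classical
  set K := levelRegion U r r₁ r₂ u₁ v₁ with hKdef
  have hKU : K ⊆ U := fun q hq => hq.1
  choose! a b c d hbox using fun q (hq : q ∈ U) => exists_box_sameSignOn hU hr hpos hq
  let B : ℝ × ℝ → Set (ℝ × ℝ) := fun q => Ioo (a q) (b q) ×ˢ Ioo (c q) (d q)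
  have hBo : ∀ q, IsOpen (B q) := fun q => isOpen_Ioo.prod isOpen_Ioo
  obtain ⟨t, htK, hcover⟩ := hK.elim_nhds_subcover B fun q hq =>
    (hBo q).mem_nhds (hbox q (hKU hq)).1
  obtain ⟨χ, hχ⟩ := SmoothPartitionOfUnity.exists_isSubordinate 𝓘(ℝ, ℝ × ℝ) hK.isClosed
    (fun i : t => B i) (fun i => hBo i) (by
      intro q hq
      obtain ⟨i, hi, hqi⟩ := mem_iUnion₂.1 (hcover hq)
      exact mem_iUnion.2 ⟨⟨i, hi⟩, hqi⟩)
  have hBU : ∀ i : t, B i ⊆ U := fun i => (hbox i (hKU (htK i i.2))).2.1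
  have hχsmooth : ∀ i : t, ContDiff ℝ ∞ (χ i) := fun i => (χ i).contMDiff.contDiff
  have hχd : ∀ (i : t) q, HasFDerivAt (χ i) (fderiv ℝ (χ i) q) q := fun i q =>
    ((hχsmooth i).differentiable (by simp) q).hasFDerivAt
  have hχ'c : ∀ (i : t) w, Continuous fun q => fderiv ℝ (χ i) q w := fun i w =>
    ((hχsmooth i).continuous_fderiv (by simp)).clm_apply continuous_const
  have hCc : ∀ i : t, IsCompact (tsupport (χ i)) := by
    intro i
    have h1 : tsupport (χ i) ⊆ Icc (a i) (b i) ×ˢ Icc (c i) (d i) :=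
      (hχ i).trans (prod_mono Ioo_subset_Icc_self Ioo_subset_Icc_self)
    exact (isCompact_Icc.prod isCompact_Icc).of_isClosed_subset (isClosed_tsupport _) h1
  have hχ0 : ∀ (i : t) q, q ∉ tsupport (χ i) → χ i q = 0 := fun i q h => image_eq_zero_of_notMem_tsupport h
  have hχ'0 : ∀ (i : t) q w, q ∉ tsupport (χ i) → fderiv ℝ (χ i) q w = 0 := fun i q w h => by
    have : fderiv ℝ (χ i) q = 0 := image_eq_zero_of_notMem_tsupport
      fun h' => h (tsupport_fderiv_subset ℝ h')
    rw [this]; rfl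
  -- a function continuous on `U` becomes continuous after cutting off
  have hcut : ∀ (i : t) (φ : ℝ × ℝ → ℝ), (∀ q, q ∉ tsupport (χ i) → φ q = 0) →
      ContinuousOn φ U → Continuous φ := by
    intro i φ h0 hc
    refine continuous_of_tsupport fun q hq => ?_
    have h1 : q ∈ tsupport (χ i) := by
      have : tsupport φ ⊆ tsupport (χ i) :=
        closure_minimal (fun x hx => by_contra fun h => hx (h0 x h)) (isClosed_tsupport _)
      exact this hq
    exact hc.continuousAt (hU.mem_nhds (hBU i (hχ i h1)))
  let Fi : t → ℝ × ℝ → ℝ := fun i q => χ i q * F q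
  let Fi' : t → ℝ × ℝ → ℝ := fun i q => fderiv ℝ (χ i) q (1, 0) * F q + χ i q * F' q
  let Gi : t → ℝ × ℝ → ℝ := fun i q => χ i q * G q
  let Gi' : t → ℝ × ℝ → ℝ := fun i q => fderiv ℝ (χ i) q (0, 1) * G q + χ i q * G' q
  have hFi0 : ∀ i q, q ∉ tsupport (χ i) → Fi i q = 0 := fun i q h => by simp [Fi, hχ0 i q h]
  have hGi0 : ∀ i q, q ∉ tsupport (χ i) → Gi i q = 0 := fun i q h => by simp [Gi, hχ0 i q h]
  have hFi'0 : ∀ i q, q ∉ tsupport (χ i) → Fi' i q = 0 := fun i q h => by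
    simp [Fi', hχ0 i q h, hχ'0 i q _ h]
  have hGi'0 : ∀ i q, q ∉ tsupport (χ i) → Gi' i q = 0 := fun i q h => by
    simp [Gi', hχ0 i q h, hχ'0 i q _ h]
  have hχcont : ∀ i : t, Continuous (χ i) := fun i => (hχsmooth i).continuous
  have hFic : ∀ i, Continuous (Fi i) := fun i =>
    hcut i _ (hFi0 i) ((hχcont i).continuousOn.mul hFc)
  have hGic : ∀ i, Continuous (Gi i) := fun i =>
    hcut i _ (hGi0 i) ((hχcont i).continuousOn.mul hGc)
  have hFi'c : ∀ i, Continuous (Fi' i) := fun i => hcut i _ (hFi'0 i)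
    (((hχ'c i _).continuousOn.mul hFc).add ((hχcont i).continuousOn.mul hF'))
  have hGi'c : ∀ i, Continuous (Gi' i) := fun i => hcut i _ (hGi'0 i)
    (((hχ'c i _).continuousOn.mul hGc).add ((hχcont i).continuousOn.mul hG'))
  have hFid : ∀ i (q : ℝ × ℝ), HasDerivAt (fun u => Fi i (u, q.2)) (Fi' i q) q.1 := by
    intro i q
    by_cases hq : q ∈ tsupport (χ i)
    · exact ((hχd i q).comp_hasDerivAt q.1 (f := fun u : ℝ => (u, q.2))
        ((hasDerivAt_id q.1).prodMk (hasDerivAt_const q.1 q.2))).mul (hF q (hBU i (hχ i hq)))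
    · rw [hFi'0 i q hq]
      refine (hasDerivAt_const q.1 (0 : ℝ)).congr_of_eventuallyEq ?_
      have h1 : ∀ᶠ u in 𝓝 q.1, (u, q.2) ∈ (tsupport (χ i))ᶜ :=
        (by fun_prop : ContinuousAt (fun u : ℝ => (u, q.2)) q.1).eventually_mem
          ((isClosed_tsupport _).isOpen_compl.mem_nhds hq)
      filter_upwards [h1] with u hu
      exact hFi0 i _ hu
  have hGid : ∀ i (q : ℝ × ℝ), HasDerivAt (fun v => Gi i (q.1, v)) (Gi' i q) q.2 := by
    intro i q
    by_cases hq : q ∈ tsupport (χ i)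
    · exact ((hχd i q).comp_hasDerivAt q.2 (f := fun v : ℝ => (q.1, v))
        ((hasDerivAt_const q.2 q.1).prodMk (hasDerivAt_id q.2))).mul (hG q (hBU i (hχ i hq)))
    · rw [hGi'0 i q hq]
      refine (hasDerivAt_const q.2 (0 : ℝ)).congr_of_eventuallyEq ?_
      have h1 : ∀ᶠ v in 𝓝 q.2, (q.1, v) ∈ (tsupport (χ i))ᶜ :=
        (by fun_prop : ContinuousAt (fun v : ℝ => (q.1, v)) q.2).eventually_mem
          ((isClosed_tsupport _).isOpen_compl.mem_nhds hq)
      filter_upwards [h1] with v hv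
      exact hGi0 i _ hv
  have hsum1 : ∀ q ∈ K, ∑ i, χ i q = 1 := fun q hq => by
    have := χ.sum_eq_one hq
    rwa [finsum_eq_sum_of_fintype] at this
  -- The sum of the cut-off functions is at most one everywhere and equals one on `K`. Each point of
  -- `K` is thus a maximum, so the derivative vanishes even at boundary points of `K`.
  have hsum' : ∀ q ∈ K, ∀ w, ∑ i, fderiv ℝ (χ i) q w = 0 := by
    intro q hq w
    have hmax : IsLocalMax (fun q => ∑ i, χ i q) q := by
      refine Eventually.of_forall fun x => ?_
      simp only
      rw [hsum1 q hq, ← finsum_eq_sum_of_fintype]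
      exact χ.sum_le_one x
    have h1 : HasFDerivAt (fun q => ∑ i, χ i q) (∑ i, fderiv ℝ (χ i) q) q :=
      HasFDerivAt.fun_sum fun i _ => hχd i q
    have h2 := hmax.hasFDerivAt_eq_zero h1
    have h3 := congrArg (fun L => L w) h2
    simpa using h3
  have hKB : ∀ i : t, ∀ q, q ∈ boxStrip (a i) (b i) (c i) (d i) r r₁ r₂ u₁ v₁ ↔ q ∈ K ∧ q ∈ B i := by
    intro i q
    constructor
    · intro h
      exact ⟨⟨hBU i h.1, h.2⟩, h.1⟩
    · intro h
      exact ⟨h.2, h.1.2⟩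
  have H := fun i : t => boxStrip_green (r₁ := r₁) (r₂ := r₂) (u₁ := u₁) (v₁ := v₁) h₁₂
    (fun q hq => (hr q (hBU i hq)).hasFDerivAt) (hbox i (hKU (htK i i.2))).2.2.1
    (hFid i) (hFic i) (hFi'c i) (hGid i) (hGic i) (hGi'c i) (hCc i) (hχ i) (hFi0 i) (hFi'0 i)
    (hGi0 i) (hGi'0 i)
  have hKm : MeasurableSet K := hK.measurableSet
  have hnB : ∀ (i : t) q, q ∈ K → q ∉ boxStrip (a i) (b i) (c i) (d i) r r₁ r₂ u₁ v₁ →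
      q ∉ tsupport (χ i) := fun i q h1 h2 h3 => h2 ((hKB i q).2 ⟨h1, hχ i h3⟩)
  have hsubK : ∀ i : t, boxStrip (a i) (b i) (c i) (d i) r r₁ r₂ u₁ v₁ ⊆ K := fun i q hq =>
    ((hKB i q).1 hq).1
  -- the four kinds of terms
  have hLHS : ∫ q in K, (F' q + G' q)
      = ∑ i : t, ∫ q in boxStrip (a i) (b i) (c i) (d i) r r₁ r₂ u₁ v₁, (Fi' i q + Gi' i q) := by
    have h1 : ∀ i : t, ∫ q in boxStrip (a i) (b i) (c i) (d i) r r₁ r₂ u₁ v₁, (Fi' i q + Gi' i q)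
        = ∫ q in K, (Fi' i q + Gi' i q) := by
      intro i
      refine (setIntegral_eq_of_subset_of_forall_sdiff_eq_zero hKm (hsubK i) ?_).symm
      rintro q ⟨h2, h3⟩
      simp [hFi'0 i q (hnB i q h2 h3), hGi'0 i q (hnB i q h2 h3)]
    simp only [h1]
    have h2 : ∀ i : t, Continuous fun q => Fi' i q + Gi' i q := fun i => (hFi'c i).add (hGi'c i)
    rw [← integral_finsetSum _ fun i _ => (h2 i).continuousOn.integrableOn_compact hK]
    refine setIntegral_congr_fun hKm fun q hq => ?_
    simp only [Fi', Gi', Finset.sum_add_distrib, ← Finset.sum_mul, hsum1 q hq, hsum' q hq]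
    ring
  have hcompu : IsCompact {v | (u₁, v) ∈ K} := by
    refine (hK.image continuous_snd).of_isClosed_subset
      (hK.isClosed.preimage (by fun_prop : Continuous fun v : ℝ => (u₁, v))) ?_
    exact fun v hv => ⟨_, hv, rfl⟩
  have hcompv : IsCompact {u | (u, v₁) ∈ K} := by
    refine (hK.image continuous_fst).of_isClosed_subset
      (hK.isClosed.preimage (by fun_prop : Continuous fun u : ℝ => (u, v₁))) ?_
    exact fun v hv => ⟨_, hv, rfl⟩
  have hFline : ∫ v in {v | (u₁, v) ∈ K}, F (u₁, v)
      = ∑ i : t, ∫ v in {v | (u₁, v) ∈ boxStrip (a i) (b i) (c i) (d i) r r₁ r₂ u₁ v₁},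
          Fi i (u₁, v) := by
    have h1 : ∀ i : t, ∫ v in {v | (u₁, v) ∈ boxStrip (a i) (b i) (c i) (d i) r r₁ r₂ u₁ v₁},
          Fi i (u₁, v) = ∫ v in {v | (u₁, v) ∈ K}, Fi i (u₁, v) := by
      intro i
      refine (setIntegral_eq_of_subset_of_forall_sdiff_eq_zero hcompu.measurableSet
        (fun v hv => hsubK i hv) ?_).symm
      rintro v ⟨h2, h3⟩
      exact hFi0 i _ (hnB i _ h2 h3)
    simp only [h1]
    have h2 : ∀ i : t, Continuous fun v => Fi i (u₁, v) := fun i => (hFic i).comp (by fun_prop)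
    rw [← integral_finsetSum _ fun i _ => (h2 i).continuousOn.integrableOn_compact hcompu]
    refine setIntegral_congr_fun hcompu.measurableSet fun v hv => ?_
    simp only [Fi, ← Finset.sum_mul, hsum1 _ hv, one_mul]
  have hGline : ∫ u in {u | (u, v₁) ∈ K}, G (u, v₁)
      = ∑ i : t, ∫ u in {u | (u, v₁) ∈ boxStrip (a i) (b i) (c i) (d i) r r₁ r₂ u₁ v₁},
          Gi i (u, v₁) := by
    have h1 : ∀ i : t, ∫ u in {u | (u, v₁) ∈ boxStrip (a i) (b i) (c i) (d i) r r₁ r₂ u₁ v₁},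
          Gi i (u, v₁) = ∫ u in {u | (u, v₁) ∈ K}, Gi i (u, v₁) := by
      intro i
      refine (setIntegral_eq_of_subset_of_forall_sdiff_eq_zero hcompv.measurableSet
        (fun v hv => hsubK i hv) ?_).symm
      rintro v ⟨h2, h3⟩
      exact hGi0 i _ (hnB i _ h2 h3)
    simp only [h1]
    have h2 : ∀ i : t, Continuous fun u => Gi i (u, v₁) := fun i => (hGic i).comp (by fun_prop)
    rw [← integral_finsetSum _ fun i _ => (h2 i).continuousOn.integrableOn_compact hcompv]
    refine setIntegral_congr_fun hcompv.measurableSet fun v hv => ?_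
    simp only [Gi, ← Finset.sum_mul, hsum1 _ hv, one_mul]
  have hlev : ∀ ρ ∈ ({r₁, r₂} : Set ℝ),
      (∫ u, ∑ᶠ v ∈ {v | (u, v) ∈ K ∧ r (u, v) = ρ}, Real.sign (fderiv ℝ r (u, v) (0, 1)) *
        (G (u, v) + fderiv ℝ r (u, v) (1, 0) / fderiv ℝ r (u, v) (0, 1) * F (u, v)))
      = ∑ i : t, ∫ u, ∑ᶠ v ∈ {v | (u, v) ∈ boxStrip (a i) (b i) (c i) (d i) r r₁ r₂ u₁ v₁ ∧
          r (u, v) = ρ}, Real.sign (fderiv ℝ r (u, v) (0, 1)) *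
        (Gi i (u, v) + fderiv ℝ r (u, v) (1, 0) / fderiv ℝ r (u, v) (0, 1) * Fi i (u, v)) := by
    intro ρ hρ
    rw [← integral_finsetSum _ fun i _ => (H i).1 ρ hρ]
    refine integral_congr_ae (Eventually.of_forall fun u => ?_)
    simp only
    -- Each of the finitely many boxes contains at most one level point on a given line. Finiteness
    -- is needed because a `finsum` over an infinite support would be zero by convention.
    have hfin : {v | (u, v) ∈ K ∧ r (u, v) = ρ}.Finite := by
      have h1 : {v | (u, v) ∈ K ∧ r (u, v) = ρ} ⊆
          ⋃ i : t, {v | (u, v) ∈ B i ∧ r (u, v) = ρ} := by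
        rintro v ⟨h1, h2⟩
        obtain ⟨i, hi, hqi⟩ := mem_iUnion₂.1 (hcover h1)
        exact mem_iUnion.2 ⟨⟨i, hi⟩, hqi, h2⟩
      refine (finite_iUnion fun i : t => Set.Subsingleton.finite ?_).subset h1
      rintro v ⟨hv1, hv2⟩ v' ⟨hv1', hv2'⟩
      exact (hbox i (hKU (htK i i.2))).2.2.2 u hv1.1 hv1.2 hv1'.2 (hv2.trans hv2'.symm)
    have h2 : ∀ i : t, ∑ᶠ v ∈ {v | (u, v) ∈ boxStrip (a i) (b i) (c i) (d i) r r₁ r₂ u₁ v₁ ∧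
          r (u, v) = ρ}, Real.sign (fderiv ℝ r (u, v) (0, 1)) *
        (Gi i (u, v) + fderiv ℝ r (u, v) (1, 0) / fderiv ℝ r (u, v) (0, 1) * Fi i (u, v))
        = ∑ᶠ v ∈ {v | (u, v) ∈ K ∧ r (u, v) = ρ}, Real.sign (fderiv ℝ r (u, v) (0, 1)) *
        (Gi i (u, v) + fderiv ℝ r (u, v) (1, 0) / fderiv ℝ r (u, v) (0, 1) * Fi i (u, v)) := by
      intro i
      refine finsum_mem_inter_support_eq' _ _ _ fun v hv => ?_
      constructor
      · rintro ⟨h3, h4⟩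
        exact ⟨hsubK i h3, h4⟩
      · rintro ⟨h3, h4⟩
        refine ⟨by_contra fun h5 => hv ?_, h4⟩
        simp [hFi0 i _ (hnB i _ h3 h5), hGi0 i _ (hnB i _ h3 h5)]
    simp only [h2, finsum_mem_eq_finite_toFinset_sum _ hfin]
    rw [Finset.sum_comm]
    refine Finset.sum_congr rfl fun v hv => ?_
    have hv' : (u, v) ∈ K := ((Set.Finite.mem_toFinset hfin).1 hv).1
    rw [← Finset.mul_sum, Finset.sum_add_distrib, ← Finset.mul_sum]
    simp only [Fi, Gi, ← Finset.sum_mul, hsum1 _ hv', one_mul]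
  rw [hLHS, hFline, hGline, hlev r₂ (by simp), hlev r₁ (by simp), ← Finset.sum_add_distrib,
    ← Finset.sum_add_distrib, ← Finset.sum_sub_distrib]
  exact Finset.sum_congr rfl fun i _ => (H i).2

end Green

/-! ### Lie derivatives of bilinear forms in vector spaces -/

section Lie

variable {V W : Type*} [NormedAddCommGroup V] [NormedSpace ℝ V] [NormedAddCommGroup W]
  [NormedSpace ℝ W]

/-- The Lie derivative of a field of bilinear forms along a vector field. -/
def lieForm (B : V → V →L[ℝ] V →L[ℝ] ℝ) (X : V → V) (y v w : V) : ℝ :=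
  fderiv ℝ B y (X y) v w + B y (fderiv ℝ X y v) w + B y v (fderiv ℝ X y w)

/-- Naturality of the Lie derivative under pull-back by a map which relates the vector fields. -/
theorem lieForm_pullback {τ : V → W} {B : W → W →L[ℝ] W →L[ℝ] ℝ} {X' : W → W} {X : V → V}
    {B' : V → V →L[ℝ] V →L[ℝ] ℝ} {y : V} (hτ : ContDiffAt ℝ 2 τ y)
    (hB : DifferentiableAt ℝ B (τ y)) (hX' : DifferentiableAt ℝ X' (τ y))
    (hX : DifferentiableAt ℝ X y) (hrel : ∀ᶠ z in nhds y, fderiv ℝ τ z (X z) = X' (τ z))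
    (hB' : ∀ᶠ z in nhds y, ∀ v w, B' z v w = B (τ z) (fderiv ℝ τ z v) (fderiv ℝ τ z w))
    (hB'd : DifferentiableAt ℝ B' y) (v w : V) :
    lieForm B' X y v w = lieForm B X' (τ y) (fderiv ℝ τ y v) (fderiv ℝ τ y w) := by
  have hτ1 : DifferentiableAt ℝ τ y := hτ.differentiableAt (by simp)
  have hdτ : DifferentiableAt ℝ (fderiv ℝ τ) y :=
    (hτ.fderiv_right (m := 1) (by norm_num)).differentiableAt (by simp)
  have hsymm : ∀ a b, fderiv ℝ (fderiv ℝ τ) y a b = fderiv ℝ (fderiv ℝ τ) y b a := fun a b =>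
    (hτ.isSymmSndFDerivAt (by simp)).eq a b
  -- derivative of the relation
  have h1 : ∀ a, fderiv ℝ (fderiv ℝ τ) y a (X y) + fderiv ℝ τ y (fderiv ℝ X y a)
      = fderiv ℝ X' (τ y) (fderiv ℝ τ y a) := by
    intro a
    have e1 : HasFDerivAt (fun z => fderiv ℝ τ z (X z)) _ y :=
      hdτ.hasFDerivAt.clm_apply hX.hasFDerivAt
    have e2 : HasFDerivAt (fun z => X' (τ z)) _ y := hX'.hasFDerivAt.comp y hτ1.hasFDerivAt
    have e3 := (e1.congr_of_eventuallyEq (hrel.mono fun z hz => hz.symm)).unique e2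
    have e4 := congrArg (fun L => L a) e3
    simp only [add_apply, ContinuousLinearMap.comp_apply, ContinuousLinearMap.flip_apply] at e4
    rw [← e4, add_comm]
  -- derivative of the pulled back form
  have h2 : fderiv ℝ B' y (X y) v w
      = fderiv ℝ B (τ y) (fderiv ℝ τ y (X y)) (fderiv ℝ τ y v) (fderiv ℝ τ y w)
        + B (τ y) (fderiv ℝ (fderiv ℝ τ) y (X y) v) (fderiv ℝ τ y w)
        + B (τ y) (fderiv ℝ τ y v) (fderiv ℝ (fderiv ℝ τ) y (X y) w) := by
    have e1 : HasFDerivAt (fun z => B' z v w) _ y :=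
      (hB'd.hasFDerivAt.clm_apply (hasFDerivAt_const v y)).clm_apply (hasFDerivAt_const w y)
    have e2 : HasFDerivAt (fun z => B (τ z) (fderiv ℝ τ z v) (fderiv ℝ τ z w)) _ y :=
      ((hB.hasFDerivAt.comp y hτ1.hasFDerivAt).clm_apply
        (hdτ.hasFDerivAt.clm_apply (hasFDerivAt_const v y))).clm_apply
        (hdτ.hasFDerivAt.clm_apply (hasFDerivAt_const w y))
    have e3 := (e2.congr_of_eventuallyEq (hB'.mono fun z hz => hz v w)).unique e1
    have e4 := congrArg (fun L => L (X y)) e3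
    simp only [add_apply, ContinuousLinearMap.comp_apply, ContinuousLinearMap.flip_apply,
      zero_apply, map_zero, zero_add] at e4
    rw [← e4]
    ring
  have hBy := hB'.self_of_nhds
  have hr := hrel.self_of_nhds
  have hv := h1 v
  have hw := h1 w
  unfold lieForm
  -- The second derivatives of `τ` enter once through the derivative of the pulled back form and
  -- once through that of the relation between the fields; by symmetry they cancel.
  rw [h2, hBy, hBy, ← hr, ← hv, ← hw, hsymm (X y) v, hsymm (X y) w]
  simp only [map_add, add_apply]
  ring

end Lie

/-! ### Densities and divergences in vector spaces -/

section Density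

variable {V : Type*} [NormedAddCommGroup V] [NormedSpace ℝ V]
  {ι : Type*} [Fintype ι] [DecidableEq ι]

/-- Jacobi's formula: differentiate the Leibniz expansion, and collect the permutations with `σ i =
k` into the cofactor. -/
theorem hasFDerivAt_matrixDet {H : V → Matrix ι ι ℝ} {H' : ι → ι → V →L[ℝ] ℝ} {y : V}
    (h : ∀ i j, HasFDerivAt (fun z => H z i j) (H' i j) y) :
    HasFDerivAt (fun z => (H z).det) (∑ i, ∑ k, (H y).adjugate i k • H' k i) y := by
  have h1 : HasFDerivAt (fun z => (H z).det) (∑ σ : Equiv.Perm ι, (Equiv.Perm.sign σ : ℤ) •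
      ∑ i, (∏ j ∈ Finset.univ.erase i, H y (σ j) j) • H' (σ i) i) y := by
    simp only [Matrix.det_apply]
    refine HasFDerivAt.fun_sum fun σ _ => ?_
    exact (HasFDerivAt.finsetProd fun i _ => h (σ i) i).const_smul _
  convert h1 using 1
  have h2 : ∀ i k, (H y).adjugate i k = ((H y).updateCol i (Pi.single k 1)).det := by
    intro i k
    rw [← Matrix.transpose_apply (H y).adjugate k i, Matrix.adjugate_transpose, Matrix.adjugate_apply,
      Matrix.updateRow_transpose, Matrix.det_transpose]
  have h3 : ∀ i k, (H y).adjugate i k = ∑ σ : Equiv.Perm ι, (Equiv.Perm.sign σ : ℤ) •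
      if σ i = k then ∏ j ∈ Finset.univ.erase i, H y (σ j) j else 0 := by
    intro i k
    rw [h2, Matrix.det_apply]
    refine Finset.sum_congr rfl fun σ _ => ?_
    rw [← Finset.mul_prod_erase _ _ (Finset.mem_univ i), Matrix.updateCol_self]
    have : ∏ j ∈ Finset.univ.erase i, (H y).updateCol i (Pi.single k 1) (σ j) j
        = ∏ j ∈ Finset.univ.erase i, H y (σ j) j :=
      Finset.prod_congr rfl fun j hj => Matrix.updateCol_ne (Finset.ne_of_mem_erase hj)
    rw [this, Pi.single_apply, ite_mul, one_mul, zero_mul]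
    rfl
  ext v
  simp only [h3, sum_apply, smul_apply, smul_eq_mul, Finset.sum_mul, Finset.smul_sum]
  conv_rhs => rw [Finset.sum_comm]
  refine Finset.sum_congr rfl fun i _ => ?_
  rw [Finset.sum_comm]
  refine Finset.sum_congr rfl fun σ _ => ?_
  simp only [smul_ite, smul_zero, ite_mul, zero_mul, Finset.sum_ite_eq, Finset.mem_univ, if_true,
    smul_mul_assoc]

/-- The matrix of a bilinear form in a basis. -/
def formMatrix (b : Module.Basis ι ℝ V) (B : V →L[ℝ] V →L[ℝ] ℝ) : Matrix ι ι ℝ :=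
  Matrix.of fun i j => B (b i) (b j)

/-- The volume density of a bilinear form in a basis. -/
def formDensity (b : Module.Basis ι ℝ V) (B : V →L[ℝ] V →L[ℝ] ℝ) : ℝ :=
  Real.sqrt |(formMatrix b B).det|

/-- The form `√|t| / (2t)` covers both signs at once, which matters because Lorentzian determinants
are negative. -/
theorem hasDerivAt_sqrt_abs {t : ℝ} (ht : t ≠ 0) :
    HasDerivAt (fun s => Real.sqrt |s|) (Real.sqrt |t| / (2 * t)) t := by
  rcases lt_or_gt_of_ne ht with h | h
  · have h1 : HasDerivAt (fun s => Real.sqrt (-s)) (-1 / (2 * Real.sqrt (-t))) t :=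
      (hasDerivAt_neg t).sqrt (by linarith)
    refine (h1.congr_of_eventuallyEq ?_).congr_deriv ?_
    · filter_upwards [gt_mem_nhds h] with s hs
      rw [abs_of_neg hs]
    · rw [abs_of_neg h]
      have h2 : 0 < Real.sqrt (-t) := Real.sqrt_pos.2 (by linarith)
      have h3 := Real.mul_self_sqrt (show 0 ≤ -t by linarith)
      field_simp
      nlinarith
  · have h1 : HasDerivAt (fun s => Real.sqrt s) (1 / (2 * Real.sqrt t)) t :=
      (hasDerivAt_id t).sqrt h.ne'
    refine (h1.congr_of_eventuallyEq ?_).congr_deriv ?_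
    · filter_upwards [lt_mem_nhds h] with s hs
      rw [abs_of_pos hs]
    · rw [abs_of_pos h]
      have h2 : 0 < Real.sqrt t := Real.sqrt_pos.2 h
      have h3 := Real.mul_self_sqrt h.le
      field_simp
      nlinarith

/-- The logarithmic derivative of `√|det h|` is half the trace of `h⁻¹ dh`; this is Jacobi's formula
with the adjugate written as determinant times inverse. -/
theorem hasFDerivAt_formDensity (b : Module.Basis ι ℝ V) {h : V → V →L[ℝ] V →L[ℝ] ℝ} {y : V}
    (hh : DifferentiableAt ℝ h y) (hdet : (formMatrix b (h y)).det ≠ 0) :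
    HasFDerivAt (fun z => formDensity b (h z)) ((formDensity b (h y) / 2) •
      ∑ i, ∑ k, (formMatrix b (h y))⁻¹ i k • ((fderiv ℝ h y).flip (b k)).flip (b i)) y := by
  have h1 : ∀ i j, HasFDerivAt (fun z => formMatrix b (h z) i j)
      (((fderiv ℝ h y).flip (b i)).flip (b j)) y := by
    intro i j
    have e1 : HasFDerivAt (fun z => h z (b i) (b j)) _ y :=
      (hh.hasFDerivAt.clm_apply (hasFDerivAt_const (b i) y)).clm_apply (hasFDerivAt_const (b j) y)
    refine e1.congr_fderiv ?_
    ext v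
    simp only [add_apply, ContinuousLinearMap.comp_apply, ContinuousLinearMap.flip_apply, zero_apply, map_zero, zero_add]
  have h2 := (hasDerivAt_sqrt_abs hdet).comp_hasFDerivAt y (hasFDerivAt_matrixDet h1)
  refine h2.congr_fderiv ?_
  have h3 : (formMatrix b (h y)).adjugate
      = (formMatrix b (h y)).det • (formMatrix b (h y))⁻¹ := by
    rw [Matrix.inv_def, smul_smul, Ring.inverse_eq_inv', mul_inv_cancel₀ hdet, one_smul]
  rw [h3]
  simp only [Matrix.smul_apply, smul_assoc, ← Finset.smul_sum]
  rw [smul_smul]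
  congr 1
  unfold formDensity
  field_simp

/-- The divergence of a vector field with respect to the density of `h` is half of the trace of the
Lie derivative of `h`. -/
theorem trace_fderiv_formDensity_smul (b : Module.Basis ι ℝ V) {h : V → V →L[ℝ] V →L[ℝ] ℝ}
    {X : V → V} {y : V} (hh : DifferentiableAt ℝ h y) (hX : DifferentiableAt ℝ X y)
    (hsymm : ∀ v w, h y v w = h y w v) (hdet : (formMatrix b (h y)).det ≠ 0) :
    ∑ i, b.repr (fderiv ℝ (fun z => formDensity b (h z) • X z) y (b i)) i
      = formDensity b (h y) * (1 / 2 *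
        ∑ i, ∑ j, (formMatrix b (h y))⁻¹ i j * lieForm h X y (b i) (b j)) := by
  have hD := hasFDerivAt_formDensity b hh hdet
  have h1 := (hD.smul hX.hasFDerivAt).fderiv
  set H := formMatrix b (h y) with hH
  have hu : IsUnit H.det := isUnit_iff_ne_zero.2 hdet
  have hHs : ∀ i j, H i j = H j i := fun i j => hsymm _ _
  have hL : ∀ (A : V →L[ℝ] V) v w, h y (A v) w = ∑ k, b.repr (A v) k * h y (b k) w := by
    intro A v w
    conv_lhs => rw [← b.sum_repr (A v)]
    simp only [map_sum, map_smul, sum_apply, smul_apply, smul_eq_mul]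
  have hR : ∀ (A : V →L[ℝ] V) v w, h y v (A w) = ∑ k, b.repr (A w) k * h y v (b k) := by
    intro A v w
    conv_lhs => rw [← b.sum_repr (A w)]
    simp only [map_sum, map_smul, smul_eq_mul]
  -- The two terms of the Lie derivative that contain `∂X` each contract to the trace of `∂X`, so
  -- the factor one half leaves a single copy. The remaining term is the derivative of the density
  -- along `X`.
  have e1 : ∑ i, ∑ j, H⁻¹ i j * h y (fderiv ℝ X y (b i)) (b j)
      = ∑ i, b.repr (fderiv ℝ X y (b i)) i := by
    refine Finset.sum_congr rfl fun i _ => ?_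
    have e2 : ∀ k, ∑ j, H⁻¹ i j * H k j = (1 : Matrix ι ι ℝ) i k := by
      intro k
      rw [← Matrix.nonsing_inv_mul H hu, Matrix.mul_apply]
      exact Finset.sum_congr rfl fun j _ => by rw [hHs]
    calc ∑ j, H⁻¹ i j * h y (fderiv ℝ X y (b i)) (b j)
        = ∑ k, b.repr (fderiv ℝ X y (b i)) k * ∑ j, H⁻¹ i j * H k j := by
          simp only [hL, Finset.mul_sum]
          rw [Finset.sum_comm]
          refine Finset.sum_congr rfl fun k _ => Finset.sum_congr rfl fun j _ => ?_
          simp only [hH, formMatrix, Matrix.of_apply]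
          ring
      _ = _ := by simp [e2, Matrix.one_apply]
  have e1' : ∑ i, ∑ j, H⁻¹ i j * h y (b i) (fderiv ℝ X y (b j))
      = ∑ i, b.repr (fderiv ℝ X y (b i)) i := by
    rw [Finset.sum_comm]
    refine Finset.sum_congr rfl fun j _ => ?_
    have e2 : ∀ k, ∑ i, H⁻¹ i j * H i k = (1 : Matrix ι ι ℝ) k j := by
      intro k
      rw [← Matrix.mul_nonsing_inv H hu, Matrix.mul_apply]
      exact Finset.sum_congr rfl fun i _ => by rw [hHs, mul_comm]
    calc ∑ i, H⁻¹ i j * h y (b i) (fderiv ℝ X y (b j))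
        = ∑ k, b.repr (fderiv ℝ X y (b j)) k * ∑ i, H⁻¹ i j * H i k := by
          simp only [hR, Finset.mul_sum]
          rw [Finset.sum_comm]
          refine Finset.sum_congr rfl fun k _ => Finset.sum_congr rfl fun i _ => ?_
          simp only [hH, formMatrix, Matrix.of_apply]
          ring
      _ = _ := by simp [e2, Matrix.one_apply]
  have e3 : ∀ i, b.repr (fderiv ℝ (fun z => formDensity b (h z) • X z) y (b i)) i
      = formDensity b (h y) * b.repr (fderiv ℝ X y (b i)) i
        + (formDensity b (h y) / 2 * ∑ j, ∑ k, H⁻¹ j k * fderiv ℝ h y (b i) (b k) (b j))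
          * b.repr (X y) i := by
    intro i
    have : fderiv ℝ (fun z => formDensity b (h z) • X z) y = _ := h1
    rw [this]
    simp
  have e4 : ∑ i, ∑ j, H⁻¹ i j * fderiv ℝ h y (X y) (b i) (b j)
      = ∑ i, (∑ j, ∑ k, H⁻¹ j k * fderiv ℝ h y (b i) (b k) (b j)) * b.repr (X y) i := by
    have e5 : ∀ v w, fderiv ℝ h y (X y) v w = ∑ l, b.repr (X y) l * fderiv ℝ h y (b l) v w := by
      intro v w
      conv_lhs => rw [← b.sum_repr (X y)]
      simp only [map_sum, map_smul, sum_apply, smul_apply, smul_eq_mul]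
    have e6 : ∀ i j, H⁻¹ i j = H⁻¹ j i := by
      intro i j
      have : H.IsSymm := Matrix.IsSymm.ext fun i j => hHs j i
      rw [← Matrix.transpose_apply H⁻¹, Matrix.transpose_nonsing_inv, this.eq]
    simp only [e5, Finset.sum_mul, Finset.mul_sum]
    rw [Finset.sum_comm]
    conv_rhs => rw [Finset.sum_comm]
    refine Finset.sum_congr rfl fun j _ => ?_
    conv_rhs => rw [Finset.sum_comm]
    refine Finset.sum_congr rfl fun i _ => Finset.sum_congr rfl fun k _ => ?_
    rw [e6 j i]
    ring
  simp only [e3, Finset.sum_add_distrib, ← Finset.mul_sum, lieForm, mul_add]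
  rw [e4, e1, e1']
  simp only [mul_assoc, ← Finset.mul_sum]
  ring

end Density

/-! ### Weyl tensors and the Bel-Robinson contraction on Minkowski space -/

section WeylAlgebra

/-- The signs of the Minkowski metric. -/
def minkSign : Fin 4 → ℝ := ![-1, 1, 1, 1]

/-- The Hodge dual of a two-form on Minkowski space. -/
def starForm (φ : Fin 4 → Fin 4 → ℝ) : Fin 4 → Fin 4 → ℝ :=
  ![![0, φ 2 3, φ 3 1, φ 1 2], ![φ 3 2, 0, -φ 0 3, φ 0 2], ![φ 1 3, φ 0 3, 0, -φ 0 1],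
    ![φ 2 1, -φ 0 2, φ 0 1, 0]]

/-- The antisymmetric part of the contraction is a commutator in the Lorentz algebra. The star acts
there as a complex structure, so the pair of duals contributes the opposite commutator. The check is
made component by component. -/
theorem starForm_contract_symm {φ ψ : Fin 4 → Fin 4 → ℝ} (hφ : ∀ a b, φ a b = -φ b a)
    (hψ : ∀ a b, ψ a b = -ψ b a) (c d : Fin 4) :
    ∑ s, minkSign s * (φ c s * ψ d s + starForm φ c s * starForm ψ d s)
      = ∑ s, minkSign s * (φ d s * ψ c s + starForm φ d s * starForm ψ c s) := by
  have h0 : ∀ a, φ a a = 0 := fun a => by linarith [hφ a a]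
  have h0' : ∀ a, ψ a a = 0 := fun a => by linarith [hψ a a]
  fin_cases c <;> fin_cases d <;>
    simp [Fin.sum_univ_four, minkSign, starForm, h0, h0', hφ 1 0, hφ 2 0, hφ 3 0, hφ 2 1, hφ 3 1,
      hφ 3 2, hψ 1 0, hψ 2 0, hψ 3 0, hψ 2 1, hψ 3 1, hψ 3 2] <;> ring

/-- The two-form with prescribed components `01`, `02`, `03`, `23`, `31`, `12`. -/
def twoForm {V : Type*} [AddGroup V] (x₁ x₂ x₃ y₁ y₂ y₃ : V) : Fin 4 → Fin 4 → V :=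
  ![![0, x₁, x₂, x₃], ![-x₁, 0, y₃, -y₂], ![-x₂, -y₃, 0, y₁], ![-x₃, y₂, -y₁, 0]]

theorem eq_twoForm {V : Type*} [AddGroup V] {φ : Fin 4 → Fin 4 → V} (h : ∀ a b, φ a b = -φ b a)
    (h0 : ∀ a, φ a a = 0) :
    φ = twoForm (φ 0 1) (φ 0 2) (φ 0 3) (φ 2 3) (φ 3 1) (φ 1 2) := by
  funext a b
  fin_cases a <;> fin_cases b <;> first | exact h0 _ | exact h _ _ | rfl

/-- The Weyl tensor on Minkowski space with electric part `e` and magnetic part `h`. -/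
def weylArr (e₁ e₂ e₃ e₄ e₅ h₁ h₂ h₃ h₄ h₅ : ℝ) : Fin 4 → Fin 4 → Fin 4 → Fin 4 → ℝ :=
  twoForm (twoForm e₁ e₂ e₃ h₁ h₂ h₃) (twoForm e₂ e₄ e₅ h₂ h₄ h₅)
    (twoForm e₃ e₅ (-e₁ - e₄) h₃ h₅ (-h₁ - h₄)) (twoForm h₁ h₂ h₃ (-e₁) (-e₂) (-e₃))
    (twoForm h₂ h₄ h₅ (-e₂) (-e₄) (-e₅)) (twoForm h₃ h₅ (-h₁ - h₄) (-e₃) (-e₅) (e₁ + e₄))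

/-- The Bel-Robinson contraction on Minkowski space. -/
def minkBel (w : Fin 4 → Fin 4 → Fin 4 → Fin 4 → ℝ) (a b c d : Fin 4) : ℝ :=
  ∑ r, ∑ s, minkSign r * minkSign s * (w a r c s * w b r d s
    + starForm (w a r) c s * starForm (w b r) d s)


/-- The algebraic symmetries of a Weyl tensor on Minkowski space. -/
structure IsMinkWeyl (w : Fin 4 → Fin 4 → Fin 4 → Fin 4 → ℝ) : Prop where
  left : ∀ a b c d, w a b c d = -w b a c d
  right : ∀ a b c d, w a b c d = -w a b d c
  cyclic : ∀ a b c d, w a b c d + w a c d b + w a d b c = 0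
  trace : ∀ b d, ∑ a, minkSign a * w a b a d = 0

/-- The classical consequence of the cyclic identity: its four instances starting at `a`, `b`, `c`,
`d` combine linearly, up to the antisymmetries. -/
theorem IsMinkWeyl.pair {w : Fin 4 → Fin 4 → Fin 4 → Fin 4 → ℝ} (hw : IsMinkWeyl w)
    (a b c d : Fin 4) : w a b c d = w c d a b := by
  linarith [hw.cyclic a b c d, hw.cyclic b c d a, hw.cyclic c d a b, hw.cyclic d a b c,
    hw.right a c d b, hw.right b c d a, hw.left b a c d, hw.left c a b d, hw.left c b d a,
    hw.left d a b c, hw.left d b c a, hw.right b d c a, hw.left d c a b]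

/-- The electric and magnetic parts are symmetric and trace-free, with five components each. The
trace conditions make the magnetic part symmetric, the electric part trace-free, and fix the purely
spatial components; the cyclic identity makes the magnetic part trace-free. -/
theorem IsMinkWeyl.eq_weylArr {w : Fin 4 → Fin 4 → Fin 4 → Fin 4 → ℝ} (hw : IsMinkWeyl w) :
    w = weylArr (w 0 1 0 1) (w 0 1 0 2) (w 0 1 0 3) (w 0 2 0 2) (w 0 2 0 3)
      (w 0 1 2 3) (-w 0 1 1 3) (w 0 1 1 2) (-w 0 2 1 3) (w 0 2 1 2) := by
  have hl := hw.left
  have hr := hw.right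
  have hl0 : ∀ a c d, w a a c d = 0 := fun a c d => by linarith [hl a a c d]
  have hr0 : ∀ a b c, w a b c c = 0 := fun a b c => by linarith [hr a b c c]
  have t00 := hw.trace 0 0
  have t01 := hw.trace 0 1
  have t02 := hw.trace 0 2
  have t03 := hw.trace 0 3
  have t11 := hw.trace 1 1
  have t12 := hw.trace 1 2
  have t13 := hw.trace 1 3
  have t22 := hw.trace 2 2
  have t23 := hw.trace 2 3
  have t33 := hw.trace 3 3
  have c0 := hw.cyclic 0 1 2 3
  simp only [Fin.sum_univ_four, minkSign, Matrix.cons_val, hl0, hr0, hl 1 0, hl 2 0, hl 3 0, hl 2 1,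
    hl 3 1, hl 3 2, hr _ _ 1 0, hr _ _ 2 0, hr _ _ 3 0, hr _ _ 2 1, hr _ _ 3 1, hr _ _ 3 2]
    at t00 t01 t02 t03 t11 t12 t13 t22 t23 t33 c0
  have e1 : w 0 3 0 3 = -w 0 1 0 1 - w 0 2 0 2 := by linarith
  have e2 : w 0 3 1 2 = -w 0 1 2 3 + w 0 2 1 3 := by linarith
  have e3 : w 0 2 2 3 = -w 0 1 1 3 := by linarith
  have e4 : w 0 3 1 3 = -w 0 2 1 2 := by linarith
  have e5 : w 0 3 2 3 = w 0 1 1 2 := by linarith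
  have e6 : w 1 2 1 2 = w 0 1 0 1 + w 0 2 0 2 := by linarith
  have e7 : w 1 3 1 3 = -w 0 2 0 2 := by linarith
  have e8 : w 2 3 2 3 = -w 0 1 0 1 := by linarith
  have e9 : w 1 2 1 3 = w 0 2 0 3 := by linarith
  have e10 : w 1 2 2 3 = -w 0 1 0 3 := by linarith
  have e11 : w 1 3 2 3 = w 0 1 0 2 := by linarith
  have hw2 : ∀ a b, w a b = twoForm (w a b 0 1) (w a b 0 2) (w a b 0 3) (w a b 2 3) (-w a b 1 3)
      (w a b 1 2) := fun a b => by
    rw [← hr a b 3 1]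
    exact eq_twoForm (hr a b) (hr0 a b)
  refine (eq_twoForm (φ := w) (fun a b => funext fun c => funext fun d => hl a b c d)
    (fun a => funext fun c => funext fun d => hl0 a c d)).trans ?_
  rw [weylArr]
  congr 1 <;> refine (hw2 _ _).trans ?_ <;>
    simp only [hl 3 1, hw.pair 0 2 0 1, hw.pair 0 3 0 1, hw.pair 0 3 0 2, hw.pair 2 3 0 1,
    hw.pair 2 3 0 2, hw.pair 2 3 0 3, hw.pair 1 3 0 1, hw.pair 1 3 0 2, hw.pair 1 3 0 3,
    hw.pair 1 2 0 1, hw.pair 1 2 0 2, hw.pair 1 2 0 3, hw.pair 2 3 1 3, hw.pair 2 3 1 2,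
    hw.pair 1 3 1 2, e1, e2, e3, e4, e5, e6, e7, e8, e9, e10, e11, neg_neg] <;>
    congr 1 <;> ring

/-- For fixed `r` the sum over `s` contracts two two-forms and their duals, so
`starForm_contract_symm` applies to each term. -/
theorem minkBel_swap_last {w : Fin 4 → Fin 4 → Fin 4 → Fin 4 → ℝ} (hw : IsMinkWeyl w)
    (a b c d : Fin 4) : minkBel w a b c d = minkBel w a b d c := by
  unfold minkBel
  refine Finset.sum_congr rfl fun r _ => ?_
  simp only [mul_assoc, ← Finset.mul_sum]
  rw [starForm_contract_symm (hw.right a r) (hw.right b r) c d]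

theorem minkBel_swap_pairs (w : Fin 4 → Fin 4 → Fin 4 → Fin 4 → ℝ)
    (a b c d : Fin 4) : minkBel w a b c d = minkBel w b a d c := by
  unfold minkBel
  refine Finset.sum_congr rfl fun r _ => Finset.sum_congr rfl fun s _ => ?_
  ring

theorem minkBel_swap_first {w : Fin 4 → Fin 4 → Fin 4 → Fin 4 → ℝ} (hw : IsMinkWeyl w)
    (a b c d : Fin 4) : minkBel w a b c d = minkBel w b a c d := by
  rw [minkBel_swap_last hw, minkBel_swap_pairs]


theorem twoForm_apply {V : Type*} [AddGroup V] (x₁ x₂ x₃ y₁ y₂ y₃ : V) :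
    twoForm x₁ x₂ x₃ y₁ y₂ y₃ 0 0 = 0 ∧
    twoForm x₁ x₂ x₃ y₁ y₂ y₃ 0 1 = x₁ ∧
    twoForm x₁ x₂ x₃ y₁ y₂ y₃ 0 2 = x₂ ∧
    twoForm x₁ x₂ x₃ y₁ y₂ y₃ 0 3 = x₃ ∧
    twoForm x₁ x₂ x₃ y₁ y₂ y₃ 1 0 = -x₁ ∧
    twoForm x₁ x₂ x₃ y₁ y₂ y₃ 1 1 = 0 ∧
    twoForm x₁ x₂ x₃ y₁ y₂ y₃ 1 2 = y₃ ∧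
    twoForm x₁ x₂ x₃ y₁ y₂ y₃ 1 3 = -y₂ ∧
    twoForm x₁ x₂ x₃ y₁ y₂ y₃ 2 0 = -x₂ ∧
    twoForm x₁ x₂ x₃ y₁ y₂ y₃ 2 1 = -y₃ ∧
    twoForm x₁ x₂ x₃ y₁ y₂ y₃ 2 2 = 0 ∧
    twoForm x₁ x₂ x₃ y₁ y₂ y₃ 2 3 = y₁ ∧
    twoForm x₁ x₂ x₃ y₁ y₂ y₃ 3 0 = -x₃ ∧
    twoForm x₁ x₂ x₃ y₁ y₂ y₃ 3 1 = y₂ ∧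
    twoForm x₁ x₂ x₃ y₁ y₂ y₃ 3 2 = -y₁ ∧
    twoForm x₁ x₂ x₃ y₁ y₂ y₃ 3 3 = 0 := by
  refine ⟨?_, ?_, ?_, ?_, ?_, ?_, ?_, ?_, ?_, ?_, ?_, ?_, ?_, ?_, ?_, ?_⟩ <;> rfl

/-- The energy-momentum contraction of two two-forms. -/
def emForm (φ ψ : Fin 4 → Fin 4 → ℝ) (c d : Fin 4) : ℝ :=
  ∑ s, minkSign s * (φ c s * ψ d s + starForm φ c s * starForm ψ d s)

theorem minkBel_eq_emForm (w : Fin 4 → Fin 4 → Fin 4 → Fin 4 → ℝ) (a b c d : Fin 4) :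
    minkBel w a b c d = -emForm (w a 0) (w b 0) c d + emForm (w a 1) (w b 1) c d
      + emForm (w a 2) (w b 2) c d + emForm (w a 3) (w b 3) c d := by
  simp only [minkBel, mul_assoc, ← Finset.mul_sum]
  rw [Fin.sum_univ_four]
  simp [minkSign, emForm]

theorem emForm_zero_left (ψ : Fin 4 → Fin 4 → ℝ) (c d : Fin 4) : emForm 0 ψ c d = 0 := by
  have h : starForm 0 = 0 := by
    funext i j
    fin_cases i <;> fin_cases j <;> simp [starForm]
  simp [emForm, h]

theorem emForm_zero_right (φ : Fin 4 → Fin 4 → ℝ) (c d : Fin 4) : emForm φ 0 c d = 0 := by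
  have h : starForm 0 = 0 := by
    funext i j
    fin_cases i <;> fin_cases j <;> simp [starForm]
  simp [emForm, h]

theorem starForm_neg (φ : Fin 4 → Fin 4 → ℝ) : starForm (-φ) = -starForm φ := by
  funext i j
  fin_cases i <;> fin_cases j <;> simp [starForm]

theorem emForm_neg_left (φ ψ : Fin 4 → Fin 4 → ℝ) (c d : Fin 4) :
    emForm (-φ) ψ c d = -emForm φ ψ c d := by
  simp only [emForm, starForm_neg, Pi.neg_apply, ← Finset.sum_neg_distrib]
  exact Finset.sum_congr rfl fun s _ => by ring

theorem emForm_neg_right (φ ψ : Fin 4 → Fin 4 → ℝ) (c d : Fin 4) :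
    emForm φ (-ψ) c d = -emForm φ ψ c d := by
  simp only [emForm, starForm_neg, Pi.neg_apply, ← Finset.sum_neg_distrib]
  exact Finset.sum_congr rfl fun s _ => by ring

/-- The polarised energy density, Poynting vector and stresses. With these in closed form, the
checks for Weyl tensors become polynomial identities without any expansion of sums over the star. -/
theorem emForm_twoForm (x₁ x₂ x₃ y₁ y₂ y₃ x₁' x₂' x₃' y₁' y₂' y₃' : ℝ) (c d : Fin 4) :
    emForm (twoForm x₁ x₂ x₃ y₁ y₂ y₃) (twoForm x₁' x₂' x₃' y₁' y₂' y₃') c d =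
      (![![x₁ * x₁' + x₂ * x₂' + x₃ * x₃' + y₁ * y₁' + y₂ * y₂' + y₃ * y₃',
          x₂ * y₃' - x₃ * y₂' - y₂ * x₃' + y₃ * x₂', x₃ * y₁' - x₁ * y₃' - y₃ * x₁' + y₁ * x₃',
          x₁ * y₂' - x₂ * y₁' - y₁ * x₂' + y₂ * x₁'],
        ![x₂ * y₃' - x₃ * y₂' - y₂ * x₃' + y₃ * x₂',
          -x₁ * x₁' + x₂ * x₂' + x₃ * x₃' - y₁ * y₁' + y₂ * y₂' + y₃ * y₃',
          -x₁ * x₂' - x₂ * x₁' - y₁ * y₂' - y₂ * y₁', -x₁ * x₃' - x₃ * x₁' - y₁ * y₃' - y₃ * y₁'],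
        ![x₃ * y₁' - x₁ * y₃' - y₃ * x₁' + y₁ * x₃', -x₁ * x₂' - x₂ * x₁' - y₁ * y₂' - y₂ * y₁',
          x₁ * x₁' - x₂ * x₂' + x₃ * x₃' + y₁ * y₁' - y₂ * y₂' + y₃ * y₃',
          -x₂ * x₃' - x₃ * x₂' - y₂ * y₃' - y₃ * y₂'],
        ![x₁ * y₂' - x₂ * y₁' - y₁ * x₂' + y₂ * x₁', -x₁ * x₃' - x₃ * x₁' - y₁ * y₃' - y₃ * y₁',
          -x₂ * x₃' - x₃ * x₂' - y₂ * y₃' - y₃ * y₂',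
          x₁ * x₁' + x₂ * x₂' - x₃ * x₃' + y₁ * y₁' + y₂ * y₂' - y₃ * y₃']] :
        Fin 4 → Fin 4 → ℝ) c d := by
  fin_cases c <;> fin_cases d <;>
    simp [emForm, Fin.sum_univ_four, minkSign, starForm, twoForm] <;> ring

/-- This symmetry mixes the two pairs of slots and does not follow from antisymmetry alone; it uses
the trace and cyclic conditions through the ten-component form. Only the six unordered pairs of
distinct middle indices have to be checked. -/
theorem minkBel_swap_middle {w : Fin 4 → Fin 4 → Fin 4 → Fin 4 → ℝ} (hw : IsMinkWeyl w)
    (a b c d : Fin 4) : minkBel w a b c d = minkBel w a c b d := by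
  have key : ∀ a d, minkBel w a 0 1 d = minkBel w a 1 0 d ∧ minkBel w a 0 2 d = minkBel w a 2 0 d ∧
      minkBel w a 0 3 d = minkBel w a 3 0 d ∧ minkBel w a 1 2 d = minkBel w a 2 1 d ∧
      minkBel w a 1 3 d = minkBel w a 3 1 d ∧ minkBel w a 2 3 d = minkBel w a 3 2 d := by
    rw [hw.eq_weylArr]
    generalize w 0 1 0 1 = e₁, w 0 1 0 2 = e₂, w 0 1 0 3 = e₃, w 0 2 0 2 = e₄, w 0 2 0 3 = e₅,
      w 0 1 2 3 = h₁, -w 0 1 1 3 = h₂, w 0 1 1 2 = h₃, -w 0 2 1 3 = h₄, w 0 2 1 2 = h₅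
    intro a d
    simp only [minkBel_eq_emForm]
    refine ⟨?_, ?_, ?_, ?_, ?_, ?_⟩ <;> fin_cases a <;> fin_cases d <;>
      simp only [weylArr, Fin.zero_eta, Fin.mk_one, Fin.reduceFinMk, twoForm_apply,
        emForm_zero_left, emForm_zero_right, emForm_neg_left, emForm_neg_right,
        emForm_twoForm, Matrix.cons_val] <;> ring
  obtain ⟨h1, h2, h3, h4, h5, h6⟩ := key a d
  fin_cases b <;> fin_cases c <;> first
    | rfl | exact h1 | exact h2 | exact h3 | exact h4 | exact h5 | exact h6
    | exact h1.symm | exact h2.symm | exact h3.symm | exact h4.symm | exact h5.symm | exact h6.symm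

theorem minkBel_trace {w : Fin 4 → Fin 4 → Fin 4 → Fin 4 → ℝ} (hw : IsMinkWeyl w)
    (c d : Fin 4) : ∑ a, minkSign a * minkBel w a a c d = 0 := by
  rw [hw.eq_weylArr]
  generalize w 0 1 0 1 = e₁, w 0 1 0 2 = e₂, w 0 1 0 3 = e₃, w 0 2 0 2 = e₄,  w 0 2 0 3 = e₅,
    w 0 1 2 3 = h₁, -w 0 1 1 3 = h₂, w 0 1 1 2 = h₃, -w 0 2 1 3 = h₄, w 0 2 1 2 = h₅
  simp only [minkBel_eq_emForm, Fin.sum_univ_four]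
  fin_cases c <;> fin_cases d <;>
    simp only [weylArr, Fin.zero_eta, Fin.mk_one, Fin.reduceFinMk, twoForm_apply,
        emForm_zero_right, emForm_neg_left, emForm_neg_right,
        emForm_twoForm, Matrix.cons_val, minkSign] <;> ring

end WeylAlgebra

/-! ### Metric contractions in an arbitrary basis -/

section MetricTrace

variable {V : Type*} [AddCommGroup V] [Module ℝ V] {ι : Type*} [Fintype ι] [DecidableEq ι]

/-- A function of two vectors which is linear in each of them. -/
structure IsBilin (β : V → V → ℝ) : Prop where
  left : ∀ y, IsLinearMap ℝ (fun x => β x y)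
  right : ∀ x, IsLinearMap ℝ (β x)

/-- The Gram matrix of a family of vectors. -/
def gramMat (f : ι → V) (B : V → V → ℝ) : Matrix ι ι ℝ := Matrix.of fun i j => B (f i) (f j)

/-- The contraction of a bilinear form `β` with the inverse of the Gram matrix of `B`. -/
def mtrace (f : ι → V) (B β : V → V → ℝ) : ℝ :=
  ∑ i, ∑ j, (gramMat f B)⁻¹ i j * β (f i) (f j)

theorem IsLinearMap.real_sum_smul {F : V → ℝ} (hF : IsLinearMap ℝ F) {κ : Type*} (s : Finset κ)
    (c : κ → ℝ) (x : κ → V) : F (∑ i ∈ s, c i • x i) = ∑ i ∈ s, c i * F (x i) := by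
  refine (map_sum (IsLinearMap.mk' F hF) (fun i => c i • x i) s).trans ?_
  exact Finset.sum_congr rfl fun i _ => hF.map_smul (c i) (x i)

theorem IsLinearMap.eq_sum_basis {F : V → ℝ} (hF : IsLinearMap ℝ F) (e : Module.Basis ι ℝ V)
    (x : V) : F x = ∑ i, e.repr x i * F (e i) := by
  conv_lhs => rw [← e.sum_repr x]
  exact hF.real_sum_smul _ _ _

theorem gramMat_basis_change {B : V → V → ℝ} (hB : IsBilin B) (e f : Module.Basis ι ℝ V) :
    gramMat f B = (e.toMatrix f).transpose * gramMat e B * e.toMatrix f := by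
  ext i j
  rw [gramMat, Matrix.of_apply, (hB.left _).eq_sum_basis e (f i), Matrix.mul_assoc]
  simp only [Matrix.mul_apply, Matrix.transpose_apply, gramMat, Matrix.of_apply,
    Module.Basis.toMatrix_apply]
  refine Finset.sum_congr rfl fun k _ => ?_
  rw [(hB.right _).eq_sum_basis e (f j)]
  exact congrArg _ (Finset.sum_congr rfl fun l _ => mul_comm _ _)

theorem mtrace_eq_trace (f : ι → V) (B β : V → V → ℝ) :
    mtrace f B β = ((gramMat f B)⁻¹ * (gramMat f β).transpose).trace := by
  simp [mtrace, Matrix.trace, Matrix.mul_apply, gramMat]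

/-- Both Gram matrices undergo the same congruence, so the product of one inverse with the transpose
of the other is conjugated and keeps its trace. This permits contractions to be moved between
orthonormal and coordinate frames. -/
theorem mtrace_basis_change {B β : V → V → ℝ} (hB : IsBilin B) (hβ : IsBilin β)
    (e f : Module.Basis ι ℝ V) : mtrace f B β = mtrace e B β := by
  have h1 : e.toMatrix f * f.toMatrix e = 1 := e.toMatrix_mul_toMatrix_flip f
  have h2 : f.toMatrix e * e.toMatrix f = 1 := f.toMatrix_mul_toMatrix_flip e
  have h3 : (e.toMatrix f)⁻¹ = f.toMatrix e := Matrix.inv_eq_right_inv h1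
  have h4 : (e.toMatrix f).transpose⁻¹ = (f.toMatrix e).transpose :=
    Matrix.inv_eq_right_inv (by rw [← Matrix.transpose_mul, h2, Matrix.transpose_one])
  rw [mtrace_eq_trace, mtrace_eq_trace, gramMat_basis_change hB e f, gramMat_basis_change hβ e f,
    Matrix.mul_inv_rev, Matrix.mul_inv_rev, h3, h4]
  have h5 : f.toMatrix e * ((gramMat e B)⁻¹ * (f.toMatrix e).transpose)
      * ((e.toMatrix f).transpose * gramMat e β * e.toMatrix f).transpose
      = f.toMatrix e * ((gramMat e B)⁻¹ * ((e.toMatrix f * f.toMatrix e).transpose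
        * ((gramMat e β).transpose * e.toMatrix f))) := by
    simp only [Matrix.transpose_mul, Matrix.transpose_transpose, Matrix.mul_assoc]
  rw [h5, h1, Matrix.transpose_one, Matrix.one_mul, Matrix.trace_mul_comm, Matrix.mul_assoc,
    Matrix.mul_assoc, h1, Matrix.mul_one]

theorem mtrace_reindex {κ : Type*} [Fintype κ] [DecidableEq κ] (σ : κ ≃ ι) (f : ι → V)
    (B β : V → V → ℝ) : mtrace (f ∘ σ) B β = mtrace f B β := by
  have h : gramMat (f ∘ σ) B = (gramMat f B).submatrix σ σ := rfl
  simp only [mtrace, h, Matrix.inv_submatrix_equiv, Matrix.submatrix_apply, Function.comp]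
  rw [← σ.sum_comp]
  exact Finset.sum_congr rfl fun i _ => by rw [← σ.sum_comp]

theorem mtrace_const_mul (f : ι → V) (B β : V → V → ℝ) (c : ℝ) :
    mtrace f B (fun x y => c * β x y) = c * mtrace f B β := by
  simp only [mtrace, Finset.mul_sum]
  exact Finset.sum_congr rfl fun i _ => Finset.sum_congr rfl fun j _ => by ring

theorem mtrace_add (f : ι → V) (B β β' : V → V → ℝ) :
    mtrace f B (fun x y => β x y + β' x y) = mtrace f B β + mtrace f B β' := by
  simp only [mtrace, mul_add, Finset.sum_add_distrib]

theorem mtrace_isLinearMap (f : ι → V) (B : V → V → ℝ) {β : V → V → V → ℝ}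
    (h : ∀ x y, IsLinearMap ℝ (fun a => β a x y)) :
    IsLinearMap ℝ (fun a => mtrace f B (β a)) := by
  refine ⟨fun a b => ?_, fun c a => ?_⟩
  · rw [← mtrace_add]
    simp only [mtrace]
    exact Finset.sum_congr rfl fun i _ => Finset.sum_congr rfl fun j _ => by rw [(h _ _).map_add]
  · rw [smul_eq_mul, ← mtrace_const_mul]
    simp only [mtrace]
    exact Finset.sum_congr rfl fun i _ => Finset.sum_congr rfl fun j _ => by
      rw [(h _ _).map_smul, smul_eq_mul]

end MetricTrace

/-! ### Functions linear in each of four slots -/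

section SlotLinear

variable {V : Type*} [AddCommGroup V] [Module ℝ V]

theorem IsLinearMap.add' {F G : V → ℝ} (hF : IsLinearMap ℝ F) (hG : IsLinearMap ℝ G) :
    IsLinearMap ℝ (fun x => F x + G x) :=
  ⟨fun x y => by rw [hF.map_add, hG.map_add]; ring, fun c x => by
    rw [hF.map_smul, hG.map_smul, smul_add]⟩

theorem IsLinearMap.mul_const' {F : V → ℝ} (hF : IsLinearMap ℝ F) (k : ℝ) :
    IsLinearMap ℝ (fun x => F x * k) :=
  ⟨fun x y => by rw [hF.map_add]; ring, fun c x => by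
    rw [hF.map_smul, smul_eq_mul, smul_eq_mul]; ring⟩

theorem IsLinearMap.const_mul' {F : V → ℝ} (hF : IsLinearMap ℝ F) (k : ℝ) :
    IsLinearMap ℝ (fun x => k * F x) :=
  ⟨fun x y => by rw [hF.map_add]; ring, fun c x => by
    rw [hF.map_smul, smul_eq_mul, smul_eq_mul]; ring⟩

/-- A function of four vectors which is linear in each of them. -/
structure IsQuadrilin (w : V → V → V → V → ℝ) : Prop where
  s1 : ∀ b c d, IsLinearMap ℝ (fun a => w a b c d)
  s2 : ∀ a c d, IsLinearMap ℝ (fun b => w a b c d)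
  s3 : ∀ a b d, IsLinearMap ℝ (fun c => w a b c d)
  s4 : ∀ a b c, IsLinearMap ℝ (fun d => w a b c d)

theorem IsQuadrilin.eq_sum {w : V → V → V → V → ℝ} (hw : IsQuadrilin w) {ι : Type*} [Fintype ι]
    [DecidableEq ι] (e : Module.Basis ι ℝ V) (a b c d : V) :
    w a b c d = ∑ i, ∑ j, ∑ k, ∑ l,
      e.repr a i * (e.repr b j * (e.repr c k * (e.repr d l * w (e i) (e j) (e k) (e l)))) := by
  rw [(hw.s1 b c d).eq_sum_basis e]
  simp only [← Finset.mul_sum]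
  refine Finset.sum_congr rfl fun i _ => congrArg _ ?_
  rw [(hw.s2 _ c d).eq_sum_basis e]
  refine Finset.sum_congr rfl fun i _ => congrArg _ ?_
  rw [(hw.s3 _ _ d).eq_sum_basis e]
  refine Finset.sum_congr rfl fun i _ => congrArg _ ?_
  rw [(hw.s4 _ _ _).eq_sum_basis e]

theorem IsQuadrilin.ext_basis {w w' : V → V → V → V → ℝ} (hw : IsQuadrilin w)
    (hw' : IsQuadrilin w') {ι : Type*} [Fintype ι] [DecidableEq ι] (e : Module.Basis ι ℝ V)
    (h : ∀ i j k l, w (e i) (e j) (e k) (e l) = w' (e i) (e j) (e k) (e l)) (a b c d : V) :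
    w a b c d = w' a b c d := by
  rw [hw.eq_sum e, hw'.eq_sum e]
  simp only [h]

theorem MultilinearMap.isQuadrilin (f : MultilinearMap ℝ (fun _ : Fin 4 => V) ℝ) :
    IsQuadrilin fun a b c d => f ![a, b, c, d] := by
  have u0 : ∀ a b c d x : V, Function.update ![a, b, c, d] 0 x = ![x, b, c, d] := by
    intro a b c d x; funext i; fin_cases i <;> rfl
  have u1 : ∀ a b c d x : V, Function.update ![a, b, c, d] 1 x = ![a, x, c, d] := by
    intro a b c d x; funext i; fin_cases i <;> rfl
  have u2 : ∀ a b c d x : V, Function.update ![a, b, c, d] 2 x = ![a, b, x, d] := by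
    intro a b c d x; funext i; fin_cases i <;> rfl
  have u3 : ∀ a b c d x : V, Function.update ![a, b, c, d] 3 x = ![a, b, c, x] := by
    intro a b c d x; funext i; fin_cases i <;> rfl
  refine ⟨fun b c d => ⟨fun x y => ?_, fun k x => ?_⟩, fun a c d => ⟨fun x y => ?_, fun k x => ?_⟩,
    fun a b d => ⟨fun x y => ?_, fun k x => ?_⟩, fun a b c => ⟨fun x y => ?_, fun k x => ?_⟩⟩
  · simpa only [u0] using f.map_update_add ![0, b, c, d] 0 x y
  · simpa only [u0] using f.map_update_smul ![0, b, c, d] 0 k x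
  · simpa only [u1] using f.map_update_add ![a, 0, c, d] 1 x y
  · simpa only [u1] using f.map_update_smul ![a, 0, c, d] 1 k x
  · simpa only [u2] using f.map_update_add ![a, b, 0, d] 2 x y
  · simpa only [u2] using f.map_update_smul ![a, b, 0, d] 2 k x
  · simpa only [u3] using f.map_update_add ![a, b, c, 0] 3 x y
  · simpa only [u3] using f.map_update_smul ![a, b, c, 0] 3 k x

end SlotLinear

/-! ### Frame independence of the Bel-Robinson tensor -/

section FrameBel

variable {V : Type*} [AddCommGroup V] [Module ℝ V]

/-- The volume form of `G`, oriented by the frame `f`. -/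
def frameVol (f : Module.Basis (Fin 4) ℝ V) (G : V → V → ℝ) (a b c d : V) : ℝ :=
  Real.sqrt |(gramMat f G).det| * f.det ![a, b, c, d]

/-- The dual of a `4`-tensor, computed in the frame `f`. -/
def frameDual (f : Module.Basis (Fin 4) ℝ V) (G : V → V → ℝ) (w : V → V → V → V → ℝ)
    (a b m n : V) : ℝ :=
  (1 / 2) * mtrace f G fun c c' => mtrace f G fun d d' => w a b c' d' * frameVol f G c d m n

/-- The Bel-Robinson tensor, computed in the frame `f`. -/
def frameBel (f : Module.Basis (Fin 4) ℝ V) (G : V → V → ℝ) (w : V → V → V → V → ℝ)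
    (a b c d : V) : ℝ :=
  mtrace f G fun r r' => mtrace f G fun s s' => w a r c s * w b r' d s'
    + frameDual f G w a r c s * frameDual f G w b r' d s'

variable {f : Module.Basis (Fin 4) ℝ V} {G : V → V → ℝ} {w : V → V → V → V → ℝ}

theorem frameVol_isQuadrilin : IsQuadrilin (frameVol f G) := by
  have h := MultilinearMap.isQuadrilin f.det.toMultilinearMap
  exact ⟨fun b c d => (h.s1 b c d).const_mul' _, fun b c d => (h.s2 b c d).const_mul' _,
    fun b c d => (h.s3 b c d).const_mul' _, fun b c d => (h.s4 b c d).const_mul' _⟩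

theorem frameDual_isQuadrilin (hw : IsQuadrilin w) : IsQuadrilin (frameDual f G w) := by
  have h := frameVol_isQuadrilin (f := f) (G := G)
  refine ⟨fun b c d => ?_, fun b c d => ?_, fun b c d => ?_, fun b c d => ?_⟩ <;>
    refine (mtrace_isLinearMap _ _ fun x y => mtrace_isLinearMap _ _ fun x' y' => ?_).const_mul' _
  · exact (hw.s1 _ _ _).mul_const' _
  · exact (hw.s2 _ _ _).mul_const' _
  · exact (h.s3 _ _ _).const_mul' _
  · exact (h.s4 _ _ _).const_mul' _

theorem frameBel_isQuadrilin (hw : IsQuadrilin w) : IsQuadrilin (frameBel f G w) := by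
  have h := frameDual_isQuadrilin (f := f) (G := G) hw
  refine ⟨fun b c d => ?_, fun b c d => ?_, fun b c d => ?_, fun b c d => ?_⟩ <;>
    refine mtrace_isLinearMap _ _ fun x y => mtrace_isLinearMap _ _ fun x' y' => ?_
  · exact ((hw.s1 _ _ _).mul_const' _).add' ((h.s1 _ _ _).mul_const' _)
  · exact ((hw.s1 _ _ _).const_mul' _).add' ((h.s1 _ _ _).const_mul' _)
  · exact ((hw.s3 _ _ _).mul_const' _).add' ((h.s3 _ _ _).mul_const' _)
  · exact ((hw.s3 _ _ _).const_mul' _).add' ((h.s3 _ _ _).const_mul' _)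

/-- The root of the Gram determinant scales by the absolute value of the change-of-basis
determinant, and the determinant form by its inverse; only the relative orientation survives. -/
theorem frameVol_basis_change (hG : IsBilin G) (e f : Module.Basis (Fin 4) ℝ V) :
    ∃ s : ℝ, s * s = 1 ∧ ∀ a b c d, frameVol f G a b c d = s * frameVol e G a b c d := by
  have hu : e.det f ≠ 0 := (Module.Basis.isUnit_det e f).ne_zero
  have h1 : (gramMat f G).det = e.det f * e.det f * (gramMat e G).det := by
    rw [gramMat_basis_change hG e f, Matrix.det_mul, Matrix.det_mul, Matrix.det_transpose,
      Module.Basis.det_apply]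
    ring
  have h2 : ∀ v : Fin 4 → V, e.det v = e.det f * f.det v := fun v => by
    have := AlternatingMap.eq_smul_basis_det f (e.det)
    conv_lhs => rw [this]
    rfl
  refine ⟨|e.det f| / e.det f, ?_, fun a b c d => ?_⟩
  · rw [div_mul_div_comm, abs_mul_abs_self, div_self (mul_ne_zero hu hu)]
  · rw [frameVol, frameVol, h1, abs_mul, Real.sqrt_mul (abs_nonneg _), abs_mul,
      Real.sqrt_mul_self (abs_nonneg _), h2 ![a, b, c, d]]
    field_simp

theorem frameDual_basis_change (hG : IsBilin G) (hw : IsQuadrilin w)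
    (e f : Module.Basis (Fin 4) ℝ V) :
    ∃ s : ℝ, s * s = 1 ∧ ∀ a b c d, frameDual f G w a b c d = s * frameDual e G w a b c d := by
  obtain ⟨s, hs, h⟩ := frameVol_basis_change hG e f
  refine ⟨s, hs, fun a b m n => ?_⟩
  have he := frameVol_isQuadrilin (f := e) (G := G)
  have hf := frameVol_isQuadrilin (f := f) (G := G)
  unfold frameDual
  have h1 : ∀ c c', mtrace f G (fun d d' => w a b c' d' * frameVol f G c d m n)
      = s * mtrace e G (fun d d' => w a b c' d' * frameVol e G c d m n) := fun c c' => by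
    rw [mtrace_basis_change hG ⟨fun y => (hf.s2 _ _ _).const_mul' _,
      fun x => (hw.s4 _ _ _).mul_const' _⟩ e f, ← mtrace_const_mul]
    congr 1
    funext d d'
    rw [h]
    ring
  simp only [h1]
  have h2 : IsBilin fun c c' => mtrace e G fun d d' => w a b c' d' * frameVol e G c d m n := by
    refine ⟨fun y => ?_, fun y => ?_⟩ <;> refine mtrace_isLinearMap _ _ fun x' y' => ?_
    · exact (he.s1 _ _ _).const_mul' _
    · exact (hw.s3 _ _ _).mul_const' _
  rw [mtrace_const_mul, mtrace_basis_change hG h2 e f]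
  ring

/-- The orientation sign of the dual enters twice and squares to one; the contractions are invariant
by `mtrace_basis_change`. Both the symmetries and the smoothness of the Bel-Robinson tensor rest on
this. -/
theorem frameBel_basis_change (hG : IsBilin G) (hw : IsQuadrilin w)
    (e f : Module.Basis (Fin 4) ℝ V) (a b c d : V) :
    frameBel f G w a b c d = frameBel e G w a b c d := by
  obtain ⟨s, hs, h⟩ := frameDual_basis_change hG hw e f
  have he := frameDual_isQuadrilin (f := e) (G := G) hw
  unfold frameBel
  have h1 : ∀ r r' q q', w a r c q * w b r' d q'
      + frameDual f G w a r c q * frameDual f G w b r' d q' =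
      w a r c q * w b r' d q' + frameDual e G w a r c q * frameDual e G w b r' d q' := by
    intro r r' q q'
    rw [h, h]
    linear_combination (frameDual e G w a r c q * frameDual e G w b r' d q') * hs
  simp only [h1]
  set β : V → V → V → V → ℝ := fun r r' q q' => w a r c q * w b r' d q'
    + frameDual e G w a r c q * frameDual e G w b r' d q' with hβ
  have h2 : ∀ r r', IsBilin (β r r') := fun r r' =>
    ⟨fun y => ((hw.s4 _ _ _).mul_const' _).add' ((he.s4 _ _ _).mul_const' _),
      fun y => ((hw.s4 _ _ _).const_mul' _).add' ((he.s4 _ _ _).const_mul' _)⟩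
  have h3 : IsBilin fun r r' => mtrace e G (β r r') := by
    refine ⟨fun y => ?_, fun y => ?_⟩ <;> refine mtrace_isLinearMap _ _ fun x' y' => ?_
    · exact ((hw.s2 _ _ _).mul_const' _).add' ((he.s2 _ _ _).mul_const' _)
    · exact ((hw.s2 _ _ _).const_mul' _).add' ((he.s2 _ _ _).const_mul' _)
  calc mtrace f G (fun r r' => mtrace f G (β r r'))
      = mtrace f G (fun r r' => mtrace e G (β r r')) := by
        congr 1
        funext r r'
        exact mtrace_basis_change hG (h2 r r') e f
    _ = _ := mtrace_basis_change hG h3 e f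

end FrameBel

/-! ### Reduction to orthonormal frames -/

section Orthonormal

/-- The Levi-Civita symbol. -/
def leviCivita (a b c d : Fin 4) : ℝ :=
  Matrix.det (fun i j : Fin 4 => if (![a, b, c, d] : Fin 4 → Fin 4) i = j then (1 : ℝ) else 0)

theorem leviCivita_eq (a b c d : Fin 4) : leviCivita a b c d =
    Matrix.detRowAlternating (R := ℝ) (n := Fin 4) ![Pi.single a 1, Pi.single b 1, Pi.single c 1,
      Pi.single d 1] := by
  refine congrArg (Matrix.detRowAlternating (R := ℝ) (n := Fin 4)) ?_
  funext i j
  fin_cases i <;> simp [Pi.single_apply, eq_comm] <;> congr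

theorem leviCivita_swap_first (a b c d : Fin 4) : leviCivita a b c d = -leviCivita b a c d := by
  rw [leviCivita_eq, leviCivita_eq, ← AlternatingMap.map_swap _ _ (show (0 : Fin 4) ≠ 1 by decide)]
  congr 1
  funext i
  fin_cases i <;> rfl

theorem leviCivita_swap_last (a b c d : Fin 4) : leviCivita a b c d = -leviCivita a b d c := by
  rw [leviCivita_eq, leviCivita_eq, ← AlternatingMap.map_swap _ _ (show (2 : Fin 4) ≠ 3 by decide)]
  congr 1
  funext i
  fin_cases i <;> rfl

theorem leviCivita_swap_middle (a b c d : Fin 4) : leviCivita a b c d = -leviCivita a c b d := by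
  rw [leviCivita_eq, leviCivita_eq, ← AlternatingMap.map_swap _ _ (show (1 : Fin 4) ≠ 2 by decide)]
  congr 1
  funext i
  fin_cases i <;> rfl

theorem leviCivita_zero_one_two_three : leviCivita 0 1 2 3 = 1 := by
  rw [leviCivita, ← Matrix.det_one (n := Fin 4)]
  congr 1
  funext i j
  fin_cases i <;> simp [Matrix.one_apply]

/-- This fixes the sign convention of `starForm`: in an orthonormal frame, raising indices is
multiplication by `minkSign`, and only permutations contribute to the symbol. Their values follow
from `leviCivita 0 1 2 3 = 1` by transpositions. -/
theorem sum_leviCivita_eq_starForm {φ : Fin 4 → Fin 4 → ℝ} (hφ : ∀ a b, φ a b = -φ b a)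
    (m n : Fin 4) :
    (1 / 2) * ∑ c, minkSign c * ∑ d, minkSign d * (φ c d * leviCivita c d m n)
      = starForm φ m n := by
  have h12 : ∀ a c d, leviCivita a a c d = 0 := fun a c d => by
    linarith [leviCivita_swap_first a a c d]
  have h34 : ∀ a c d, leviCivita a c d d = 0 := fun a c d => by
    linarith [leviCivita_swap_last a c d d]
  have h23 : ∀ a c d, leviCivita a c c d = 0 := fun a c d => by
    linarith [leviCivita_swap_middle a c c d]
  have h13 : ∀ a c d, leviCivita a c a d = 0 := fun a c d => by
    rw [leviCivita_swap_middle, h12, neg_zero]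
  have h24 : ∀ a c d, leviCivita a c d c = 0 := fun a c d => by
    rw [leviCivita_swap_middle, h34, neg_zero]
  have h14 : ∀ a c d, leviCivita a c d a = 0 := fun a c d => by
    rw [leviCivita_swap_first, h24, neg_zero]
  have h0 : ∀ a, φ a a = 0 := fun a => by linarith [hφ a a]
  have p0 := leviCivita_zero_one_two_three
  have p1 : leviCivita 0 2 1 3 = -1 := by rw [leviCivita_swap_middle, p0]
  have p2 : leviCivita 0 2 3 1 = 1 := by rw [leviCivita_swap_last, p1, neg_neg]
  have p3 : leviCivita 0 3 2 1 = -1 := by rw [leviCivita_swap_middle, p2]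
  have p4 : leviCivita 0 3 1 2 = 1 := by rw [leviCivita_swap_last, p3, neg_neg]
  have p5 : leviCivita 2 0 1 3 = 1 := by rw [leviCivita_swap_first, p1, neg_neg]
  have p6 : leviCivita 2 1 0 3 = -1 := by rw [leviCivita_swap_middle, p5]
  have p7 : leviCivita 1 2 0 3 = 1 := by rw [leviCivita_swap_first, p6, neg_neg]
  have p8 : leviCivita 3 0 1 2 = -1 := by rw [leviCivita_swap_first, p4]
  have p9 : leviCivita 3 1 0 2 = 1 := by rw [leviCivita_swap_middle, p8, neg_neg]
  have p10 : leviCivita 1 3 0 2 = -1 := by rw [leviCivita_swap_first, p9]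
  have p11 : leviCivita 2 0 3 1 = -1 := by rw [leviCivita_swap_first, p2]
  have p12 : leviCivita 2 3 0 1 = 1 := by rw [leviCivita_swap_middle, p11, neg_neg]
  have q0 : leviCivita 0 1 3 2 = -1 := by rw [leviCivita_swap_last, p0]
  have q1 : leviCivita 1 2 3 0 = -1 := by rw [leviCivita_swap_last, p7]
  have q2 : leviCivita 1 3 2 0 = 1 := by rw [leviCivita_swap_last, p10, neg_neg]
  have q3 : leviCivita 2 3 1 0 = -1 := by rw [leviCivita_swap_last, p12]
  fin_cases m <;> fin_cases n <;>
    simp [Fin.sum_univ_four, minkSign, starForm, h12, h34, h23, h13, h24, h14, h0,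
      leviCivita_swap_first 1 0, leviCivita_swap_first 2 0, leviCivita_swap_first 3 0,
      leviCivita_swap_first 2 1, leviCivita_swap_first 3 1, leviCivita_swap_first 3 2,
      p0, p1, p2, p3, p4, p7, p10, p12, q0, q1, q2, q3,
      hφ 1 0, hφ 2 0, hφ 3 0, hφ 2 1, hφ 3 1, hφ 3 2] <;> ring

variable {V : Type*} [AddCommGroup V] [Module ℝ V]
  {f : Module.Basis (Fin 4) ℝ V} {G : V → V → ℝ} {w : V → V → V → V → ℝ}

/-- An orthonormal frame for the Lorentzian form `G`. -/
def IsOrthoFrame (f : Fin 4 → V) (G : V → V → ℝ) : Prop :=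
  ∀ i j, G (f i) (f j) = if i = j then (if i = 0 then -1 else 1) else 0

theorem IsOrthoFrame.gramMat_eq {f : Fin 4 → V} (h : IsOrthoFrame f G) :
    gramMat f G = Matrix.diagonal minkSign := by
  ext i j
  rw [gramMat, Matrix.of_apply, h i j, Matrix.diagonal_apply]
  fin_cases i <;> fin_cases j <;> rfl

theorem IsOrthoFrame.mtrace_eq {f : Fin 4 → V} (h : IsOrthoFrame f G) (β : V → V → ℝ) :
    mtrace f G β = ∑ i, minkSign i * β (f i) (f i) := by
  have h1 : (Matrix.diagonal minkSign)⁻¹ = Matrix.diagonal minkSign := by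
    refine Matrix.inv_eq_right_inv ?_
    rw [Matrix.diagonal_mul_diagonal, ← Matrix.diagonal_one]
    congr 1
    funext i
    fin_cases i <;> norm_num [minkSign]
  simp [mtrace, h.gramMat_eq, h1, Matrix.diagonal_apply]

theorem IsOrthoFrame.frameVol_eq (h : IsOrthoFrame f G) (a b c d : Fin 4) :
    frameVol f G (f a) (f b) (f c) (f d) = leviCivita a b c d := by
  rw [frameVol, h.gramMat_eq, Matrix.det_diagonal, Fin.prod_univ_four, Module.Basis.det_apply,
    ← Matrix.det_transpose, leviCivita]
  have : Real.sqrt |minkSign 0 * minkSign 1 * minkSign 2 * minkSign 3| = 1 := by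
    simp [minkSign]
  rw [this, one_mul]
  congr 1
  funext i j
  rw [Matrix.transpose_apply, Module.Basis.toMatrix_apply]
  fin_cases i <;> simp [Finsupp.single_apply] <;> congr

theorem IsOrthoFrame.frameDual_eq (h : IsOrthoFrame f G)
    (hw : ∀ a b c d, w a b c d = -w a b d c) (a b m n : Fin 4) :
    frameDual f G w (f a) (f b) (f m) (f n)
      = starForm (fun c d => w (f a) (f b) (f c) (f d)) m n := by
  simp only [frameDual, h.mtrace_eq, h.frameVol_eq]
  exact sum_leviCivita_eq_starForm (fun c d => hw _ _ _ _) m n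

theorem IsOrthoFrame.frameBel_eq (h : IsOrthoFrame f G)
    (hw : ∀ a b c d, w a b c d = -w a b d c) (a b c d : Fin 4) :
    frameBel f G w (f a) (f b) (f c) (f d)
      = minkBel (fun a b c d => w (f a) (f b) (f c) (f d)) a b c d := by
  simp only [frameBel, h.mtrace_eq, h.frameDual_eq hw, minkBel, Finset.mul_sum, mul_assoc]

/-- The algebraic symmetries of a Weyl tensor for the metric `G`. -/
structure IsWeylForm (e : Fin 4 → V) (G : V → V → ℝ) (w : V → V → V → V → ℝ) : Prop where
  left : ∀ a b c d, w a b c d = -w b a c d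
  right : ∀ a b c d, w a b c d = -w a b d c
  cyclic : ∀ a b c d, w a b c d + w a c d b + w a d b c = 0
  trace : ∀ b d, mtrace e G (fun a c => w a b c d) = 0

variable {e : Module.Basis (Fin 4) ℝ V}

theorem IsWeylForm.isMinkWeyl (hw : IsWeylForm e G w) (hG : IsBilin G) (hq : IsQuadrilin w)
    (h : IsOrthoFrame f G) : IsMinkWeyl fun a b c d => w (f a) (f b) (f c) (f d) where
  left _ _ _ _ := hw.left _ _ _ _
  right _ _ _ _ := hw.right _ _ _ _
  cyclic _ _ _ _ := hw.cyclic _ _ _ _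
  trace b d := by
    have := hw.trace (f b) (f d)
    rw [← mtrace_basis_change hG ⟨fun _ => hq.s1 _ _ _, fun _ => hq.s3 _ _ _⟩ e f,
      h.mtrace_eq] at this
    exact this

theorem IsQuadrilin.swap_first (hw : IsQuadrilin w) : IsQuadrilin fun a b c d => w b a c d :=
  ⟨fun _ _ _ => hw.s2 _ _ _, fun _ _ _ => hw.s1 _ _ _, fun _ _ _ => hw.s3 _ _ _,
    fun _ _ _ => hw.s4 _ _ _⟩

theorem IsQuadrilin.swap_middle (hw : IsQuadrilin w) : IsQuadrilin fun a b c d => w a c b d :=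
  ⟨fun _ _ _ => hw.s1 _ _ _, fun _ _ _ => hw.s3 _ _ _, fun _ _ _ => hw.s2 _ _ _,
    fun _ _ _ => hw.s4 _ _ _⟩

theorem IsQuadrilin.swap_last (hw : IsQuadrilin w) : IsQuadrilin fun a b c d => w a b d c :=
  ⟨fun _ _ _ => hw.s1 _ _ _, fun _ _ _ => hw.s2 _ _ _, fun _ _ _ => hw.s4 _ _ _,
    fun _ _ _ => hw.s3 _ _ _⟩

/-- Pass to an orthonormal frame by `frameBel_basis_change`, reduce to frame vectors by
multilinearity, and quote the Minkowski identity. The two other exchanges are obtained in the same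
way. -/
theorem frameBel_swap_first (hw : IsWeylForm e G w) (hG : IsBilin G) (hq : IsQuadrilin w)
    (h : IsOrthoFrame f G) (a b c d : V) : frameBel e G w a b c d = frameBel e G w b a c d := by
  rw [← frameBel_basis_change hG hq e f, ← frameBel_basis_change hG hq e f]
  refine (frameBel_isQuadrilin hq).ext_basis (frameBel_isQuadrilin hq).swap_first f
    (fun i j k l => ?_) a b c d
  rw [h.frameBel_eq hw.right, h.frameBel_eq hw.right]
  exact minkBel_swap_first (hw.isMinkWeyl hG hq h) i j k l

theorem frameBel_swap_middle (hw : IsWeylForm e G w) (hG : IsBilin G) (hq : IsQuadrilin w)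
    (h : IsOrthoFrame f G) (a b c d : V) : frameBel e G w a b c d = frameBel e G w a c b d := by
  rw [← frameBel_basis_change hG hq e f, ← frameBel_basis_change hG hq e f]
  refine (frameBel_isQuadrilin hq).ext_basis (frameBel_isQuadrilin hq).swap_middle f
    (fun i j k l => ?_) a b c d
  rw [h.frameBel_eq hw.right, h.frameBel_eq hw.right]
  exact minkBel_swap_middle (hw.isMinkWeyl hG hq h) i j k l

theorem frameBel_swap_last (hw : IsWeylForm e G w) (hG : IsBilin G) (hq : IsQuadrilin w)
    (h : IsOrthoFrame f G) (a b c d : V) : frameBel e G w a b c d = frameBel e G w a b d c := by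
  rw [← frameBel_basis_change hG hq e f, ← frameBel_basis_change hG hq e f]
  refine (frameBel_isQuadrilin hq).ext_basis (frameBel_isQuadrilin hq).swap_last f
    (fun i j k l => ?_) a b c d
  rw [h.frameBel_eq hw.right, h.frameBel_eq hw.right]
  exact minkBel_swap_last (hw.isMinkWeyl hG hq h) i j k l

theorem frameBel_trace (hw : IsWeylForm e G w) (hG : IsBilin G) (hq : IsQuadrilin w)
    (h : IsOrthoFrame f G) (c d : V) :
    mtrace e G (fun a b => frameBel e G w a b c d) = 0 := by
  have hb := frameBel_isQuadrilin (f := f) (G := G) hq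
  simp only [← frameBel_basis_change hG hq e f]
  rw [← mtrace_basis_change hG ⟨fun _ => hb.s1 _ _ _, fun _ => hb.s2 _ _ _⟩ e f]
  have h3 : ∀ d, IsLinearMap ℝ fun c => mtrace f G (fun a b => frameBel f G w a b c d) :=
    fun d => mtrace_isLinearMap _ _ fun _ _ => hb.s3 _ _ _
  have h4 : ∀ c, IsLinearMap ℝ fun d => mtrace f G (fun a b => frameBel f G w a b c d) :=
    fun c => mtrace_isLinearMap _ _ fun _ _ => hb.s4 _ _ _
  rw [(h3 d).eq_sum_basis f]
  refine Finset.sum_eq_zero fun i _ => ?_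
  rw [(h4 (f i)).eq_sum_basis f, Finset.sum_eq_zero, mul_zero]
  intro j _
  rw [h.mtrace_eq]
  simp only [h.frameBel_eq hw.right]
  rw [minkBel_trace (hw.isMinkWeyl hG hq h), mul_zero]

end Orthonormal

/-! ### From the component definitions to frames -/

section PointBasis

variable {M : Type*} [TopologicalSpace M] [ChartedSpace (EuclideanSpace ℝ (Fin 4)) M]

/-- The basis `basisVec p` of the tangent space at `p`. -/
def pointBasis (p : M) : Module.Basis (Fin 4) ℝ (TangentSpace (𝓡 4) p) :=
  (EuclideanSpace.basisFun (Fin 4) ℝ).toBasis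

theorem pointBasis_apply (p : M) (i : Fin 4) : pointBasis p i = basisVec p i := by
  have : (EuclideanSpace.basisFun (Fin 4) ℝ).toBasis i = EuclideanSpace.single i (1 : ℝ) := by simp
  exact this

theorem coe_pointBasis (p : M) : ⇑(pointBasis p) = basisVec p :=
  funext (pointBasis_apply p)

theorem pointBasis_repr (p : M) (v : TangentSpace (𝓡 4) p) (i : Fin 4) :
    (pointBasis p).repr v i = vecComp p i v := rfl

theorem vecComp_basisVec (p : M) (i j : Fin 4) :
    vecComp p i (basisVec p j) = if i = j then 1 else 0 := by
  have : (EuclideanSpace.single j (1 : ℝ) : EuclideanSpace ℝ (Fin 4)) i = if i = j then 1 else 0 := by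
    simp [Pi.single_apply]
  exact this

theorem ofComp_apply {k : ℕ} (p : M) (c : (Fin k → Fin 4) → ℝ)
    (v : Fin k → TangentSpace (𝓡 4) p) :
    ofComp p c v = ∑ i, c i * ∏ j, vecComp p (i j) (v j) := by
  have h : ∀ (s : Finset (Fin k → Fin 4)) (F : (Fin k → Fin 4) → ContinuousMultilinearMap ℝ
      (fun _ : Fin k => TangentSpace (𝓡 4) p) ℝ), (∑ i ∈ s, F i) v = ∑ i ∈ s, F i v := by
    intro s F
    exact _root_.sum_apply s F v
  unfold ofComp
  rw [h]
  refine Finset.sum_congr rfl fun i _ => ?_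
  show c i * _ = _
  congr 1

theorem ofComp_basisVec {k : ℕ} (p : M) (c : (Fin k → Fin 4) → ℝ) (i : Fin k → Fin 4) :
    ofComp p c (fun j => basisVec p (i j)) = c i := by
  rw [ofComp_apply, Finset.sum_eq_single i]
  · simp [vecComp_basisVec]
  · intro i' _ hi'
    obtain ⟨j, hj⟩ := Function.ne_iff.1 hi'
    rw [Finset.prod_eq_zero (Finset.mem_univ j) (by rw [vecComp_basisVec, if_neg hj]), mul_zero]
  · simp

/-- The bilinear form of a `2`-tensor at `p`. -/
def form2 (g : CovTensorField 2 M) (p : M) (x y : TangentSpace (𝓡 4) p) : ℝ := g p ![x, y]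

/-- The multilinear form of a `4`-tensor at `p`. -/
def form4 (W : CovTensorField 4 M) (p : M) (a b c d : TangentSpace (𝓡 4) p) : ℝ :=
  W p ![a, b, c, d]

theorem form2_isBilin (g : CovTensorField 2 M) (p : M) : IsBilin (form2 g p) := by
  have u0 : ∀ a b x : TangentSpace (𝓡 4) p, Function.update ![a, b] 0 x = ![x, b] := by
    intro a b x; funext i; fin_cases i <;> rfl
  have u1 : ∀ a b x : TangentSpace (𝓡 4) p, Function.update ![a, b] 1 x = ![a, x] := by
    intro a b x; funext i; fin_cases i <;> rfl
  refine ⟨fun b => ⟨fun x y => ?_, fun k x => ?_⟩, fun a => ⟨fun x y => ?_, fun k x => ?_⟩⟩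
  · simp only [form2]
    simpa only [u0] using (g p).map_update_add ![0, b] 0 x y
  · simp only [form2]
    simpa only [u0] using (g p).map_update_smul ![0, b] 0 k x
  · simp only [form2]
    simpa only [u1] using (g p).map_update_add ![a, 0] 1 x y
  · simp only [form2]
    simpa only [u1] using (g p).map_update_smul ![a, 0] 1 k x

theorem form4_isQuadrilin (W : CovTensorField 4 M) (p : M) : IsQuadrilin (form4 W p) :=
  MultilinearMap.isQuadrilin (W p).toMultilinearMap

theorem gUp_eq (g : CovTensorField 2 M) (p : M) :
    gUp g p = (gramMat (pointBasis p) (form2 g p))⁻¹ := by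
  rw [gUp, coe_pointBasis]
  congr 1
  ext i j
  show g p _ = g p _
  congr 1
  funext k
  fin_cases k <;> rfl

theorem comp_four (W : CovTensorField 4 M) (p : M) (a b c d : Fin 4) :
    comp W p ![a, b, c, d]
      = form4 W p (pointBasis p a) (pointBasis p b) (pointBasis p c) (pointBasis p d) := by
  rw [coe_pointBasis]
  show W p _ = W p _
  congr 1
  funext k
  fin_cases k <;> rfl

theorem comp_two (g : CovTensorField 2 M) (p : M) (a b : Fin 4) :
    comp g p ![a, b] = form2 g p (pointBasis p a) (pointBasis p b) := by
  rw [coe_pointBasis]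
  show g p _ = g p _
  congr 1
  funext k
  fin_cases k <;> rfl

theorem volForm_eq (g : CovTensorField 2 M) (p : M) (a b c d : Fin 4) :
    volForm g p ![a, b, c, d] = frameVol (pointBasis p) (form2 g p) (pointBasis p a)
      (pointBasis p b) (pointBasis p c) (pointBasis p d) := by
  have h : gLow g p = gramMat (pointBasis p) (form2 g p) := by
    ext i j
    exact comp_two g p i j
  rw [volForm, frameVol, h, Module.Basis.det_apply, ← Matrix.det_transpose (Module.Basis.toMatrix _ _)]
  congr 2
  funext i j
  rw [Matrix.transpose_apply, Module.Basis.toMatrix_apply]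
  fin_cases i <;> simp [Finsupp.single_apply] <;> congr

theorem dualComp_eq (g : CovTensorField 2 M) (W : CovTensorField 4 M) (p : M) (a b m n : Fin 4) :
    dualComp g W p a b m n = frameDual (pointBasis p) (form2 g p) (form4 W p) (pointBasis p a)
      (pointBasis p b) (pointBasis p m) (pointBasis p n) := by
  simp only [dualComp, frameDual, mtrace, volForm_eq, comp_four, ← gUp_eq, Finset.mul_sum]
  refine Finset.sum_congr rfl fun c _ => ?_
  rw [Finset.sum_comm]
  refine Finset.sum_congr rfl fun c' _ => Finset.sum_congr rfl fun d _ =>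
    Finset.sum_congr rfl fun d' _ => ?_
  ring

/-- The bridge to the frame formalism: the index sums in the definition are nested `mtrace`
contractions in the basis `pointBasis p`, up to the order of summation. -/
theorem form4_belRobinson (g : CovTensorField 2 M) (W : CovTensorField 4 M) (p : M)
    (a b c d : TangentSpace (𝓡 4) p) :
    form4 (belRobinson g W) p a b c d
      = frameBel (pointBasis p) (form2 g p) (form4 W p) a b c d := by
  refine (form4_isQuadrilin _ p).ext_basis (frameBel_isQuadrilin (form4_isQuadrilin W p))
    (pointBasis p) (fun i j k l => ?_) a b c d
  rw [← comp_four]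
  refine (ofComp_basisVec p _ _).trans ?_
  simp only [frameBel, mtrace, dualComp_eq, comp_four, ← gUp_eq, Finset.mul_sum]
  refine Finset.sum_congr rfl fun r _ => ?_
  rw [Finset.sum_comm]
  refine Finset.sum_congr rfl fun r' _ => Finset.sum_congr rfl fun s _ =>
    Finset.sum_congr rfl fun s' _ => ?_
  simp only [Matrix.cons_val]
  ring

theorem IsWeylFieldOn.isWeylForm {g : CovTensorField 2 M} {W : CovTensorField 4 M} {R : Set M}
    (hW : IsWeylFieldOn g W R) {p : M} (hp : p ∈ R) :
    IsWeylForm (pointBasis p) (form2 g p) (form4 W p) where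
  left := hW.antisymm_left p hp
  right := hW.antisymm_right p hp
  cyclic := hW.cyclic p hp
  trace b d := by
    have hq := form4_isQuadrilin W p
    have h3 : ∀ d, IsLinearMap ℝ fun b => mtrace (pointBasis p) (form2 g p)
        (fun a c => form4 W p a b c d) := fun d => mtrace_isLinearMap _ _ fun _ _ => hq.s2 _ _ _
    have h4 : ∀ b, IsLinearMap ℝ fun d => mtrace (pointBasis p) (form2 g p)
        (fun a c => form4 W p a b c d) := fun d => mtrace_isLinearMap _ _ fun _ _ => hq.s4 _ _ _
    rw [(h3 d).eq_sum_basis (pointBasis p)]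
    refine Finset.sum_eq_zero fun i _ => ?_
    rw [(h4 _).eq_sum_basis (pointBasis p), Finset.sum_eq_zero, mul_zero]
    intro j _
    have := hW.trace_free p hp i j
    simp only [comp_four, gUp_eq] at this
    rw [mtrace, this, mul_zero]

/-- The symmetries of the Bel-Robinson tensor of a Weyl field. -/
theorem IsWeylFieldOn.belRobinson_symm {g : CovTensorField 2 M} (hg : IsLorentzMetric g)
    {W : CovTensorField 4 M} {R : Set M} (hW : IsWeylFieldOn g W R) {p : M} (hp : p ∈ R)
    (a b c d : TangentSpace (𝓡 4) p) :
    form4 (belRobinson g W) p a b c d = form4 (belRobinson g W) p b a c d ∧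
    form4 (belRobinson g W) p a b c d = form4 (belRobinson g W) p a c b d ∧
    form4 (belRobinson g W) p a b c d = form4 (belRobinson g W) p a b d c := by
  obtain ⟨f, hf⟩ := hg.signature p
  simp only [form4_belRobinson]
  exact ⟨frameBel_swap_first (hW.isWeylForm hp) (form2_isBilin g p) (form4_isQuadrilin W p) hf _ _ _ _,
    frameBel_swap_middle (hW.isWeylForm hp) (form2_isBilin g p) (form4_isQuadrilin W p) hf _ _ _ _,
    frameBel_swap_last (hW.isWeylForm hp) (form2_isBilin g p) (form4_isQuadrilin W p) hf _ _ _ _⟩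

theorem IsWeylFieldOn.belRobinson_trace {g : CovTensorField 2 M} (hg : IsLorentzMetric g)
    {W : CovTensorField 4 M} {R : Set M} (hW : IsWeylFieldOn g W R) {p : M} (hp : p ∈ R)
    (c d : TangentSpace (𝓡 4) p) :
    ∑ a, ∑ b, gUp g p a b * form4 (belRobinson g W) p (basisVec p a) (basisVec p b) c d = 0 := by
  obtain ⟨f, hf⟩ := hg.signature p
  have := frameBel_trace (hW.isWeylForm hp) (form2_isBilin g p) (form4_isQuadrilin W p) hf c d
  simp only [← form4_belRobinson] at this
  rwa [mtrace, ← gUp_eq, coe_pointBasis] at this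

end PointBasis

/-! ### Tensors and vector fields in a fixed chart -/

section ChartCalculus

variable {M : Type*} [TopologicalSpace M] [ChartedSpace (EuclideanSpace ℝ (Fin 4)) M]

/-- The differential at `q` of the preferred chart at `p`. -/
def chartD (p q : M) : TangentSpace (𝓡 4) q →L[ℝ] EuclideanSpace ℝ (Fin 4) :=
  mfderiv (𝓡 4) 𝓘(ℝ, EuclideanSpace ℝ (Fin 4)) (extChartAt (𝓡 4) p) q

variable [IsManifold (𝓡 4) ∞ M]

theorem isManifold_one : IsManifold (𝓡 4) 1 M := IsManifold.of_le (n := ∞) (by simp)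

theorem chartD_isInvertible {p q : M} (hq : q ∈ (extChartAt (𝓡 4) p).source) :
    (chartD p q).IsInvertible :=
  haveI := isManifold_one (M := M)
  isInvertible_mfderiv_extChartAt hq

theorem chartD_coordField {p q : M} (hq : q ∈ (extChartAt (𝓡 4) p).source) (i : Fin 4) :
    chartD p q (coordField p i q) = EuclideanSpace.single i (1 : ℝ) :=
  (chartD_isInvertible hq).self_apply_inverse _

theorem eq_sum_coordField {p q : M} (hq : q ∈ (extChartAt (𝓡 4) p).source)
    (v : TangentSpace (𝓡 4) q) : v = ∑ i, chartD p q v i • coordField p i q := by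
  have hinj : Function.Injective (chartD p q) := (chartD_isInvertible hq).injective
  apply hinj
  rw [map_sum]
  simp only [map_smul, chartD_coordField hq]
  ext j
  simp [Finset.sum_apply, Pi.single_apply]

theorem chartD_self (p : M) (v : TangentSpace (𝓡 4) p) : chartD p p v = v := by
  have h1 := isManifold_one (M := M)
  have h2 := mfderiv_chartAt_eq_tangentCoordChange (I := 𝓡 4) (mem_chart_source
      (EuclideanSpace ℝ (Fin 4)) p)
  have h3 := tangentCoordChange_self (I := 𝓡 4) (x := p) (z := p) (v := v)
      (mem_extChartAt_source p)
  exact (congrArg (fun L => L v) h2).trans h3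

/-- Preferred charts may vary discontinuously from point to point. Expanding in the coordinate
fields of the one chart at `p` separates the smooth components of `T` from those of its arguments.
-/
theorem tensor_eq_sum_chartComp {k : ℕ} (T : CovTensorField k M) {p q : M}
    (hq : q ∈ (extChartAt (𝓡 4) p).source) (v : Fin k → TangentSpace (𝓡 4) q) :
    T q v = ∑ i : Fin k → Fin 4, (∏ j, chartD p q (v j) (i j)) * chartComp T p i q := by
  have h : v = fun j => ∑ i, chartD p q (v j) i • coordField p i q :=
    funext fun j => eq_sum_coordField hq (v j)
  conv_lhs => rw [h]
  rw [(T q).map_sum]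
  refine Finset.sum_congr rfl fun i _ => ?_
  exact (T q).map_smul_univ _ _

variable {E : Type*} [NormedAddCommGroup E] [NormedSpace ℝ E] {n : ℕ∞ω}

/-- A vector field along `ψ : E → M` is `C^n` at `y₀`. -/
def ContDiffAlong (n : ℕ∞ω) (ψ : E → M) (v : ∀ y, TangentSpace (𝓡 4) (ψ y)) (y₀ : E) : Prop :=
  ContDiffAt ℝ n (fun y => chartD (ψ y₀) (ψ y) (v y)) y₀

theorem eventually_mem_extChartAt_source {ψ : E → M} {y₀ : E} (hψ : ContinuousAt ψ y₀) :
    ∀ᶠ y in nhds y₀, ψ y ∈ (extChartAt (𝓡 4) (ψ y₀)).source :=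
  hψ.preimage_mem_nhds (extChartAt_source_mem_nhds (ψ y₀))

theorem ContDiffAlong.tensor {k : ℕ} {T : CovTensorField k M} {R : Set M} (hT : TensorSmoothOn T R)
    {ψ : E → M} {y₀ : E} (hy : ψ y₀ ∈ R) (hn : n ≤ ∞) (hψ : ContMDiffAt 𝓘(ℝ, E) (𝓡 4) n ψ y₀)
    {v : ∀ y, Fin k → TangentSpace (𝓡 4) (ψ y)}
    (hv : ∀ j, ContDiffAlong n ψ (fun y => v y j) y₀) :
    ContDiffAt ℝ n (fun y => T (ψ y) (v y)) y₀ := by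
  have h1 : ContDiffAt ℝ n (fun y => ∑ i : Fin k → Fin 4,
      (∏ j, chartD (ψ y₀) (ψ y) (v y j) (i j)) * chartComp T (ψ y₀) i (ψ y)) y₀ := by
    refine ContDiffAt.sum fun i _ => ContDiffAt.mul ?_ ?_
    · refine contDiffAt_prod fun j _ => ?_
      exact (EuclideanSpace.proj (i j) : EuclideanSpace ℝ (Fin 4) →L[ℝ] ℝ).contDiff.contDiffAt.comp
        y₀ (hv j)
    · exact (((hT _ hy i).of_le hn).comp y₀ hψ).contDiffAt
  refine h1.congr_of_eventuallyEq ?_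
  filter_upwards [eventually_mem_extChartAt_source hψ.continuousAt] with y hy'
  exact tensor_eq_sum_chartComp T hy' _

/-- Near `p`, the fibre coordinate of the tangent bundle trivialisation at `p` is the differential
of the chart at `p`. -/
theorem VecSmoothOn.chartD {X : VecField M} {R : Set M} (hR : IsOpen R) (hX : VecSmoothOn X R)
    {p : M} (hp : p ∈ R) :
    ContMDiffAt (𝓡 4) 𝓘(ℝ, EuclideanSpace ℝ (Fin 4)) ∞ (fun q => _root_.chartD p q (X q)) p := by
  have h1 := isManifold_one (M := M)
  have h := (hX.contMDiffAt (hR.mem_nhds hp))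
  rw [Bundle.contMDiffAt_section] at h
  refine h.congr_of_eventuallyEq ?_
  filter_upwards [(chartAt (EuclideanSpace ℝ (Fin 4)) p).open_source.mem_nhds
    (mem_chart_source _ p)] with q hq
  have h2 := TangentBundle.continuousLinearMapAt_trivializationAt (I := 𝓡 4) hq
  have h3 := congrArg (fun L => L (X q)) h2
  refine h3.symm.trans ?_
  rw [Bundle.Trivialization.continuousLinearMapAt_apply]
  rw [Bundle.Trivialization.linearMapAt_apply, if_pos]
  simpa using hq

/-- By the chain rule, the derivative of `ψ` read in the chart is the ordinary derivative of the
chart composed with `ψ`, at the cost of one order of differentiability. -/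
theorem contDiffAlong_mfderiv {m : ℕ∞ω} {ψ : E → M} {y₀ : E} (hmn : m + 1 ≤ n) (hn : n ≤ ∞)
    (hψ : ContMDiffAt 𝓘(ℝ, E) (𝓡 4) n ψ y₀)
    (hψ' : ∀ᶠ y in nhds y₀, MDifferentiableAt 𝓘(ℝ, E) (𝓡 4) ψ y) (ξ : E) :
    ContDiffAlong m ψ (fun y => mfderiv 𝓘(ℝ, E) (𝓡 4) ψ y ξ) y₀ := by
  have h1 : ContDiffAt ℝ n (fun y => extChartAt (𝓡 4) (ψ y₀) (ψ y)) y₀ := by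
    have : IsManifold (𝓡 4) n M := IsManifold.of_le hn
    exact (((contMDiffAt_extChartAt (I := 𝓡 4) (n := n) (x := ψ y₀)).comp y₀ hψ).contDiffAt :)
  have h2 : ContDiffAt ℝ m (fun y => fderiv ℝ (fun y => extChartAt (𝓡 4) (ψ y₀) (ψ y)) y ξ) y₀ :=
    (h1.fderiv_right hmn).clm_apply contDiffAt_const
  refine h2.congr_of_eventuallyEq ?_
  filter_upwards [hψ', eventually_mem_extChartAt_source hψ.continuousAt] with y hy hys
  have := isManifold_one (M := M)
  have h3 : MDifferentiableAt (𝓡 4) 𝓘(ℝ, EuclideanSpace ℝ (Fin 4)) (extChartAt (𝓡 4) (ψ y₀)) (ψ y) :=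
    mdifferentiableAt_extChartAt (by simpa using hys)
  have h4 := mfderiv_comp_apply y h3 hy ξ
  rw [← mfderiv_eq_fderiv]
  exact h4.symm

end ChartCalculus

/-! ### Partial and covariant derivatives -/

section ChartDerivative

variable {M : Type*} [TopologicalSpace M] [ChartedSpace (EuclideanSpace ℝ (Fin 4)) M]

theorem partialD_eq_fderiv {f : M → ℝ} {p : M} (hf : MDifferentiableAt (𝓡 4) 𝓘(ℝ, ℝ) f p)
    (a : Fin 4) : partialD f p a = fderiv ℝ (fun z => f ((extChartAt (𝓡 4) p).symm z))
      (extChartAt (𝓡 4) p p) (EuclideanSpace.single a (1 : ℝ)) := by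
  have h : mfderiv (𝓡 4) 𝓘(ℝ, ℝ) f p = fderiv ℝ (fun z => f ((extChartAt (𝓡 4) p).symm z))
      (extChartAt (𝓡 4) p p) := by
    refine hf.mfderiv.trans ?_
    show fderivWithin ℝ (fun z => f ((extChartAt (𝓡 4) p).symm z)) (range (𝓡 4)) _ = _
    rw [modelWithCornersSelf_coe, Set.range_id, fderivWithin_univ]
  exact congrArg (fun L => L (EuclideanSpace.single a (1 : ℝ))) h

theorem partialD_congr {f f' : M → ℝ} {p : M} (h : f =ᶠ[nhds p] f') (a : Fin 4) :
    partialD f p a = partialD f' p a := by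
  have : mfderiv (𝓡 4) 𝓘(ℝ, ℝ) f p = mfderiv (𝓡 4) 𝓘(ℝ, ℝ) f' p := h.mfderiv_eq
  exact congrArg (fun L => L (basisVec p a)) this

variable [IsManifold (𝓡 4) ∞ M]

theorem mdifferentiableAt_iff_chart {f : M → ℝ} {p : M} :
    MDifferentiableAt (𝓡 4) 𝓘(ℝ, ℝ) f p ↔ ContinuousAt f p ∧ DifferentiableAt ℝ
      (fun z => f ((extChartAt (𝓡 4) p).symm z)) (extChartAt (𝓡 4) p p) := by
  rw [mdifferentiableAt_iff]
  simp only [writtenInExtChartAt, extChartAt_model_space_eq_id, PartialEquiv.refl_coe,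
      Function.id_comp, modelWithCornersSelf_coe, Set.range_id, differentiableWithinAt_univ]
  rfl

theorem MDifferentiableAt.chart {f : M → ℝ} {p : M} (hf : MDifferentiableAt (𝓡 4) 𝓘(ℝ, ℝ) f p) :
    DifferentiableAt ℝ (fun z => f ((extChartAt (𝓡 4) p).symm z)) (extChartAt (𝓡 4) p p) :=
  (mdifferentiableAt_iff_chart.1 hf).2

theorem extChartAt_symm_self (p : M) : (extChartAt (𝓡 4) p).symm (extChartAt (𝓡 4) p p) = p :=
  extChartAt_to_inv p

/-- The components of a vector field in the chart at `p`. -/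
def chartVec (X : VecField M) (p : M) (c : Fin 4) (q : M) : ℝ := chartD p q (X q) c

/-- The partial derivatives `∂_a X^c` in the chart at `p`. -/
def partialVec (X : VecField M) (p : M) (a : Fin 4) : TangentSpace (𝓡 4) p :=
  ∑ c, partialD (chartVec X p c) p a • basisVec p c

/-- The connection matrix `v ↦ Γ(∂_a, v)`. -/
def connMap (g : CovTensorField 2 M) (p : M) (a : Fin 4) :
    TangentSpace (𝓡 4) p →L[ℝ] TangentSpace (𝓡 4) p :=
  ∑ m, ∑ c, (christoffel g p m a c • vecComp p c).smulRight (basisVec p m)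

/-- The covariant derivative `∇_a X`. -/
def nablaVec (g : CovTensorField 2 M) (X : VecField M) (p : M) (a : Fin 4) :
    TangentSpace (𝓡 4) p :=
  partialVec X p a + connMap g p a (X p)

/-- The multilinear form `∇_a T`. -/
def nablaTensor {k : ℕ} (g : CovTensorField 2 M) (T : CovTensorField k M) (p : M) (a : Fin 4) :
    ContinuousMultilinearMap ℝ (fun _ : Fin k => TangentSpace (𝓡 4) p) ℝ :=
  ofComp p (covDeriv g T p a)

theorem chartVec_self (X : VecField M) (p : M) (c : Fin 4) : chartVec X p c p = vecComp p c (X p) :=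
  congrArg (fun v : EuclideanSpace ℝ (Fin 4) => v c) (chartD_self p (X p))

theorem chartComp_self {k : ℕ} (T : CovTensorField k M) (p : M) (i : Fin k → Fin 4) :
    chartComp T p i p = comp T p i := by
  simp only [chartComp, comp, coordField_self]

theorem multilin_eq_sum {k : ℕ} {p : M}
    (T : ContinuousMultilinearMap ℝ (fun _ : Fin k => TangentSpace (𝓡 4) p) ℝ)
    (v : Fin k → TangentSpace (𝓡 4) p) :
    T v = ∑ i : Fin k → Fin 4, (∏ j, vecComp p (i j) (v j)) * T fun j => basisVec p (i j) := by
  have h : v = fun j => ∑ i, vecComp p i (v j) • basisVec p i := by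
    funext j
    have := (pointBasis p).sum_repr (v j)
    simpa only [pointBasis_repr, pointBasis_apply] using this.symm
  conv_lhs => rw [h]
  rw [T.map_sum]
  exact Finset.sum_congr rfl fun i _ => T.map_smul_univ _ _

theorem multilin_update_eq_sum {k : ℕ} {p : M}
    (T : ContinuousMultilinearMap ℝ (fun _ : Fin k => TangentSpace (𝓡 4) p) ℝ)
    (v : Fin k → TangentSpace (𝓡 4) p) (j : Fin k) (w : TangentSpace (𝓡 4) p) :
    T (Function.update v j w) = ∑ i : Fin k → Fin 4,
      ((∏ l ∈ Finset.univ.erase j, vecComp p (i l) (v l)) * vecComp p (i j) w)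
        * T fun j => basisVec p (i j) := by
  rw [multilin_eq_sum]
  refine Finset.sum_congr rfl fun i _ => congrArg (· * _) ?_
  rw [← Finset.prod_erase_mul _ _ (Finset.mem_univ j), Function.update_self]
  refine congrArg (· * _) (Finset.prod_congr rfl fun l hl => ?_)
  rw [Function.update_of_ne (Finset.ne_of_mem_erase hl)]

theorem vecComp_sum_smul (p : M) (f : Fin 4 → ℝ) (c : Fin 4) :
    vecComp p c (∑ m, f m • basisVec p m) = f c := by
  rw [map_sum]
  simp only [map_smul, vecComp_basisVec, smul_eq_mul]
  simp

theorem connMap_basisVec (g : CovTensorField 2 M) (p : M) (a c : Fin 4) :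
    connMap g p a (basisVec p c) = ∑ m, christoffel g p m a c • basisVec p m := by
  unfold connMap
  rw [sum_apply]
  refine Finset.sum_congr rfl fun m _ => ?_
  rw [sum_apply, Finset.sum_eq_single c]
  · rw [ContinuousLinearMap.smulRight_apply]
    congr 1
    show christoffel g p m a c * vecComp p c (basisVec p c) = _
    rw [vecComp_basisVec, if_pos rfl, mul_one]
  · intro c' _ hc'
    rw [ContinuousLinearMap.smulRight_apply]
    show (christoffel g p m a c' * vecComp p c' (basisVec p c)) • _ = _
    rw [vecComp_basisVec, if_neg hc', mul_zero, zero_smul]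
  · simp

/-- The Christoffel correction of one index, made invariant: expanding `T` with the connection
matrix inserted in slot `j` reproduces the sum in `covDeriv`. -/
theorem sum_christoffel_comp {k : ℕ} (g : CovTensorField 2 M) (T : CovTensorField k M) (p : M)
    (a : Fin 4) (v : Fin k → TangentSpace (𝓡 4) p) (j : Fin k) :
    ∑ i : Fin k → Fin 4, (∏ l, vecComp p (i l) (v l)) *
      ∑ m, christoffel g p m a (i j) * comp T p (Function.update i j m)
      = T p (Function.update v j (connMap g p a (v j))) := by
  have h1 := multilin_eq_sum ((T p).compContinuousLinearMap
    (Function.update (fun _ => ContinuousLinearMap.id ℝ _) j (connMap g p a))) v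
  have h2 : ∀ w : Fin k → TangentSpace (𝓡 4) p, (fun l => (Function.update (fun _ : Fin k =>
      ContinuousLinearMap.id ℝ (TangentSpace (𝓡 4) p)) j (connMap g p a)) l (w l))
      = Function.update w j (connMap g p a (w j)) := by
    intro w
    funext l
    by_cases hl : l = j
    · subst hl; simp
    · simp [Function.update_of_ne hl]
  rw [ContinuousMultilinearMap.compContinuousLinearMap_apply, h2] at h1
  rw [h1]
  refine Finset.sum_congr rfl fun i _ => congrArg _ ?_
  rw [ContinuousMultilinearMap.compContinuousLinearMap_apply, h2, connMap_basisVec]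
  refine Eq.trans ?_ (MultilinearMap.map_update_sum (T p).toMultilinearMap Finset.univ j
    (fun m => christoffel g p m a (i j) • basisVec p m) (fun l => basisVec p (i l))).symm
  refine Finset.sum_congr rfl fun m _ => ?_
  refine Eq.trans ?_ ((T p).map_update_smul _ _ _ _).symm
  rw [smul_eq_mul]
  congr 1
  show T p _ = T p _
  congr 1
  funext l
  by_cases hl : l = j
  · subst hl; simp
  · simp [Function.update_of_ne hl]

/-- The Leibniz rule for the covariant derivative. -/
theorem partialD_tensor_apply {k : ℕ} (g : CovTensorField 2 M) (T : CovTensorField k M) (p : M)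
    (hT : ∀ i, MDifferentiableAt (𝓡 4) 𝓘(ℝ, ℝ) (chartComp T p i) p) (V : Fin k → VecField M)
    (hV : ∀ j c, MDifferentiableAt (𝓡 4) 𝓘(ℝ, ℝ) (chartVec (V j) p c) p) (a : Fin 4) :
    partialD (fun q => T q fun j => V j q) p a
      = nablaTensor g T p a (fun j => V j p)
        + ∑ j, T p (Function.update (fun j => V j p) j (nablaVec g (V j) p a)) := by
  have h1 : (fun q => T q fun j => V j q) =ᶠ[nhds p] fun q => ∑ i : Fin k → Fin 4,
      (∏ j, chartVec (V j) p (i j) q) * chartComp T p i q := by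
    filter_upwards [extChartAt_source_mem_nhds (I := 𝓡 4) p] with q hq
    exact tensor_eq_sum_chartComp T hq _
  rw [partialD_congr h1]
  have hV' : ∀ j c, HasFDerivAt (fun z => chartVec (V j) p c ((extChartAt (𝓡 4) p).symm z)) _
      (extChartAt (𝓡 4) p p) := fun j c => (hV j c).chart.hasFDerivAt
  have hT' : ∀ i, HasFDerivAt (fun z => chartComp T p i ((extChartAt (𝓡 4) p).symm z)) _
      (extChartAt (𝓡 4) p p) := fun i => (hT i).chart.hasFDerivAt
  have h2 := HasFDerivAt.fun_sum (u := Finset.univ) fun (i : Fin k → Fin 4) _ =>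
    (HasFDerivAt.finsetProd (u := Finset.univ) fun j _ => hV' j (i j)).fun_mul (hT' i)
  have hd : MDifferentiableAt (𝓡 4) 𝓘(ℝ, ℝ) (fun q => ∑ i : Fin k → Fin 4,
      (∏ j, chartVec (V j) p (i j) q) * chartComp T p i q) p := by
    refine mdifferentiableAt_iff_chart.2 ⟨?_, h2.differentiableAt⟩
    exact tendsto_finsetSum _ fun i _ => Filter.Tendsto.mul
      (tendsto_finsetProd _ fun j _ => (hV j (i j)).continuousAt) (hT i).continuousAt
  rw [partialD_eq_fderiv hd]
  refine (congrArg (fun L => L (EuclideanSpace.single a (1 : ℝ))) h2.fderiv).trans ?_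
  rw [sum_apply]
  simp only [add_apply, smul_apply, sum_apply, smul_eq_mul, extChartAt_symm_self,
    ← partialD_eq_fderiv (hV _ _), ← partialD_eq_fderiv (hT _), chartVec_self, chartComp_self]
  -- The Christoffel part of `∇V` in slot `j` is exactly what `covDeriv` subtracts for that slot;
  -- after cancellation the ordinary product rule remains.
  have h3 : ∀ j, T p (Function.update (fun j => V j p) j (nablaVec g (V j) p a))
      = T p (Function.update (fun j => V j p) j (partialVec (V j) p a))
        + T p (Function.update (fun j => V j p) j (connMap g p a (V j p))) := fun j =>
    ContinuousMultilinearMap.map_update_add _ _ _ _ _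
  have e1 : ∑ j, T p (Function.update (fun j => V j p) j (partialVec (V j) p a))
      = ∑ i : Fin k → Fin 4, (∑ j, (∏ l ∈ Finset.univ.erase j, vecComp p (i l) (V l p))
        * partialD (chartVec (V j) p (i j)) p a) * comp T p i := by
    simp only [multilin_update_eq_sum, partialVec, vecComp_sum_smul, Finset.sum_mul]
    rw [Finset.sum_comm]
    rfl
  have e2 : ∑ j, T p (Function.update (fun j => V j p) j (connMap g p a (V j p)))
      = ∑ i : Fin k → Fin 4, (∏ l, vecComp p (i l) (V l p)) *
      ∑ j, ∑ m, christoffel g p m a (i j) * comp T p (Function.update i j m) := by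
    rw [← Finset.sum_congr rfl fun j _ => sum_christoffel_comp g T p a (fun j => V j p) j,
      Finset.sum_comm]
    simp only [Finset.mul_sum]
  have e3 : ∑ j, T p (Function.update (fun j => V j p) j (nablaVec g (V j) p a))
      = _ + _ := (Finset.sum_congr rfl fun j _ => h3 j).trans Finset.sum_add_distrib
  rw [e3, e1, e2, nablaTensor, ofComp_apply, ← Finset.sum_add_distrib, ← Finset.sum_add_distrib]
  refine Finset.sum_congr rfl fun i _ => ?_
  rw [covDeriv]
  ring

end ChartDerivative

/-! ### The Levi-Civita connection and the divergence of the current -/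

section CovariantCalculus

variable {M : Type*} [TopologicalSpace M] [ChartedSpace (EuclideanSpace ℝ (Fin 4)) M]
  [IsManifold (𝓡 4) ∞ M] {g : CovTensorField 2 M}

theorem IsLorentzMetric.form2_symm (hg : IsLorentzMetric g) (p : M) (v w : TangentSpace (𝓡 4) p) :
    form2 g p v w = form2 g p w v := hg.symm p v w

theorem IsLorentzMetric.isUnit_det (hg : IsLorentzMetric g) (p : M) : IsUnit (gLow g p).det := by
  obtain ⟨f, hf⟩ := hg.signature p
  have h1 : gLow g p = gramMat (pointBasis p) (form2 g p) := by
    ext i j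
    exact comp_two g p i j
  have h2 : (gramMat f (form2 g p)).det = -1 := by
    rw [IsOrthoFrame.gramMat_eq (G := form2 g p) hf, Matrix.det_diagonal, Fin.prod_univ_four]
    simp [minkSign]
  rw [gramMat_basis_change (form2_isBilin g p) (pointBasis p) f, Matrix.det_mul, Matrix.det_mul,
    ← h1] at h2
  rw [isUnit_iff_ne_zero]
  intro h
  simp [h] at h2

theorem IsLorentzMetric.gLow_mul_gUp (hg : IsLorentzMetric g) (p : M) : gLow g p * gUp g p = 1 :=
  Matrix.mul_nonsing_inv _ (hg.isUnit_det p)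

theorem IsLorentzMetric.gUp_mul_gLow (hg : IsLorentzMetric g) (p : M) : gUp g p * gLow g p = 1 :=
  Matrix.nonsing_inv_mul _ (hg.isUnit_det p)

theorem gLow_eq_form2 (g : CovTensorField 2 M) (p : M) (a b : Fin 4) :
    gLow g p a b = form2 g p (basisVec p a) (basisVec p b) := by
  rw [← coe_pointBasis]
  exact comp_two g p a b

theorem IsLorentzMetric.gLow_symm (hg : IsLorentzMetric g) (p : M) (a b : Fin 4) :
    gLow g p a b = gLow g p b a := by
  rw [gLow_eq_form2, gLow_eq_form2, hg.form2_symm]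

theorem IsLorentzMetric.gUp_symm (hg : IsLorentzMetric g) (p : M) (a b : Fin 4) :
    gUp g p a b = gUp g p b a := by
  have h : (gLow g p).transpose = gLow g p := by
    ext i j
    exact hg.gLow_symm p j i
  have h2 : (gUp g p).transpose = gUp g p := by
    rw [gUp, Matrix.transpose_nonsing_inv, h]
  exact congrFun (congrFun h2.symm a) b

theorem IsLorentzMetric.sum_gUp_gLow (hg : IsLorentzMetric g) (p : M) (a b : Fin 4) :
    ∑ c, gUp g p a c * gLow g p c b = if a = b then 1 else 0 := by
  have := congrFun (congrFun (hg.gUp_mul_gLow p) a) b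
  rwa [Matrix.mul_apply, Matrix.one_apply] at this

theorem IsLorentzMetric.sum_gLow_gUp (hg : IsLorentzMetric g) (p : M) (a b : Fin 4) :
    ∑ c, gLow g p a c * gUp g p c b = if a = b then 1 else 0 := by
  have := congrFun (congrFun (hg.gLow_mul_gUp p) a) b
  rwa [Matrix.mul_apply, Matrix.one_apply] at this

theorem eq_sum_vecComp (p : M) (v : TangentSpace (𝓡 4) p) :
    v = ∑ i, vecComp p i v • basisVec p i := by
  have := (pointBasis p).sum_repr v
  simpa only [pointBasis_repr, pointBasis_apply] using this.symm

theorem IsLinearMap.eq_sum_basisVec {p : M} {F : TangentSpace (𝓡 4) p → ℝ} (hF : IsLinearMap ℝ F)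
    (v : TangentSpace (𝓡 4) p) : F v = ∑ i, vecComp p i v * F (basisVec p i) := by
  have := hF.eq_sum_basis (pointBasis p) v
  simpa only [pointBasis_repr, pointBasis_apply] using this

theorem flat_apply (g : CovTensorField 2 M) (X : VecField M) (p : M)
    (v : Fin 1 → TangentSpace (𝓡 4) p) : flat g X p v = form2 g p (v 0) (X p) := by
  rw [flat, ofComp_apply, ((form2_isBilin g p).left _).eq_sum_basisVec (v 0),
    ← (Equiv.funUnique (Fin 1) (Fin 4)).symm.sum_comp]
  refine Finset.sum_congr rfl fun i _ => ?_
  rw [((form2_isBilin g p).right _).eq_sum_basisVec (X p)]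
  simp only [Finset.univ_unique, Fin.default_eq_zero, Finset.prod_singleton, gLow_eq_form2]
  rw [mul_comm]
  exact congrArg _ (Finset.sum_congr rfl fun j _ => mul_comm _ _)

/-- The vector field metrically dual to a one-form. -/
def sharp (g : CovTensorField 2 M) (θ : CovTensorField 1 M) : VecField M := fun p =>
  ∑ a, (∑ b, gUp g p a b * θ p ![basisVec p b]) • basisVec p a

theorem vecComp_sharp (g : CovTensorField 2 M) (θ : CovTensorField 1 M) (p : M) (a : Fin 4) :
    vecComp p a (sharp g θ p) = ∑ b, gUp g p a b * θ p ![basisVec p b] :=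
  vecComp_sum_smul p _ a

theorem IsLorentzMetric.flat_sharp (hg : IsLorentzMetric g) (θ : CovTensorField 1 M) :
    flat g (sharp g θ) = θ := by
  funext p
  ext v
  rw [flat_apply, ((form2_isBilin g p).right _).eq_sum_basisVec]
  have hv : v = ![v 0] := by funext i; fin_cases i; rfl
  have hθ : IsLinearMap ℝ fun x => θ p ![x] := by
    have u0 : ∀ a x : TangentSpace (𝓡 4) p, Function.update ![a] 0 x = ![x] := by
      intro a x; funext i; fin_cases i; rfl
    refine ⟨fun x y => ?_, fun k x => ?_⟩
    · simpa only [u0] using (θ p).map_update_add ![0] 0 x y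
    · simpa only [u0] using (θ p).map_update_smul ![0] 0 k x
  rw [hv, hθ.eq_sum_basisVec (v 0)]
  simp only [vecComp_sharp, Matrix.cons_val_zero]
  have h1 : ∀ a, form2 g p (v 0) (basisVec p a) = ∑ c, vecComp p c (v 0) * gLow g p c a := by
    intro a
    rw [((form2_isBilin g p).left _).eq_sum_basisVec (v 0)]
    simp only [gLow_eq_form2]
  simp only [h1, Finset.sum_mul, Finset.mul_sum]
  have h2 : ∀ b c, ∑ a, gUp g p a b * θ p ![basisVec p b] * (vecComp p c (v 0) * gLow g p c a)
      = if c = b then vecComp p c (v 0) * θ p ![basisVec p b] else 0 := by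
    intro b c
    have := congrArg (· * (vecComp p c (v 0) * θ p ![basisVec p b])) (hg.sum_gLow_gUp p c b)
    simp only [Finset.sum_mul, ite_mul, one_mul, zero_mul] at this
    rw [← this]
    exact Finset.sum_congr rfl fun a _ => by ring
  rw [Finset.sum_comm, Finset.sum_congr rfl fun b _ => Finset.sum_comm]
  simp only [h2]
  simp

theorem TensorSmoothOn.mdifferentiableAt {k : ℕ} {T : CovTensorField k M} {R : Set M}
    (hT : TensorSmoothOn T R) {p : M} (hp : p ∈ R) (i : Fin k → Fin 4) :
    MDifferentiableAt (𝓡 4) 𝓘(ℝ, ℝ) (chartComp T p i) p :=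
  (hT p hp i).mdifferentiableAt (by simp)

theorem partialD_metric_symm (hg : IsLorentzMetric g) (p : M) (a b c : Fin 4) :
    partialD (chartComp g p ![b, c]) p a = partialD (chartComp g p ![c, b]) p a := by
  congr 1
  funext q
  have h : ∀ b c, chartComp g p ![b, c] q = form2 g q (coordField p b q) (coordField p c q) := by
    intro b c
    refine congrArg (g q) ?_
    funext j
    fin_cases j <;> rfl
  rw [h, h, hg.form2_symm]

theorem IsLorentzMetric.sum_gLow_christoffel (hg : IsLorentzMetric g) (p : M) (a b c : Fin 4) :
    ∑ m, gLow g p c m * christoffel g p m a b = (1 / 2) *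
      (partialD (chartComp g p ![b, c]) p a + partialD (chartComp g p ![a, c]) p b
      - partialD (chartComp g p ![a, b]) p c) := by
  simp only [christoffel, Finset.mul_sum]
  rw [Finset.sum_comm]
  have h : ∀ l, ∑ m, gLow g p c m * (1 / 2 * (gUp g p m l * (partialD (chartComp g p ![b, l]) p a
      + partialD (chartComp g p ![a, l]) p b - partialD (chartComp g p ![a, b]) p l)))
      = if c = l then (1 / 2) * (partialD (chartComp g p ![b, l]) p a
        + partialD (chartComp g p ![a, l]) p b - partialD (chartComp g p ![a, b]) p l) else 0 := by
    intro l
    have := congrArg (· * ((1 / 2) * (partialD (chartComp g p ![b, l]) p a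
        + partialD (chartComp g p ![a, l]) p b - partialD (chartComp g p ![a, b]) p l)))
        (hg.sum_gLow_gUp p c l)
    simp only [Finset.sum_mul, ite_mul, one_mul, zero_mul] at this
    rw [← this]
    exact Finset.sum_congr rfl fun a _ => by ring
  simp only [h]
  simp

/-- The Levi-Civita connection is metric. -/
theorem IsLorentzMetric.covDeriv_self (hg : IsLorentzMetric g) (p : M) (a : Fin 4)
    (i : Fin 2 → Fin 4) : covDeriv g g p a i = 0 := by
  have hi : i = ![i 0, i 1] := by funext j; fin_cases j <;> rfl
  generalize i 0 = b, i 1 = c at hi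
  subst hi
  rw [covDeriv, Fin.sum_univ_two]
  have u0 : ∀ m, Function.update ![b, c] 0 m = ![m, c] := by
    intro x; funext i; fin_cases i <;> rfl
  have u1 : ∀ m, Function.update ![b, c] 1 m = ![b, m] := by
    intro x; funext i; fin_cases i <;> rfl
  have h1 : ∑ m, christoffel g p m a (![b, c] 0) * comp g p (Function.update ![b, c] 0 m)
      = ∑ m, gLow g p c m * christoffel g p m a b := by
    refine Finset.sum_congr rfl fun m _ => ?_
    rw [u0, mul_comm, hg.gLow_symm]
    rfl
  have h2 : ∑ m, christoffel g p m a (![b, c] 1) * comp g p (Function.update ![b, c] 1 m)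
      = ∑ m, gLow g p b m * christoffel g p m a c := by
    refine Finset.sum_congr rfl fun m _ => ?_
    rw [u1, mul_comm]
    rfl
  rw [h1, h2, hg.sum_gLow_christoffel, hg.sum_gLow_christoffel, partialD_metric_symm hg p a c b]
  ring

theorem chartVec_coordField (p : M) (b c : Fin 4) (a : Fin 4) :
    MDifferentiableAt (𝓡 4) 𝓘(ℝ, ℝ) (chartVec (coordField p b) p c) p ∧
      partialD (chartVec (coordField p b) p c) p a = 0 := by
  have h : chartVec (coordField p b) p c =ᶠ[nhds p]
      fun _ => (EuclideanSpace.single b (1 : ℝ) : EuclideanSpace ℝ (Fin 4)) c := by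
    filter_upwards [extChartAt_source_mem_nhds (I := 𝓡 4) p] with q hq
    exact congrArg (fun v : EuclideanSpace ℝ (Fin 4) => v c) (chartD_coordField hq b)
  refine ⟨mdifferentiableAt_const.congr_of_eventuallyEq h, ?_⟩
  rw [partialD_congr h, partialD, mvfderiv_const]
  rfl

theorem nablaVec_coordField (g : CovTensorField 2 M) (p : M) (a b : Fin 4) :
    nablaVec g (coordField p b) p a = connMap g p a (basisVec p b) := by
  rw [nablaVec, partialVec, coordField_self]
  simp [(chartVec_coordField p b _ a).2]

/-- The covariant derivative of a one-form obtained by contracting a tensor with vector fields. -/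
theorem covDeriv_contract {k : ℕ} (g : CovTensorField 2 M) (T : CovTensorField (k + 1) M) (p : M)
    (hT : ∀ i, MDifferentiableAt (𝓡 4) 𝓘(ℝ, ℝ) (chartComp T p i) p) (V : Fin k → VecField M)
    (hV : ∀ j c, MDifferentiableAt (𝓡 4) 𝓘(ℝ, ℝ) (chartVec (V j) p c) p)
    (θ : CovTensorField 1 M) (hθ : ∀ q v, θ q v = T q (Fin.cons (v 0) fun j => V j q))
    (a b : Fin 4) :
    covDeriv g θ p a ![b] = nablaTensor g T p a (Fin.cons (basisVec p b) fun j => V j p)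
      + ∑ j, T p (Fin.cons (basisVec p b) (Function.update (fun j => V j p) j
          (nablaVec g (V j) p a))) := by
  -- With the coordinate field in slot zero, the components of `θ` become full evaluations of `T`.
  -- Its chart components are constant near `p`, so its covariant derivative is the Christoffel term
  -- subtracted for `θ`.
  let V' : Fin (k + 1) → VecField M := Fin.cons (coordField p b) V
  have hV' : ∀ q, (fun j => V' j q) = Fin.cons (coordField p b q) (fun j => V j q) := by
    intro q
    funext j
    refine Fin.cases ?_ (fun j => ?_) j <;> rfl
  have h1 := partialD_tensor_apply g T p hT V' (fun j c => by
    refine Fin.cases ?_ (fun j => ?_) j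
    · exact (chartVec_coordField p b c 0).1
    · exact hV j c) a
  rw [Fin.sum_univ_succ, hV' p] at h1
  have h2 : (fun q => T q fun j => V' j q) = chartComp θ p ![b] := by
    funext q
    rw [hV', chartComp, hθ]
    rfl
  rw [h2] at h1
  rw [covDeriv, h1, coordField_self]
  have h3 : Function.update (Fin.cons (basisVec p b) fun j => V j p :
      Fin (k + 1) → TangentSpace (𝓡 4) p) 0 (nablaVec g (V' 0) p a)
      = Fin.cons (∑ m, christoffel g p m a b • basisVec p m) fun j => V j p := by
    rw [Fin.update_cons_zero]
    congr 1
    exact (nablaVec_coordField g p a b).trans (connMap_basisVec g p a b)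
  have h4 : T p (Fin.cons (∑ m, christoffel g p m a b • basisVec p m) fun j => V j p)
      = ∑ m, christoffel g p m a b * T p (Fin.cons (basisVec p m) fun j => V j p) := by
    have := MultilinearMap.map_update_sum (T p).toMultilinearMap Finset.univ 0
      (fun m => christoffel g p m a b • basisVec p m) (Fin.cons 0 fun j => V j p)
    simp only [Fin.update_cons_zero] at this
    refine this.trans (Finset.sum_congr rfl fun m _ => ?_)
    have := (T p).map_update_smul (Fin.cons 0 fun j => V j p) 0 (christoffel g p m a b)
      (basisVec p m)
    simp only [Fin.update_cons_zero] at this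
    exact this
  have h5 : ∑ j : Fin 1, ∑ m, christoffel g p m a (![b] j) * comp θ p (Function.update ![b] j m)
      = ∑ m, christoffel g p m a b * T p (Fin.cons (basisVec p m) fun j => V j p) := by
    rw [Fin.sum_univ_one]
    refine Finset.sum_congr rfl fun m _ => ?_
    rw [comp, hθ]
    rfl
  rw [h3, h4, h5]
  simp only [Fin.cons_update]
  have h6 : ∀ i : Fin k, V' i.succ = V i := fun i => rfl
  simp only [h6]
  ring


theorem sum_cons {k : ℕ} (F : (Fin (k + 1) → Fin 4) → ℝ) :
    ∑ i, F i = ∑ a, ∑ i : Fin k → Fin 4, F (Fin.cons a i) := by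
  rw [← (Fin.consEquiv fun _ => Fin 4).sum_comp, Fintype.sum_prod_type]
  rfl

theorem divergence_apply {k : ℕ} (g : CovTensorField 2 M) (T : CovTensorField (k + 1) M) (p : M)
    (v : Fin k → TangentSpace (𝓡 4) p) :
    divergence g T p v = ∑ a, ∑ c, gUp g p a c * nablaTensor g T p c (Fin.cons (basisVec p a) v) := by
  have h : ∀ a c, nablaTensor g T p c (Fin.cons (basisVec p a) v) = ∑ i : Fin k → Fin 4,
      covDeriv g T p c (Fin.cons a i) * ∏ j, vecComp p (i j) (v j) := by
    intro a c
    rw [nablaTensor, ofComp_apply, sum_cons, Finset.sum_eq_single a]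
    · refine Finset.sum_congr rfl fun i _ => ?_
      rw [Fin.prod_univ_succ, Fin.cons_zero, Fin.cons_zero, vecComp_basisVec, if_pos rfl, one_mul]
      rfl
    · intro a' _ ha'
      refine Finset.sum_eq_zero fun i _ => ?_
      rw [Fin.prod_univ_succ, Fin.cons_zero, Fin.cons_zero, vecComp_basisVec, if_neg ha', zero_mul,
        mul_zero]
    · simp
  simp only [h]
  rw [divergence, ofComp_apply]
  simp only [Finset.sum_mul, Finset.mul_sum]
  rw [Finset.sum_comm]
  refine Finset.sum_congr rfl fun a _ => ?_
  rw [Finset.sum_comm]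
  exact Finset.sum_congr rfl fun c _ => Finset.sum_congr rfl fun i _ => by ring

/-- Lowering the index commutes with `∇` because the connection is metric: in the Leibniz rule for
`g(·, X)` the term with `∇g` drops out. -/
theorem IsLorentzMetric.covDeriv_flat (hg : IsLorentzMetric g) {X : VecField M} {p : M}
    (hX : ∀ c, MDifferentiableAt (𝓡 4) 𝓘(ℝ, ℝ) (chartVec X p c) p) (a b : Fin 4) :
    covDeriv g (flat g X) p a ![b] = form2 g p (basisVec p b) (nablaVec g X p a) := by
  rw [covDeriv_contract g g p (fun i => hg.smooth.mdifferentiableAt (mem_univ p) i) (fun _ => X)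
    (fun _ => hX) (flat g X) (fun q v => ?_)]
  · have h : nablaTensor g g p a = 0 := by
      have h1 : covDeriv g g p a = fun _ => 0 := funext fun i => hg.covDeriv_self p a i
      rw [nablaTensor, h1]
      simp [ofComp]
    rw [h, Fin.sum_univ_one]
    refine (zero_add _).trans (congrArg (g p) ?_)
    funext j
    fin_cases j <;> rfl
  · rw [flat_apply]
    refine congrArg (g q) ?_
    funext j
    fin_cases j <;> rfl

theorem IsLorentzMetric.deformation_eq (hg : IsLorentzMetric g) {X : VecField M} {p : M}
    (hX : ∀ c, MDifferentiableAt (𝓡 4) 𝓘(ℝ, ℝ) (chartVec X p c) p) (a b : Fin 4) :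
    deformation g X p a b = form2 g p (basisVec p b) (nablaVec g X p a)
      + form2 g p (basisVec p a) (nablaVec g X p b) := by
  rw [deformation, hg.covDeriv_flat hX, hg.covDeriv_flat hX]

theorem IsLorentzMetric.sum_gUp_form2 (hg : IsLorentzMetric g) (p : M) (v : TangentSpace (𝓡 4) p)
    (b : Fin 4) : ∑ d, gUp g p b d * form2 g p (basisVec p d) v = vecComp p b v := by
  have h : ∀ d, form2 g p (basisVec p d) v = ∑ c, vecComp p c v * gLow g p d c := fun d => by
    rw [((form2_isBilin g p).right _).eq_sum_basisVec v]
    simp only [gLow_eq_form2]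
  simp only [h, Finset.mul_sum]
  rw [Finset.sum_comm]
  have h2 : ∀ c, ∑ d, gUp g p b d * (vecComp p c v * gLow g p d c)
      = if b = c then vecComp p c v else 0 := by
    intro c
    have := congrArg (vecComp p c v * ·) (hg.sum_gUp_gLow p b c)
    simp only [Finset.mul_sum, mul_ite, mul_one, mul_zero] at this
    rw [← this]
    exact Finset.sum_congr rfl fun a _ => by ring
  simp only [h2]
  simp

/-- For a symmetric trace-free form, contraction with the trace-free part of the deformation tensor
is contraction with the covariant derivative. -/
theorem IsLorentzMetric.sum_deformationHatUp (hg : IsLorentzMetric g) {X : VecField M} {p : M}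
    (hX : ∀ c, MDifferentiableAt (𝓡 4) 𝓘(ℝ, ℝ) (chartVec X p c) p)
    {β : TangentSpace (𝓡 4) p → TangentSpace (𝓡 4) p → ℝ} (hβ : IsBilin β)
    (hs : ∀ v w, β v w = β w v)
    (ht : ∑ a, ∑ b, gUp g p a b * β (basisVec p a) (basisVec p b) = 0) :
    (1 / 2) * ∑ a, ∑ b, β (basisVec p a) (basisVec p b) * deformationHatUp g X p a b
      = ∑ a, ∑ c, gUp g p a c * β (basisVec p a) (nablaVec g X p c) := by
  set t := (1 / 4) * ∑ c, ∑ d, gUp g p c d * deformation g X p c d with ht'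
  have h1 : ∀ a b, deformationHatUp g X p a b = (∑ c, gUp g p a c * vecComp p b (nablaVec g X p c)
      + ∑ c, gUp g p b c * vecComp p a (nablaVec g X p c)) - t * gUp g p a b := by
    intro a b
    have e1 : ∑ c, ∑ d, gUp g p a c * gUp g p b d * form2 g p (basisVec p d) (nablaVec g X p c)
        = ∑ c, gUp g p a c * vecComp p b (nablaVec g X p c) := by
      simp only [mul_assoc, ← Finset.mul_sum, hg.sum_gUp_form2]
    have e2 : ∑ c, ∑ d, gUp g p a c * gUp g p b d * form2 g p (basisVec p c) (nablaVec g X p d)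
        = ∑ c, gUp g p b c * vecComp p a (nablaVec g X p c) := by
      rw [Finset.sum_comm]
      refine Finset.sum_congr rfl fun c _ => ?_
      rw [← hg.sum_gUp_form2, Finset.mul_sum]
      exact Finset.sum_congr rfl fun d _ => by ring
    have e3 : ∑ c, ∑ d, gUp g p a c * gUp g p b d * gLow g p c d = gUp g p a b := by
      have : ∀ c, ∑ d, gUp g p a c * gUp g p b d * gLow g p c d
          = gUp g p a c * if b = c then 1 else 0 := fun c => by
        rw [← hg.sum_gUp_gLow, Finset.mul_sum]
        exact Finset.sum_congr rfl fun d _ => by rw [hg.gLow_symm p c d, mul_assoc]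
      simp only [this]
      simp
    rw [← e1, ← e2, ← e3, Finset.mul_sum, ← Finset.sum_add_distrib, ← Finset.sum_sub_distrib]
    refine Finset.sum_congr rfl fun c _ => ?_
    rw [Finset.mul_sum, ← Finset.sum_add_distrib, ← Finset.sum_sub_distrib]
    refine Finset.sum_congr rfl fun d _ => ?_
    rw [deformationHat, ← ht', hg.deformation_eq hX]
    ring
  have h2 : ∀ a c, β (basisVec p a) (nablaVec g X p c)
      = ∑ b, vecComp p b (nablaVec g X p c) * β (basisVec p a) (basisVec p b) :=
    fun a c => (hβ.right _).eq_sum_basisVec _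
  have h3 : ∑ a, ∑ b, β (basisVec p a) (basisVec p b)
      * ∑ c, gUp g p a c * vecComp p b (nablaVec g X p c)
      = ∑ a, ∑ c, gUp g p a c * β (basisVec p a) (nablaVec g X p c) := by
    refine Finset.sum_congr rfl fun a _ => ?_
    simp only [h2, Finset.mul_sum]
    rw [Finset.sum_comm]
    exact Finset.sum_congr rfl fun b _ => Finset.sum_congr rfl fun c _ => by ring
  -- Symmetry of `β` identifies the two halves of the deformation tensor, which cancels the factor
  -- one half.
  have h4 : ∑ a, ∑ b, β (basisVec p a) (basisVec p b)
      * ∑ c, gUp g p b c * vecComp p a (nablaVec g X p c)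
      = ∑ a, ∑ c, gUp g p a c * β (basisVec p a) (nablaVec g X p c) := by
    rw [← h3, Finset.sum_comm]
    exact Finset.sum_congr rfl fun b _ => Finset.sum_congr rfl fun c _ => by rw [hs]
  -- The trace removed from the deformation tensor is a multiple of `g^{ab}`, which a trace-free `β`
  -- does not see.
  have h5 : ∑ a, ∑ b, β (basisVec p a) (basisVec p b) * (t * gUp g p a b) = 0 := by
    have := congrArg (t * ·) ht
    simp only [Finset.mul_sum, mul_zero] at this
    rw [← this]
    exact Finset.sum_congr rfl fun b _ => Finset.sum_congr rfl fun c _ => by ring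
  simp only [h1, mul_sub, mul_add, Finset.sum_sub_distrib, Finset.sum_add_distrib]
  rw [h3, h4, h5]
  ring

/-- The current `P^a = g^{ab} Q_b(X, Y, Z)`. -/
def current (g : CovTensorField 2 M) (Q : CovTensorField 4 M) (X Y Z : VecField M) : VecField M :=
  sharp g fun p => ofComp p fun i => form4 Q p (basisVec p (i 0)) (X p) (Y p) (Z p)

theorem IsLorentzMetric.flat_current (hg : IsLorentzMetric g) (Q : CovTensorField 4 M)
    (X Y Z : VecField M) (p : M) (v : Fin 1 → TangentSpace (𝓡 4) p) :
    flat g (current g Q X Y Z) p v = form4 Q p (v 0) (X p) (Y p) (Z p) := by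
  rw [current, hg.flat_sharp, ofComp_apply, ((form4_isQuadrilin Q p).s1 _ _ _).eq_sum_basisVec (v 0),
    ← (Equiv.funUnique (Fin 1) (Fin 4)).symm.sum_comp]
  refine Finset.sum_congr rfl fun i _ => ?_
  simp only [Finset.univ_unique, Fin.default_eq_zero, Finset.prod_singleton]
  rw [mul_comm]
  rfl

/-- Each of the three terms is `sum_deformationHatUp` for the form left after two slots are filled.
The total symmetry of the Bel-Robinson tensor then moves the differentiated field back to its own
slot. -/
theorem bulkK_eq (hg : IsLorentzMetric g) {W : CovTensorField 4 M} {R : Set M}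
    (hW : IsWeylFieldOn g W R) {X Y Z : VecField M} {p : M} (hp : p ∈ R)
    (hX : ∀ c, MDifferentiableAt (𝓡 4) 𝓘(ℝ, ℝ) (chartVec X p c) p)
    (hY : ∀ c, MDifferentiableAt (𝓡 4) 𝓘(ℝ, ℝ) (chartVec Y p c) p)
    (hZ : ∀ c, MDifferentiableAt (𝓡 4) 𝓘(ℝ, ℝ) (chartVec Z p c) p) :
    bulkK g W X Y Z p = ∑ a, ∑ c, gUp g p a c *
      (form4 (belRobinson g W) p (basisVec p a) (nablaVec g X p c) (Y p) (Z p)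
        + form4 (belRobinson g W) p (basisVec p a) (X p) (nablaVec g Y p c) (Z p)
        + form4 (belRobinson g W) p (basisVec p a) (X p) (Y p) (nablaVec g Z p c)) := by
  set Q := belRobinson g W with hQ
  have hq := form4_isQuadrilin Q p
  have hs := fun a b c d => hW.belRobinson_symm hg hp a b c d
  have key : ∀ (X Y Z : VecField M),
      (∀ c, MDifferentiableAt (𝓡 4) 𝓘(ℝ, ℝ) (chartVec X p c) p) →
      (1 / 2) * ∑ a, ∑ b, ∑ c, ∑ d, comp Q p ![a, b, c, d] *
        (deformationHatUp g X p a b * vecComp p c (Y p) * vecComp p d (Z p))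
      = ∑ a, ∑ c, gUp g p a c * form4 Q p (basisVec p a) (nablaVec g X p c) (Y p) (Z p) := by
    intro X Y Z hX
    rw [← hg.sum_deformationHatUp hX (β := fun a b => form4 Q p a b (Y p) (Z p))
      ⟨fun _ => hq.s1 _ _ _, fun _ => hq.s2 _ _ _⟩ (fun v w => (hs v w _ _).1)
      (hW.belRobinson_trace hg hp _ _)]
    congr 1
    refine Finset.sum_congr rfl fun a _ => Finset.sum_congr rfl fun b _ => ?_
    rw [(hq.s3 _ _ _).eq_sum_basisVec (Y p), Finset.sum_mul]
    refine Finset.sum_congr rfl fun c _ => ?_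
    rw [(hq.s4 _ _ _).eq_sum_basisVec (Z p), Finset.mul_sum, Finset.sum_mul]
    refine Finset.sum_congr rfl fun d _ => ?_
    rw [comp_four, coe_pointBasis]
    ring
  have h1 : bulkK g W X Y Z p = ∑ a, ∑ c, gUp g p a c *
      form4 Q p (basisVec p a) (nablaVec g X p c) (Y p) (Z p)
      + ∑ a, ∑ c, gUp g p a c * form4 Q p (basisVec p a) (nablaVec g Y p c) (X p) (Z p)
      + ∑ a, ∑ c, gUp g p a c * form4 Q p (basisVec p a) (nablaVec g Z p c) (X p) (Y p) := by
    rw [← key X Y Z hX, ← key Y X Z hY, ← key Z X Y hZ, bulkK]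
    simp only [mul_add, Finset.sum_add_distrib, ← hQ]
  rw [h1]
  simp only [mul_add, Finset.sum_add_distrib]
  congr 1
  · congr 1
    refine Finset.sum_congr rfl fun a _ => Finset.sum_congr rfl fun c _ => ?_
    rw [(hs _ _ _ _).2.1]
  · refine Finset.sum_congr rfl fun a _ => Finset.sum_congr rfl fun c _ => ?_
    rw [(hs _ _ _ _).2.1, (hs _ (X p) _ _).2.2]

theorem covDeriv_flat_current (hg : IsLorentzMetric g) {Q : CovTensorField 4 M}
    {X Y Z : VecField M} {p : M}
    (hQ : ∀ i, MDifferentiableAt (𝓡 4) 𝓘(ℝ, ℝ) (chartComp Q p i) p)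
    (hX : ∀ c, MDifferentiableAt (𝓡 4) 𝓘(ℝ, ℝ) (chartVec X p c) p)
    (hY : ∀ c, MDifferentiableAt (𝓡 4) 𝓘(ℝ, ℝ) (chartVec Y p c) p)
    (hZ : ∀ c, MDifferentiableAt (𝓡 4) 𝓘(ℝ, ℝ) (chartVec Z p c) p) (a b : Fin 4) :
    covDeriv g (flat g (current g Q X Y Z)) p a ![b]
      = nablaTensor g Q p a (Fin.cons (basisVec p b) ![X p, Y p, Z p])
      + (form4 Q p (basisVec p b) (nablaVec g X p a) (Y p) (Z p)
        + form4 Q p (basisVec p b) (X p) (nablaVec g Y p a) (Z p)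
        + form4 Q p (basisVec p b) (X p) (Y p) (nablaVec g Z p a)) := by
  obtain ⟨V, rfl, rfl, rfl⟩ : ∃ V : Fin 3 → VecField M, V 0 = X ∧ V 1 = Y ∧ V 2 = Z :=
    ⟨![X, Y, Z], rfl, rfl, rfl⟩
  have hV : ∀ q, (fun j => V j q) = ![V 0 q, V 1 q, V 2 q] := by
    intro q; funext j; fin_cases j <;> rfl
  have hθ : ∀ q v, flat g (current g Q (V 0) (V 1) (V 2)) q v
      = Q q (Fin.cons (v 0) fun j => V j q) := by
    intro q v
    rw [hg.flat_current, hV]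
    rfl
  have hVd : ∀ j c, MDifferentiableAt (𝓡 4) 𝓘(ℝ, ℝ) (chartVec (V j) p c) p := by
    intro j
    fin_cases j
    exacts [hX, hY, hZ]
  rw [covDeriv_contract g Q p hQ V hVd _ hθ, hV, Fin.sum_univ_three]
  have u0 : ∀ w, Function.update ![V 0 p, V 1 p, V 2 p] 0 w = ![w, V 1 p, V 2 p] := by
    intro w; funext j; fin_cases j <;> rfl
  have u1 : ∀ w, Function.update ![V 0 p, V 1 p, V 2 p] 1 w = ![V 0 p, w, V 2 p] := by
    intro w; funext j; fin_cases j <;> rfl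
  have u2 : ∀ w, Function.update ![V 0 p, V 1 p, V 2 p] 2 w = ![V 0 p, V 1 p, w] := by
    intro w; funext j; fin_cases j <;> rfl
  have f4 : ∀ a b c d, Q p (Fin.cons a ![b, c, d]) = form4 Q p a b c d := fun _ _ _ _ => rfl
  rw [u0, u1, u2, f4, f4, f4]

/-- The divergence identity for the current of a Bel-Robinson tensor. -/
theorem divergence_add_bulkK (hg : IsLorentzMetric g) {W : CovTensorField 4 M} {R : Set M}
    (hW : IsWeylFieldOn g W R) {X Y Z : VecField M} {p : M} (hp : p ∈ R)
    (hQ : ∀ i, MDifferentiableAt (𝓡 4) 𝓘(ℝ, ℝ) (chartComp (belRobinson g W) p i) p)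
    (hX : ∀ c, MDifferentiableAt (𝓡 4) 𝓘(ℝ, ℝ) (chartVec X p c) p)
    (hY : ∀ c, MDifferentiableAt (𝓡 4) 𝓘(ℝ, ℝ) (chartVec Y p c) p)
    (hZ : ∀ c, MDifferentiableAt (𝓡 4) 𝓘(ℝ, ℝ) (chartVec Z p c) p) :
    divergence g (belRobinson g W) p ![X p, Y p, Z p] + bulkK g W X Y Z p
      = (1 / 2) * ∑ a, ∑ b, gUp g p a b
        * deformation g (current g (belRobinson g W) X Y Z) p a b := by
  set Q := belRobinson g W with hQd
  have h1 := covDeriv_flat_current hg hQ hX hY hZ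
  -- The inverse metric is symmetric, so both halves of the deformation tensor have the divergence
  -- of the current as trace.
  have h2 : (1 / 2) * ∑ a, ∑ b, gUp g p a b * deformation g (current g Q X Y Z) p a b
      = ∑ a, ∑ c, gUp g p a c * covDeriv g (flat g (current g Q X Y Z)) p c ![a] := by
    have h3 : ∑ a, ∑ b, gUp g p a b * covDeriv g (flat g (current g Q X Y Z)) p a ![b]
        = ∑ a, ∑ c, gUp g p a c * covDeriv g (flat g (current g Q X Y Z)) p c ![a] := by
      rw [Finset.sum_comm]
      exact Finset.sum_congr rfl fun a _ => Finset.sum_congr rfl fun c _ => by rw [hg.gUp_symm]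
    simp only [deformation, mul_add, Finset.sum_add_distrib]
    rw [h3]
    ring
  rw [h2, divergence_apply, bulkK_eq hg hW hp hX hY hZ, ← Finset.sum_add_distrib]
  refine Finset.sum_congr rfl fun a _ => ?_
  rw [← Finset.sum_add_distrib]
  refine Finset.sum_congr rfl fun c _ => ?_
  rw [h1]
  ring

end CovariantCalculus

/-! ### Smoothness of the Bel-Robinson tensor -/

section BelSmooth

theorem basis_det_eq_leviCivita {V : Type*} [AddCommGroup V] [Module ℝ V]
    (f : Module.Basis (Fin 4) ℝ V) (a b c d : Fin 4) :
    f.det ![f a, f b, f c, f d] = leviCivita a b c d := by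
  rw [Module.Basis.det_apply, ← Matrix.det_transpose, leviCivita]
  congr 1
  funext i j
  rw [Matrix.transpose_apply, Module.Basis.toMatrix_apply]
  fin_cases i <;> simp [Finsupp.single_apply] <;> congr

section ScalarSmooth

variable {E : Type*} [NormedAddCommGroup E] [NormedSpace ℝ E] {H : Type*} [TopologicalSpace H]
  {I : ModelWithCorners ℝ E H} {M : Type*} [TopologicalSpace M] [ChartedSpace H M] {n : ℕ∞ω}
  {p : M} {ι : Type*} [Fintype ι] [DecidableEq ι]

theorem ContMDiffAt.matrixDet {A : M → Matrix ι ι ℝ}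
    (hA : ∀ i j, ContMDiffAt I 𝓘(ℝ, ℝ) n (fun q => A q i j) p) :
    ContMDiffAt I 𝓘(ℝ, ℝ) n (fun q => (A q).det) p := by
  simp only [Matrix.det_apply']
  refine ContMDiffAt.sum fun σ _ => contMDiffAt_const.mul ?_
  exact contMDiffAt_finsetProd fun i _ => hA _ _

theorem ContMDiffAt.matrixInv {A : M → Matrix ι ι ℝ}
    (hA : ∀ i j, ContMDiffAt I 𝓘(ℝ, ℝ) n (fun q => A q i j) p) (hdet : (A p).det ≠ 0) (i j : ι) :
    ContMDiffAt I 𝓘(ℝ, ℝ) n (fun q => (A q)⁻¹ i j) p := by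
  have h : ∀ q, (A q)⁻¹ i j = ((A q).det)⁻¹ * ((A q).updateRow j (Pi.single i 1)).det := by
    intro q
    rw [Matrix.inv_def, Matrix.smul_apply, Matrix.adjugate_apply, Ring.inverse_eq_inv', smul_eq_mul]
  simp only [h]
  refine ContMDiffAt.mul ?_ (ContMDiffAt.matrixDet fun k l => ?_)
  · exact ((contDiffAt_inv ℝ hdet).contMDiffAt).comp p (ContMDiffAt.matrixDet hA)
  · by_cases hk : k = j
    · subst hk
      simp only [Matrix.updateRow_self]
      exact contMDiffAt_const
    · simp only [Matrix.updateRow_ne hk]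
      exact hA k l

theorem ContMDiffAt.sqrt_abs {f : M → ℝ} (hf : ContMDiffAt I 𝓘(ℝ, ℝ) ∞ f p) (h0 : f p ≠ 0) :
    ContMDiffAt I 𝓘(ℝ, ℝ) ∞ (fun q => Real.sqrt |f q|) p := by
  have h : ContDiffAt ℝ ∞ (fun x : ℝ => Real.sqrt |x|) (f p) :=
    (Real.contDiffAt_sqrt (abs_ne_zero.2 h0)).comp _ (contDiffAt_abs h0)
  exact h.contMDiffAt.comp p hf

end ScalarSmooth

variable {M : Type*} [TopologicalSpace M] [ChartedSpace (EuclideanSpace ℝ (Fin 4)) M]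
  [IsManifold (𝓡 4) ∞ M] {g : CovTensorField 2 M}

/-- The coordinate basis at `q` of the chart at `p`. -/
theorem exists_chartBasis {p q : M} (hq : q ∈ (extChartAt (𝓡 4) p).source) :
    ∃ f : Module.Basis (Fin 4) ℝ (TangentSpace (𝓡 4) q), ∀ i, f i = coordField p i q := by
  obtain ⟨L, hL⟩ := chartD_isInvertible hq
  refine ⟨((EuclideanSpace.basisFun (Fin 4) ℝ).toBasis).map L.symm.toLinearEquiv, fun i => ?_⟩
  rw [Module.Basis.map_apply, OrthonormalBasis.coe_toBasis, EuclideanSpace.basisFun_apply]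
  have h : coordField p i q = (L : TangentSpace (𝓡 4) q →L[ℝ] EuclideanSpace ℝ (Fin 4)).inverse
      (EuclideanSpace.single i (1 : ℝ)) := by
    rw [hL]
    rfl
  rw [h, ContinuousLinearMap.inverse_equiv]
  rfl

/-- The definition uses the preferred chart of each point separately, so smoothness cannot be read
off. By `frameBel_basis_change` the tensor may be computed in the coordinate frame of the chart at
`p`; there it is built from smooth components, the inverse of a matrix with nonzero determinant, and
`√|det|`. -/
theorem belRobinson_smoothOn (hg : IsLorentzMetric g) {W : CovTensorField 4 M} {R : Set M}
    (hW : TensorSmoothOn W R) : TensorSmoothOn (belRobinson g W) R := by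
  intro p hp i
  let A : M → Matrix (Fin 4) (Fin 4) ℝ := fun q => Matrix.of fun i j => chartComp g p ![i, j] q
  have hA : ∀ i j, ContMDiffAt (𝓡 4) 𝓘(ℝ, ℝ) ∞ (fun q => A q i j) p := fun i j =>
    hg.smooth p (mem_univ p) _
  have hdet : (A p).det ≠ 0 := by
    have : A p = gLow g p := by
      ext i j
      exact chartComp_self g p _
    rw [this]
    exact (hg.isUnit_det p).ne_zero
  let D : Fin 4 → Fin 4 → Fin 4 → Fin 4 → M → ℝ := fun a b m n q =>
    (1 / 2) * ∑ c, ∑ c', (A q)⁻¹ c c' * ∑ d, ∑ d', (A q)⁻¹ d d' *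
      (chartComp W p ![a, b, c', d'] q * (Real.sqrt |(A q).det| * leviCivita c d m n))
  have hD : ∀ a b m n, ContMDiffAt (𝓡 4) 𝓘(ℝ, ℝ) ∞ (D a b m n) p := fun a b m n =>
    contMDiffAt_const.mul (ContMDiffAt.sum fun c _ => ContMDiffAt.sum fun c' _ =>
      (ContMDiffAt.matrixInv hA hdet c c').mul (ContMDiffAt.sum fun d _ => ContMDiffAt.sum fun d' _ =>
        (ContMDiffAt.matrixInv hA hdet d d').mul ((hW p hp _).mul
          ((ContMDiffAt.matrixDet hA).sqrt_abs hdet |>.mul contMDiffAt_const))))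
  have h1 : ContMDiffAt (𝓡 4) 𝓘(ℝ, ℝ) ∞ (fun q => ∑ r, ∑ r', (A q)⁻¹ r r' * ∑ s, ∑ s',
      (A q)⁻¹ s s' * (chartComp W p ![i 0, r, i 2, s] q * chartComp W p ![i 1, r', i 3, s'] q
        + D (i 0) r (i 2) s q * D (i 1) r' (i 3) s' q)) p :=
    ContMDiffAt.sum fun c _ => ContMDiffAt.sum fun c' _ =>
      (ContMDiffAt.matrixInv hA hdet c c').mul (ContMDiffAt.sum fun d _ => ContMDiffAt.sum fun d' _ =>
        (ContMDiffAt.matrixInv hA hdet d d').mul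
          (((hW p hp _).mul (hW p hp _)).add ((hD _ _ _ _).mul (hD _ _ _ _))))
  refine h1.congr_of_eventuallyEq ?_
  filter_upwards [extChartAt_source_mem_nhds (I := 𝓡 4) p] with q hq
  obtain ⟨f, hf⟩ := exists_chartBasis hq
  have h4 : ∀ (T : CovTensorField 4 M) (a b c d : Fin 4),
      form4 T q (f a) (f b) (f c) (f d) = chartComp T p ![a, b, c, d] q := by
    intro T a b c d
    rw [hf, hf, hf, hf]
    refine congrArg (T q) ?_
    funext j
    fin_cases j <;> rfl
  have h2 : gramMat f (form2 g q) = A q := by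
    ext a b
    rw [gramMat, Matrix.of_apply, hf, hf]
    refine congrArg (g q) ?_
    funext j
    fin_cases j <;> rfl
  have h3 : i = ![i 0, i 1, i 2, i 3] := by
    funext j
    fin_cases j <;> rfl
  rw [h3, ← h4, form4_belRobinson, ← frameBel_basis_change (form2_isBilin g q)
    (form4_isQuadrilin W q) (pointBasis q) f]
  simp only [frameBel, frameDual, mtrace, frameVol, h2, h4, basis_det_eq_leviCivita]
  rfl

end BelSmooth

/-! ### The deformation tensor as a Lie derivative in a chart -/

section ChartLie

/-- The bilinear form `(v, w) ↦ α v * β w`. -/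
def formProd {E : Type*} [NormedAddCommGroup E] [NormedSpace ℝ E] (α β : E →L[ℝ] ℝ) :
    E →L[ℝ] E →L[ℝ] ℝ := α.smulRight β

theorem formProd_apply {E : Type*} [NormedAddCommGroup E] [NormedSpace ℝ E] (α β : E →L[ℝ] ℝ)
    (v w : E) : formProd α β v w = α v * β w := by
  simp [formProd]

theorem contDiffAt_smul_vector {E F : Type*} [NormedAddCommGroup E] [NormedSpace ℝ E]
    [NormedAddCommGroup F] [NormedSpace ℝ F] {n : ℕ∞ω} {f : E → ℝ} {B : E → F} {y : E}
    (hf : ContDiffAt ℝ n f y) (hB : ContDiffAt ℝ n B y) :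
    ContDiffAt ℝ n (fun z => f z • B z) y := hf.smul hB

theorem differentiableAt_smul_const_vector {E F : Type*} [NormedAddCommGroup E] [NormedSpace ℝ E]
    [NormedAddCommGroup F] [NormedSpace ℝ F] {f : E → ℝ} {y : E}
    (hf : DifferentiableAt ℝ f y) (B : F) :
    DifferentiableAt ℝ (fun z => f z • B) y := hf.smul_const B

theorem contDiffAt_sum_smul_formProd {E : Type*} [NormedAddCommGroup E] [NormedSpace ℝ E]
    {ι : Type*} [Fintype ι] {n : ℕ∞ω} {f : ι → ι → E → ℝ} {α β : ι → E → E →L[ℝ] ℝ} {y : E}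
    (hf : ∀ i j, ContDiffAt ℝ n (f i j) y) (hα : ∀ i, ContDiffAt ℝ n (α i) y)
    (hβ : ∀ i, ContDiffAt ℝ n (β i) y) :
    ContDiffAt ℝ n (fun z => ∑ i, ∑ j, f i j z • formProd (α i z) (β j z)) y :=
  ContDiffAt.sum fun i _ => ContDiffAt.sum fun j _ =>
    contDiffAt_smul_vector (hf i j) ((hα i).smulRight (hβ j))

theorem differentiableAt_sum_smul_formProd {E : Type*} [NormedAddCommGroup E] [NormedSpace ℝ E]
    {ι : Type*} [Fintype ι] {f : ι → ι → E → ℝ} (α β : ι → E →L[ℝ] ℝ) {y : E}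
    (hf : ∀ i j, DifferentiableAt ℝ (f i j) y) :
    DifferentiableAt ℝ (fun z => ∑ i, ∑ j, f i j z • formProd (α i) (β j)) y :=
  DifferentiableAt.fun_sum fun i _ => DifferentiableAt.fun_sum fun j _ =>
    differentiableAt_smul_const_vector (hf i j) (formProd (α i) (β j))

variable {M : Type*} [TopologicalSpace M] [ChartedSpace (EuclideanSpace ℝ (Fin 4)) M]
  [IsManifold (𝓡 4) ∞ M] {g : CovTensorField 2 M}

/-- The metric in the chart at `p`. -/
def chartMetric (g : CovTensorField 2 M) (p : M) (z : EuclideanSpace ℝ (Fin 4)) :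
    EuclideanSpace ℝ (Fin 4) →L[ℝ] EuclideanSpace ℝ (Fin 4) →L[ℝ] ℝ :=
  ∑ i, ∑ j, chartComp g p ![i, j] ((extChartAt (𝓡 4) p).symm z) •
    formProd (EuclideanSpace.proj i) (EuclideanSpace.proj j)

/-- A vector field in the chart at `p`. -/
def chartField (X : VecField M) (p : M) (z : EuclideanSpace ℝ (Fin 4)) :
    EuclideanSpace ℝ (Fin 4) :=
  chartD p ((extChartAt (𝓡 4) p).symm z) (X ((extChartAt (𝓡 4) p).symm z))

theorem chartMetric_apply (g : CovTensorField 2 M) (p : M) (z v w : EuclideanSpace ℝ (Fin 4)) :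
    chartMetric g p z v w
      = ∑ i, ∑ j, chartComp g p ![i, j] ((extChartAt (𝓡 4) p).symm z) * (v i * w j) := by
  simp [chartMetric, formProd_apply]

theorem chartMetric_chartD (g : CovTensorField 2 M) {p q : M}
    (hq : q ∈ (extChartAt (𝓡 4) p).source) (v w : TangentSpace (𝓡 4) q) :
    chartMetric g p (extChartAt (𝓡 4) p q) (chartD p q v) (chartD p q w) = form2 g q v w := by
  have h0 : IsBilin (form2 g q) := form2_isBilin g q
  rw [chartMetric_apply, (extChartAt (𝓡 4) p).left_inv hq]
  have h1 : form2 g q v w = ∑ i, chartD p q v i * form2 g q (coordField p i q) w := by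
    conv_lhs => rw [eq_sum_coordField hq v]
    exact (h0.left w).real_sum_smul _ _ _
  rw [h1]
  refine Finset.sum_congr rfl fun i _ => ?_
  have h2 : form2 g q (coordField p i q) w
      = ∑ j, chartD p q w j * form2 g q (coordField p i q) (coordField p j q) := by
    conv_lhs => rw [eq_sum_coordField hq w]
    exact (h0.right _).real_sum_smul _ _ _
  rw [h2, Finset.mul_sum]
  refine Finset.sum_congr rfl fun j _ => ?_
  have h3 : chartComp g p ![i, j] q = form2 g q (coordField p i q) (coordField p j q) := by
    refine congrArg (g q) ?_
    funext j
    fin_cases j <;> rfl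
  rw [h3]
  ring

theorem IsLorentzMetric.mdifferentiableAt (hg : IsLorentzMetric g) (p : M) (i : Fin 2 → Fin 4) :
    MDifferentiableAt (𝓡 4) 𝓘(ℝ, ℝ) (chartComp g p i) p :=
  hg.smooth.mdifferentiableAt (mem_univ p) i

theorem IsLorentzMetric.differentiableAt_chartMetric (hg : IsLorentzMetric g) (p : M) :
    DifferentiableAt ℝ (chartMetric g p) (extChartAt (𝓡 4) p p) := by
  exact differentiableAt_sum_smul_formProd _ _ fun i j => (hg.mdifferentiableAt p ![i, j]).chart

theorem differentiableAt_chartField {X : VecField M} {p : M}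
    (hX : ∀ c, MDifferentiableAt (𝓡 4) 𝓘(ℝ, ℝ) (chartVec X p c) p) :
    DifferentiableAt ℝ (chartField X p) (extChartAt (𝓡 4) p p) :=
  differentiableAt_euclidean.2 fun c => (hX c).chart

theorem fderiv_chartMetric (hg : IsLorentzMetric g) (p : M) (c a b : Fin 4) :
    fderiv ℝ (chartMetric g p) (extChartAt (𝓡 4) p p) (EuclideanSpace.single c 1)
      (EuclideanSpace.single a 1) (EuclideanSpace.single b 1)
      = partialD (chartComp g p ![a, b]) p c := by
  have h1 : HasFDerivAt (fun z => chartMetric g p z (EuclideanSpace.single a 1)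
      (EuclideanSpace.single b 1)) _ (extChartAt (𝓡 4) p p) :=
    ((hg.differentiableAt_chartMetric p).hasFDerivAt.clm_apply (hasFDerivAt_const _ _)).clm_apply
      (hasFDerivAt_const _ _)
  have h2 : (fun z => chartMetric g p z (EuclideanSpace.single a 1) (EuclideanSpace.single b 1))
      = fun z => chartComp g p ![a, b] ((extChartAt (𝓡 4) p).symm z) := by
    funext z
    rw [chartMetric_apply, Finset.sum_eq_single a, Finset.sum_eq_single b]
    · simp
    · intro j _ hj; simp [hj]
    · simp
    · intro i _ hi; simp [hi]
    · simp
  rw [h2] at h1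
  rw [partialD_eq_fderiv (hg.mdifferentiableAt p _), h1.fderiv]
  simp

theorem fderiv_chartField {X : VecField M} {p : M}
    (hX : ∀ c, MDifferentiableAt (𝓡 4) 𝓘(ℝ, ℝ) (chartVec X p c) p) (a : Fin 4) :
    fderiv ℝ (chartField X p) (extChartAt (𝓡 4) p p) (EuclideanSpace.single a 1)
      = partialVec X p a := by
  have h2 : ∀ c, (fderiv ℝ (chartField X p) (extChartAt (𝓡 4) p p) (EuclideanSpace.single a 1)) c
      = partialD (chartVec X p c) p a := by
    intro c
    rw [partialD_eq_fderiv (hX c)]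
    have h1 : HasFDerivAt (fun z => chartField X p z c) _ (extChartAt (𝓡 4) p p) :=
      (EuclideanSpace.proj c : EuclideanSpace ℝ (Fin 4) →L[ℝ] ℝ).hasFDerivAt.comp _
        (differentiableAt_chartField hX).hasFDerivAt
    exact (congrArg (fun L => L (EuclideanSpace.single a (1 : ℝ))) h1.fderiv).symm
  refine PiLp.ext fun c => (h2 c).trans ?_
  exact (vecComp_sum_smul p (fun c => partialD (chartVec X p c) p a) c).symm

theorem chartField_self (X : VecField M) (p : M) :
    chartField X p (extChartAt (𝓡 4) p p) = X p := by
  unfold chartField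
  rw [extChartAt_symm_self]
  exact chartD_self p (X p)

/-- The deformation tensor as a bilinear form. -/
def deformationForm (g : CovTensorField 2 M) (X : VecField M) (p : M)
    (v w : TangentSpace (𝓡 4) p) : ℝ :=
  ∑ a, ∑ b, vecComp p a v * (vecComp p b w * deformation g X p a b)

theorem lieForm_isBilin {E : Type*} [NormedAddCommGroup E] [NormedSpace ℝ E]
    (B : E → E →L[ℝ] E →L[ℝ] ℝ) (X : E → E) (y : E) : IsBilin (lieForm B X y) := by
  refine ⟨fun w => ⟨fun v v' => ?_, fun c v => ?_⟩, fun w => ⟨fun v v' => ?_, fun c v => ?_⟩⟩ <;>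
    simp only [lieForm, map_add, map_smul, add_apply, smul_apply, smul_eq_mul] <;> ring

/-- The two expressions for `𝓛_X g` agree: partial derivatives of `X` match term by term, and the
lowered Christoffel symbols of `∇_a X_b + ∇_b X_a` account for the derivative of `g` along `X`. -/
theorem lieForm_chart (hg : IsLorentzMetric g) {X : VecField M} {p : M}
    (hX : ∀ c, MDifferentiableAt (𝓡 4) 𝓘(ℝ, ℝ) (chartVec X p c) p)
    (v w : EuclideanSpace ℝ (Fin 4)) :
    lieForm (chartMetric g p) (chartField X p) (extChartAt (𝓡 4) p p) v w
      = deformationForm g X p v w := by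
  set z := extChartAt (𝓡 4) p p with hz
  have hm : ∀ v w, chartMetric g p z v w = form2 g p v w := by
    intro v w
    exact (congrArg₂ (fun a b => chartMetric g p z a b) (chartD_self p v)
      (chartD_self p w)).symm.trans
      (chartMetric_chartD g (mem_extChartAt_source (I := 𝓡 4) p) v w)
  have key : ∀ a b, lieForm (chartMetric g p) (chartField X p) z (EuclideanSpace.single a 1)
      (EuclideanSpace.single b 1) = deformation g X p a b := by
    intro a b
    have hq := form2_isBilin g p
    have e1 : fderiv ℝ (chartMetric g p) z (chartField X p z) (EuclideanSpace.single a 1)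
        (EuclideanSpace.single b 1) = ∑ c, vecComp p c (X p) * partialD (chartComp g p ![a, b]) p c := by
      have hl : IsLinearMap ℝ fun v => fderiv ℝ (chartMetric g p) z v (EuclideanSpace.single a 1)
          (EuclideanSpace.single b 1) := by
        refine ⟨fun v v' => ?_, fun c v => ?_⟩ <;> simp
      have h3 := hl.eq_sum_basis (EuclideanSpace.basisFun (Fin 4) ℝ).toBasis (chartField X p z)
      rw [chartField_self] at h3
      rw [chartField_self, h3]
      refine Finset.sum_congr rfl fun c _ => ?_
      rw [← fderiv_chartMetric hg]
      simp only [OrthonormalBasis.coe_toBasis, EuclideanSpace.basisFun_apply]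
      rfl
    have e2 : ∀ a b, form2 g p (basisVec p b) (connMap g p a (X p))
        = ∑ c, vecComp p c (X p) * ((1 / 2) * (partialD (chartComp g p ![c, b]) p a
          + partialD (chartComp g p ![a, b]) p c - partialD (chartComp g p ![a, c]) p b)) := by
      intro a b
      have hl : IsLinearMap ℝ fun v => form2 g p (basisVec p b) (connMap g p a v) := by
        refine ⟨fun v v' => ?_, fun c v => ?_⟩
        · rw [map_add, (hq.right _).map_add]
        · rw [map_smul, (hq.right _).map_smul]
      rw [hl.eq_sum_basisVec (X p)]
      refine Finset.sum_congr rfl fun c _ => congrArg _ ?_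
      rw [connMap_basisVec, (hq.right _).real_sum_smul, ← hg.sum_gLow_christoffel]
      refine Finset.sum_congr rfl fun m _ => ?_
      rw [gLow_eq_form2, mul_comm]
    have e3 : ∀ a b, form2 g p (basisVec p b) (nablaVec g X p a)
        = form2 g p (basisVec p b) (partialVec X p a)
          + form2 g p (basisVec p b) (connMap g p a (X p)) := fun a b => (hq.right _).map_add _ _
    have e4 : form2 g p (partialVec X p a) (basisVec p b)
        = form2 g p (basisVec p b) (partialVec X p a) := hg.form2_symm _ _ _
    rw [hg.deformation_eq hX, e3, e3, e2, e2]
    rw [lieForm, e1, hm, hm, fderiv_chartField hX, fderiv_chartField hX]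
    have e5 : form2 g p (partialVec X p a) (EuclideanSpace.single b 1 : EuclideanSpace ℝ (Fin 4))
        = form2 g p (basisVec p b) (partialVec X p a) := e4
    have e6 : form2 g p (EuclideanSpace.single a 1 : EuclideanSpace ℝ (Fin 4)) (partialVec X p b)
        = form2 g p (basisVec p a) (partialVec X p b) := rfl
    rw [e5, e6]
    -- In the sum of the two lowered Christoffel terms all derivatives cancel except `X^c ∂_c
    -- g_{ab}`, which occurs twice with weight one half.
    have e7 : ∑ c, vecComp p c (X p) * partialD (chartComp g p ![a, b]) p c
        = ∑ c, vecComp p c (X p) * ((1 / 2) * (partialD (chartComp g p ![c, b]) p a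
          + partialD (chartComp g p ![a, b]) p c - partialD (chartComp g p ![a, c]) p b))
        + ∑ c, vecComp p c (X p) * ((1 / 2) * (partialD (chartComp g p ![c, a]) p b
          + partialD (chartComp g p ![b, a]) p c - partialD (chartComp g p ![b, c]) p a)) := by
      rw [← Finset.sum_add_distrib]
      refine Finset.sum_congr rfl fun c _ => ?_
      rw [partialD_metric_symm hg p c b a, partialD_metric_symm hg p a c b,
        partialD_metric_symm hg p b a c]
      ring
    rw [e7]
    ring
  have hb := lieForm_isBilin (chartMetric g p) (chartField X p) z
  rw [(hb.left w).eq_sum_basis (EuclideanSpace.basisFun (Fin 4) ℝ).toBasis v]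
  unfold deformationForm
  refine Finset.sum_congr rfl fun a _ => ?_
  rw [(hb.right _).eq_sum_basis (EuclideanSpace.basisFun (Fin 4) ℝ).toBasis w, Finset.mul_sum]
  refine Finset.sum_congr rfl fun b _ => ?_
  rw [← key]
  simp only [OrthonormalBasis.coe_toBasis, EuclideanSpace.basisFun_apply]
  rfl

end ChartLie

/-! ### Pull-back of the metric to a vector space -/

section PullBack

variable {M : Type*} [TopologicalSpace M] [ChartedSpace (EuclideanSpace ℝ (Fin 4)) M]
  [IsManifold (𝓡 4) ∞ M] {g : CovTensorField 2 M}
  {E : Type*} [NormedAddCommGroup E] [NormedSpace ℝ E]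

theorem two_le_infty : (2 : ℕ∞ω) ≤ ∞ := by
  exact WithTop.coe_le_coe.2 (le_top : (2 : ℕ∞) ≤ ⊤)

/-- The components of the derivative of `ψ : E → M` as linear forms on `E`. -/
def mfderivComp (ψ : E → M) (y : E) (i : Fin 4) : E →L[ℝ] ℝ :=
  (vecComp (ψ y) i).comp (mfderiv 𝓘(ℝ, E) (𝓡 4) ψ y)

/-- The symmetric form `ψ^* g + dρ ⊗ dρ` on `E`. -/
def pullForm (g : CovTensorField 2 M) (ψ : E → M) (ρ : E → ℝ) (y : E) : E →L[ℝ] E →L[ℝ] ℝ :=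
  ∑ i, ∑ j, gLow g (ψ y) i j • formProd (mfderivComp ψ y i) (mfderivComp ψ y j)
    + formProd (fderiv ℝ ρ y) (fderiv ℝ ρ y)

theorem pullForm_apply (g : CovTensorField 2 M) (ψ : E → M) (ρ : E → ℝ) (y v w : E) :
    pullForm g ψ ρ y v w = form2 g (ψ y) (mfderiv 𝓘(ℝ, E) (𝓡 4) ψ y v)
      (mfderiv 𝓘(ℝ, E) (𝓡 4) ψ y w) + fderiv ℝ ρ y v * fderiv ℝ ρ y w := by
  have h := form2_isBilin g (ψ y)
  have h1 : form2 g (ψ y) (mfderiv 𝓘(ℝ, E) (𝓡 4) ψ y v) (mfderiv 𝓘(ℝ, E) (𝓡 4) ψ y w)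
      = ∑ i, ∑ j, gLow g (ψ y) i j * (mfderivComp ψ y i v * mfderivComp ψ y j w) := by
    rw [(h.left _).eq_sum_basisVec (mfderiv 𝓘(ℝ, E) (𝓡 4) ψ y v)]
    refine Finset.sum_congr rfl fun i _ => ?_
    rw [(h.right _).eq_sum_basisVec (mfderiv 𝓘(ℝ, E) (𝓡 4) ψ y w), Finset.mul_sum]
    refine Finset.sum_congr rfl fun j _ => ?_
    rw [gLow_eq_form2]
    have e : ∀ (i : Fin 4) (v : E), mfderivComp ψ y i v
        = vecComp (ψ y) i (mfderiv 𝓘(ℝ, E) (𝓡 4) ψ y v) := fun _ _ => rfl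
    rw [e, e]
    ring
  rw [h1]
  simp [pullForm, formProd_apply]

theorem chartD_mfderiv {ψ : E → M} {y : E} (hy : MDifferentiableAt 𝓘(ℝ, E) (𝓡 4) ψ y) {p : M}
    (hys : ψ y ∈ (extChartAt (𝓡 4) p).source) (v : E) :
    fderiv ℝ (fun y => extChartAt (𝓡 4) p (ψ y)) y v
      = chartD p (ψ y) (mfderiv 𝓘(ℝ, E) (𝓡 4) ψ y v) := by
  have := isManifold_one (M := M)
  have h3 : MDifferentiableAt (𝓡 4) 𝓘(ℝ, EuclideanSpace ℝ (Fin 4)) (extChartAt (𝓡 4) p) (ψ y) :=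
    mdifferentiableAt_extChartAt (by simpa using hys)
  have h4 := mfderiv_comp_apply y h3 hy v
  rw [← mfderiv_eq_fderiv]
  exact h4

theorem contDiffAt_extChartAt_comp {ψ : E → M} {y : E} {p : M}
    (hψ : ContMDiffAt 𝓘(ℝ, E) (𝓡 4) ∞ ψ y) (hy : ψ y ∈ (extChartAt (𝓡 4) p).source) :
    ContDiffAt ℝ ∞ (fun y => extChartAt (𝓡 4) p (ψ y)) y := by
  have h : ContMDiffAt (𝓡 4) 𝓘(ℝ, EuclideanSpace ℝ (Fin 4)) ∞ (extChartAt (𝓡 4) p) (ψ y) :=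
    contMDiffAt_extChartAt' (by simpa using hy)
  exact ((h.comp y hψ).contDiffAt :)

/-- The part `ψ^* g` of the form `pullForm`, in a chart. -/
def chartPull (g : CovTensorField 2 M) (ψ : E → M) (p : M) (y : E) : E →L[ℝ] E →L[ℝ] ℝ :=
  ∑ i, ∑ j, chartComp g p ![i, j] (ψ y) •
    formProd ((EuclideanSpace.proj i : EuclideanSpace ℝ (Fin 4) →L[ℝ] ℝ).comp
        (fderiv ℝ (fun y => extChartAt (𝓡 4) p (ψ y)) y))
      ((EuclideanSpace.proj j : EuclideanSpace ℝ (Fin 4) →L[ℝ] ℝ).comp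
        (fderiv ℝ (fun y => extChartAt (𝓡 4) p (ψ y)) y))

theorem chartPull_apply {ψ : E → M} {y : E} {p : M} (hys : ψ y ∈ (extChartAt (𝓡 4) p).source)
    (v w : E) :
    chartPull g ψ p y v w = chartMetric g p (extChartAt (𝓡 4) p (ψ y))
      (fderiv ℝ (fun y => extChartAt (𝓡 4) p (ψ y)) y v)
      (fderiv ℝ (fun y => extChartAt (𝓡 4) p (ψ y)) y w) := by
  rw [chartMetric_apply, (extChartAt (𝓡 4) p).left_inv hys]
  simp [chartPull, formProd_apply]

/-- The definition of `pullForm` refers to the preferred chart at `ψ y`, which changes with `y`. In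
one fixed chart the same form is an expression in smooth functions. -/
theorem pullForm_eq_chartPull {ψ : E → M} {y : E} (hy : MDifferentiableAt 𝓘(ℝ, E) (𝓡 4) ψ y)
    {p : M} (hys : ψ y ∈ (extChartAt (𝓡 4) p).source) (ρ : E → ℝ) :
    pullForm g ψ ρ y = chartPull g ψ p y + formProd (fderiv ℝ ρ y) (fderiv ℝ ρ y) := by
  ext v w
  rw [pullForm_apply, ← chartMetric_chartD g hys]
  show _ = chartPull g ψ p y v w + formProd (fderiv ℝ ρ y) (fderiv ℝ ρ y) v w
  rw [formProd_apply, chartPull_apply hys, chartD_mfderiv hy hys, chartD_mfderiv hy hys]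

theorem contDiffAt_chartPull (hg : IsLorentzMetric g) {ψ : E → M} {y : E}
    (hψ : ContMDiffAt 𝓘(ℝ, E) (𝓡 4) ∞ ψ y) : ContDiffAt ℝ ∞ (chartPull g ψ (ψ y)) y := by
  have hys : ψ y ∈ (extChartAt (𝓡 4) (ψ y)).source := mem_extChartAt_source _
  have h1 : ContDiffAt ℝ ∞ (fderiv ℝ (fun z => extChartAt (𝓡 4) (ψ y) (ψ z))) y :=
    (contDiffAt_extChartAt_comp hψ hys).fderiv_right (m := ∞) (by simp)
  exact contDiffAt_sum_smul_formProd
    (fun i j => ((hg.smooth _ (mem_univ _) ![i, j]).comp y hψ).contDiffAt)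
    (fun i => contDiffAt_const.clm_comp h1) (fun i => contDiffAt_const.clm_comp h1)

theorem contDiffAt_formProd_fderiv {ρ : E → ℝ} {y : E} (hρ : ContDiffAt ℝ ∞ ρ y) :
    ContDiffAt ℝ ∞ (fun z => formProd (fderiv ℝ ρ z) (fderiv ℝ ρ z)) y :=
  (hρ.fderiv_right (m := ∞) (by simp)).smulRight (hρ.fderiv_right (m := ∞) (by simp))

theorem eventually_pullForm_eq {ψ : E → M} {y : E}
    (hψ : ∀ᶠ z in nhds y, ContMDiffAt 𝓘(ℝ, E) (𝓡 4) ∞ ψ z) (ρ : E → ℝ) :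
    pullForm g ψ ρ =ᶠ[nhds y] fun z =>
      chartPull g ψ (ψ y) z + formProd (fderiv ℝ ρ z) (fderiv ℝ ρ z) := by
  filter_upwards [hψ, eventually_mem_extChartAt_source hψ.self_of_nhds.continuousAt] with z hz hzs
  exact pullForm_eq_chartPull (hz.mdifferentiableAt (by simp)) hzs ρ

theorem contDiffAt_pullForm (hg : IsLorentzMetric g) {ψ : E → M} {y : E}
    (hψ : ∀ᶠ z in nhds y, ContMDiffAt 𝓘(ℝ, E) (𝓡 4) ∞ ψ z) {ρ : E → ℝ}
    (hρ : ContDiffAt ℝ ∞ ρ y) : ContDiffAt ℝ ∞ (pullForm g ψ ρ) y :=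
  ((contDiffAt_chartPull hg hψ.self_of_nhds).add (contDiffAt_formProd_fderiv hρ)).congr_of_eventuallyEq
    (eventually_pullForm_eq hψ ρ)

theorem lieForm_congr {B B' : E → E →L[ℝ] E →L[ℝ] ℝ} {y : E} (h : B =ᶠ[nhds y] B') (X : E → E)
    (v w : E) : lieForm B X y v w = lieForm B' X y v w := by
  rw [lieForm, lieForm, h.fderiv_eq, h.self_of_nhds]

theorem fderiv_add_vector {F : Type*} [NormedAddCommGroup F] [NormedSpace ℝ F] {B B' : E → F}
    {y : E} (hB : DifferentiableAt ℝ B y) (hB' : DifferentiableAt ℝ B' y)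
    (x : E) : fderiv ℝ (fun z => B z + B' z) y x = fderiv ℝ B y x + fderiv ℝ B' y x := by
  rw [fderiv_fun_add hB hB', add_apply]

theorem lieForm_add {B B' : E → E →L[ℝ] E →L[ℝ] ℝ} {y : E} (hB : DifferentiableAt ℝ B y)
    (hB' : DifferentiableAt ℝ B' y) (X : E → E) (v w : E) :
    lieForm (fun z => B z + B' z) X y v w = lieForm B X y v w + lieForm B' X y v w := by
  have e : fderiv ℝ (fun z => B z + B' z) y (X y) v w
      = fderiv ℝ B y (X y) v w + fderiv ℝ B' y (X y) v w :=
    congrArg (fun L : E →L[ℝ] E →L[ℝ] ℝ => L v w) (fderiv_add_vector hB hB' (X y))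
  rw [lieForm, lieForm, lieForm, e]
  simp only [add_apply]
  ring

/-- The Lie derivative of `ψ^* g + dρ ⊗ dρ` along a lift of `X` on which `dρ` vanishes is the
pull-back of the deformation tensor of `X`. -/
theorem lieForm_pullForm (hg : IsLorentzMetric g) {ψ : E → M} {y : E}
    (hψ : ∀ᶠ z in nhds y, ContMDiffAt 𝓘(ℝ, E) (𝓡 4) ∞ ψ z) {ρ : E → ℝ}
    (hρ : ContDiffAt ℝ ∞ ρ y) {X : VecField M}
    (hX : ∀ c, MDifferentiableAt (𝓡 4) 𝓘(ℝ, ℝ) (chartVec X (ψ y) c) (ψ y))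
    {X' : E → E} (hX' : DifferentiableAt ℝ X' y)
    (hrel : ∀ᶠ z in nhds y, mfderiv 𝓘(ℝ, E) (𝓡 4) ψ z (X' z) = X (ψ z))
    (hrelρ : ∀ᶠ z in nhds y, fderiv ℝ ρ z (X' z) = 0) (v w : E) :
    lieForm (pullForm g ψ ρ) X' y v w = deformationForm g X (ψ y)
      (mfderiv 𝓘(ℝ, E) (𝓡 4) ψ y v) (mfderiv 𝓘(ℝ, E) (𝓡 4) ψ y w) := by
  have hψ0 := hψ.self_of_nhds
  have hys : ψ y ∈ (extChartAt (𝓡 4) (ψ y)).source := mem_extChartAt_source _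
  have hev : ∀ᶠ z in nhds y, ψ z ∈ (extChartAt (𝓡 4) (ψ y)).source :=
    eventually_mem_extChartAt_source hψ0.continuousAt
  have d1 : DifferentiableAt ℝ (chartPull g ψ (ψ y)) y :=
    (contDiffAt_chartPull hg hψ0).differentiableAt (by simp)
  have d2 : DifferentiableAt ℝ (fun z => formProd (fderiv ℝ ρ z) (fderiv ℝ ρ z)) y :=
    (contDiffAt_formProd_fderiv hρ).differentiableAt (by simp)
  rw [lieForm_congr (eventually_pullForm_eq hψ ρ), lieForm_add d1 d2]
  have e1 : lieForm (chartPull g ψ (ψ y)) X' y v w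
      = deformationForm g X (ψ y) (mfderiv 𝓘(ℝ, E) (𝓡 4) ψ y v)
        (mfderiv 𝓘(ℝ, E) (𝓡 4) ψ y w) := by
    rw [lieForm_pullback (τ := fun z => extChartAt (𝓡 4) (ψ y) (ψ z)) (B := chartMetric g (ψ y))
      (X' := chartField X (ψ y)) ((contDiffAt_extChartAt_comp hψ0 hys).of_le two_le_infty)
      (hg.differentiableAt_chartMetric _) (differentiableAt_chartField hX) hX' ?_ ?_ d1,
      chartD_mfderiv (hψ0.mdifferentiableAt (by simp)) hys,
      chartD_mfderiv (hψ0.mdifferentiableAt (by simp)) hys, lieForm_chart hg hX]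
    · exact congrArg₂ (fun a b => deformationForm g X (ψ y) a b) (chartD_self _ _) (chartD_self _ _)
    · filter_upwards [hψ, hev, hrel] with z hz hzs hr
      rw [chartD_mfderiv (hz.mdifferentiableAt (by simp)) hzs, hr]
      unfold chartField
      rw [(extChartAt (𝓡 4) (ψ y)).left_inv hzs]
    · filter_upwards [hev] with z hzs v w
      exact chartPull_apply hzs v w
  -- The form `dρ ⊗ dρ` is the pull-back under `ρ` of a constant form on the line, and `X'` is
  -- `ρ`-related to the zero field; naturality makes its Lie derivative vanish.
  have e2 : lieForm (fun z => formProd (fderiv ℝ ρ z) (fderiv ℝ ρ z)) X' y v w = 0 := by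
    rw [lieForm_pullback (τ := ρ) (B := fun _ => formProd (ContinuousLinearMap.id ℝ ℝ)
      (ContinuousLinearMap.id ℝ ℝ)) (X' := fun _ => 0) (hρ.of_le two_le_infty)
      (differentiableAt_const _) (differentiableAt_const _) hX' hrelρ
      (Filter.Eventually.of_forall fun z v w => by simp [formProd_apply]) d2]
    simp [lieForm]
  rw [e1, e2, add_zero]

end PullBack

/-! ### Smoothness of the current -/

section CurrentSmooth

variable {M : Type*} [TopologicalSpace M] [ChartedSpace (EuclideanSpace ℝ (Fin 4)) M]
  [IsManifold (𝓡 4) ∞ M] {g : CovTensorField 2 M}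

theorem TensorSmoothOn.contMDiffAt_apply {k : ℕ} {T : CovTensorField k M} {R : Set M}
    (hT : TensorSmoothOn T R) {p : M} (hp : p ∈ R) {v : ∀ q : M, Fin k → TangentSpace (𝓡 4) q}
    (hv : ∀ j, ContMDiffAt (𝓡 4) 𝓘(ℝ, EuclideanSpace ℝ (Fin 4)) ∞ (fun q => chartD p q (v q j)) p) :
    ContMDiffAt (𝓡 4) 𝓘(ℝ, ℝ) ∞ (fun q => T q (v q)) p := by
  have h1 : ContMDiffAt (𝓡 4) 𝓘(ℝ, ℝ) ∞ (fun q => ∑ i : Fin k → Fin 4,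
      (∏ j, chartD p q (v q j) (i j)) * chartComp T p i q) p := by
    refine ContMDiffAt.sum fun i _ => ContMDiffAt.mul ?_ (hT p hp i)
    refine contMDiffAt_finsetProd fun j _ => ?_
    exact (EuclideanSpace.proj (i j) : EuclideanSpace ℝ (Fin 4) →L[ℝ] ℝ).contMDiff.contMDiffAt.comp
      p (hv j)
  refine h1.congr_of_eventuallyEq ?_
  filter_upwards [extChartAt_source_mem_nhds (I := 𝓡 4) p] with q hq
  exact tensor_eq_sum_chartComp T hq _

theorem contMDiffAt_chartD_coordField (p : M) (i : Fin 4) :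
    ContMDiffAt (𝓡 4) 𝓘(ℝ, EuclideanSpace ℝ (Fin 4)) ∞ (fun q => chartD p q (coordField p i q)) p := by
  have h : ContMDiffAt (𝓡 4) 𝓘(ℝ, EuclideanSpace ℝ (Fin 4)) ∞
      (fun _ : M => (EuclideanSpace.single i (1 : ℝ) : EuclideanSpace ℝ (Fin 4))) p :=
    contMDiffAt_const
  refine h.congr_of_eventuallyEq ?_
  filter_upwards [extChartAt_source_mem_nhds (I := 𝓡 4) p] with q hq
  exact chartD_coordField hq i

/-- The matrix of a metric in the coordinates of the chart at `p`. -/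
def chartGram (g : CovTensorField 2 M) (p q : M) : Matrix (Fin 4) (Fin 4) ℝ :=
  Matrix.of fun i j => chartComp g p ![i, j] q

theorem gramMat_coordField (g : CovTensorField 2 M) {p q : M} {f : Module.Basis (Fin 4) ℝ
    (TangentSpace (𝓡 4) q)} (hf : ∀ i, f i = coordField p i q) :
    gramMat f (form2 g q) = chartGram g p q := by
  ext a b
  rw [gramMat, Matrix.of_apply, hf, hf]
  refine congrArg (g q) ?_
  funext j
  fin_cases j <;> rfl

theorem IsLorentzMetric.gramMat_det_ne_zero (hg : IsLorentzMetric g) {q : M}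
    (f : Module.Basis (Fin 4) ℝ (TangentSpace (𝓡 4) q)) : (gramMat f (form2 g q)).det ≠ 0 := by
  obtain ⟨e, he⟩ := hg.signature q
  have h2 : (gramMat e (form2 g q)).det = -1 := by
    rw [IsOrthoFrame.gramMat_eq (G := form2 g q) he, Matrix.det_diagonal, Fin.prod_univ_four]
    simp [minkSign]
  rw [gramMat_basis_change (form2_isBilin g q) f e, Matrix.det_mul, Matrix.det_mul] at h2
  intro h
  simp [h] at h2

theorem chartGram_smooth (hg : IsLorentzMetric g) (p : M) (i j : Fin 4) :
    ContMDiffAt (𝓡 4) 𝓘(ℝ, ℝ) ∞ (fun q => chartGram g p q i j) p := hg.smooth p (mem_univ p) _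

theorem chartGram_det_ne_zero (hg : IsLorentzMetric g) {p q : M}
    (hq : q ∈ (extChartAt (𝓡 4) p).source) : (chartGram g p q).det ≠ 0 := by
  obtain ⟨f, hf⟩ := exists_chartBasis hq
  rw [← gramMat_coordField g hf]
  exact hg.gramMat_det_ne_zero f

theorem chartGram_inv_smooth (hg : IsLorentzMetric g) (p : M) (i j : Fin 4) :
    ContMDiffAt (𝓡 4) 𝓘(ℝ, ℝ) ∞ (fun q => (chartGram g p q)⁻¹ i j) p :=
  ContMDiffAt.matrixInv (chartGram_smooth hg p)
    (chartGram_det_ne_zero hg (mem_extChartAt_source p)) i j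

theorem contMDiffAt_euclidean_iff {f : M → EuclideanSpace ℝ (Fin 4)} {p : M} :
    ContMDiffAt (𝓡 4) 𝓘(ℝ, EuclideanSpace ℝ (Fin 4)) ∞ f p ↔
      ∀ i, ContMDiffAt (𝓡 4) 𝓘(ℝ, ℝ) ∞ (fun q => f q i) p := by
  refine ⟨fun h i => ?_, fun h => ?_⟩
  · exact (EuclideanSpace.proj i : EuclideanSpace ℝ (Fin 4) →L[ℝ] ℝ).contMDiff.contMDiffAt.comp p h
  · have h1 : ContMDiffAt (𝓡 4) 𝓘(ℝ, Fin 4 → ℝ) ∞ (fun q i => f q i) p :=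
      contMDiffAt_pi_space.2 h
    exact (EuclideanSpace.equiv (Fin 4) ℝ).symm.toContinuousLinearMap.contMDiff.contMDiffAt.comp p h1

/-- A vector field is smooth if its contractions with the coordinate fields are. -/
theorem contMDiffAt_chartD_of_form2 (hg : IsLorentzMetric g) {P : VecField M} {p : M}
    (h : ∀ j, ContMDiffAt (𝓡 4) 𝓘(ℝ, ℝ) ∞ (fun q => form2 g q (coordField p j q) (P q)) p) :
    ContMDiffAt (𝓡 4) 𝓘(ℝ, EuclideanSpace ℝ (Fin 4)) ∞ (fun q => chartD p q (P q)) p := by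
  rw [contMDiffAt_euclidean_iff]
  intro i
  have h1 : ContMDiffAt (𝓡 4) 𝓘(ℝ, ℝ) ∞ (fun q => ∑ j, (chartGram g p q)⁻¹ i j *
      form2 g q (coordField p j q) (P q)) p :=
    ContMDiffAt.sum fun j _ => (chartGram_inv_smooth hg p i j).mul (h j)
  refine h1.congr_of_eventuallyEq ?_
  filter_upwards [extChartAt_source_mem_nhds (I := 𝓡 4) p] with q hq
  obtain ⟨f, hf⟩ := exists_chartBasis hq
  have h2 : ∀ j, form2 g q (coordField p j q) (P q)
      = ∑ k, chartGram g p q j k * chartD p q (P q) k := by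
    intro j
    conv_lhs => rw [eq_sum_coordField hq (P q)]
    rw [((form2_isBilin g q).right _).real_sum_smul, ← gramMat_coordField g hf]
    refine Finset.sum_congr rfl fun k _ => ?_
    rw [gramMat, Matrix.of_apply, hf, hf, mul_comm]
  have h3 : (chartGram g p q)⁻¹.mulVec ((chartGram g p q).mulVec fun k => chartD p q (P q) k)
      = fun k => chartD p q (P q) k := by
    rw [Matrix.mulVec_mulVec, Matrix.nonsing_inv_mul _
      (isUnit_iff_ne_zero.2 (chartGram_det_ne_zero hg hq)), Matrix.one_mulVec]
  simp only [h2]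
  exact (congrFun h3 i).symm

theorem form2_current (hg : IsLorentzMetric g) (Q : CovTensorField 4 M) (X Y Z : VecField M) (q : M)
    (v : TangentSpace (𝓡 4) q) :
    form2 g q v (current g Q X Y Z q) = Q q ![v, X q, Y q, Z q] := by
  have := hg.flat_current Q X Y Z q ![v]
  rwa [flat_apply] at this

theorem contMDiffAt_current (hg : IsLorentzMetric g) {Q : CovTensorField 4 M} {R : Set M}
    (hR : IsOpen R) (hQ : TensorSmoothOn Q R) {X Y Z : VecField M} (hX : VecSmoothOn X R)
    (hY : VecSmoothOn Y R) (hZ : VecSmoothOn Z R) {p : M} (hp : p ∈ R) :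
    ContMDiffAt (𝓡 4) 𝓘(ℝ, EuclideanSpace ℝ (Fin 4)) ∞
      (fun q => chartD p q (current g Q X Y Z q)) p := by
  refine contMDiffAt_chartD_of_form2 hg fun j => ?_
  simp only [form2_current hg]
  refine hQ.contMDiffAt_apply hp fun i => ?_
  fin_cases i
  · exact contMDiffAt_chartD_coordField p j
  · exact hX.chartD hR hp
  · exact hY.chartD hR hp
  · exact hZ.chartD hR hp

theorem mdifferentiableAt_chartVec {X : VecField M} {p : M}
    (h : ContMDiffAt (𝓡 4) 𝓘(ℝ, EuclideanSpace ℝ (Fin 4)) ∞ (fun q => chartD p q (X q)) p)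
    (c : Fin 4) : MDifferentiableAt (𝓡 4) 𝓘(ℝ, ℝ) (chartVec X p c) p :=
  ((contMDiffAt_euclidean_iff.1 h c).mdifferentiableAt (by simp) :)

end CurrentSmooth

/-! ### Continuity of the bulk density -/

section ContinuousDeformation

variable {M : Type*} [TopologicalSpace M] [ChartedSpace (EuclideanSpace ℝ (Fin 4)) M]
  [IsManifold (𝓡 4) ∞ M] {g : CovTensorField 2 M}

theorem chartD_injective {p q : M} (hq : q ∈ (extChartAt (𝓡 4) p).source) :
    Function.Injective (chartD p q) := by
  obtain ⟨L, hL⟩ := chartD_isInvertible hq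
  rw [← hL]
  exact L.injective

theorem contMDiffAt_extChartAt_symm {p : M} {z : EuclideanSpace ℝ (Fin 4)}
    (hz : z ∈ (extChartAt (𝓡 4) p).target) :
    ContMDiffAt 𝓘(ℝ, EuclideanSpace ℝ (Fin 4)) (𝓡 4) ∞ (extChartAt (𝓡 4) p).symm z :=
  (contMDiffOn_extChartAt_symm p).contMDiffAt ((isOpen_extChartAt_target p).mem_nhds hz)

theorem chartD_mfderiv_symm {p : M} {z : EuclideanSpace ℝ (Fin 4)}
    (hz : z ∈ (extChartAt (𝓡 4) p).target) (v : EuclideanSpace ℝ (Fin 4)) :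
    chartD p ((extChartAt (𝓡 4) p).symm z)
      (mfderiv 𝓘(ℝ, EuclideanSpace ℝ (Fin 4)) (𝓡 4) (extChartAt (𝓡 4) p).symm z v) = v := by
  rw [← chartD_mfderiv ((contMDiffAt_extChartAt_symm hz).mdifferentiableAt (by simp))
    ((extChartAt (𝓡 4) p).map_target hz)]
  have h : (fun y => extChartAt (𝓡 4) p ((extChartAt (𝓡 4) p).symm y)) =ᶠ[nhds z] id := by
    filter_upwards [(isOpen_extChartAt_target p).mem_nhds hz] with y hy
    exact (extChartAt (𝓡 4) p).right_inv hy
  rw [h.fderiv_eq, fderiv_id]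
  rfl

/-- The deformation tensor is defined in a chart that depends on the point. Applying
`lieForm_pullForm` to the inverse of the chart at `p`, with `ρ = 0`, turns it into a Lie derivative
of smooth data in that single chart. -/
theorem deformationForm_coordField (hg : IsLorentzMetric g) {R : Set M} (hR : IsOpen R)
    {X : VecField M} (hX : VecSmoothOn X R) {p : M} (hp : p ∈ R) (c d : Fin 4) :
    ContinuousAt (fun q => deformationForm g X q (coordField p c q) (coordField p d q)) p := by
  set φ := extChartAt (𝓡 4) p with hφ
  have hpz : φ p ∈ φ.target := φ.map_source (mem_extChartAt_source p)
  have hF : ContDiffAt ℝ ∞ (chartField X p) (φ p) := by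
    have h1 := hX.chartD hR hp
    have h2 : ContMDiffAt 𝓘(ℝ, EuclideanSpace ℝ (Fin 4)) 𝓘(ℝ, EuclideanSpace ℝ (Fin 4)) ∞
        ((fun q => chartD p q (X q)) ∘ φ.symm) (φ p) :=
      ContMDiffAt.comp (I' := 𝓡 4) (φ p) (by rwa [hφ, extChartAt_symm_self])
        (contMDiffAt_extChartAt_symm hpz)
    exact h2.contDiffAt
  have hψ : ∀ z ∈ φ.target, ContMDiffAt 𝓘(ℝ, EuclideanSpace ℝ (Fin 4)) (𝓡 4) ∞ φ.symm z :=
    fun z hz => contMDiffAt_extChartAt_symm hz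
  have hψ' : ∀ z ∈ φ.target, ∀ᶠ z in nhds z,
      ContMDiffAt 𝓘(ℝ, EuclideanSpace ℝ (Fin 4)) (𝓡 4) ∞ φ.symm z := fun z hz => by
    filter_upwards [(isOpen_extChartAt_target p).mem_nhds hz] with y hy using hψ y hy
  have hh : ContDiffAt ℝ ∞ (pullForm g φ.symm (fun _ => (0 : ℝ))) (φ p) :=
    contDiffAt_pullForm hg (hψ' _ hpz) contDiffAt_const
  have hc : ContinuousAt (fun z => lieForm (pullForm g φ.symm (fun _ => (0 : ℝ))) (chartField X p) z
      (EuclideanSpace.single c 1) (EuclideanSpace.single d 1)) (φ p) := by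
    have c1 := (hh.fderiv_right (m := ∞) (by simp)).continuousAt
    have c2 := (hF.fderiv_right (m := ∞) (by simp)).continuousAt
    have c3 := hh.continuousAt
    have c4 := hF.continuousAt
    exact ((((c1.clm_apply c4).clm_apply continuousAt_const).clm_apply continuousAt_const).add
      ((c3.clm_apply (c2.clm_apply continuousAt_const)).clm_apply continuousAt_const)).add
      ((c3.clm_apply continuousAt_const).clm_apply (c2.clm_apply continuousAt_const))
  have hd : ∀ᶠ z in nhds (φ p), DifferentiableAt ℝ (chartField X p) z :=
    (((hF.of_le two_le_infty).eventually (by simp)).mono fun z hz => hz.differentiableAt (by simp))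
  have hcq := hc.comp (continuousAt_extChartAt (I := 𝓡 4) p)
  refine hcq.congr ?_
  filter_upwards [extChartAt_source_mem_nhds (I := 𝓡 4) p,
    (continuousAt_extChartAt (I := 𝓡 4) p).eventually hd, hR.mem_nhds hp] with q hq hdq hqR
  have hqz : φ q ∈ φ.target := φ.map_source hq
  have hcf : ∀ i, mfderiv 𝓘(ℝ, EuclideanSpace ℝ (Fin 4)) (𝓡 4) φ.symm (φ q)
      (EuclideanSpace.single i 1) = coordField p i (φ.symm (φ q)) := fun i =>
    chartD_injective (φ.map_target hqz) ((chartD_mfderiv_symm hqz _).trans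
      (chartD_coordField (φ.map_target hqz) i).symm)
  have hqq : φ.symm (φ q) = q := φ.left_inv hq
  have h5 := lieForm_pullForm hg (hψ' _ hqz) (ρ := fun _ => (0 : ℝ)) contDiffAt_const (X := X)
    (fun c => mdifferentiableAt_chartVec (hX.chartD hR (by rwa [hqq])) c) hdq
    (by
      filter_upwards [(isOpen_extChartAt_target p).mem_nhds hqz] with z hz
      exact chartD_injective (φ.map_target hz) (chartD_mfderiv_symm hz _))
    (by simp) (EuclideanSpace.single c 1) (EuclideanSpace.single d 1)
  rw [hcf, hcf] at h5
  refine h5.trans ?_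
  rw [hqq]

theorem deformationForm_isBilin (g : CovTensorField 2 M) (X : VecField M) (p : M) :
    IsBilin (deformationForm g X p) := by
  refine ⟨fun w => ⟨fun v v' => ?_, fun c v => ?_⟩, fun w => ⟨fun v v' => ?_, fun c v => ?_⟩⟩ <;>
    simp only [deformationForm, map_add, map_smul, smul_eq_mul, add_mul, mul_add,
      Finset.sum_add_distrib, Finset.mul_sum]
  · exact Finset.sum_congr rfl fun _ _ => Finset.sum_congr rfl fun _ _ => by ring
  · exact Finset.sum_congr rfl fun _ _ => Finset.sum_congr rfl fun _ _ => by ring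

theorem deformationForm_basisVec (g : CovTensorField 2 M) (X : VecField M) (p : M) (a b : Fin 4) :
    deformationForm g X p (basisVec p a) (basisVec p b) = deformation g X p a b := by
  simp [deformationForm, vecComp_basisVec]

theorem mtrace_pointBasis (g : CovTensorField 2 M) (p : M)
    (β : TangentSpace (𝓡 4) p → TangentSpace (𝓡 4) p → ℝ) :
    mtrace (pointBasis p) (form2 g p) β = ∑ a, ∑ b, gUp g p a b * β (basisVec p a) (basisVec p b) := by
  rw [mtrace, ← gUp_eq, coe_pointBasis]

/-- The contraction of a trace-free form with `deformationHatUp` as a double contraction. -/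
theorem sum_deformationHatUp_eq_mtrace (hg : IsLorentzMetric g) (X : VecField M) {p : M}
    {β : TangentSpace (𝓡 4) p → TangentSpace (𝓡 4) p → ℝ}
    (ht : ∑ a, ∑ b, gUp g p a b * β (basisVec p a) (basisVec p b) = 0) :
    ∑ a, ∑ b, β (basisVec p a) (basisVec p b) * deformationHatUp g X p a b
      = mtrace (pointBasis p) (form2 g p) fun v v' => mtrace (pointBasis p) (form2 g p)
        fun w w' => β v w * deformationForm g X p v' w' := by
  set t := (1 / 4) * ∑ c, ∑ d, gUp g p c d * deformation g X p c d with ht'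
  have e3 : ∀ a b, ∑ c, ∑ d, gUp g p a c * gUp g p b d * gLow g p c d = gUp g p a b := by
    intro a b
    have : ∀ c, ∑ d, gUp g p a c * gUp g p b d * gLow g p c d
        = gUp g p a c * if b = c then 1 else 0 := fun c => by
      rw [← hg.sum_gUp_gLow, Finset.mul_sum]
      exact Finset.sum_congr rfl fun d _ => by rw [hg.gLow_symm p c d, mul_assoc]
    simp only [this]
    simp
  have h1 : ∀ a b, deformationHatUp g X p a b
      = ∑ c, ∑ d, gUp g p a c * gUp g p b d * deformation g X p c d - t * gUp g p a b := by
    intro a b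
    rw [← e3 a b, Finset.mul_sum, ← Finset.sum_sub_distrib]
    refine Finset.sum_congr rfl fun c _ => ?_
    rw [Finset.mul_sum, ← Finset.sum_sub_distrib]
    refine Finset.sum_congr rfl fun d _ => ?_
    rw [deformationHat, ← ht']
    ring
  have h5 : ∑ a, ∑ b, β (basisVec p a) (basisVec p b) * (t * gUp g p a b) = 0 := by
    have := congrArg (t * ·) ht
    simp only [mul_zero, Finset.mul_sum] at this
    rw [← this]
    exact Finset.sum_congr rfl fun a _ => Finset.sum_congr rfl fun b _ => by ring
  simp only [h1, mul_sub, Finset.sum_sub_distrib, h5, sub_zero, mtrace_pointBasis,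
    deformationForm_basisVec, Finset.mul_sum]
  refine Finset.sum_congr rfl fun a _ => ?_
  rw [Finset.sum_comm]
  exact Finset.sum_congr rfl fun c _ => Finset.sum_congr rfl fun b _ =>
    Finset.sum_congr rfl fun d _ => by ring

/-- The double contraction is independent of the frame, so it may be evaluated in the coordinate
fields of the chart at `p`, where every factor is continuous at `p`. -/
theorem sum_deformationHatUp_continuousAt (hg : IsLorentzMetric g) {R : Set M} (hR : IsOpen R)
    {X : VecField M} (hX : VecSmoothOn X R) {p : M} (hp : p ∈ R)
    {β : ∀ q : M, TangentSpace (𝓡 4) q → TangentSpace (𝓡 4) q → ℝ}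
    (hβ : ∀ q ∈ R, IsBilin (β q))
    (ht : ∀ q ∈ R, ∑ a, ∑ b, gUp g q a b * β q (basisVec q a) (basisVec q b) = 0)
    (hc : ∀ a b, ContinuousAt (fun q => β q (coordField p a q) (coordField p b q)) p) :
    ContinuousAt (fun q => ∑ a, ∑ b, β q (basisVec q a) (basisVec q b)
      * deformationHatUp g X q a b) p := by
  have h1 : ContinuousAt (fun q => ∑ a, ∑ c, (chartGram g p q)⁻¹ a c * ∑ b, ∑ d,
      (chartGram g p q)⁻¹ b d * (β q (coordField p a q) (coordField p b q)
        * deformationForm g X q (coordField p c q) (coordField p d q))) p := by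
    have hs : ∀ {ι : Type} [Fintype ι] {f : ι → M → ℝ}, (∀ i, ContinuousAt (f i) p) →
        ContinuousAt (fun q => ∑ i, f i q) p := fun h => tendsto_finsetSum _ fun i _ => h i
    exact hs fun a => hs fun c => (chartGram_inv_smooth hg p a c).continuousAt.mul <|
      hs fun b => hs fun d => (chartGram_inv_smooth hg p b d).continuousAt.mul <|
        (hc a b).mul (deformationForm_coordField hg hR hX hp c d)
  refine h1.congr ?_
  filter_upwards [extChartAt_source_mem_nhds (I := 𝓡 4) p, hR.mem_nhds hp] with q hq hqR
  obtain ⟨f, hf⟩ := exists_chartBasis hq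
  have hG := form2_isBilin g q
  have hD := deformationForm_isBilin g X q
  have hb := hβ q hqR
  rw [sum_deformationHatUp_eq_mtrace hg X (ht q hqR)]
  have hin : ∀ v v', IsBilin fun w w' => β q v w * deformationForm g X q v' w' := fun v v' =>
    ⟨fun y => (hb.right v).mul_const' _, fun x => (hD.right v').const_mul' _⟩
  have hout : IsBilin fun v v' => mtrace (pointBasis q) (form2 g q)
      fun w w' => β q v w * deformationForm g X q v' w' :=
    ⟨fun y => mtrace_isLinearMap _ _ fun w w' => (hb.left w).mul_const' _,
      fun x => mtrace_isLinearMap _ _ fun w w' => (hD.left w').const_mul' _⟩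
  rw [← mtrace_basis_change hG hout (pointBasis q) f]
  simp only [← mtrace_basis_change hG (hin _ _) (pointBasis q) f]
  simp only [mtrace, gramMat_coordField g hf, hf]

/-- Needed to split the bulk integral of a sum: the pointwise identity controls only the sum of the
divergence term and `bulkK`, so one of the two must be shown continuous by itself. -/
theorem bulkK_continuousOn (hg : IsLorentzMetric g) {W : CovTensorField 4 M} {R : Set M}
    (hR : IsOpen R) (hW : TensorSmoothOn W R) (hWeyl : IsWeylFieldOn g W R) {X Y Z : VecField M}
    (hX : VecSmoothOn X R) (hY : VecSmoothOn Y R) (hZ : VecSmoothOn Z R) :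
    ContinuousOn (bulkK g W X Y Z) R := by
  intro p hp
  refine ContinuousAt.continuousWithinAt ?_
  have hQ := belRobinson_smoothOn hg hW
  have key : ∀ {X Y Z : VecField M}, VecSmoothOn X R → VecSmoothOn Y R → VecSmoothOn Z R →
      ContinuousAt (fun q => ∑ a, ∑ b, form4 (belRobinson g W) q (basisVec q a) (basisVec q b)
        (Y q) (Z q) * deformationHatUp g X q a b) p := by
    intro X Y Z hX hY hZ
    refine sum_deformationHatUp_continuousAt hg hR hX hp
      (β := fun q a b => form4 (belRobinson g W) q a b (Y q) (Z q)) (fun q _ => ?_) (fun q hq => ?_)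
      fun a b => ?_
    · have hq := form4_isQuadrilin (belRobinson g W) q
      exact ⟨fun _ => hq.s1 _ _ _, fun _ => hq.s2 _ _ _⟩
    · exact hWeyl.belRobinson_trace hg hq _ _
    · refine (hQ.contMDiffAt_apply hp (v := fun q => ![coordField p a q, coordField p b q, Y q, Z q])
        fun i => ?_).continuousAt
      fin_cases i
      · exact contMDiffAt_chartD_coordField p a
      · exact contMDiffAt_chartD_coordField p b
      · exact hY.chartD hR hp
      · exact hZ.chartD hR hp
  have h := continuousAt_const (y := (1 / 2 : ℝ)) |>.mul
    (((key hX hY hZ).add (key hY hX hZ)).add (key hZ hX hY))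
  refine h.congr (Filter.Eventually.of_forall fun q => ?_)
  have hq := form4_isQuadrilin (belRobinson g W) q
  have e : ∀ (X Y Z : VecField M) (a b : Fin 4),
      form4 (belRobinson g W) q (basisVec q a) (basisVec q b) (Y q) (Z q)
        * deformationHatUp g X q a b
      = ∑ c, ∑ d, comp (belRobinson g W) q ![a, b, c, d] *
        (deformationHatUp g X q a b * vecComp q c (Y q) * vecComp q d (Z q)) := by
    intro X Y Z a b
    rw [(hq.s3 _ _ _).eq_sum_basisVec (Y q), Finset.sum_mul]
    refine Finset.sum_congr rfl fun c _ => ?_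
    rw [(hq.s4 _ _ _).eq_sum_basisVec (Z q), Finset.mul_sum, Finset.sum_mul]
    refine Finset.sum_congr rfl fun d _ => ?_
    rw [comp_four, coe_pointBasis]
    ring
  simp only [Pi.mul_apply, Pi.add_apply, e, bulkK, mul_add, Finset.sum_add_distrib]

end ContinuousDeformation

/-! ### Contractions with a degenerate pull-back completed by a square -/

section PullTrace

variable {E F : Type*} [AddCommGroup E] [Module ℝ E] [AddCommGroup F] [Module ℝ F]
  {ι κ : Type*} [Fintype ι] [DecidableEq ι] [Fintype κ] [DecidableEq κ]

/-- A basis adapted to a surjection with one-dimensional kernel. -/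
theorem exists_adapted_basis (b : Module.Basis ι ℝ E) (e : Module.Basis κ ℝ F) {T : E →ₗ[ℝ] F}
    (hT : Function.Surjective T) {l : E →ₗ[ℝ] ℝ} {k : E} (hk : T k = 0) (hl : l k = 1)
    (hcard : Fintype.card ι = Fintype.card κ + 1) :
    ∃ f : Module.Basis (κ ⊕ Unit) ℝ E, (∀ a, T (f (Sum.inl a)) = e a) ∧ (∀ a, l (f (Sum.inl a)) = 0)
      ∧ f (Sum.inr ()) = k := by
  choose s hs using fun a => hT (e a)
  let f : κ ⊕ Unit → E := Sum.elim (fun a => s a - l (s a) • k) fun _ => k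
  have hf1 : ∀ a, T (f (Sum.inl a)) = e a := fun a => by simp [f, hs, hk]
  have hf2 : ∀ a, l (f (Sum.inl a)) = 0 := fun a => by simp [f, hl]
  have hli : LinearIndependent ℝ f := by
    rw [Fintype.linearIndependent_iff]
    intro c hc
    rw [Fintype.sum_sum_type] at hc
    simp only [Finset.univ_unique, Finset.sum_singleton] at hc
    have h1 := congrArg T hc
    rw [map_add, map_sum, map_smul, show T (f (Sum.inr default)) = 0 from hk] at h1
    simp only [map_smul, hf1, smul_zero, add_zero, map_zero] at h1
    have h2 := Fintype.linearIndependent_iff.1 e.linearIndependent _ h1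
    have h3 := congrArg l hc
    rw [map_add, map_sum, map_smul, show l (f (Sum.inr default)) = 1 from hl] at h3
    simp only [map_smul, hf2, smul_eq_mul, mul_zero, Finset.sum_const_zero, zero_add, mul_one,
      map_zero] at h3
    rintro (a | a)
    · exact h2 a
    · exact h3
  have : Nonempty (κ ⊕ Unit) := ⟨Sum.inr ()⟩
  have hc : Fintype.card (κ ⊕ Unit) = Module.finrank ℝ E := by
    rw [Module.finrank_eq_card_basis b, hcard]
    simp
  refine ⟨basisOfLinearIndependentOfCardEqFinrank hli hc, fun a => ?_, fun a => ?_, ?_⟩ <;>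
    rw [coe_basisOfLinearIndependentOfCardEqFinrank]
  · exact hf1 a
  · exact hf2 a
  · rfl

theorem gramMat_adapted {B : F → F → ℝ} (hB : IsBilin B) (e : κ → F) {T : E →ₗ[ℝ] F}
    {l : E →ₗ[ℝ] ℝ} {f : κ ⊕ Unit → E} (h1 : ∀ a, T (f (Sum.inl a)) = e a)
    (h2 : ∀ a, l (f (Sum.inl a)) = 0) (h3 : T (f (Sum.inr ())) = 0) (h4 : l (f (Sum.inr ())) = 1) :
    gramMat f (fun v w => B (T v) (T w) + l v * l w)
      = Matrix.fromBlocks (gramMat e B) 0 0 1 := by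
  ext i j
  have z1 : ∀ x, B 0 x = 0 := fun x => (hB.left x).map_zero
  have z2 : ∀ x, B x 0 = 0 := fun x => (hB.right x).map_zero
  rcases i with a | a <;> rcases j with b | b <;> simp [gramMat, h1, h2, h3, h4, z1, z2]

theorem isBilin_pull {B : F → F → ℝ} (hB : IsBilin B) (T : E →ₗ[ℝ] F) :
    IsBilin fun v w => B (T v) (T w) :=
  ⟨fun y => ⟨fun a b => by rw [map_add, (hB.left _).map_add],
    fun c a => by rw [map_smul, (hB.left _).map_smul]⟩,
   fun x => ⟨fun a b => by rw [map_add, (hB.right _).map_add],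
    fun c a => by rw [map_smul, (hB.right _).map_smul]⟩⟩

theorem isBilin_pull_add {B : F → F → ℝ} (hB : IsBilin B) (T : E →ₗ[ℝ] F) (l : E →ₗ[ℝ] ℝ) :
    IsBilin fun v w => B (T v) (T w) + l v * l w :=
  ⟨fun y => ((isBilin_pull hB T).left y).add' (l.isLinear.mul_const' _),
   fun x => ((isBilin_pull hB T).right x).add' (l.isLinear.const_mul' _)⟩

/-- Contracting with the inverse of `T^* B + l ⊗ l` pulls back the contraction with the inverse
of `B`. -/
theorem mtrace_pull (b : Module.Basis ι ℝ E) (e : Module.Basis κ ℝ F) {T : E →ₗ[ℝ] F}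
    (hT : Function.Surjective T) {l : E →ₗ[ℝ] ℝ} {k : E} (hk : T k = 0) (hl : l k = 1)
    (hcard : Fintype.card ι = Fintype.card κ + 1) {B β : F → F → ℝ} (hB : IsBilin B)
    (hβ : IsBilin β) (hdet : (gramMat e B).det ≠ 0) :
    (gramMat b fun v w => B (T v) (T w) + l v * l w).det ≠ 0 ∧
      mtrace b (fun v w => B (T v) (T w) + l v * l w) (fun v w => β (T v) (T w))
        = mtrace e B β := by
  -- In the adapted basis the Gram matrix is block diagonal, with the Gram matrix of `B` and a
  -- single entry one. The last basis vector is killed by `T`, so its block does not contribute to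
  -- the contraction.
  obtain ⟨f, hf1, hf2, hf3⟩ := exists_adapted_basis b e hT hk hl hcard
  have hH := isBilin_pull_add hB T l
  have hG := gramMat_adapted hB e hf1 hf2 (hf3 ▸ hk) (hf3 ▸ hl)
  obtain ⟨σ⟩ : Nonempty (ι ≃ κ ⊕ Unit) := Fintype.card_eq.1 (by simp [hcard])
  have hr : ∀ β : E → E → ℝ, mtrace (f.reindex σ.symm) (fun v w => B (T v) (T w) + l v * l w) β
      = mtrace f (fun v w => B (T v) (T w) + l v * l w) β := by
    intro β
    have := mtrace_reindex σ f (fun v w => B (T v) (T w) + l v * l w) β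
    rw [← this]
    congr 1
    funext i
    simp
  constructor
  · intro h0
    have h1 := gramMat_basis_change hH b (f.reindex σ.symm)
    have h2 := congrArg Matrix.det h1
    rw [Matrix.det_mul, Matrix.det_mul, h0, mul_zero, zero_mul] at h2
    have h3 : gramMat (f.reindex σ.symm) (fun v w => B (T v) (T w) + l v * l w)
        = (gramMat f (fun v w => B (T v) (T w) + l v * l w)).submatrix σ σ := by
      ext i j
      simp [gramMat]
    rw [h3, Matrix.det_submatrix_equiv_self, hG, Matrix.det_fromBlocks_zero₂₁, Matrix.det_one,
      mul_one] at h2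
    exact hdet h2
  · rw [← mtrace_basis_change hH (isBilin_pull hβ T) b (f.reindex σ.symm), hr, mtrace, hG]
    have hinv : (Matrix.fromBlocks (gramMat e B) 0 0 (1 : Matrix Unit Unit ℝ))⁻¹
        = Matrix.fromBlocks (gramMat e B)⁻¹ 0 0 1 := by
      refine Matrix.inv_eq_right_inv ?_
      rw [Matrix.fromBlocks_multiply, Matrix.mul_nonsing_inv _ (isUnit_iff_ne_zero.2 hdet)]
      simp
    rw [hinv]
    simp [Fintype.sum_sum_type, hf1, mtrace, hf3, hk, (hβ.left _).map_zero]

/-- Under a change of basis all Gram determinants scale by the same square, so the ratio for two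
forms is intrinsic. It serves to compare the metric density with the Euclidean one. -/
theorem gramMat_det_mul (b : Module.Basis ι ℝ E) (f : Module.Basis κ ℝ E)
    {B B' : E → E → ℝ} (hB : IsBilin B) (hB' : IsBilin B') :
    (gramMat f B).det * (gramMat b B').det = (gramMat b B).det * (gramMat f B').det := by
  obtain ⟨σ⟩ : Nonempty (ι ≃ κ) := ⟨b.indexEquiv f⟩
  have h : ∀ B : E → E → ℝ, (gramMat (f.reindex σ.symm) B).det = (gramMat f B).det := by
    intro B
    have h3 : gramMat (f.reindex σ.symm) B = (gramMat f B).submatrix σ σ := by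
      ext i j
      simp [gramMat]
    rw [h3, Matrix.det_submatrix_equiv_self]
  rw [← h B, ← h B', gramMat_basis_change hB b (f.reindex σ.symm),
    gramMat_basis_change hB' b (f.reindex σ.symm)]
  simp only [Matrix.det_mul, Matrix.det_transpose]
  ring

end PullTrace

/-! ### The unit sphere and radial projection -/

section SphereProj

theorem fact_finrank_three : Fact (Module.finrank ℝ (EuclideanSpace ℝ (Fin 3)) = 2 + 1) :=
  ⟨by simp⟩

/-- The radial projection to the unit sphere. -/
def sphereProj (x : EuclideanSpace ℝ (Fin 3)) : S2 :=
  if h : x ≠ 0 then ⟨‖x‖⁻¹ • x, by simp [norm_smul, norm_ne_zero_iff.2 h]⟩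
  -- The value at the origin is arbitrary; `sphereProj 0` also serves as a convenient point of the
  -- sphere.
  else ⟨EuclideanSpace.single 0 1, by simp⟩

theorem coe_sphereProj {x : EuclideanSpace ℝ (Fin 3)} (h : x ≠ 0) :
    (sphereProj x : EuclideanSpace ℝ (Fin 3)) = ‖x‖⁻¹ • x := by
  rw [sphereProj, dif_pos h]

theorem sphere_ne_zero (x : S2) : (x : EuclideanSpace ℝ (Fin 3)) ≠ 0 :=
  ne_zero_of_mem_unit_sphere x

theorem sphereProj_smul {c : ℝ} (hc : 0 < c) (x : S2) :
    sphereProj (c • (x : EuclideanSpace ℝ (Fin 3))) = x := by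
  have hn : ‖(x : EuclideanSpace ℝ (Fin 3))‖ = 1 := norm_eq_of_mem_sphere x
  apply Subtype.ext
  rw [coe_sphereProj (smul_ne_zero hc.ne' (sphere_ne_zero x)), norm_smul, hn, mul_one,
    Real.norm_of_nonneg hc.le, inv_smul_smul₀ hc.ne']

theorem norm_smul_sphereProj {x : EuclideanSpace ℝ (Fin 3)} (h : x ≠ 0) :
    ‖x‖ • (sphereProj x : EuclideanSpace ℝ (Fin 3)) = x := by
  rw [coe_sphereProj h, smul_inv_smul₀ (norm_ne_zero_iff.2 h)]

/-- Smoothness into the sphere is obtained by restricting the codomain of a globally defined smooth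
map, so the argument passes through the open submanifold of nonzero vectors. -/
theorem contMDiffAt_sphereProj {x : EuclideanSpace ℝ (Fin 3)} (h : x ≠ 0) :
    ContMDiffAt 𝓘(ℝ, EuclideanSpace ℝ (Fin 3)) (𝓡 2) ∞ sphereProj x := by
  let O : TopologicalSpace.Opens (EuclideanSpace ℝ (Fin 3)) := ⟨{0}ᶜ, isOpen_compl_singleton⟩
  have h1 : ContMDiff 𝓘(ℝ, EuclideanSpace ℝ (Fin 3)) 𝓘(ℝ, EuclideanSpace ℝ (Fin 3)) ∞
      (fun y : O => ‖(y : EuclideanSpace ℝ (Fin 3))‖⁻¹ • (y : EuclideanSpace ℝ (Fin 3))) := by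
    intro y
    have hy : (y : EuclideanSpace ℝ (Fin 3)) ≠ 0 := y.2
    refine (contMDiffAt_subtype_iff (f := fun y : EuclideanSpace ℝ (Fin 3) => ‖y‖⁻¹ • y)).2 ?_
    exact (((contDiffAt_norm ℝ hy).inv (norm_ne_zero_iff.2 hy)).smul contDiffAt_id).contMDiffAt
  have := fact_finrank_three
  have h2 := h1.codRestrict_sphere (n := 2) (fun y => by
    have hy : (y : EuclideanSpace ℝ (Fin 3)) ≠ 0 := y.2
    simp [norm_smul, norm_ne_zero_iff.2 hy])
  have h3 := h2 ⟨x, h⟩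
  refine (contMDiffAt_subtype_iff (U := O) (x := ⟨x, h⟩)).1 (h3.congr_of_eventuallyEq ?_)
  refine Filter.Eventually.of_forall fun y => Subtype.ext ?_
  exact coe_sphereProj y.2

/-- The inclusion of the sphere has a derivative onto the orthogonal complement. -/
theorem hasMFDerivAt_coe_sphere (x : S2) :
    HasMFDerivAt (𝓡 2) 𝓘(ℝ, EuclideanSpace ℝ (Fin 3)) (fun y : S2 => (y : EuclideanSpace ℝ (Fin 3)))
      x (mfderiv (𝓡 2) 𝓘(ℝ, EuclideanSpace ℝ (Fin 3))
        (fun y : S2 => (y : EuclideanSpace ℝ (Fin 3))) x) := by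
  have := fact_finrank_three
  have h : ContMDiffAt (𝓡 2) 𝓘(ℝ, EuclideanSpace ℝ (Fin 3)) 1
    (fun y : S2 => (y : EuclideanSpace ℝ (Fin 3))) x := contMDiff_coe_sphere (n := 2) (m := 1) x
  exact (h.mdifferentiableAt (by simp)).hasMFDerivAt

/-- A tangent vector of the sphere as a vector of `ℝ³`. -/
def sphereIncl (x : S2) : TangentSpace (𝓡 2) x →L[ℝ] EuclideanSpace ℝ (Fin 3) :=
  mfderiv (𝓡 2) 𝓘(ℝ, EuclideanSpace ℝ (Fin 3)) (fun y : S2 => (y : EuclideanSpace ℝ (Fin 3))) x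

theorem sphereIncl_injective (x : S2) : Function.Injective (sphereIncl x) := by
  have := fact_finrank_three
  exact injective_mvfderiv_subtypeVal_sphere (n := 2) x

theorem exists_sphereIncl_eq (x : S2) {w : EuclideanSpace ℝ (Fin 3)}
    (hw : inner ℝ (x : EuclideanSpace ℝ (Fin 3)) w = 0) : ∃ ξ, sphereIncl x ξ = w := by
  have := fact_finrank_three
  have h := range_mvfderiv_subtypeVal (n := 2) x
  have h2 : w ∈ (Submodule.span ℝ {(x : EuclideanSpace ℝ (Fin 3))})ᗮ :=
    Submodule.mem_orthogonal_singleton_iff_inner_right.2 hw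
  rw [← h] at h2
  exact h2

theorem inner_sphereIncl (x : S2) (ξ : TangentSpace (𝓡 2) x) :
    inner ℝ (x : EuclideanSpace ℝ (Fin 3)) (sphereIncl x ξ) = 0 := by
  have := fact_finrank_three
  have h := range_mvfderiv_subtypeVal (n := 2) x
  have h2 : sphereIncl x ξ ∈ (Submodule.span ℝ {(x : EuclideanSpace ℝ (Fin 3))})ᗮ := by
    rw [← h]
    exact ⟨ξ, rfl⟩
  exact Submodule.mem_orthogonal_singleton_iff_inner_right.1 h2

end SphereProj

/-! ### The gauge chart extended to an open set of a vector space -/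

/-- The space `ℝ² × ℝ³` containing `ℝ² × S²`. -/
abbrev GaugeSpace : Type := (ℝ × ℝ) × EuclideanSpace ℝ (Fin 3)

namespace DoubleNullGauge

variable {M : Type*} [TopologicalSpace M] [ChartedSpace (EuclideanSpace ℝ (Fin 4)) M]
  [IsManifold (𝓡 4) ∞ M] {g : CovTensorField 2 M} (N : DoubleNullGauge g)

theorem isOpen_U : IsOpen N.U := by
  have h := N.chart.open_source
  rw [N.source_eq] at h
  have h2 : N.U = (fun q => (q, sphereProj 0)) ⁻¹' (N.U ×ˢ (univ : Set S2)) := by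
    ext q
    simp
  rw [h2]
  exact h.preimage (by fun_prop)

theorem isOpen_R : IsOpen N.R := N.chart.open_target

theorem mem_source {q : ℝ × ℝ} (hq : q ∈ N.U) (x : S2) : (q, x) ∈ N.chart.source := by
  rw [N.source_eq]
  exact ⟨hq, mem_univ _⟩

theorem chart_mem_R {q : ℝ × ℝ} (hq : q ∈ N.U) (x : S2) : N.chart (q, x) ∈ N.R :=
  N.chart.map_source (N.mem_source hq x)

theorem contMDiffAt_chart {q : ℝ × ℝ} (hq : q ∈ N.U) (x : S2) :
    ContMDiffAt (𝓘(ℝ, ℝ × ℝ).prod (𝓡 2)) (𝓡 4) ∞ N.chart (q, x) :=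
  N.smooth_chart.contMDiffAt (N.chart.open_source.mem_nhds (N.mem_source hq x))

theorem contMDiffAt_symm {p : M} (hp : p ∈ N.R) :
    ContMDiffAt (𝓡 4) (𝓘(ℝ, ℝ × ℝ).prod (𝓡 2)) ∞ N.chart.symm p :=
  N.smooth_symm.contMDiffAt (N.isOpen_R.mem_nhds hp)

theorem symm_chart {q : ℝ × ℝ} (hq : q ∈ N.U) (x : S2) : N.chart.symm (N.chart (q, x)) = (q, x) :=
  N.chart.left_inv (N.mem_source hq x)

/-- The derivative of the gauge chart is onto. -/
theorem mfderiv_chart_surjective {q : ℝ × ℝ} (hq : q ∈ N.U) (x : S2) :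
    Function.Surjective (mfderiv (𝓘(ℝ, ℝ × ℝ).prod (𝓡 2)) (𝓡 4) N.chart (q, x)) := by
  intro w
  have h1 := (N.contMDiffAt_chart hq x).mdifferentiableAt (by simp)
  have h2 := (N.contMDiffAt_symm (N.chart_mem_R hq x)).mdifferentiableAt (by simp)
  have h1' : MDifferentiableAt (𝓘(ℝ, ℝ × ℝ).prod (𝓡 2)) (𝓡 4) N.chart
      (N.chart.symm (N.chart (q, x))) := by rwa [N.symm_chart hq]
  have h3 := mfderiv_comp_apply (N.chart (q, x)) h1' h2 w
  have h4 : N.chart ∘ N.chart.symm =ᶠ[nhds (N.chart (q, x))] id := by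
    filter_upwards [N.isOpen_R.mem_nhds (N.chart_mem_R hq x)] with p hp
    exact N.chart.right_inv hp
  rw [h4.mfderiv_eq, mfderiv_id] at h3
  have h5 := h3.symm
  rw [N.symm_chart hq] at h5
  exact ⟨_, h5⟩

theorem mfderiv_chart_injective {q : ℝ × ℝ} (hq : q ∈ N.U) (x : S2) :
    Function.Injective (mfderiv (𝓘(ℝ, ℝ × ℝ).prod (𝓡 2)) (𝓡 4) N.chart (q, x)) := by
  have h1 := (N.contMDiffAt_chart hq x).mdifferentiableAt (by simp)
  have h2 := (N.contMDiffAt_symm (N.chart_mem_R hq x)).mdifferentiableAt (by simp)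
  have h4 : N.chart.symm ∘ N.chart =ᶠ[nhds (q, x)] id := by
    filter_upwards [N.chart.open_source.mem_nhds (N.mem_source hq x)] with p hp
    exact N.chart.left_inv hp
  intro v w hvw
  have h3 := mfderiv_comp_apply (q, x) h2 h1 v
  have h3' := mfderiv_comp_apply (q, x) h2 h1 w
  rw [h4.mfderiv_eq, mfderiv_id] at h3 h3'
  refine h3.trans (Eq.trans ?_ h3'.symm)
  rw [hvw]

/-- The gauge chart, extended to `U × (ℝ³ ∖ 0)` by homogeneity of degree zero. -/
def gaugeMap (y : GaugeSpace) : M := N.chart (y.1, sphereProj y.2)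

/-- The domain `U × (ℝ³ ∖ 0)` of `gaugeMap`. -/
def gaugeDom : Set GaugeSpace := {y | y.1 ∈ N.U ∧ y.2 ≠ 0}

theorem isOpen_gaugeDom : IsOpen N.gaugeDom :=
  (N.isOpen_U.preimage continuous_fst).inter (isOpen_compl_singleton.preimage continuous_snd)

theorem gaugeMap_mem_R {y : GaugeSpace} (hy : y ∈ N.gaugeDom) : N.gaugeMap y ∈ N.R :=
  N.chart_mem_R hy.1 _

theorem contMDiffAt_gaugeMap {y : GaugeSpace} (hy : y ∈ N.gaugeDom) :
    ContMDiffAt 𝓘(ℝ, GaugeSpace) (𝓡 4) ∞ N.gaugeMap y := by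
  have h1 : ContMDiffAt 𝓘(ℝ, GaugeSpace) 𝓘(ℝ, ℝ × ℝ) ∞ (fun y : GaugeSpace => y.1) y :=
    contDiff_fst.contMDiff.contMDiffAt
  have h2 : ContMDiffAt 𝓘(ℝ, GaugeSpace) (𝓡 2) ∞ (fun y : GaugeSpace => sphereProj y.2) y :=
    (contMDiffAt_sphereProj hy.2).comp y contDiff_snd.contMDiff.contMDiffAt
  exact (N.contMDiffAt_chart hy.1 _).comp y (h1.prodMk h2)

theorem eventually_contMDiffAt_gaugeMap {y : GaugeSpace} (hy : y ∈ N.gaugeDom) :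
    ∀ᶠ z in nhds y, ContMDiffAt 𝓘(ℝ, GaugeSpace) (𝓡 4) ∞ N.gaugeMap z := by
  filter_upwards [N.isOpen_gaugeDom.mem_nhds hy] with z hz using N.contMDiffAt_gaugeMap hz

theorem gaugeMap_smul {c : ℝ} (hc : 0 < c) (q : ℝ × ℝ) (x : S2) :
    N.gaugeMap (q, c • (x : EuclideanSpace ℝ (Fin 3))) = N.chart (q, x) := by
  rw [gaugeMap, sphereProj_smul hc]

theorem smul_mem_gaugeDom {c : ℝ} (hc : 0 < c) {q : ℝ × ℝ} (hq : q ∈ N.U) (x : S2) :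
    ((q, c • (x : EuclideanSpace ℝ (Fin 3))) : GaugeSpace) ∈ N.gaugeDom :=
  ⟨hq, smul_ne_zero hc.ne' (sphere_ne_zero x)⟩

theorem coe_mem_gaugeDom {q : ℝ × ℝ} (hq : q ∈ N.U) (x : S2) :
    ((q, (x : EuclideanSpace ℝ (Fin 3))) : GaugeSpace) ∈ N.gaugeDom :=
  ⟨hq, sphere_ne_zero x⟩

theorem gaugeMap_coe (q : ℝ × ℝ) (x : S2) :
    N.gaugeMap (q, (x : EuclideanSpace ℝ (Fin 3))) = N.chart (q, x) := by
  have := N.gaugeMap_smul one_pos q x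
  rwa [one_smul] at this

/-- The derivative of `gaugeMap`. -/
def gaugeT (y : GaugeSpace) : GaugeSpace →L[ℝ] TangentSpace (𝓡 4) (N.gaugeMap y) :=
  mfderiv 𝓘(ℝ, GaugeSpace) (𝓡 4) N.gaugeMap y

/-- Chain rule for the embedding `(q, x) ↦ (q, c x)`, whose composition with `gaugeMap` is the gauge
chart. The base points agree only propositionally, so the equality is stated in the model space. -/
theorem gaugeT_push_heq {c : ℝ} (hc : 0 < c) {q : ℝ × ℝ} (hq : q ∈ N.U) (x : S2) (w : ℝ × ℝ)
    (ξ : TangentSpace (𝓡 2) x) :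
    (N.gaugeT (q, c • (x : EuclideanSpace ℝ (Fin 3))) (w, c • sphereIncl x ξ) :
      EuclideanSpace ℝ (Fin 4))
      = (mfderiv (𝓘(ℝ, ℝ × ℝ).prod (𝓡 2)) (𝓡 4) N.chart (q, x) (w, ξ) :
        EuclideanSpace ℝ (Fin 4)) := by
  let L₁ : (ℝ × ℝ) →L[ℝ] GaugeSpace := ContinuousLinearMap.inl ℝ _ _
  let L₂ : EuclideanSpace ℝ (Fin 3) →L[ℝ] GaugeSpace := c • ContinuousLinearMap.inr ℝ _ _
  let σ : (ℝ × ℝ) × S2 → GaugeSpace := fun z => L₁ z.1 + L₂ (z.2 : EuclideanSpace ℝ (Fin 3))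
  have hσ : ∀ q x, σ (q, x) = (q, c • (x : EuclideanSpace ℝ (Fin 3))) := fun q x => by
    simp [σ, L₁, L₂]
  have h1 : HasMFDerivAt (𝓘(ℝ, ℝ × ℝ).prod (𝓡 2)) 𝓘(ℝ, GaugeSpace)
      (fun z : (ℝ × ℝ) × S2 => L₁ z.1) (q, x) _ :=
    (L₁.hasMFDerivAt (x := q)).comp (q, x) (hasMFDerivAt_fst (q, x))
  have h2 : HasMFDerivAt (𝓘(ℝ, ℝ × ℝ).prod (𝓡 2)) 𝓘(ℝ, GaugeSpace)
      (fun z : (ℝ × ℝ) × S2 => L₂ (z.2 : EuclideanSpace ℝ (Fin 3))) (q, x) _ :=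
    (L₂.hasMFDerivAt (x := (x : EuclideanSpace ℝ (Fin 3)))).comp (q, x)
      ((hasMFDerivAt_coe_sphere x).comp (q, x) (hasMFDerivAt_snd (q, x)))
  have h3 : HasMFDerivAt (𝓘(ℝ, ℝ × ℝ).prod (𝓡 2)) 𝓘(ℝ, GaugeSpace) σ (q, x) _ := h1.add h2
  have hmem := N.smul_mem_gaugeDom hc hq x
  have h4 : HasMFDerivAt 𝓘(ℝ, GaugeSpace) (𝓡 4) N.gaugeMap (σ (q, x)) _ :=
    (((N.contMDiffAt_gaugeMap (y := σ (q, x)) (by rwa [hσ])).mdifferentiableAt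
      (by simp)).hasMFDerivAt)
  have h5 := h4.comp (q, x) h3
  have h6 : N.gaugeMap ∘ σ = N.chart := by
    funext z
    obtain ⟨q, x⟩ := z
    rw [Function.comp_apply, hσ, N.gaugeMap_smul hc]
  rw [h6] at h5
  have h7 := congrArg (fun L => L (w, ξ)) h5.mfderiv
  have h8 : (L₁ w + L₂ (sphereIncl x ξ)) = (w, c • sphereIncl x ξ) := by simp [L₁, L₂]
  refine Eq.trans ?_ h7.symm
  show _ = mfderiv 𝓘(ℝ, GaugeSpace) (𝓡 4) N.gaugeMap (σ (q, x)) (L₁ w + L₂ (sphereIncl x ξ))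
  rw [h8, hσ]
  rfl

end DoubleNullGauge

/-! ### The distance to the origin -/

section NormSnd

theorem hasFDerivAt_norm_snd {y : GaugeSpace} (hy : y.2 ≠ 0) :
    HasFDerivAt (fun y : GaugeSpace => ‖y.2‖)
      ((‖y.2‖⁻¹ • innerSL ℝ y.2).comp (ContinuousLinearMap.snd ℝ (ℝ × ℝ) _)) y := by
  have h1 : HasFDerivAt (fun x : EuclideanSpace ℝ (Fin 3) => ‖x‖) (‖y.2‖⁻¹ • innerSL ℝ y.2) y.2 := by
    have h2 := (hasStrictFDerivAt_norm_sq y.2).hasFDerivAt.sqrt (by simpa using hy)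
    simp only [Real.sqrt_sq (norm_nonneg _)] at h2
    have h3 : (1 / (2 * ‖y.2‖)) • (2 : ℕ) • innerSL ℝ y.2 = ‖y.2‖⁻¹ • innerSL ℝ y.2 := by
      rw [← Nat.cast_smul_eq_nsmul ℝ, smul_smul]
      congr 1
      push_cast
      field_simp
    rwa [h3] at h2
  exact h1.comp y hasFDerivAt_snd

theorem fderiv_norm_snd {y : GaugeSpace} (hy : y.2 ≠ 0) (v : GaugeSpace) :
    fderiv ℝ (fun y : GaugeSpace => ‖y.2‖) y v = ‖y.2‖⁻¹ * inner ℝ y.2 v.2 := by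
  rw [(hasFDerivAt_norm_snd hy).fderiv]
  simp

theorem contDiffAt_norm_snd {y : GaugeSpace} (hy : y.2 ≠ 0) :
    ContDiffAt ℝ ∞ (fun y : GaugeSpace => ‖y.2‖) y :=
  (contDiffAt_norm ℝ hy).comp y contDiffAt_snd

/-- The standard basis of `GaugeSpace`. -/
def gaugeBasis : Module.Basis (Fin 2 ⊕ Fin 3) ℝ GaugeSpace :=
  (Module.Basis.finTwoProd ℝ).prod (EuclideanSpace.basisFun (Fin 3) ℝ).toBasis

end NormSnd

/-! ### The completed metric and the lift of a vector field -/

namespace DoubleNullGauge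

variable {M : Type*} [TopologicalSpace M] [ChartedSpace (EuclideanSpace ℝ (Fin 4)) M]
  [IsManifold (𝓡 4) ∞ M] {g : CovTensorField 2 M} (N : DoubleNullGauge g)

theorem exists_eq_smul {y : GaugeSpace} (hy : y ∈ N.gaugeDom) :
    ∃ c : ℝ, 0 < c ∧ ∃ q ∈ N.U, ∃ x : S2, y = (q, c • (x : EuclideanSpace ℝ (Fin 3))) :=
  ⟨‖y.2‖, norm_pos_iff.2 hy.2, y.1, hy.1, sphereProj y.2,
    Prod.ext rfl (norm_smul_sphereProj hy.2).symm⟩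

theorem gaugeT_surjective {y : GaugeSpace} (hy : y ∈ N.gaugeDom) :
    Function.Surjective (N.gaugeT y) := by
  obtain ⟨c, hc, q, hq, x, rfl⟩ := N.exists_eq_smul hy
  intro w
  obtain ⟨⟨a, ξ⟩, h⟩ := N.mfderiv_chart_surjective hq x w
  exact ⟨_, (N.gaugeT_push_heq hc hq x a ξ).trans h⟩

/-- Differentiate along the ray through `y`, on which `gaugeMap` is constant. -/
theorem gaugeT_radial {y : GaugeSpace} (hy : y ∈ N.gaugeDom) : N.gaugeT y (0, y.2) = 0 := by
  have h1 : HasFDerivAt (fun t : ℝ => (y.1, t • y.2)) (ContinuousLinearMap.toSpanSingleton ℝ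
      ((0, y.2) : GaugeSpace)) (1 : ℝ) := by
    have h := (hasDerivAt_const (1 : ℝ) y.1).prodMk ((hasDerivAt_id (1 : ℝ)).smul_const y.2)
    simp only [one_smul] at h
    exact h.hasFDerivAt
  have hy1 : ((y.1, (1 : ℝ) • y.2) : GaugeSpace) = y := by simp
  have h2 : MDifferentiableAt 𝓘(ℝ, GaugeSpace) (𝓡 4) N.gaugeMap (y.1, (1 : ℝ) • y.2) := by
    rw [hy1]
    exact (N.contMDiffAt_gaugeMap hy).mdifferentiableAt (by simp)
  have h3 := mfderiv_comp_apply (1 : ℝ) h2 h1.hasMFDerivAt.mdifferentiableAt (1 : ℝ)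
  have h4 : N.gaugeMap ∘ (fun t : ℝ => (y.1, t • y.2)) =ᶠ[nhds 1] fun _ => N.gaugeMap y := by
    filter_upwards [lt_mem_nhds (zero_lt_one' ℝ)] with t ht
    obtain ⟨c, hc, q, hq, x, rfl⟩ := N.exists_eq_smul hy
    rw [Function.comp_apply, N.gaugeMap_smul hc]
    dsimp only
    rw [smul_smul, N.gaugeMap_smul (mul_pos ht hc)]
  rw [h4.mfderiv_eq, mfderiv_const, h1.hasMFDerivAt.mfderiv] at h3
  have h5 : ContinuousLinearMap.toSpanSingleton ℝ ((0, y.2) : GaugeSpace) 1 = (0, y.2) := by simp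
  have h6 : (0 : EuclideanSpace ℝ (Fin 4)) = N.gaugeT (y.1, (1 : ℝ) • y.2) (0, y.2) := by
    rw [← h5]
    exact h3
  rw [hy1] at h6
  exact h6.symm

/-- The metric `Ψ^* g + dρ ⊗ dρ` on `gaugeDom`, with `Ψ` the map `gaugeMap` and `ρ` the distance
to the origin. -/
def gaugeForm (y : GaugeSpace) : GaugeSpace →L[ℝ] GaugeSpace →L[ℝ] ℝ :=
  pullForm g N.gaugeMap (fun y : GaugeSpace => ‖y.2‖) y

theorem gaugeForm_apply (y v w : GaugeSpace) :
    N.gaugeForm y v w = form2 g (N.gaugeMap y) (N.gaugeT y v) (N.gaugeT y w)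
      + fderiv ℝ (fun y : GaugeSpace => ‖y.2‖) y v * fderiv ℝ (fun y : GaugeSpace => ‖y.2‖) y w :=
  pullForm_apply g N.gaugeMap _ y v w

theorem contDiffAt_gaugeForm (hg : IsLorentzMetric g) {y : GaugeSpace} (hy : y ∈ N.gaugeDom) :
    ContDiffAt ℝ ∞ N.gaugeForm y :=
  contDiffAt_pullForm hg (N.eventually_contMDiffAt_gaugeMap hy) (contDiffAt_norm_snd hy.2)

/-- An instance of `mtrace_pull`: the kernel of the derivative contains the unit radial vector, on
which the differential of the distance equals one. -/
theorem gauge_mtrace (hg : IsLorentzMetric g) {y : GaugeSpace} (hy : y ∈ N.gaugeDom)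
    {β : TangentSpace (𝓡 4) (N.gaugeMap y) → TangentSpace (𝓡 4) (N.gaugeMap y) → ℝ}
    (hβ : IsBilin β) :
    (formMatrix gaugeBasis (N.gaugeForm y)).det ≠ 0 ∧
      ∑ i, ∑ j, (formMatrix gaugeBasis (N.gaugeForm y))⁻¹ i j
        * β (N.gaugeT y (gaugeBasis i)) (N.gaugeT y (gaugeBasis j))
      = ∑ a, ∑ b, gUp g (N.gaugeMap y) a b
        * β (basisVec (N.gaugeMap y) a) (basisVec (N.gaugeMap y) b) := by
  have hn : ‖y.2‖ ≠ 0 := norm_ne_zero_iff.2 hy.2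
  have h := mtrace_pull gaugeBasis (pointBasis (N.gaugeMap y)) (T := (N.gaugeT y).toLinearMap)
    (N.gaugeT_surjective hy) (l := (fderiv ℝ (fun y : GaugeSpace => ‖y.2‖) y).toLinearMap)
    (k := ‖y.2‖⁻¹ • ((0, y.2) : GaugeSpace))
    (by
      rw [map_smul]
      exact (congrArg (‖y.2‖⁻¹ • ·) (N.gaugeT_radial hy)).trans (smul_zero _))
    (by
      rw [map_smul, ContinuousLinearMap.coe_coe, fderiv_norm_snd hy.2, smul_eq_mul,
        real_inner_self_eq_norm_sq]
      field_simp)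
    (by simp) (form2_isBilin g _) hβ (hg.gramMat_det_ne_zero _)
  have hG : formMatrix gaugeBasis (N.gaugeForm y) = gramMat gaugeBasis fun v w =>
      form2 g (N.gaugeMap y) ((N.gaugeT y).toLinearMap v) ((N.gaugeT y).toLinearMap w)
      + (fderiv ℝ (fun y : GaugeSpace => ‖y.2‖) y).toLinearMap v
        * (fderiv ℝ (fun y : GaugeSpace => ‖y.2‖) y).toLinearMap w := by
    ext i j
    exact N.gaugeForm_apply y _ _
  rw [hG]
  refine ⟨h.1, ?_⟩
  rw [← mtrace_pointBasis]
  exact h.2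

/-- The lift of a vector field to `gaugeDom`, tangential to the spheres. -/
def gaugeLift (P : VecField M) (y : GaugeSpace) : GaugeSpace :=
  ∑ i, (∑ j, (formMatrix gaugeBasis (N.gaugeForm y))⁻¹ i j
    * form2 g (N.gaugeMap y) (N.gaugeT y (gaugeBasis j)) (P (N.gaugeMap y))) • gaugeBasis i

/-- The characteristic property of the lift: it is dual, with respect to the completed metric, to
the pull-back of the one-form `g(·, P)`. The formula with the inverse matrix makes its smoothness
evident. -/
theorem gaugeForm_gaugeLift (hg : IsLorentzMetric g) (P : VecField M) {y : GaugeSpace}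
    (hy : y ∈ N.gaugeDom) (v : GaugeSpace) :
    N.gaugeForm y v (N.gaugeLift P y) = form2 g (N.gaugeMap y) (N.gaugeT y v) (P (N.gaugeMap y)) := by
  have hdet := (N.gauge_mtrace hg hy (form2_isBilin g _)).1
  have hb := form2_isBilin g (N.gaugeMap y)
  have h1 : ∀ k, N.gaugeForm y (gaugeBasis k) (N.gaugeLift P y)
      = form2 g (N.gaugeMap y) (N.gaugeT y (gaugeBasis k)) (P (N.gaugeMap y)) := by
    intro k
    have h3 := congrFun (congrArg (fun A : Matrix _ _ ℝ => A.mulVec fun j =>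
      form2 g (N.gaugeMap y) (N.gaugeT y (gaugeBasis j)) (P (N.gaugeMap y)))
      (Matrix.mul_nonsing_inv (formMatrix gaugeBasis (N.gaugeForm y))
        (isUnit_iff_ne_zero.2 hdet))) k
    rw [← Matrix.mulVec_mulVec, Matrix.one_mulVec] at h3
    rw [← h3, gaugeLift, map_sum]
    simp only [map_smul, smul_eq_mul, Matrix.mulVec, dotProduct, formMatrix, Matrix.of_apply]
    exact Finset.sum_congr rfl fun i _ => mul_comm _ _
  have hl : IsLinearMap ℝ fun v => N.gaugeForm y v (N.gaugeLift P y) := by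
    refine ⟨fun v v' => ?_, fun c v => ?_⟩ <;> simp
  have hr : IsLinearMap ℝ fun v => form2 g (N.gaugeMap y) (N.gaugeT y v) (P (N.gaugeMap y)) :=
    ⟨fun a b => by rw [map_add, (hb.left _).map_add],
      fun c a => by rw [map_smul, (hb.left _).map_smul]⟩
  rw [hl.eq_sum_basis gaugeBasis v, hr.eq_sum_basis gaugeBasis v]
  exact Finset.sum_congr rfl fun k _ => by rw [h1]

/-- Test the characteristic property of the lift with the radial vector. The pull-back of `g` does
not see this vector, so only the product of the two derivatives of the distance remains. -/
theorem fderiv_norm_gaugeLift (hg : IsLorentzMetric g) (P : VecField M) {y : GaugeSpace}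
    (hy : y ∈ N.gaugeDom) :
    fderiv ℝ (fun y : GaugeSpace => ‖y.2‖) y (N.gaugeLift P y) = 0 := by
  have h := N.gaugeForm_gaugeLift hg P hy (0, y.2)
  have hb := form2_isBilin g (N.gaugeMap y)
  have e : ∀ v, form2 g (N.gaugeMap y) (N.gaugeT y (0, y.2)) v = 0 := fun v =>
    (congrArg (fun w => form2 g (N.gaugeMap y) w v) (N.gaugeT_radial hy)).trans (hb.left v).map_zero
  rw [N.gaugeForm_apply, e, e, zero_add, fderiv_norm_snd hy.2, real_inner_self_eq_norm_sq] at h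
  have hn : ‖y.2‖ ≠ 0 := norm_ne_zero_iff.2 hy.2
  refine (mul_eq_zero.1 h).resolve_left ?_
  positivity

theorem inner_gaugeLift (hg : IsLorentzMetric g) (P : VecField M) {y : GaugeSpace}
    (hy : y ∈ N.gaugeDom) : inner ℝ y.2 (N.gaugeLift P y).2 = 0 := by
  have h := N.fderiv_norm_gaugeLift hg P hy
  rw [fderiv_norm_snd hy.2] at h
  exact (mul_eq_zero.1 h).resolve_left (inv_ne_zero (norm_ne_zero_iff.2 hy.2))

theorem gaugeT_gaugeLift (hg : IsLorentzMetric g) (P : VecField M) {y : GaugeSpace}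
    (hy : y ∈ N.gaugeDom) : N.gaugeT y (N.gaugeLift P y) = P (N.gaugeMap y) := by
  have hb := form2_isBilin g (N.gaugeMap y)
  have h : ∀ w, form2 g (N.gaugeMap y) w (N.gaugeT y (N.gaugeLift P y))
      = form2 g (N.gaugeMap y) w (P (N.gaugeMap y)) := by
    intro w
    obtain ⟨v, rfl⟩ := N.gaugeT_surjective hy w
    have h1 := N.gaugeForm_gaugeLift hg P hy v
    rwa [N.gaugeForm_apply, N.fderiv_norm_gaugeLift hg P hy, mul_zero, add_zero] at h1
  rw [eq_sum_vecComp _ (N.gaugeT y (N.gaugeLift P y)), eq_sum_vecComp _ (P (N.gaugeMap y))]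
  refine Finset.sum_congr rfl fun i _ => ?_
  rw [← hg.sum_gUp_form2, ← hg.sum_gUp_form2]
  simp only [h]

/-- A vector field is smooth on `R`, in terms of charts. -/
def _root_.ChartSmoothOn (P : VecField M) (R : Set M) : Prop :=
  ∀ p ∈ R, ContMDiffAt (𝓡 4) 𝓘(ℝ, EuclideanSpace ℝ (Fin 4)) ∞ (fun q => chartD p q (P q)) p

theorem contDiffAt_formMatrix (hg : IsLorentzMetric g) {y : GaugeSpace} (hy : y ∈ N.gaugeDom)
    (i j : Fin 2 ⊕ Fin 3) :
    ContDiffAt ℝ ∞ (fun y => formMatrix gaugeBasis (N.gaugeForm y) i j) y :=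
  ((N.contDiffAt_gaugeForm hg hy).clm_apply contDiffAt_const).clm_apply contDiffAt_const

theorem contDiffAt_formMatrix_inv (hg : IsLorentzMetric g) {y : GaugeSpace} (hy : y ∈ N.gaugeDom)
    (i j : Fin 2 ⊕ Fin 3) :
    ContDiffAt ℝ ∞ (fun y => (formMatrix gaugeBasis (N.gaugeForm y))⁻¹ i j) y :=
  (ContMDiffAt.matrixInv (fun i j => (N.contDiffAt_formMatrix hg hy i j).contMDiffAt)
    (N.gauge_mtrace hg hy (form2_isBilin g _)).1 i j).contDiffAt

theorem contDiffAt_gaugeLift (hg : IsLorentzMetric g) {P : VecField M} (hP : ChartSmoothOn P N.R)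
    {y : GaugeSpace} (hy : y ∈ N.gaugeDom) : ContDiffAt ℝ ∞ (N.gaugeLift P) y := by
  have hψ := N.contMDiffAt_gaugeMap hy
  refine ContDiffAt.sum fun i _ => ContDiffAt.smul (ContDiffAt.sum fun j _ =>
    (N.contDiffAt_formMatrix_inv hg hy i j).mul ?_) contDiffAt_const
  refine ContDiffAlong.tensor hg.smooth (mem_univ _) le_rfl hψ
    (v := fun y => ![N.gaugeT y (gaugeBasis j), P (N.gaugeMap y)]) fun k => ?_
  fin_cases k
  · exact contDiffAlong_mfderiv (by simp) le_rfl hψ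
      ((N.eventually_contMDiffAt_gaugeMap hy).mono fun z hz => hz.mdifferentiableAt (by simp)) _
  · exact ((hP _ (N.gaugeMap_mem_R hy)).comp y hψ).contDiffAt

/-- The density of the volume form of `gaugeForm`. -/
def gaugeDensity (y : GaugeSpace) : ℝ := formDensity gaugeBasis (N.gaugeForm y)

theorem contDiffAt_gaugeDensity (hg : IsLorentzMetric g) {y : GaugeSpace} (hy : y ∈ N.gaugeDom) :
    ContDiffAt ℝ ∞ N.gaugeDensity y :=
  (ContMDiffAt.sqrt_abs (ContMDiffAt.matrixDet fun i j =>
    (N.contDiffAt_formMatrix hg hy i j).contMDiffAt)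
    (N.gauge_mtrace hg hy (form2_isBilin g _)).1).contDiffAt

/-- The divergence of the lift of a vector field. -/
theorem trace_fderiv_gaugeLift (hg : IsLorentzMetric g) {P : VecField M} (hP : ChartSmoothOn P N.R)
    {y : GaugeSpace} (hy : y ∈ N.gaugeDom) :
    ∑ i, gaugeBasis.repr (fderiv ℝ (fun z => N.gaugeDensity z • N.gaugeLift P z) y (gaugeBasis i)) i
      = N.gaugeDensity y * (1 / 2 * ∑ a, ∑ b, gUp g (N.gaugeMap y) a b
        * deformation g P (N.gaugeMap y) a b) := by
  have hdet := (N.gauge_mtrace hg hy (form2_isBilin g _)).1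
  have h1 := trace_fderiv_formDensity_smul gaugeBasis (h := N.gaugeForm) (X := N.gaugeLift P)
    ((N.contDiffAt_gaugeForm hg hy).differentiableAt (by simp))
    ((N.contDiffAt_gaugeLift hg hP hy).differentiableAt (by simp))
    (fun v w => by rw [N.gaugeForm_apply, N.gaugeForm_apply, hg.form2_symm]; ring) hdet
  refine h1.trans ?_
  rw [gaugeDensity]
  congr 2
  have hev : ∀ᶠ z in nhds y, z ∈ N.gaugeDom := N.isOpen_gaugeDom.mem_nhds hy
  have h2 := fun v w => lieForm_pullForm hg (N.eventually_contMDiffAt_gaugeMap hy)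
    (contDiffAt_norm_snd hy.2) (X := P) (fun c => mdifferentiableAt_chartVec (hP _
      (N.gaugeMap_mem_R hy)) c) ((N.contDiffAt_gaugeLift hg hP hy).differentiableAt (by simp))
    (hev.mono fun z hz => N.gaugeT_gaugeLift hg P hz)
    (hev.mono fun z hz => N.fderiv_norm_gaugeLift hg P hz) v w
  have h3 := (N.gauge_mtrace hg hy (deformationForm_isBilin g P _)).2
  simp only [deformationForm_basisVec] at h3
  rw [← h3]
  exact Finset.sum_congr rfl fun i _ => Finset.sum_congr rfl fun j _ => congrArg _ (h2 _ _)

end DoubleNullGauge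

/-! ### The round density from Gram determinants -/

section RoundDensity

/-- The Euclidean inner product of `GaugeSpace`. -/
def euclidForm (v w : GaugeSpace) : ℝ := v.1.1 * w.1.1 + v.1.2 * w.1.2 + inner ℝ v.2 w.2

theorem euclidForm_isBilin : IsBilin euclidForm := by
  refine ⟨fun w => ⟨fun v v' => ?_, fun c v => ?_⟩, fun w => ⟨fun v v' => ?_, fun c v => ?_⟩⟩ <;>
    simp [euclidForm, inner_add_left, inner_add_right, inner_smul_left, inner_smul_right] <;> ring

theorem gramMat_euclidForm : gramMat gaugeBasis euclidForm = 1 := by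
  ext i j
  rcases i with i | i <;> rcases j with j | j <;> fin_cases i <;> fin_cases j <;>
    simp [gramMat, gaugeBasis, euclidForm, EuclideanSpace.inner_single_left]

theorem sphereVec_eq (x : S2) (A : Fin 2) : sphereVec x A = sphereIncl x (sphereBasis x A) := rfl

/-- The vectors `∂_u, ∂_v`, the coordinate vectors of the sphere and the normal of the sphere. -/
def sphereFrame (x : S2) : Fin 4 ⊕ Unit → GaugeSpace :=
  Sum.elim ![((1, 0), sphereIncl x 0), ((0, 1), sphereIncl x 0),
    ((0, 0), sphereIncl x (sphereBasis x 0)), ((0, 0), sphereIncl x (sphereBasis x 1))]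
    fun _ => (0, x)

theorem linearIndependent_sphereFrame (x : S2) : LinearIndependent ℝ (sphereFrame x) := by
  have hx : inner ℝ (x : EuclideanSpace ℝ (Fin 3)) (x : EuclideanSpace ℝ (Fin 3)) = 1 := by
    rw [real_inner_self_eq_norm_sq, norm_eq_of_mem_sphere, one_pow]
  rw [Fintype.linearIndependent_iff]
  intro c hc
  simp only [Fintype.sum_sum_type, Finset.univ_unique, Finset.sum_singleton, Fin.sum_univ_four,
    sphereFrame, Sum.elim_inl, Sum.elim_inr, Matrix.cons_val_zero, Matrix.cons_val_one,
    Matrix.cons_val_two, Matrix.cons_val_three, map_zero] at hc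
  have h1 := congrArg (fun z : GaugeSpace => z.1.1) hc
  have h2 := congrArg (fun z : GaugeSpace => z.1.2) hc
  have h3 := congrArg (fun z : GaugeSpace => z.2) hc
  simp at h1 h2 h3
  have h4 := congrArg (fun z => inner ℝ (x : EuclideanSpace ℝ (Fin 3)) z) h3
  simp only [inner_add_right, inner_smul_right, inner_sphereIncl, hx, inner_zero_right] at h4
  have h5 : c (Sum.inr ()) = 0 := by simpa using h4
  have h6 : sphereIncl x (c (Sum.inl 2) • sphereBasis x 0 + c (Sum.inl 3) • sphereBasis x 1) = 0 := by
    rw [map_add, map_smul, map_smul]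
    simpa [h5] using h3
  have h7 := sphereIncl_injective x (h6.trans (map_zero _).symm)
  have h8 : ∀ i, (c (Sum.inl 2) • EuclideanSpace.single (0 : Fin 2) (1 : ℝ)
      + c (Sum.inl 3) • EuclideanSpace.single (1 : Fin 2) (1 : ℝ) : EuclideanSpace ℝ (Fin 2)) i = 0 :=
    fun i => congrArg (fun z : EuclideanSpace ℝ (Fin 2) => z i) h7
  have h9 := h8 0
  have h10 := h8 1
  simp at h9 h10
  rintro (i | i)
  · fin_cases i
    · exact h1
    · exact h2
    · exact h9
    · exact h10
  · exact h5

/-- `sphereFrame` as a basis. -/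
def sphereFrameBasis (x : S2) : Module.Basis (Fin 4 ⊕ Unit) ℝ GaugeSpace :=
  basisOfLinearIndependentOfCardEqFinrank (linearIndependent_sphereFrame x)
    (by rw [Module.finrank_eq_card_basis gaugeBasis]; simp)

theorem coe_sphereFrameBasis (x : S2) : ⇑(sphereFrameBasis x) = sphereFrame x :=
  coe_basisOfLinearIndependentOfCardEqFinrank _ _

theorem det_gramMat_euclidForm (x : S2) : (gramMat (sphereFrame x) euclidForm).det
    = Matrix.det (fun A B : Fin 2 => (inner ℝ (sphereVec x A) (sphereVec x B) : ℝ)) := by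
  have hx : inner ℝ (x : EuclideanSpace ℝ (Fin 3)) (x : EuclideanSpace ℝ (Fin 3)) = 1 := by
    rw [real_inner_self_eq_norm_sq, norm_eq_of_mem_sphere, one_pow]
  have hx1 : ‖(x : EuclideanSpace ℝ (Fin 3))‖ = 1 := norm_eq_of_mem_sphere x
  have hx' : ∀ ξ, inner ℝ (sphereIncl x ξ) (x : EuclideanSpace ℝ (Fin 3)) = 0 := fun ξ => by
    rw [real_inner_comm, inner_sphereIncl]
  have h : gramMat (sphereFrame x) euclidForm = Matrix.fromBlocks
      !![1, 0, 0, 0; 0, 1, 0, 0;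
        0, 0, inner ℝ (sphereVec x 0) (sphereVec x 0), inner ℝ (sphereVec x 0) (sphereVec x 1);
        0, 0, inner ℝ (sphereVec x 1) (sphereVec x 0), inner ℝ (sphereVec x 1) (sphereVec x 1)]
      0 0 1 := by
    ext i j
    rcases i with i | i <;> rcases j with j | j <;> (try fin_cases i) <;> (try fin_cases j) <;>
      simp [gramMat, sphereFrame, euclidForm, inner_sphereIncl, hx', hx1, sphereVec_eq]
  rw [h, Matrix.det_fromBlocks_zero₂₁, Matrix.det_one, mul_one]
  refine Eq.trans ?_ (Matrix.det_fin_two _).symm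
  simp [Matrix.det_succ_row_zero, Fin.sum_univ_succ]
  ring

/-- The Euclidean Gram matrix of the standard basis is the identity, so that of any other basis has
the square of a nonzero determinant; `sphereFrame` adds only orthonormal directions to the two
tangent vectors of the sphere. -/
theorem roundDet_pos (x : S2) :
    0 < Matrix.det (fun A B : Fin 2 => (inner ℝ (sphereVec x A) (sphereVec x B) : ℝ)) := by
  have h := gramMat_basis_change euclidForm_isBilin gaugeBasis
    ((sphereFrameBasis x).reindex (gaugeBasis.indexEquiv (sphereFrameBasis x)).symm)
  rw [gramMat_euclidForm, Matrix.mul_one] at h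
  have h3 : gramMat ((sphereFrameBasis x).reindex (gaugeBasis.indexEquiv (sphereFrameBasis x)).symm)
      euclidForm = (gramMat (sphereFrame x) euclidForm).submatrix
        (gaugeBasis.indexEquiv (sphereFrameBasis x)) (gaugeBasis.indexEquiv (sphereFrameBasis x)) := by
    ext i j
    simp [gramMat, coe_sphereFrameBasis]
  have h4 := congrArg Matrix.det h
  rw [h3, Matrix.det_submatrix_equiv_self, det_gramMat_euclidForm, Matrix.det_mul,
    Matrix.det_transpose] at h4
  rw [h4]
  refine mul_self_pos.2 fun h0 => ?_
  have h5 := congrArg Matrix.det (gaugeBasis.toMatrix_mul_toMatrix_flip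
    ((sphereFrameBasis x).reindex (gaugeBasis.indexEquiv (sphereFrameBasis x)).symm))
  rw [Matrix.det_mul, h0, zero_mul, Matrix.det_one] at h5
  exact zero_ne_one h5

theorem roundDensity_pos (x : S2) : 0 < roundDensity x := Real.sqrt_pos.2 (roundDet_pos x)

end RoundDensity

/-! ### Volume densities in the double null gauge -/

namespace DoubleNullGauge

variable {M : Type*} [TopologicalSpace M] [ChartedSpace (EuclideanSpace ℝ (Fin 4)) M]
  [IsManifold (𝓡 4) ∞ M] {g : CovTensorField 2 M} (N : DoubleNullGauge g)

theorem gaugeT_coe {q : ℝ × ℝ} (hq : q ∈ N.U) (x : S2) (a c : ℝ) (ξ : TangentSpace (𝓡 2) x) :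
    (N.gaugeT (q, (x : EuclideanSpace ℝ (Fin 3))) ((a, c), sphereIncl x ξ) :
      EuclideanSpace ℝ (Fin 4)) = (N.push q x a c ξ : EuclideanSpace ℝ (Fin 4)) := by
  have h := N.gaugeT_push_heq one_pos hq x (a, c) ξ
  rwa [one_smul, one_smul] at h

theorem form2_congr_point (T : CovTensorField 2 M) {p p' : M} (h : p = p')
    (v w : EuclideanSpace ℝ (Fin 4)) : form2 T p v w = form2 T p' v w := by
  subst h
  rfl

theorem form2_gaugeT (T : CovTensorField 2 M) {q : ℝ × ℝ} (hq : q ∈ N.U) (x : S2) (a c a' c' : ℝ)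
    (ξ ξ' : TangentSpace (𝓡 2) x) :
    form2 T (N.gaugeMap (q, (x : EuclideanSpace ℝ (Fin 3))))
      (N.gaugeT (q, (x : EuclideanSpace ℝ (Fin 3))) ((a, c), sphereIncl x ξ))
      (N.gaugeT (q, (x : EuclideanSpace ℝ (Fin 3))) ((a', c'), sphereIncl x ξ'))
      = form2 T (N.chart (q, x)) (N.push q x a c ξ) (N.push q x a' c' ξ') :=
  (congrArg₂ (fun v w : EuclideanSpace ℝ (Fin 4) =>
    form2 T (N.gaugeMap (q, (x : EuclideanSpace ℝ (Fin 3)))) v w)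
    (N.gaugeT_coe hq x a c ξ) (N.gaugeT_coe hq x a' c' ξ')).trans
    (form2_congr_point T (N.gaugeMap_coe q x) _ _)

theorem form2_push {q : ℝ × ℝ} (hq : q ∈ N.U) (x : S2) (a c a' c' : ℝ)
    (ξ ξ' : TangentSpace (𝓡 2) x) :
    form2 g (N.chart (q, x)) (N.push q x a c ξ) (N.push q x a' c' ξ')
      = -2 * N.Ω q x ^ 2 * (a * c' + c * a') + N.γ q x (ξ - c • N.b q x) (ξ' - c' • N.b q x) :=
  N.metric_eq q hq x a c a' c' ξ ξ'

/-- The determinant of `γ` in the coordinate basis of the sphere. -/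
def gammaDet (q : ℝ × ℝ) (x : S2) : ℝ :=
  Matrix.det (fun A B : Fin 2 => N.γ q x (sphereBasis x A) (sphereBasis x B))

theorem gammaDet_eq {q : ℝ × ℝ} (hq : q ∈ N.U) (x : S2) : N.gammaDet q x
    = N.γ q x (sphereBasis x 0) (sphereBasis x 0) * N.γ q x (sphereBasis x 1) (sphereBasis x 1)
      - N.γ q x (sphereBasis x 0) (sphereBasis x 1) ^ 2 := by
  refine (Matrix.det_fin_two _).trans ?_
  rw [N.γ_symm q hq x (sphereBasis x 1) (sphereBasis x 0)]
  ring

theorem gammaDet_nonneg {q : ℝ × ℝ} (hq : q ∈ N.U) (x : S2) : 0 ≤ N.gammaDet q x := by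
  rw [N.gammaDet_eq hq]
  set α := N.γ q x (sphereBasis x 0) (sphereBasis x 0) with hα
  set β := N.γ q x (sphereBasis x 0) (sphereBasis x 1) with hβ
  set δ := N.γ q x (sphereBasis x 1) (sphereBasis x 1) with hδ
  have hnn : ∀ ξ, 0 ≤ N.γ q x ξ ξ := fun ξ => by
    rcases eq_or_ne ξ 0 with rfl | h
    · simp
    · exact (N.γ_pos q hq x ξ h).le
  have h0 : sphereBasis x 0 ≠ 0 := by
    intro h
    have := congrArg (fun z : EuclideanSpace ℝ (Fin 2) => z 0) h
    simp [sphereBasis] at this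
    exact one_ne_zero this
  have hα0 : 0 < α := N.γ_pos q hq x _ h0
  -- Cauchy–Schwarz: this vector is `α` times the component of the second basis vector orthogonal to
  -- the first, so its square is `α` times the determinant.
  have h1 := hnn (α • sphereBasis x 1 - β • sphereBasis x 0)
  have h2 : N.γ q x (α • sphereBasis x 1 - β • sphereBasis x 0)
      (α • sphereBasis x 1 - β • sphereBasis x 0) = α * (α * δ - β ^ 2) := by
    simp only [map_sub, map_smul, sub_apply, smul_apply, smul_eq_mul,
      N.γ_symm q hq x (sphereBasis x 1) (sphereBasis x 0), ← hα, ← hβ, ← hδ]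
    ring
  rw [h2] at h1
  exact nonneg_of_mul_nonneg_right h1 hα0

theorem sphereDensity_eq (q : ℝ × ℝ) (x : S2) :
    N.sphereDensity q x = Real.sqrt (N.gammaDet q x) / roundDensity x := rfl

/-- The frame `∂_u, ∂_v, ∂_1, ∂_2`. -/
def pushFrame (q : ℝ × ℝ) (x : S2) : Fin 4 → TangentSpace (𝓡 4) (N.chart (q, x)) :=
  ![N.push q x 1 0 0, N.push q x 0 1 0, N.push q x 0 0 (sphereBasis x 0),
    N.push q x 0 0 (sphereBasis x 1)]

/-- The shift does not appear because replacing `∂_v` by `∂_v + b^A ∂_A` is a unimodular change of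
frame, after which the matrix splits into a null block and `γ`. -/
theorem det_pushFrame {q : ℝ × ℝ} (hq : q ∈ N.U) (x : S2) :
    Matrix.det (fun i j => g (N.chart (q, x)) ![N.pushFrame q x i, N.pushFrame q x j])
      = -4 * N.Ω q x ^ 4 * N.gammaDet q x := by
  have h : (fun i j => g (N.chart (q, x)) ![N.pushFrame q x i, N.pushFrame q x j])
      = !![0, -2 * N.Ω q x ^ 2, 0, 0;
          -2 * N.Ω q x ^ 2, N.γ q x (N.b q x) (N.b q x), -N.γ q x (N.b q x) (sphereBasis x 0),
            -N.γ q x (N.b q x) (sphereBasis x 1);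
          0, -N.γ q x (sphereBasis x 0) (N.b q x), N.γ q x (sphereBasis x 0) (sphereBasis x 0),
            N.γ q x (sphereBasis x 0) (sphereBasis x 1);
          0, -N.γ q x (sphereBasis x 1) (N.b q x), N.γ q x (sphereBasis x 1) (sphereBasis x 0),
            N.γ q x (sphereBasis x 1) (sphereBasis x 1)] := by
    ext i j
    fin_cases i <;> fin_cases j <;> refine (N.form2_push hq x _ _ _ _ _ _).trans ?_ <;> simp
  rw [h, N.gammaDet_eq hq]
  simp [Matrix.det_succ_row_zero, Fin.sum_univ_succ, Fin.succAbove,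
    N.γ_symm q hq x (sphereBasis x 1) (sphereBasis x 0)]
  ring

theorem gramDensity_pushFrame {q : ℝ × ℝ} (hq : q ∈ N.U) (x : S2) :
    gramDensity g (N.chart (q, x)) (N.pushFrame q x)
      = 2 * N.Ω q x ^ 2 * Real.sqrt (N.gammaDet q x) := by
  rw [gramDensity, N.det_pushFrame hq]
  have h1 : |-4 * N.Ω q x ^ 4 * N.gammaDet q x| = (2 * N.Ω q x ^ 2) ^ 2 * N.gammaDet q x := by
    rw [abs_mul, abs_of_nonneg (N.gammaDet_nonneg hq x), abs_of_nonpos (by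
      have := pow_pos (N.Ω_pos q hq x) 4
      linarith)]
    ring
  rw [h1, Real.sqrt_mul (by positivity), Real.sqrt_sq (by positivity)]

theorem bulkDensity_eq {q : ℝ × ℝ} (hq : q ∈ N.U) (x : S2) :
    N.bulkDensity q x = 2 * N.Ω q x ^ 2 * N.sphereDensity q x := by
  rw [bulkDensity, sphereDensity_eq]
  refine (congrArg (· / roundDensity x) (N.gramDensity_pushFrame hq x)).trans ?_
  ring

/-- Compare the completed metric with the Euclidean form in two bases by `gramMat_det_mul`. In the
standard basis the Euclidean determinant is one; in `sphereFrame` it is the square of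
`roundDensity`, and the completed metric has the Gram determinant of `pushFrame`. -/
theorem gaugeDensity_coe {q : ℝ × ℝ} (hq : q ∈ N.U) (x : S2) :
    N.gaugeDensity (q, (x : EuclideanSpace ℝ (Fin 3))) = N.bulkDensity q x := by
  set y : GaugeSpace := (q, (x : EuclideanSpace ℝ (Fin 3))) with hy
  have hyD : y ∈ N.gaugeDom := N.coe_mem_gaugeDom hq x
  have hx1 : ‖(x : EuclideanSpace ℝ (Fin 3))‖ = 1 := norm_eq_of_mem_sphere x
  have hform := isBilin_pull_add (form2_isBilin g (N.gaugeMap y)) (N.gaugeT y).toLinearMap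
    (fderiv ℝ (fun y : GaugeSpace => ‖y.2‖) y).toLinearMap
  have h1 := gramMat_det_mul gaugeBasis (sphereFrameBasis x) hform euclidForm_isBilin
  rw [gramMat_euclidForm, Matrix.det_one, mul_one, coe_sphereFrameBasis,
    det_gramMat_euclidForm] at h1
  have h2 := gramMat_adapted (form2_isBilin g (N.gaugeMap y))
    (fun a => N.gaugeT y (sphereFrame x (Sum.inl a))) (T := (N.gaugeT y).toLinearMap)
    (l := (fderiv ℝ (fun y : GaugeSpace => ‖y.2‖) y).toLinearMap) (f := sphereFrame x)
    (fun a => rfl)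
    (fun a => by
      rw [ContinuousLinearMap.coe_coe, fderiv_norm_snd hyD.2]
      fin_cases a <;> simp [sphereFrame, hy, inner_sphereIncl])
    (N.gaugeT_radial hyD)
    (by
      rw [ContinuousLinearMap.coe_coe, fderiv_norm_snd hyD.2]
      simp [sphereFrame, hy, hx1])
  rw [h2, Matrix.det_fromBlocks_zero₂₁, Matrix.det_one, mul_one] at h1
  have h3 : gramMat (fun a => N.gaugeT y (sphereFrame x (Sum.inl a))) (form2 g (N.gaugeMap y))
      = fun i j => g (N.chart (q, x)) ![N.pushFrame q x i, N.pushFrame q x j] := by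
    ext i j
    fin_cases i <;> fin_cases j <;> exact N.form2_gaugeT g hq x _ _ _ _ _ _
  have h4 : gramDensity g (N.chart (q, x)) (N.pushFrame q x)
      = N.gaugeDensity y * roundDensity x := by
    rw [gramDensity, ← h3, h1, abs_mul, abs_of_pos (roundDet_pos x), Real.sqrt_mul (abs_nonneg _)]
    congr 3
    refine congrArg Matrix.det ?_
    ext i j
    exact (N.gaugeForm_apply y _ _).symm
  rw [bulkDensity, eq_div_iff (roundDensity_pos x).ne']
  exact h4.symm

end DoubleNullGauge

/-! ### The divergence theorem on the sphere -/

section SphereDivergence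

local notation "E₃" => EuclideanSpace ℝ (Fin 3)

/-- The integral of a divergence over the whole space vanishes. -/
theorem integral_divergence_eq_zero {W : E₃ → E₃} (hW : ContDiff ℝ 1 W) (hc : HasCompactSupport W) :
    ∫ x, ∑ i, fderiv ℝ W x (EuclideanSpace.single i 1) i = 0 := by
  have hint : ∀ i, Integrable (fun x => fderiv ℝ W x (EuclideanSpace.single i 1) i) := fun i => by
    refine Continuous.integrable_of_hasCompactSupport ?_ ?_
    · have := (hW.continuous_fderiv (by simp)).clm_apply
        (continuous_const (y := (EuclideanSpace.single i (1 : ℝ) : E₃)))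
      exact (EuclideanSpace.proj i : E₃ →L[ℝ] ℝ).continuous.comp this
    · exact ((hc.fderiv (𝕜 := ℝ)).comp_left (g := fun L : E₃ →L[ℝ] E₃ =>
        L (EuclideanSpace.single i 1) i) (by simp))
  rw [integral_finsetSum _ fun i _ => hint i]
  refine Finset.sum_eq_zero fun i _ => ?_
  have hd : ∀ x, fderiv ℝ (fun x => W x i) x (EuclideanSpace.single i 1)
      = fderiv ℝ W x (EuclideanSpace.single i 1) i := fun x => by
    have h := ((EuclideanSpace.proj i : E₃ →L[ℝ] ℝ).hasFDerivAt.comp x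
      ((hW.differentiable (by simp)) x).hasFDerivAt).fderiv
    exact congrArg (fun L => L (EuclideanSpace.single i (1 : ℝ))) h
  have h := integral_mul_fderiv_eq_neg_fderiv_mul_of_integrable (μ := (volume : Measure E₃))
    (f := fun _ => (1 : ℝ)) (g := fun x => W x i) (v := EuclideanSpace.single i (1 : ℝ))
    (by simp) (by simpa [hd] using hint i)
    (by
      simp only [one_mul]
      refine Continuous.integrable_of_hasCompactSupport ?_ ?_
      · exact (EuclideanSpace.proj i : E₃ →L[ℝ] ℝ).continuous.comp hW.continuous
      · exact hc.comp_left (g := fun v : E₃ => v i) (by simp))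
    (fun x _ => by fun_prop)
    (fun x _ => (EuclideanSpace.proj i : E₃ →L[ℝ] ℝ).differentiableAt.comp x
      ((hW.differentiable (by simp)) x))
  simpa [hd] using h

/-- Integrals in polar coordinates of products of a radial and an angular function. -/
theorem integral_radial_mul_angular (a : ℝ → ℝ) (b : S2 → ℝ) :
    ∫ x : E₃, a ‖x‖ * b (sphereProj x)
      = (∫ x, b x ∂roundMeasure) * ∫ s : Ioi (0 : ℝ), a s ∂Measure.volumeIoiPow 2 := by
  have h1 : ∫ x : E₃, a ‖x‖ * b (sphereProj x)
      = ∫ x : ({0}ᶜ : Set E₃), a ‖(x : E₃)‖ * b (sphereProj x)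
        ∂((volume : Measure E₃).comap Subtype.val) := by
    rw [integral_subtype_comap (measurableSet_singleton _).compl
      fun x : E₃ => a ‖x‖ * b (sphereProj x), restrict_compl_singleton]
  have h2 := ((volume : Measure E₃).measurePreserving_homeomorphUnitSphereProd).integral_comp
    (Homeomorph.measurableEmbedding _) (fun z : Metric.sphere (0 : E₃) 1 × Ioi (0 : ℝ) => b z.1 * a z.2)
  have h3 : Module.finrank ℝ E₃ - 1 = 2 := by simp
  rw [h1]
  rw [integral_prod_mul (fun x => b x) fun s : Ioi (0 : ℝ) => a s, h3] at h2
  rw [roundMeasure, ← h2]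
  refine integral_congr_ae (Filter.Eventually.of_forall fun x => ?_)
  have h4 : sphereProj (x : E₃) = (homeomorphUnitSphereProd E₃ x).1 := by
    apply Subtype.ext
    rw [coe_sphereProj x.2]
    simp
  simp only [h4, mul_comm, homeomorphUnitSphereProd_apply_snd_coe]

/-- A bump function of the distance to the origin, supported away from the origin. -/
def radialBump : ContDiffBump (1 : ℝ) := ⟨1 / 4, 1 / 2, by norm_num, by norm_num⟩

theorem radialBump_eq_zero {t : ℝ} (ht : t ≤ 1 / 2 ∨ 3 / 2 ≤ t) : radialBump t = 0 := by
  refine radialBump.zero_of_le_dist ?_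
  rw [Real.dist_eq]
  show (1 / 2 : ℝ) ≤ _
  rcases ht with h | h
  · rw [abs_of_nonpos (by linarith)]; linarith
  · rw [abs_of_nonneg (by linarith)]; linarith

theorem radialBump_one : radialBump 1 = 1 :=
  radialBump.one_of_mem_closedBall (by simpa using radialBump.rIn_pos.le)

/-- Polar coordinates with the angular function one: if the radial integral vanished, so would the
integral over space of a nonnegative continuous function that is positive at a unit vector. -/
theorem integral_radialBump_pos :
    (∫ s : Ioi (0 : ℝ), radialBump s * (s : ℝ)⁻¹ ∂Measure.volumeIoiPow 2) ≠ 0 := by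
  intro h0
  have h := integral_radial_mul_angular (fun s => radialBump s * s⁻¹) fun _ => 1
  rw [h0, mul_zero] at h
  simp only [mul_one] at h
  have hc : Continuous fun x : E₃ => radialBump ‖x‖ * ‖x‖⁻¹ := by
    rw [continuous_iff_continuousAt]
    intro x
    rcases eq_or_ne x 0 with rfl | hx
    · have : (fun x : E₃ => radialBump ‖x‖ * ‖x‖⁻¹) =ᶠ[nhds 0] fun _ => 0 := by
        filter_upwards [Metric.ball_mem_nhds (0 : E₃) (ε := 1 / 2) (by norm_num)] with x hx
        rw [radialBump_eq_zero (Or.inl (by simpa using (mem_ball_zero_iff.1 hx).le)), zero_mul]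
      exact continuousAt_const.congr this.symm
    · exact (radialBump.continuous.continuousAt.comp continuous_norm.continuousAt).mul
        (continuous_norm.continuousAt.inv₀ (norm_ne_zero_iff.2 hx))
  have hs : HasCompactSupport fun x : E₃ => radialBump ‖x‖ * ‖x‖⁻¹ := by
    refine HasCompactSupport.intro (isCompact_closedBall (0 : E₃) 2) fun x hx => ?_
    rw [radialBump_eq_zero (Or.inr ?_), zero_mul]
    have : 2 < ‖x‖ := by simpa using hx
    linarith
  have := hc.integral_pos_of_hasCompactSupport_nonneg_nonzero (μ := volume) hs
    (fun x => mul_nonneg radialBump.nonneg (inv_nonneg.2 (norm_nonneg _)))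
    (x := EuclideanSpace.single 0 1) (by simp [radialBump_one])
  exact this.ne' h

theorem hasFDerivAt_norm {x : E₃} (hx : x ≠ 0) :
    HasFDerivAt (fun x : E₃ => ‖x‖) (‖x‖⁻¹ • innerSL ℝ x) x := by
  have h2 := (hasStrictFDerivAt_norm_sq x).hasFDerivAt.sqrt (by simpa using hx)
  simp only [Real.sqrt_sq (norm_nonneg _)] at h2
  have h3 : (1 / (2 * ‖x‖)) • (2 : ℕ) • innerSL ℝ x = ‖x‖⁻¹ • innerSL ℝ x := by
    rw [← Nat.cast_smul_eq_nsmul ℝ, smul_smul]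
    congr 1
    push_cast
    field_simp
  rwa [h3] at h2

/-- The integral over the sphere of the divergence of a tangential vector field vanishes. -/
theorem integral_sphere_divergence {Z : E₃ → E₃} (hZ : ∀ x, x ≠ 0 → ContDiffAt ℝ 1 Z x)
    (ht : ∀ x, x ≠ 0 → inner ℝ x (Z x) = 0) :
    ∫ x : S2, ∑ i, fderiv ℝ Z x (EuclideanSpace.single i 1) i ∂roundMeasure = 0 := by
  have hn0 : ∀ {x : E₃}, x ≠ 0 → ‖x‖⁻¹ • x ≠ 0 := fun hx =>
    smul_ne_zero (inv_ne_zero (norm_ne_zero_iff.2 hx)) hx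
  -- Extend the values on the sphere constantly along rays and cut off. The divergence of `W`
  -- integrates to zero over space, and for tangential `Z` it factors into a radial function and the
  -- divergence on the sphere.
  let W : E₃ → E₃ := fun x => radialBump ‖x‖ • Z (‖x‖⁻¹ • x)
  have hWs : ∀ x, x ≠ 0 → ContDiffAt ℝ 1 W x := by
    intro x hx
    have h1 : ContDiffAt ℝ 1 (fun x : E₃ => ‖x‖) x := contDiffAt_norm ℝ hx
    have h2 : ContDiffAt ℝ 1 (fun x : E₃ => ‖x‖⁻¹ • x) x :=
      (h1.inv (norm_ne_zero_iff.2 hx)).smul contDiffAt_id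
    exact (radialBump.contDiff.contDiffAt.comp x h1).smul
      (ContDiffAt.comp (f := fun x : E₃ => ‖x‖⁻¹ • x) x (hZ _ (hn0 hx)) h2)
  have hW : ContDiff ℝ 1 W := by
    rw [contDiff_iff_contDiffAt]
    intro x
    rcases eq_or_ne x 0 with rfl | hx
    · have : W =ᶠ[nhds 0] fun _ => 0 := by
        filter_upwards [Metric.ball_mem_nhds (0 : E₃) (ε := 1 / 2) (by norm_num)] with x hx
        show radialBump ‖x‖ • _ = (0 : E₃)
        rw [radialBump_eq_zero (Or.inl (by simpa using (mem_ball_zero_iff.1 hx).le)), zero_smul]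
      exact contDiffAt_const.congr_of_eventuallyEq this
    · exact hWs x hx
  have hWc : HasCompactSupport W := by
    refine HasCompactSupport.intro (isCompact_closedBall (0 : E₃) 2) fun x hx => ?_
    have : 2 < ‖x‖ := by simpa using hx
    show radialBump ‖x‖ • _ = (0 : E₃)
    rw [radialBump_eq_zero (Or.inr (by linarith)), zero_smul]
  have h0 := integral_divergence_eq_zero hW hWc
  have key : ∀ x : E₃, x ≠ 0 → ∑ i, fderiv ℝ W x (EuclideanSpace.single i 1) i
      = (radialBump ‖x‖ * ‖x‖⁻¹)
        * ∑ i, fderiv ℝ Z (sphereProj x) (EuclideanSpace.single i 1) i := by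
    intro x hx
    set n := ‖x‖⁻¹ • x with hn
    have hxn : ‖x‖ ≠ 0 := norm_ne_zero_iff.2 hx
    have hnn : n ≠ 0 := hn0 hx
    rw [coe_sphereProj hx, ← hn]
    have d1 := hasFDerivAt_norm hx
    have d2 : HasFDerivAt (fun x : E₃ => radialBump ‖x‖) (deriv radialBump ‖x‖ • (‖x‖⁻¹ • innerSL ℝ x)) x :=
      ((radialBump.contDiff (n := 1)).differentiable (by simp) ‖x‖).hasDerivAt.comp_hasFDerivAt x d1
    have d3 : HasFDerivAt (fun x : E₃ => ‖x‖⁻¹) (-(‖x‖ ^ 2)⁻¹ • (‖x‖⁻¹ • innerSL ℝ x)) x :=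
      (hasDerivAt_inv hxn).comp_hasFDerivAt x d1
    have d4 := d3.smul (hasFDerivAt_id x)
    have d5 := ((hZ n hnn).differentiableAt (by simp)).hasFDerivAt
    have d6 := d2.smul (HasFDerivAt.comp x (f := fun x : E₃ => ‖x‖⁻¹ • x) d5 d4)
    have hW' : fderiv ℝ W x = _ := d6.fderiv
    -- the radial derivative of the normal component
    have e1 : inner ℝ n (fderiv ℝ Z n n) = 0 := by
      have h1 : HasFDerivAt (fun x => inner ℝ x (Z x)) _ n := (hasFDerivAt_id n).inner ℝ d5
      have h2 : (fun x => inner ℝ x (Z x)) =ᶠ[nhds n] fun _ => 0 := by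
        filter_upwards [isOpen_ne.mem_nhds hnn] with y hy using ht y hy
      have h3 := h1.fderiv.symm
      rw [h2.fderiv_eq, fderiv_const_apply] at h3
      have h4 := congrArg (fun L => L n) h3
      have h5 := ht n hnn
      simpa [fderivInnerCLM_apply, h5] using h4
    have e2 : ∑ i, n i * Z n i = 0 := by
      have := ht n hnn
      simpa [PiLp.inner_apply, mul_comm] using this
    have e3 : ∑ i, n i * fderiv ℝ Z n n i = 0 := by
      simpa [PiLp.inner_apply, mul_comm] using e1
    have e4 : ∀ i, x i = ‖x‖ * n i := fun i => by
      rw [hn, PiLp.smul_apply, smul_eq_mul, mul_inv_cancel_left₀ hxn]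
    have e5 : x = ‖x‖ • n := by rw [hn, smul_inv_smul₀ hxn]
    have e6 : ∀ i, fderiv ℝ W x (EuclideanSpace.single i 1) i
        = radialBump ‖x‖ * ‖x‖⁻¹ * fderiv ℝ Z n (EuclideanSpace.single i 1) i
          - radialBump ‖x‖ * ‖x‖⁻¹ * (n i * fderiv ℝ Z n n i)
          + deriv radialBump ‖x‖ * (n i * Z n i) := by
      intro i
      have e7 : fderiv ℝ Z n x i = ‖x‖ * fderiv ℝ Z n n i := by
        conv_lhs => rw [e5]
        rw [map_smul]
        rfl
      have e8 : inner ℝ x (EuclideanSpace.single i (1 : ℝ)) = ‖x‖ * n i := by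
        rw [← e4]; simp [EuclideanSpace.inner_single_right]
      rw [hW']
      simp [← hn, e7, e8]
      field_simp
      ring
    simp only [e6, Finset.sum_add_distrib, Finset.sum_sub_distrib, ← Finset.mul_sum, e2, e3]
    ring
  have h1 := integral_radial_mul_angular (fun s => radialBump s * s⁻¹)
    fun x : S2 => ∑ i, fderiv ℝ Z x (EuclideanSpace.single i 1) i
  have h2 : ∫ x : E₃, ∑ i, fderiv ℝ W x (EuclideanSpace.single i 1) i
      = ∫ x : E₃, (radialBump ‖x‖ * ‖x‖⁻¹)
        * ∑ i, fderiv ℝ Z (sphereProj x) (EuclideanSpace.single i 1) i := by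
    refine integral_congr_ae ?_
    have : ∀ᵐ x : E₃, x ≠ 0 := Measure.ae_ne volume 0
    filter_upwards [this] with x hx using key x hx
  rw [← h2, h0] at h1
  exact (mul_eq_zero.1 h1.symm).resolve_right integral_radialBump_pos

end SphereDivergence

/-! ### Sphere integrals depending on parameters -/

section SphereIntegrals

local notation "E₃" => EuclideanSpace ℝ (Fin 3)

instance instIsFiniteMeasureRound : IsFiniteMeasure roundMeasure := by
  unfold roundMeasure; infer_instance

theorem continuousOn_sphereIntegral {U : Set (ℝ × ℝ)} {f : GaugeSpace → ℝ}
    (hf : ∀ q ∈ U, ∀ x : S2, ContinuousAt f (q, (x : E₃))) :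
    ContinuousOn (fun q => ∫ x : S2, f (q, (x : E₃)) ∂roundMeasure) U := by
  refine continuousOn_integral_of_compact_support (f := fun q (x : S2) => f (q, (x : E₃)))
    (k := univ) isCompact_univ ?_ (fun _ _ _ h => absurd (mem_univ _) h)
  rintro ⟨q, x⟩ ⟨hq, -⟩
  have h : Continuous fun z : (ℝ × ℝ) × S2 => ((z.1, (z.2 : E₃)) : GaugeSpace) := by fun_prop
  exact (ContinuousAt.comp (f := fun z : (ℝ × ℝ) × S2 => ((z.1, (z.2 : E₃)) : GaugeSpace))
    (hf q hq x) h.continuousAt).continuousWithinAt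

theorem integrable_sphere {f : S2 → ℝ} (hf : Continuous f) : Integrable f roundMeasure :=
  hf.integrable_of_hasCompactSupport (HasCompactSupport.of_compactSpace f)

/-- Differentiation under the integral sign. A constant dominates the derivative because it is
continuous on a compact parameter interval times the sphere. -/
theorem hasDerivAt_sphereIntegral {U : Set (ℝ × ℝ)} (hU : IsOpen U) {f : GaugeSpace → ℝ}
    (hf : ∀ y : GaugeSpace, y.1 ∈ U → y.2 ≠ 0 → ContDiffAt ℝ 1 f y) (q₀ e : ℝ × ℝ) {t₀ : ℝ}
    (ht : q₀ + t₀ • e ∈ U) :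
    HasDerivAt (fun t : ℝ => ∫ x : S2, f (q₀ + t • e, (x : E₃)) ∂roundMeasure)
      (∫ x : S2, fderiv ℝ f (q₀ + t₀ • e, (x : E₃)) (e, 0) ∂roundMeasure) t₀ := by
  have hγ : Continuous fun t : ℝ => q₀ + t • e := by fun_prop
  obtain ⟨ε, hε, hball⟩ := Metric.nhds_basis_closedBall.mem_iff.1
    (hγ.continuousAt.preimage_mem_nhds (hU.mem_nhds ht))
  let j : ℝ × S2 → GaugeSpace := fun z => (q₀ + z.1 • e, (z.2 : E₃))
  have hj : Continuous j := by fun_prop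
  have hjmem : ∀ t ∈ Metric.closedBall t₀ ε, ∀ x : S2, ContDiffAt ℝ 1 f (q₀ + t • e, (x : E₃)) :=
    fun t ht x => hf _ (hball ht) (sphere_ne_zero x)
  have hcont : ContinuousOn (fun z => fderiv ℝ f (j z) (e, 0)) (Metric.closedBall t₀ ε ×ˢ univ) := by
    rintro ⟨t, x⟩ ⟨ht, -⟩
    have h1 : ContinuousAt (fun y => fderiv ℝ f y (e, 0)) (j (t, x)) :=
      ((hjmem t ht x).fderiv_right (m := 0) (by simp)).continuousAt.clm_apply continuousAt_const
    exact (ContinuousAt.comp (f := j) h1 hj.continuousAt).continuousWithinAt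
  obtain ⟨C, hC⟩ := ((isCompact_closedBall t₀ ε).prod isCompact_univ).exists_bound_of_continuousOn
    hcont
  have hx : ∀ t ∈ Metric.closedBall t₀ ε, Continuous fun x : S2 => f (q₀ + t • e, (x : E₃)) := by
    intro t ht
    rw [continuous_iff_continuousAt]
    intro x
    exact ContinuousAt.comp (f := fun x : S2 => ((q₀ + t • e, (x : E₃)) : GaugeSpace))
      (hjmem t ht x).continuousAt (by fun_prop)
  have hx' : Continuous fun x : S2 => fderiv ℝ f (q₀ + t₀ • e, (x : E₃)) (e, 0) := by
    have h2 := hcont.comp_continuous (f := fun x : S2 => (t₀, x)) (by fun_prop)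
      (fun x => ⟨Metric.mem_closedBall_self hε.le, mem_univ _⟩)
    exact h2
  refine (hasDerivAt_integral_of_dominated_loc_of_deriv_le (μ := roundMeasure)
    (F := fun t (x : S2) => f (q₀ + t • e, (x : E₃)))
    (F' := fun t (x : S2) => fderiv ℝ f (q₀ + t • e, (x : E₃)) (e, 0)) (bound := fun _ => C)
    (Metric.closedBall_mem_nhds t₀ hε) ?_ ?_ ?_ ?_ ?_ ?_).2
  · filter_upwards [Metric.closedBall_mem_nhds t₀ hε] with t ht
    exact (hx t ht).aestronglyMeasurable
  · exact integrable_sphere (hx t₀ (Metric.mem_closedBall_self hε.le))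
  · exact hx'.aestronglyMeasurable
  · exact Filter.Eventually.of_forall fun x t ht => hC (t, x) ⟨ht, mem_univ _⟩
  · exact integrable_const _
  · refine Filter.Eventually.of_forall fun x t ht => ?_
    have h1 : HasDerivAt (fun t : ℝ => ((q₀ + t • e, (x : E₃)) : GaugeSpace)) (e, 0) t := by
      have h2 := ((hasDerivAt_const t q₀).add ((hasDerivAt_id t).smul_const e)).prodMk
        (hasDerivAt_const t (x : E₃))
      simpa using h2
    exact (((hjmem t ht x).differentiableAt (by simp)).hasFDerivAt).comp_hasDerivAt t h1

theorem gaugeBasis_trace (L : GaugeSpace →L[ℝ] GaugeSpace) :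
    ∑ i, gaugeBasis.repr (L (gaugeBasis i)) i = (L ((1, 0), 0)).1.1 + (L ((0, 1), 0)).1.2
      + ∑ k, (L (0, EuclideanSpace.single k 1)).2 k := by
  simp [gaugeBasis, Fintype.sum_sum_type, Fin.sum_univ_two]

/-- The divergence theorem on `U × S²`, integrated over the spheres. -/
theorem sphereIntegral_trace {U : Set (ℝ × ℝ)} {V : GaugeSpace → GaugeSpace}
    (hV : ∀ y : GaugeSpace, y.1 ∈ U → y.2 ≠ 0 → ContDiffAt ℝ 1 V y)
    (ht : ∀ y : GaugeSpace, y.1 ∈ U → y.2 ≠ 0 → inner ℝ y.2 (V y).2 = 0) {q : ℝ × ℝ} (hq : q ∈ U) :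
    ∫ x : S2, ∑ i, gaugeBasis.repr (fderiv ℝ V (q, (x : E₃)) (gaugeBasis i)) i ∂roundMeasure
      = (∫ x : S2, fderiv ℝ (fun y => (V y).1.1) (q, (x : E₃)) ((1, 0), 0) ∂roundMeasure)
        + ∫ x : S2, fderiv ℝ (fun y => (V y).1.2) (q, (x : E₃)) ((0, 1), 0) ∂roundMeasure := by
  have hc : ∀ v : GaugeSpace, Continuous fun x : S2 => fderiv ℝ V (q, (x : E₃)) v := by
    intro v
    rw [continuous_iff_continuousAt]
    intro x
    have h1 : ContinuousAt (fun y => fderiv ℝ V y v) ((q, (x : E₃)) : GaugeSpace) :=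
      ((hV _ hq (sphere_ne_zero x)).fderiv_right (m := 0) (by simp)).continuousAt.clm_apply
        continuousAt_const
    exact ContinuousAt.comp (f := fun x : S2 => ((q, (x : E₃)) : GaugeSpace)) h1 (by fun_prop)
  have hd : ∀ x : S2, HasFDerivAt V (fderiv ℝ V (q, (x : E₃))) (q, (x : E₃)) := fun x =>
    ((hV _ hq (sphere_ne_zero x)).differentiableAt (by simp)).hasFDerivAt
  have e1 : ∀ x : S2, fderiv ℝ (fun y => (V y).1.1) (q, (x : E₃)) ((1, 0), 0)
      = (fderiv ℝ V (q, (x : E₃)) ((1, 0), 0)).1.1 := fun x => by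
    rw [((hd x).fst.fst).fderiv]
    rfl
  have e2 : ∀ x : S2, fderiv ℝ (fun y => (V y).1.2) (q, (x : E₃)) ((0, 1), 0)
      = (fderiv ℝ V (q, (x : E₃)) ((0, 1), 0)).1.2 := fun x => by
    rw [((hd x).fst.snd).fderiv]
    rfl
  have e3 := integral_sphere_divergence (Z := fun x => (V (q, x)).2)
    (fun x hx => (ContDiffAt.comp x (f := fun x : E₃ => ((q, x) : GaugeSpace)) (hV (q, x) hq hx)
      (contDiffAt_const.prodMk contDiffAt_id)).snd) (fun x hx => ht (q, x) hq hx)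
  have e4 : ∀ (x : S2) v, fderiv ℝ (fun x => (V (q, x)).2) x v
      = (fderiv ℝ V (q, (x : E₃)) (0, v)).2 := fun x v => by
    have h1 : HasFDerivAt (fun x : E₃ => ((q, x) : GaugeSpace)) (ContinuousLinearMap.inr ℝ _ _)
        (x : E₃) := hasFDerivAt_prodMk_right q (x : E₃)
    have h2 : HasFDerivAt (fun x : E₃ => (V (q, x)).2) _ (x : E₃) := ((hd x).comp (x : E₃) h1).snd
    rw [h2.fderiv]
    rfl
  simp only [e4] at e3
  simp only [e1, e2, gaugeBasis_trace]
  rw [integral_add, integral_add, e3, add_zero]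
  · exact integrable_sphere (continuous_fst.comp (continuous_fst.comp (hc _)))
  · exact integrable_sphere (continuous_snd.comp (continuous_fst.comp (hc _)))
  · exact integrable_sphere ((continuous_fst.comp (continuous_fst.comp (hc _))).add
      (continuous_snd.comp (continuous_fst.comp (hc _))))
  · refine integrable_sphere (continuous_finsetSum _ fun k _ => ?_)
    exact (EuclideanSpace.proj k : E₃ →L[ℝ] ℝ).continuous.comp (continuous_snd.comp (hc _))

end SphereIntegrals

/-! ### Derivatives of the area radius -/

namespace DoubleNullGauge

variable {M : Type*} [TopologicalSpace M] [ChartedSpace (EuclideanSpace ℝ (Fin 4)) M]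
  [IsManifold (𝓡 4) ∞ M] {g : CovTensorField 2 M} (N : DoubleNullGauge g)

theorem radiusFun_chart {q : ℝ × ℝ} (hq : q ∈ N.U) (x : S2) :
    N.radiusFun (N.chart (q, x)) = N.radius q := by rw [radiusFun, N.symm_chart hq]

theorem push_eq_zero_iff {q : ℝ × ℝ} (hq : q ∈ N.U) (x : S2) (a c : ℝ) (ξ : TangentSpace (𝓡 2) x) :
    N.push q x a c ξ = 0 ↔ a = 0 ∧ c = 0 ∧ ξ = 0 := by
  have h0 : N.push q x a c ξ = 0 ↔ (((a, c), ξ) : (ℝ × ℝ) × TangentSpace (𝓡 2) x) = 0 :=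
    ⟨fun h => N.mfderiv_chart_injective hq x (h.trans (map_zero _).symm),
      fun h => (congrArg (mfderiv (𝓘(ℝ, ℝ × ℝ).prod (𝓡 2)) (𝓡 4) N.chart (q, x)) h).trans
        (map_zero _)⟩
  rw [h0]
  refine (Prod.ext_iff.trans (and_congr_left' Prod.ext_iff)).trans ?_
  exact and_assoc

/-- At a point of non-differentiability the derivative is zero by convention. Every vector would
then count as tangent to the level, including the null vector `∂_u`, which is not spacelike. -/
theorem mdifferentiableAt_radiusFun (hr : N.LevelsSpacelike) {q : ℝ × ℝ} (hq : q ∈ N.U) (x : S2) :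
    MDifferentiableAt (𝓡 4) 𝓘(ℝ, ℝ) N.radiusFun (N.chart (q, x)) := by
  by_contra h
  have h1 : mvfderiv (𝓡 4) N.radiusFun (N.chart (q, x)) = 0 := by
    have := mfderiv_zero_of_not_mdifferentiableAt h
    ext v
    exact congrArg (fun L => L v) this
  have h2 := hr _ (N.chart_mem_R hq x) (N.push q x 1 0 0)
    (fun h => one_ne_zero ((N.push_eq_zero_iff hq x _ _ _).1 h).1) (by rw [h1]; rfl)
  have h3 := N.form2_push hq x 1 0 1 0 0 0
  have h4 := h2.trans_eq h3
  simp at h4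

theorem differentiableAt_radius (hr : N.LevelsSpacelike) {q : ℝ × ℝ} (hq : q ∈ N.U) :
    DifferentiableAt ℝ N.radius q := by
  let x : S2 := sphereProj 0
  have h1 : MDifferentiableAt 𝓘(ℝ, ℝ × ℝ) (𝓘(ℝ, ℝ × ℝ).prod (𝓡 2)) (fun q : ℝ × ℝ => (q, x)) q :=
    mdifferentiableAt_id.prodMk mdifferentiableAt_const
  have h2 := ((N.mdifferentiableAt_radiusFun hr hq x).comp q
    (((N.contMDiffAt_chart hq x).mdifferentiableAt (by simp)).comp q h1)).differentiableAt
  refine h2.congr_of_eventuallyEq ?_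
  filter_upwards [N.isOpen_U.mem_nhds hq] with q' hq'
  exact (N.radiusFun_chart hq' x).symm

theorem mvfderiv_radiusFun_push (hr : N.LevelsSpacelike) {q : ℝ × ℝ} (hq : q ∈ N.U) (x : S2)
    (a c : ℝ) (ξ : TangentSpace (𝓡 2) x) :
    mvfderiv (𝓡 4) N.radiusFun (N.chart (q, x)) (N.push q x a c ξ) = fderiv ℝ N.radius q (a, c) := by
  have h1 := (N.mdifferentiableAt_radiusFun hr hq x).hasMFDerivAt.comp (q, x)
    ((N.contMDiffAt_chart hq x).mdifferentiableAt (by simp)).hasMFDerivAt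
  have h2 : HasMFDerivAt (𝓘(ℝ, ℝ × ℝ).prod (𝓡 2)) 𝓘(ℝ, ℝ)
      (fun z : (ℝ × ℝ) × S2 => N.radius z.1) (q, x) _ :=
    HasMFDerivAt.comp (g := N.radius) (q, x)
      (N.differentiableAt_radius hr hq).hasFDerivAt.hasMFDerivAt (hasMFDerivAt_fst (q, x))
  have h3 : (fun z : (ℝ × ℝ) × S2 => N.radius z.1) =ᶠ[nhds (q, x)] N.radiusFun ∘ N.chart := by
    filter_upwards [N.chart.open_source.mem_nhds (N.mem_source hq x)] with z hz
    rw [N.source_eq] at hz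
    exact (N.radiusFun_chart hz.1 z.2).symm
  have h4 := hasMFDerivAt_unique (h2.congr_of_eventuallyEq h3.symm) h1
  exact congrArg (fun L => L ((a, c), ξ)) h4.symm

/-- The derivatives of the radius in the null directions are nonzero and of the same sign. -/
theorem radius_deriv_pos (hr : N.LevelsSpacelike) {q : ℝ × ℝ} (hq : q ∈ N.U) :
    0 < fderiv ℝ N.radius q (1, 0) * fderiv ℝ N.radius q (0, 1) := by
  let x : S2 := sphereProj 0
  have hd : ∀ a c : ℝ, fderiv ℝ N.radius q (a, c)
      = a * fderiv ℝ N.radius q (1, 0) + c * fderiv ℝ N.radius q (0, 1) := by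
    intro a c
    rw [← smul_eq_mul, ← smul_eq_mul, ← map_smul, ← map_smul, ← map_add]
    simp
  -- Taking `c b` as spherical part cancels the `γ` term, so the vector has square `-4Ω² a c`. The
  -- choice `(∂_v r, -∂_u r)` below is tangent to the level and gives the sign of the product.
  have key : ∀ a c : ℝ, ¬ (a = 0 ∧ c = 0) → fderiv ℝ N.radius q (a, c) = 0 →
      0 < -2 * N.Ω q x ^ 2 * (a * c + c * a) := by
    intro a c hac h0
    have h2 := hr _ (N.chart_mem_R hq x) (N.push q x a c (c • N.b q x))
      (fun h => hac ⟨((N.push_eq_zero_iff hq x _ _ _).1 h).1,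
        ((N.push_eq_zero_iff hq x _ _ _).1 h).2.1⟩)
      ((N.mvfderiv_radiusFun_push hr hq x _ _ _).trans h0)
    have h4 := h2.trans_eq (N.form2_push hq x a c a c _ _)
    simpa using h4
  set ru := fderiv ℝ N.radius q (1, 0) with hru
  set rv := fderiv ℝ N.radius q (0, 1) with hrv
  have hΩ := N.Ω_pos q hq x
  by_cases h : ru = 0
  · have := key 1 0 (by simp) (by rw [hd, h]; ring)
    simp at this
  · have := key rv (-ru) (fun h' => h (neg_eq_zero.1 h'.2)) (by rw [hd]; ring)
    have h5 : -2 * N.Ω q x ^ 2 * (rv * -ru + -ru * rv) = 4 * N.Ω q x ^ 2 * (ru * rv) := by ring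
    rw [h5] at this
    exact pos_of_mul_pos_right this (by positivity)

end DoubleNullGauge

/-! ### Flux densities as components of the lifted current -/

namespace DoubleNullGauge

variable {M : Type*} [TopologicalSpace M] [ChartedSpace (EuclideanSpace ℝ (Fin 4)) M]
  [IsManifold (𝓡 4) ∞ M] {g : CovTensorField 2 M} (N : DoubleNullGauge g)

theorem vecField_congr_point (P : VecField M) {p p' : M} (h : p = p') :
    (P p : EuclideanSpace ℝ (Fin 4)) = P p' := by
  subst h
  rfl

/-- A vector field in terms of its lift. -/
theorem exists_push_gaugeLift (hg : IsLorentzMetric g) (P : VecField M) {q : ℝ × ℝ} (hq : q ∈ N.U)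
    (x : S2) : ∃ ξ : TangentSpace (𝓡 2) x, P (N.chart (q, x))
      = N.push q x (N.gaugeLift P (q, (x : EuclideanSpace ℝ (Fin 3)))).1.1
        (N.gaugeLift P (q, (x : EuclideanSpace ℝ (Fin 3)))).1.2 ξ := by
  have hy := N.coe_mem_gaugeDom hq x
  obtain ⟨ξ, hξ⟩ := exists_sphereIncl_eq x (N.inner_gaugeLift hg P hy)
  refine ⟨ξ, (vecField_congr_point P (N.gaugeMap_coe q x)).symm.trans ?_⟩
  refine (N.gaugeT_gaugeLift hg P hy).symm.trans (Eq.trans ?_ (N.gaugeT_coe hq x _ _ ξ))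
  rw [hξ]

theorem form2_gradV (hg : IsLorentzMetric g) (p : M) (w : TangentSpace (𝓡 4) p) :
    form2 g p w (N.gradV p) = -mvfderiv (𝓡 4) N.radiusFun p w := by
  have h1 : N.gradV p = sharp g (fun p => ofComp p fun i => -partialD N.radiusFun p (i 0)) p := by
    refine Finset.sum_congr rfl fun a _ => congrArg (· • basisVec p a) ?_
    rw [← Finset.sum_neg_distrib]
    refine Finset.sum_congr rfl fun c _ => ?_
    have : (![basisVec p c] : Fin 1 → TangentSpace (𝓡 4) p) = fun j => basisVec p (![c] j) := by
      funext j
      fin_cases j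
      rfl
    rw [this, ofComp_basisVec]
    simp
  have h2 := flat_apply g (sharp g fun p => ofComp p fun i => -partialD N.radiusFun p (i 0)) p ![w]
  rw [hg.flat_sharp, ofComp_apply, ← (Equiv.funUnique (Fin 1) (Fin 4)).symm.sum_comp] at h2
  rw [h1]
  refine h2.symm.trans ?_
  have h3 : IsLinearMap ℝ fun w => mvfderiv (𝓡 4) N.radiusFun p w :=
    ⟨fun v w => map_add _ v w, fun c v => map_smul _ c v⟩
  rw [h3.eq_sum_basisVec w, ← Finset.sum_neg_distrib]
  refine Finset.sum_congr rfl fun i _ => ?_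
  simp only [Finset.univ_unique, Fin.default_eq_zero, Finset.prod_singleton, partialD]
  exact (neg_mul _ _).trans (congrArg Neg.neg (mul_comm _ _))

theorem fderiv_radius_apply (q : ℝ × ℝ) (a c : ℝ) : fderiv ℝ N.radius q (a, c)
    = a * fderiv ℝ N.radius q (1, 0) + c * fderiv ℝ N.radius q (0, 1) := by
  rw [← smul_eq_mul, ← smul_eq_mul, ← map_smul, ← map_smul, ← map_add]
  simp

/-- Pairing `V` with `∂_u` and with `∂_v + b` reads off its null components `∂_u r / (2Ω²)` along
`∂_v` and `∂_v r / (2Ω²)` along `∂_u`; then `g(V, V) = -dr(V)`. -/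
theorem form2_gradV_gradV (hg : IsLorentzMetric g) (hr : N.LevelsSpacelike) {q : ℝ × ℝ}
    (hq : q ∈ N.U) (x : S2) : form2 g (N.chart (q, x)) (N.gradV (N.chart (q, x)))
      (N.gradV (N.chart (q, x)))
      = -(fderiv ℝ N.radius q (1, 0) * fderiv ℝ N.radius q (0, 1) / N.Ω q x ^ 2) := by
  obtain ⟨a, c, ξ, hw'⟩ : ∃ (a c : ℝ) (ξ : TangentSpace (𝓡 2) x),
      N.gradV (N.chart (q, x)) = N.push q x a c ξ := by
    obtain ⟨⟨⟨a, c⟩, ξ⟩, hw⟩ := N.mfderiv_chart_surjective hq x (N.gradV (N.chart (q, x)))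
    exact ⟨a, c, ξ, hw.symm⟩
  have hΩ := N.Ω_pos q hq x
  have h1 := (N.form2_gradV hg (N.chart (q, x)) (N.push q x 1 0 0))
  have h2 := (N.form2_gradV hg (N.chart (q, x)) (N.push q x 0 1 (N.b q x)))
  have h3 := (N.form2_gradV hg (N.chart (q, x)) (N.push q x a c ξ))
  rw [N.mvfderiv_radiusFun_push hr hq, hw'] at h1 h2 h3
  rw [N.form2_push hq] at h1 h2
  rw [hw', h3, N.fderiv_radius_apply]
  simp only [one_smul, zero_smul, sub_self, map_zero, zero_apply] at h1 h2
  rw [← neg_eq_iff_eq_neg] at h1 h2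
  rw [← h1, ← h2]
  field_simp
  ring

theorem form2_gradV_current (hg : IsLorentzMetric g) (hr : N.LevelsSpacelike) (P : VecField M)
    {q : ℝ × ℝ} (hq : q ∈ N.U) (x : S2) :
    form2 g (N.chart (q, x)) (N.gradV (N.chart (q, x))) (P (N.chart (q, x)))
      = -fderiv ℝ N.radius q (N.gaugeLift P (q, (x : EuclideanSpace ℝ (Fin 3)))).1 := by
  obtain ⟨ξ, h⟩ := N.exists_push_gaugeLift hg P hq x
  rw [hg.form2_symm, N.form2_gradV hg, h, N.mvfderiv_radiusFun_push hr hq]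

theorem sphereTangent_eq (x : S2) (ξ : TangentSpace (𝓡 2) x) :
    ∃ s t : ℝ, ξ = s • sphereBasis x 0 + t • sphereBasis x 1 := by
  let ζ : EuclideanSpace ℝ (Fin 2) := ξ
  refine ⟨ζ 0, ζ 1, ?_⟩
  have : ζ = ζ 0 • EuclideanSpace.single (0 : Fin 2) (1 : ℝ) + ζ 1 • EuclideanSpace.single 1 (1 : ℝ) := by
    ext i
    fin_cases i <;> simp
  exact this

/-- The frame `∂_u + m ∂_v, ∂_1, ∂_2`. -/
def levelFrame (q : ℝ × ℝ) (x : S2) (m : ℝ) : Fin 3 → TangentSpace (𝓡 4) (N.chart (q, x)) :=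
  ![N.push q x 1 m 0, N.push q x 0 0 (sphereBasis x 0), N.push q x 0 0 (sphereBasis x 1)]

theorem det_levelFrame {q : ℝ × ℝ} (hq : q ∈ N.U) (x : S2) (m : ℝ) :
    Matrix.det (fun i j => g (N.chart (q, x)) ![N.levelFrame q x m i, N.levelFrame q x m j])
      = -4 * N.Ω q x ^ 2 * m * N.gammaDet q x := by
  have h : (fun i j => g (N.chart (q, x)) ![N.levelFrame q x m i, N.levelFrame q x m j])
      = !![-4 * N.Ω q x ^ 2 * m + m ^ 2 * N.γ q x (N.b q x) (N.b q x),
            -m * N.γ q x (N.b q x) (sphereBasis x 0), -m * N.γ q x (N.b q x) (sphereBasis x 1);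
          -m * N.γ q x (sphereBasis x 0) (N.b q x), N.γ q x (sphereBasis x 0) (sphereBasis x 0),
            N.γ q x (sphereBasis x 0) (sphereBasis x 1);
          -m * N.γ q x (sphereBasis x 1) (N.b q x), N.γ q x (sphereBasis x 1) (sphereBasis x 0),
            N.γ q x (sphereBasis x 1) (sphereBasis x 1)] := by
    ext i j
    fin_cases i <;> fin_cases j <;> refine (N.form2_push hq x _ _ _ _ _ _).trans ?_ <;> simp
    ring
  rw [h, N.gammaDet_eq hq]
  obtain ⟨s, t, hb⟩ := sphereTangent_eq x (N.b q x)
  rw [hb]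
  simp only [map_add, map_smul, add_apply, smul_apply, smul_eq_mul, Matrix.det_fin_three,
    N.γ_symm q hq x (sphereBasis x 1) (sphereBasis x 0)]
  simp
  ring

theorem slope_neg (hr : N.LevelsSpacelike) {q : ℝ × ℝ} (hq : q ∈ N.U) : N.slope q < 0 := by
  have h := N.radius_deriv_pos hr hq
  rw [slope, neg_div, neg_lt_zero]
  exact div_pos_iff.2 (mul_pos_iff.1 h)

theorem levelDensity_eq (hr : N.LevelsSpacelike) {q : ℝ × ℝ} (hq : q ∈ N.U) (x : S2) :
    N.levelDensity q x = 2 * N.Ω q x * Real.sqrt (-N.slope q) * N.sphereDensity q x := by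
  have hm := N.slope_neg hr hq
  have hΩ := N.Ω_pos q hq x
  have hγ := N.gammaDet_nonneg hq x
  have h : gramDensity g (N.chart (q, x)) (N.levelFrame q x (N.slope q))
      = 2 * N.Ω q x * Real.sqrt (-N.slope q) * Real.sqrt (N.gammaDet q x) := by
    rw [gramDensity, N.det_levelFrame hq]
    have h1 : |-4 * N.Ω q x ^ 2 * N.slope q * N.gammaDet q x|
        = (2 * N.Ω q x) ^ 2 * (-N.slope q * N.gammaDet q x) := by
      rw [abs_of_nonneg]
      · ring
      · have := mul_nonneg (mul_nonneg (sq_nonneg (2 * N.Ω q x)) (neg_pos.2 hm).le) hγ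
        linarith
    rw [h1, Real.sqrt_mul (by positivity), Real.sqrt_sq (by positivity),
      Real.sqrt_mul (neg_pos.2 hm).le]
    ring
  rw [levelDensity, sphereDensity_eq]
  refine (congrArg (· / roundDensity x) h).trans ?_
  ring

/-- The density times the lift of the current. -/
def fluxField (P : VecField M) (y : GaugeSpace) : GaugeSpace := N.gaugeDensity y • N.gaugeLift P y

theorem fluxField_coe {q : ℝ × ℝ} (hq : q ∈ N.U) (x : S2) (P : VecField M) :
    N.fluxField P (q, (x : EuclideanSpace ℝ (Fin 3)))
      = (2 * N.Ω q x ^ 2 * N.sphereDensity q x)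
        • N.gaugeLift P (q, (x : EuclideanSpace ℝ (Fin 3))) := by
  rw [fluxField, N.gaugeDensity_coe hq, N.bulkDensity_eq hq]

theorem form2_smul_left (T : CovTensorField 2 M) (p : M) (k : ℝ) (v w : TangentSpace (𝓡 4) p) :
    form2 T p (k • v) w = k * form2 T p v w := ((form2_isBilin T p).left w).map_smul k v

/-- The weight `Ω` cancels the normalisation of `L̂`, and `g(∂_v + b, P) = -2Ω² P^u`. The factor
`2Ω²` is what turns the area density of the spheres into the spacetime density. -/
theorem outgoing_density (hg : IsLorentzMetric g) (Q : CovTensorField 4 M) (X Y Z : VecField M)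
    {q : ℝ × ℝ} (hq : q ∈ N.U) (x : S2) :
    N.Ω q x * Q (N.chart (q, x)) ![N.Lhat q x, X _, Y _, Z _] * N.sphereDensity q x
      = -(N.fluxField (current g Q X Y Z) (q, (x : EuclideanSpace ℝ (Fin 3)))).1.1 := by
  obtain ⟨ξ, h⟩ := N.exists_push_gaugeLift hg (current g Q X Y Z) hq x
  have hΩ := N.Ω_pos q hq x
  rw [← form2_current hg Q X Y Z, Lhat, form2_smul_left, h, N.form2_push hq, N.fluxField_coe hq]
  simp
  field_simp

theorem ingoing_density (hg : IsLorentzMetric g) (Q : CovTensorField 4 M) (X Y Z : VecField M)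
    {q : ℝ × ℝ} (hq : q ∈ N.U) (x : S2) :
    N.Ω q x * Q (N.chart (q, x)) ![N.Lbarhat q x, X _, Y _, Z _] * N.sphereDensity q x
      = -(N.fluxField (current g Q X Y Z) (q, (x : EuclideanSpace ℝ (Fin 3)))).1.2 := by
  obtain ⟨ξ, h⟩ := N.exists_push_gaugeLift hg (current g Q X Y Z) hq x
  have hΩ := N.Ω_pos q hq x
  rw [← form2_current hg Q X Y Z, Lbarhat, form2_smul_left, h, N.form2_push hq, N.fluxField_coe hq]
  simp
  field_simp

/-- Write `r_u`, `r_v` for the partial derivatives. The normalisation of `n` gives `Ω / √(r_u r_v)`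
and the induced volume `2Ω √(r_u / r_v)`, with product `2Ω² / |r_v|`. It multiplies `g(V, P) = -(r_u
P^u + r_v P^v)`; taking `r_v` out leaves its sign. -/
theorem level_density (hg : IsLorentzMetric g) (hr : N.LevelsSpacelike) (Q : CovTensorField 4 M)
    (X Y Z : VecField M) {q : ℝ × ℝ} (hq : q ∈ N.U) (x : S2) :
    (fun p => Q p ![N.normal p, X p, Y p, Z p]) (N.chart (q, x)) * N.levelDensity q x
      = -(Real.sign (fderiv ℝ N.radius q (0, 1)) *
        ((N.fluxField (current g Q X Y Z) (q, (x : EuclideanSpace ℝ (Fin 3)))).1.2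
          + fderiv ℝ N.radius q (1, 0) / fderiv ℝ N.radius q (0, 1)
            * (N.fluxField (current g Q X Y Z) (q, (x : EuclideanSpace ℝ (Fin 3)))).1.1)) := by
  have hΩ := N.Ω_pos q hq x
  have hpos := N.radius_deriv_pos hr hq
  have h1 : form2 g (N.chart (q, x)) (N.gradV (N.chart (q, x))) (N.gradV (N.chart (q, x))) = _ :=
    N.form2_gradV_gradV hg hr hq x
  show Q (N.chart (q, x)) ![N.normal (N.chart (q, x)), X _, Y _, Z _] * _ = _
  rw [← form2_current hg Q X Y Z, normal, form2_smul_left, N.form2_gradV_current hg hr _ hq]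
  change 1 / Real.sqrt (-form2 g (N.chart (q, x)) (N.gradV (N.chart (q, x)))
    (N.gradV (N.chart (q, x)))) * _ * _ = _
  rw [h1, neg_neg, N.levelDensity_eq hr hq, N.fluxField_coe hq, slope, neg_div, neg_neg]
  obtain ⟨⟨⟨α, β⟩, η⟩, hα⟩ : ∃ z : GaugeSpace, z = N.gaugeLift (current g Q X Y Z)
    (q, (x : EuclideanSpace ℝ (Fin 3))) := ⟨_, rfl⟩
  rw [← hα, N.fderiv_radius_apply q α β]
  generalize fderiv ℝ N.radius q (1, 0) = ru at *
  generalize fderiv ℝ N.radius q (0, 1) = rv at *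
  have hrv : rv ≠ 0 := right_ne_zero_of_mul hpos.ne'
  have h2 : Real.sqrt (ru / rv) = Real.sqrt (ru * rv) / |rv| := by
    rw [← Real.sqrt_sq_eq_abs, ← Real.sqrt_div' _ (sq_nonneg rv)]
    congr 1
    field_simp
  have h3 : Real.sqrt (ru * rv / N.Ω q x ^ 2) = Real.sqrt (ru * rv) / N.Ω q x := by
    rw [Real.sqrt_div' _ (sq_nonneg _), Real.sqrt_sq hΩ.le]
  have h4 : Real.sign rv = rv / |rv| := by
    rcases lt_or_gt_of_ne hrv with h | h
    · rw [Real.sign_of_neg h, abs_of_neg h, div_neg, div_self hrv]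
    · rw [Real.sign_of_pos h, abs_of_pos h, div_self hrv]
  have h5 : Real.sqrt (ru * rv) ≠ 0 := (Real.sqrt_pos.2 hpos).ne'
  have h6 : |rv| ≠ 0 := abs_ne_zero.2 hrv
  rw [h2, h3, h4]
  simp only [smul_eq_mul, Prod.smul_mk]
  field_simp
  ring

end DoubleNullGauge

/-! ### Integrated fluxes and bulk integrals -/

namespace DoubleNullGauge

variable {M : Type*} [TopologicalSpace M] [ChartedSpace (EuclideanSpace ℝ (Fin 4)) M]
  [IsManifold (𝓡 4) ∞ M] {g : CovTensorField 2 M} (N : DoubleNullGauge g)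

theorem isCompact_quotientDomain {r₁ r₂ u₁ v₁ : ℝ} (hD : IsCompact (N.domain r₁ r₂ u₁ v₁)) :
    IsCompact (N.quotientDomain r₁ r₂ u₁ v₁) := by
  have h : N.quotientDomain r₁ r₂ u₁ v₁ = (fun p => (N.chart.symm p).1) '' N.domain r₁ r₂ u₁ v₁ := by
    ext q
    constructor
    · rintro ⟨hq, h1, h2, h3, h4⟩
      refine ⟨N.chart (q, sphereProj 0), ⟨N.chart_mem_R hq _, ?_, ?_, ?_, ?_⟩, ?_⟩
      · rwa [N.radiusFun_chart hq]
      · rwa [N.radiusFun_chart hq]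
      · rwa [N.symm_chart hq]
      · rwa [N.symm_chart hq]
      · show (N.chart.symm (N.chart (q, sphereProj 0))).1 = q
        rw [N.symm_chart hq]
    · rintro ⟨p, ⟨hp, h1, h2, h3, h4⟩, rfl⟩
      have hs := N.chart.map_target hp
      rw [N.source_eq] at hs
      exact ⟨hs.1, h1, h2, h3, h4⟩
  rw [h]
  exact hD.image_of_continuousOn
    (continuous_fst.comp_continuousOn (N.chart.continuousOn_symm.mono fun p hp => hp.1))

theorem contDiffAt_fluxField (hg : IsLorentzMetric g) {P : VecField M} (hP : ChartSmoothOn P N.R)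
    {y : GaugeSpace} (hy : y ∈ N.gaugeDom) : ContDiffAt ℝ ∞ (N.fluxField P) y :=
  (N.contDiffAt_gaugeDensity hg hy).smul (N.contDiffAt_gaugeLift hg hP hy)

theorem contDiffAt_fluxField_fst (hg : IsLorentzMetric g) {P : VecField M}
    (hP : ChartSmoothOn P N.R) {y : GaugeSpace} (hy : y ∈ N.gaugeDom) :
    ContDiffAt ℝ 1 (fun y => (N.fluxField P y).1.1) y :=
  ((N.contDiffAt_fluxField hg hP hy).fst.fst).of_le (by simp)

theorem contDiffAt_fluxField_snd (hg : IsLorentzMetric g) {P : VecField M}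
    (hP : ChartSmoothOn P N.R) {y : GaugeSpace} (hy : y ∈ N.gaugeDom) :
    ContDiffAt ℝ 1 (fun y => (N.fluxField P y).1.2) y :=
  ((N.contDiffAt_fluxField hg hP hy).fst.snd).of_le (by simp)

theorem continuous_comp_sphere {f : GaugeSpace → ℝ} (hf : ∀ y ∈ N.gaugeDom, ContinuousAt f y)
    {q : ℝ × ℝ} (hq : q ∈ N.U) :
    Continuous fun x : S2 => f (q, (x : EuclideanSpace ℝ (Fin 3))) := by
  rw [continuous_iff_continuousAt]
  intro x
  exact ContinuousAt.comp
    (f := fun x : S2 => ((q, (x : EuclideanSpace ℝ (Fin 3))) : GaugeSpace))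
    (hf _ (N.coe_mem_gaugeDom hq x)) (by fun_prop)

/-- The integral of the outgoing flux density over the spheres. -/
def fluxU (P : VecField M) (q : ℝ × ℝ) : ℝ :=
  ∫ x : S2, (N.fluxField P (q, (x : EuclideanSpace ℝ (Fin 3)))).1.1 ∂roundMeasure

/-- The integral of the ingoing flux density over the spheres. -/
def fluxV (P : VecField M) (q : ℝ × ℝ) : ℝ :=
  ∫ x : S2, (N.fluxField P (q, (x : EuclideanSpace ℝ (Fin 3)))).1.2 ∂roundMeasure

/-- The derivative of `fluxU` in `u`. -/
def fluxU' (P : VecField M) (q : ℝ × ℝ) : ℝ :=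
  ∫ x : S2, fderiv ℝ (fun y => (N.fluxField P y).1.1) (q, (x : EuclideanSpace ℝ (Fin 3)))
    ((1, 0), 0) ∂roundMeasure

/-- The derivative of `fluxV` in `v`. -/
def fluxV' (P : VecField M) (q : ℝ × ℝ) : ℝ :=
  ∫ x : S2, fderiv ℝ (fun y => (N.fluxField P y).1.2) (q, (x : EuclideanSpace ℝ (Fin 3)))
    ((0, 1), 0) ∂roundMeasure

section Fluxes

variable {P : VecField M} {N} (hg : IsLorentzMetric g) (hP : ChartSmoothOn P N.R)

include hg hP

theorem hasDerivAt_fluxU {q : ℝ × ℝ} (hq : q ∈ N.U) :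
    HasDerivAt (fun u => N.fluxU P (u, q.2)) (N.fluxU' P q) q.1 := by
  have e : ∀ t : ℝ, ((0, q.2) : ℝ × ℝ) + t • ((1, 0) : ℝ × ℝ) = (t, q.2) := fun t => by simp
  have h := hasDerivAt_sphereIntegral N.isOpen_U (f := fun y => (N.fluxField P y).1.1)
    (fun y h1 h2 => N.contDiffAt_fluxField_fst hg hP ⟨h1, h2⟩) (0, q.2) (1, 0) (t₀ := q.1)
    (by rwa [e])
  simp only [e] at h
  exact h

theorem hasDerivAt_fluxV {q : ℝ × ℝ} (hq : q ∈ N.U) :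
    HasDerivAt (fun v => N.fluxV P (q.1, v)) (N.fluxV' P q) q.2 := by
  have e : ∀ t : ℝ, ((q.1, 0) : ℝ × ℝ) + t • ((0, 1) : ℝ × ℝ) = (q.1, t) := fun t => by simp
  have h := hasDerivAt_sphereIntegral N.isOpen_U (f := fun y => (N.fluxField P y).1.2)
    (fun y h1 h2 => N.contDiffAt_fluxField_snd hg hP ⟨h1, h2⟩) (q.1, 0) (0, 1) (t₀ := q.2)
    (by rwa [e])
  simp only [e] at h
  exact h

theorem continuousOn_fluxU : ContinuousOn (N.fluxU P) N.U :=
  continuousOn_sphereIntegral fun _ hq x =>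
    (N.contDiffAt_fluxField_fst hg hP (N.coe_mem_gaugeDom hq x)).continuousAt

theorem continuousOn_fluxV : ContinuousOn (N.fluxV P) N.U :=
  continuousOn_sphereIntegral fun _ hq x =>
    (N.contDiffAt_fluxField_snd hg hP (N.coe_mem_gaugeDom hq x)).continuousAt

theorem continuousOn_fluxU' : ContinuousOn (N.fluxU' P) N.U :=
  continuousOn_sphereIntegral (f := fun z => fderiv ℝ (fun y => (N.fluxField P y).1.1) z ((1, 0), 0))
    fun _ hq x => ((N.contDiffAt_fluxField_fst hg hP (N.coe_mem_gaugeDom hq x)).fderiv_right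
      (m := 0) (by simp)).continuousAt.clm_apply continuousAt_const

theorem continuousOn_fluxV' : ContinuousOn (N.fluxV' P) N.U :=
  continuousOn_sphereIntegral (f := fun z => fderiv ℝ (fun y => (N.fluxField P y).1.2) z ((0, 1), 0))
    fun _ hq x => ((N.contDiffAt_fluxField_snd hg hP (N.coe_mem_gaugeDom hq x)).fderiv_right
      (m := 0) (by simp)).continuousAt.clm_apply continuousAt_const

/-- The full divergence of the flux field is known from `trace_fderiv_gaugeLift`; since the field is
tangent to the spheres, its angular part integrates to zero. -/
theorem fluxU'_add_fluxV' {q : ℝ × ℝ} (hq : q ∈ N.U) : N.fluxU' P q + N.fluxV' P q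
    = ∫ x : S2, N.gaugeDensity (q, (x : EuclideanSpace ℝ (Fin 3)))
      * (1 / 2 * ∑ a, ∑ b, gUp g (N.gaugeMap (q, (x : EuclideanSpace ℝ (Fin 3)))) a b
        * deformation g P (N.gaugeMap (q, (x : EuclideanSpace ℝ (Fin 3)))) a b) ∂roundMeasure := by
  refine (sphereIntegral_trace (U := N.U)
    (fun y h1 h2 => (N.contDiffAt_fluxField hg hP ⟨h1, h2⟩).of_le (by simp))
    (fun y h1 h2 => ?_) hq).symm.trans (integral_congr_ae (Filter.Eventually.of_forall fun x => ?_))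
  · rw [fluxField, Prod.smul_snd, inner_smul_right, N.inner_gaugeLift hg P ⟨h1, h2⟩, mul_zero]
  · exact N.trace_fderiv_gaugeLift hg hP (N.coe_mem_gaugeDom hq x)

/-- Continuity is transferred from the coordinate divergence of the smooth flux field, with which
the expression agrees on the open set `gaugeDom`. -/
theorem continuousAt_trace_fluxField {y : GaugeSpace} (hy : y ∈ N.gaugeDom) :
    ContinuousAt (fun y => N.gaugeDensity y * (1 / 2 * ∑ a, ∑ b, gUp g (N.gaugeMap y) a b
      * deformation g P (N.gaugeMap y) a b)) y := by
  have h1 : ContinuousAt (fun y => ∑ i, gaugeBasis.repr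
      (fderiv ℝ (N.fluxField P) y (gaugeBasis i)) i) y := by
    refine tendsto_finsetSum _ fun i _ => ?_
    have h2 : ContinuousAt (fun y => fderiv ℝ (N.fluxField P) y (gaugeBasis i)) y :=
      ((N.contDiffAt_fluxField hg hP hy).fderiv_right (m := 0) (by simp)).continuousAt.clm_apply
        continuousAt_const
    have h3 : Continuous (gaugeBasis.coord i) := LinearMap.continuous_of_finiteDimensional _
    exact ContinuousAt.comp (f := fun y => fderiv ℝ (N.fluxField P) y (gaugeBasis i))
      h3.continuousAt h2
  refine h1.congr ?_
  filter_upwards [N.isOpen_gaugeDom.mem_nhds hy] with z hz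
  exact N.trace_fderiv_gaugeLift hg hP hz

end Fluxes

section Current

variable (hg : IsLorentzMetric g) (hr : N.LevelsSpacelike) (Q : CovTensorField 4 M)
  (X Y Z : VecField M) (hP : ChartSmoothOn (current g Q X Y Z) N.R) (r₁ r₂ u₁ v₁ : ℝ)

include hg

variable {r₁ r₂ u₁ v₁}
variable (hK : IsCompact (N.quotientDomain r₁ r₂ u₁ v₁))

include hK in
theorem outgoingFlux_eq : N.outgoingFlux r₁ r₂ u₁ v₁ Q X Y Z
    = -∫ v in {v | (u₁, v) ∈ N.quotientDomain r₁ r₂ u₁ v₁}, N.fluxU (current g Q X Y Z) (u₁, v) := by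
  have h : ∀ q ∈ N.U, N.sphereIntegral q (fun x => N.Ω q x * Q (N.chart (q, x))
      ![N.Lhat q x, X _, Y _, Z _]) = -N.fluxU (current g Q X Y Z) q := by
    intro q hq
    rw [fluxU, ← integral_neg]
    exact integral_congr_ae (Filter.Eventually.of_forall fun x => N.outgoing_density hg Q X Y Z hq x)
  rw [outgoingFlux, ← integral_neg]
  refine setIntegral_congr_fun ?_ fun v hv => h _ hv.1
  exact hK.isClosed.measurableSet.preimage (measurable_const.prodMk measurable_id)

include hK in
theorem ingoingFlux_eq : N.ingoingFlux r₁ r₂ u₁ v₁ Q X Y Z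
    = -∫ u in {u | (u, v₁) ∈ N.quotientDomain r₁ r₂ u₁ v₁}, N.fluxV (current g Q X Y Z) (u, v₁) := by
  have h : ∀ q ∈ N.U, N.sphereIntegral q (fun x => N.Ω q x * Q (N.chart (q, x))
      ![N.Lbarhat q x, X _, Y _, Z _]) = -N.fluxV (current g Q X Y Z) q := by
    intro q hq
    rw [fluxV, ← integral_neg]
    exact integral_congr_ae (Filter.Eventually.of_forall fun x => N.ingoing_density hg Q X Y Z hq x)
  rw [ingoingFlux, ← integral_neg]
  refine setIntegral_congr_fun ?_ fun v hv => h _ hv.1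
  exact hK.isClosed.measurableSet.preimage (measurable_id.prodMk measurable_const)

include hr hP

theorem levelFlux_eq (r : ℝ) : N.levelFlux r₁ r₂ u₁ v₁ r Q X Y Z
    = -∫ u, ∑ᶠ v ∈ {v | (u, v) ∈ N.quotientDomain r₁ r₂ u₁ v₁ ∧ N.radius (u, v) = r},
      Real.sign (fderiv ℝ N.radius (u, v) (0, 1)) * (N.fluxV (current g Q X Y Z) (u, v)
        + fderiv ℝ N.radius (u, v) (1, 0) / fderiv ℝ N.radius (u, v) (0, 1)
          * N.fluxU (current g Q X Y Z) (u, v)) := by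
  have h : ∀ q ∈ N.U, ∫ x, (fun p => Q p ![N.normal p, X p, Y p, Z p]) (N.chart (q, x))
      * N.levelDensity q x ∂roundMeasure
      = -(Real.sign (fderiv ℝ N.radius q (0, 1)) * (N.fluxV (current g Q X Y Z) q
        + fderiv ℝ N.radius q (1, 0) / fderiv ℝ N.radius q (0, 1)
          * N.fluxU (current g Q X Y Z) q)) := by
    intro q hq
    have h1 := integrable_sphere (N.continuous_comp_sphere
      (fun y hy => (N.contDiffAt_fluxField_fst hg hP hy).continuousAt) hq)
    have h2 := integrable_sphere (N.continuous_comp_sphere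
      (fun y hy => (N.contDiffAt_fluxField_snd hg hP hy).continuousAt) hq)
    rw [fluxU, fluxV, ← integral_const_mul, ← integral_add h2 (h1.const_mul _),
      ← integral_const_mul, ← integral_neg]
    exact integral_congr_ae (Filter.Eventually.of_forall fun x =>
      N.level_density hg hr Q X Y Z hq x)
  rw [levelFlux, ← integral_neg]
  refine integral_congr_ae (Filter.Eventually.of_forall fun u => ?_)
  simp only
  rw [← finsum_neg_distrib]
  refine finsum_congr fun v => ?_
  rw [← finsum_neg_distrib]
  exact finsum_congr fun hv => h _ hv.1.1

end Current

section Bulk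

theorem bulkIntegral_add {r₁ r₂ u₁ v₁ : ℝ}
    (hK : IsCompact (N.quotientDomain r₁ r₂ u₁ v₁)) {f₁ f₂ : M → ℝ}
    (h₁ : ∀ y ∈ N.gaugeDom, ContinuousAt (fun y => f₁ (N.gaugeMap y) * N.gaugeDensity y) y)
    (h₂ : ∀ y ∈ N.gaugeDom, ContinuousAt (fun y => f₂ (N.gaugeMap y) * N.gaugeDensity y) y) :
    N.bulkIntegral r₁ r₂ u₁ v₁ f₁ + N.bulkIntegral r₁ r₂ u₁ v₁ f₂
      = ∫ q in N.quotientDomain r₁ r₂ u₁ v₁, ∫ x : S2,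
        (f₁ (N.gaugeMap (q, (x : EuclideanSpace ℝ (Fin 3))))
          + f₂ (N.gaugeMap (q, (x : EuclideanSpace ℝ (Fin 3)))))
          * N.gaugeDensity (q, (x : EuclideanSpace ℝ (Fin 3))) ∂roundMeasure := by
  have hsub : N.quotientDomain r₁ r₂ u₁ v₁ ⊆ N.U := fun q hq => hq.1
  have hm := hK.isClosed.measurableSet
  have e : ∀ f : M → ℝ, N.bulkIntegral r₁ r₂ u₁ v₁ f = ∫ q in N.quotientDomain r₁ r₂ u₁ v₁,
      ∫ x : S2, f (N.gaugeMap (q, (x : EuclideanSpace ℝ (Fin 3))))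
        * N.gaugeDensity (q, (x : EuclideanSpace ℝ (Fin 3))) ∂roundMeasure := fun f =>
    setIntegral_congr_fun hm fun q hq => integral_congr_ae (Filter.Eventually.of_forall fun x => by
      simp only [N.gaugeMap_coe, N.gaugeDensity_coe (hsub hq)])
  have hi : ∀ f : M → ℝ,
      (∀ y ∈ N.gaugeDom, ContinuousAt (fun y => f (N.gaugeMap y) * N.gaugeDensity y) y) →
      IntegrableOn (fun q => ∫ x : S2, f (N.gaugeMap (q, (x : EuclideanSpace ℝ (Fin 3))))
        * N.gaugeDensity (q, (x : EuclideanSpace ℝ (Fin 3))) ∂roundMeasure)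
        (N.quotientDomain r₁ r₂ u₁ v₁) := fun f hf =>
    ((continuousOn_sphereIntegral fun q hq x =>
      hf _ (N.coe_mem_gaugeDom hq x)).mono hsub).integrableOn_compact hK
  rw [e, e, ← integral_add (hi f₁ h₁) (hi f₂ h₂)]
  refine setIntegral_congr_fun hm fun q hq => ?_
  simp only [add_mul]
  exact (integral_add (integrable_sphere (N.continuous_comp_sphere h₁ (hsub hq)))
    (integrable_sphere (N.continuous_comp_sphere h₂ (hsub hq)))).symm

end Bulk

end DoubleNullGauge

end

/-! ### The energy identity -/

theorem mainTheorem6 {M : Type*} [TopologicalSpace M] [T2Space M] [SecondCountableTopology M]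
    [ChartedSpace (EuclideanSpace ℝ (Fin 4)) M] [IsManifold (𝓡 4) ∞ M]
    (g : CovTensorField 2 M) (hg : IsLorentzMetric g)
    (N : DoubleNullGauge g) (hr : N.LevelsSpacelike)
    (r₁ r₂ u₁ v₁ : ℝ) (h₁₂ : r₁ < r₂) (hD : IsCompact (N.domain r₁ r₂ u₁ v₁))
    (W : CovTensorField 4 M) (hW : TensorSmoothOn W N.R) (hWeyl : IsWeylFieldOn g W N.R)
    (J : CovTensorField 3 M) (hJ : ∀ p ∈ N.R, divergence g W p = J p)
    (X Y Z : VecField M) (hX : VecSmoothOn X N.R) (hY : VecSmoothOn Y N.R)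
    (hZ : VecSmoothOn Z N.R) :
    N.outgoingFlux r₁ r₂ u₁ v₁ (belRobinson g W) X Y Z
      + N.levelFlux r₁ r₂ u₁ v₁ r₂ (belRobinson g W) X Y Z
      + N.bulkIntegral r₁ r₂ u₁ v₁ (fun p => divergence g (belRobinson g W) p ![X p, Y p, Z p])
      + N.ingoingFlux r₁ r₂ u₁ v₁ (belRobinson g W) X Y Z
      + N.bulkIntegral r₁ r₂ u₁ v₁ (bulkK g W X Y Z)
      = N.levelFlux r₁ r₂ u₁ v₁ r₁ (belRobinson g W) X Y Z := by
  have hK := N.isCompact_quotientDomain hD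
  have hQ := belRobinson_smoothOn hg hW
  have hc : ∀ T : VecField M, VecSmoothOn T N.R → ∀ p ∈ N.R, ∀ c,
      MDifferentiableAt (𝓡 4) 𝓘(ℝ, ℝ) (chartVec T p c) p := fun T hT p hp c =>
    mdifferentiableAt_chartVec (hT.chartD N.isOpen_R hp) c
  have hpt : ∀ p ∈ N.R, divergence g (belRobinson g W) p ![X p, Y p, Z p] + bulkK g W X Y Z p
      = 1 / 2 * ∑ a, ∑ b, gUp g p a b
        * deformation g (current g (belRobinson g W) X Y Z) p a b := by
    intro p hp
    exact divergence_add_bulkK hg hWeyl hp (fun i => hQ.mdifferentiableAt hp i) (hc X hX p hp)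
      (hc Y hY p hp) (hc Z hZ p hp)
  -- From here on, the structure of the Bel-Robinson tensor matters only through the pointwise
  -- identity `hpt`, its smoothness, and the continuity of `bulkK`.
  generalize belRobinson g W = Q at *
  obtain ⟨δ, hδ⟩ : ∃ δ : M → ℝ, δ = fun p => divergence g Q p ![X p, Y p, Z p] := ⟨_, rfl⟩
  replace hpt : ∀ p ∈ N.R, δ p + bulkK g W X Y Z p
      = 1 / 2 * ∑ a, ∑ b, gUp g p a b * deformation g (current g Q X Y Z) p a b := by
    rw [hδ]
    exact hpt
  rw [← hδ]
  have hP : ChartSmoothOn (current g Q X Y Z) N.R := fun p hp =>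
    contMDiffAt_current hg N.isOpen_R hQ hX hY hZ hp
  have hKc : ∀ y ∈ N.gaugeDom,
      ContinuousAt (fun y => bulkK g W X Y Z (N.gaugeMap y) * N.gaugeDensity y) y := fun y hy =>
    (ContinuousAt.comp (f := N.gaugeMap) ((bulkK_continuousOn hg N.isOpen_R hW hWeyl hX hY
      hZ).continuousAt (N.isOpen_R.mem_nhds (N.gaugeMap_mem_R hy)))
      (N.contMDiffAt_gaugeMap hy).continuousAt).mul (N.contDiffAt_gaugeDensity hg hy).continuousAt
  -- Continuity of the divergence term is obtained by subtraction: the total divergence and `bulkK`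
  -- are both continuous.
  have hdc : ∀ y ∈ N.gaugeDom, ContinuousAt (fun y => δ (N.gaugeMap y) * N.gaugeDensity y) y := fun y hy => by
    refine ((DoubleNullGauge.continuousAt_trace_fluxField hg hP hy).sub (hKc y hy)).congr ?_
    filter_upwards [N.isOpen_gaugeDom.mem_nhds hy] with z hz
    have h := hpt _ (N.gaugeMap_mem_R hz)
    rw [Pi.sub_apply, ← h]
    ring
  have hbulk := N.bulkIntegral_add hK hdc hKc
  have hgreen := green_levelRegion N.isOpen_U (fun q hq => N.differentiableAt_radius hr hq)
    (fun q hq => N.radius_deriv_pos hr hq) h₁₂.le hK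
    (fun q hq => DoubleNullGauge.hasDerivAt_fluxU hg hP hq)
    (DoubleNullGauge.continuousOn_fluxU hg hP) (DoubleNullGauge.continuousOn_fluxU' hg hP)
    (fun q hq => DoubleNullGauge.hasDerivAt_fluxV hg hP hq)
    (DoubleNullGauge.continuousOn_fluxV hg hP) (DoubleNullGauge.continuousOn_fluxV' hg hP)
  have hbg : N.bulkIntegral r₁ r₂ u₁ v₁ δ
      + N.bulkIntegral r₁ r₂ u₁ v₁ (bulkK g W X Y Z)
      = ∫ q in levelRegion N.U N.radius r₁ r₂ u₁ v₁,
        (N.fluxU' (current g Q X Y Z) q + N.fluxV' (current g Q X Y Z) q) := by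
    refine hbulk.trans (setIntegral_congr_fun hK.isClosed.measurableSet fun q hq => ?_)
    refine Eq.trans (integral_congr_ae (Filter.Eventually.of_forall fun x => ?_))
      (DoubleNullGauge.fluxU'_add_fluxV' hg hP hq.1).symm
    simp only
    rw [hpt _ (N.gaugeMap_mem_R (N.coe_mem_gaugeDom hq.1 x)), mul_comm]
  rw [N.outgoingFlux_eq hg Q X Y Z hK, N.ingoingFlux_eq hg Q X Y Z hK,
    N.levelFlux_eq hg hr Q X Y Z hP, N.levelFlux_eq hg hr Q X Y Z hP]
  rw [← hbg] at hgreen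
  -- `quotientDomain` is by definition the `levelRegion` of the radius. Once the names agree, every
  -- flux is minus a term of Green's formula and the identity is linear.
  change _ = (∫ v in {v | (u₁, v) ∈ N.quotientDomain r₁ r₂ u₁ v₁}, _)
    + (∫ u in {u | (u, v₁) ∈ N.quotientDomain r₁ r₂ u₁ v₁}, _)
    + (∫ u, ∑ᶠ v ∈ {v | (u, v) ∈ N.quotientDomain r₁ r₂ u₁ v₁ ∧ N.radius (u, v) = r₂}, _)
    - (∫ u, ∑ᶠ v ∈ {v | (u, v) ∈ N.quotientDomain r₁ r₂ u₁ v₁ ∧ N.radius (u, v) = r₁}, _) at hgreen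
  linarith
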